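/- Let $\tau\in\mathbb C$ with $\operatorname{Im}\tau>0$, let $m\ge 1$ be an integer, and let $\eta\in\mathbb C$ be generic in the sense that $k\eta\notin\mathbb Z+\tau\mathbb Z$ for every non-zero integer $k$. Let $\theta(t)=-\sum_{j\in\mathbb Z}e^{\pi i(j+\frac12)^2\tau+2\pi i(j+\frac12)(t+\frac12)}$, let $E_\tau=\mathbb C/(\mathbb Z+\tau\mathbb Z)$ and $S^mE_\tau=E_\tau^m/S_m$. For $t\in\mathbb C^m$ put $$b_i(t)=\frac{\theta(t_i-\eta(1+2m))}{\theta(t_i-\eta(1-2m))}\prod_{j\ne i}\frac{\theta(t_j-t_i-2\eta)}{\theta(t_j-t_i+2\eta)},\qquad i=1,\dots,m.$$ Call $t$ admissible if $t_i\ne t_j \bmod \mathbb Z+\tau\mathbb Z$ for $i\neq j$ and no denominator in the $b_i(t)$ vanishes. The Hermite--Bethe variety $X\subset S^mE_\tau$ is the set of classes of admissible $t$ with $b_i(t)=b_j(t)$ for all $i,j$. A solution of the Bethe ansatz equations is a pair $(t,c)$ with $t$ admissible, $c\in\mathbb C$ and $b_i(t)=e^{4\eta c}$ for all $i$; put $$\psi_{t,c}(\lambda)=e^{c\lambda}\prod_{j=1}^m\theta(\lambda+t_j-\eta),\qquad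 \epsilon(t,c)=e^{-2\eta c}\,\frac{\theta(4\eta m)}{\theta(2\eta m)}\prod_{j=1}^m\frac{\theta(t_j+(2m-3)\eta)}{\theta(t_j+(2m-1)\eta)},$$ $$L\psi(\lambda)=\frac{\theta(\lambda+2\eta m)}{\theta(\lambda)}\psi(\lambda-2\eta)+\frac{\theta(\lambda-2\eta m)}{\theta(\lambda)}\psi(\lambda+2\eta).$$ Theorem. The closure $\bar X$ of $X$ in $S^mE_\tau$ contains an algebraic curve $Y$ (a non-empty Zariski closed set all of whose irreducible components have dimension one) with the following properties. 1. There is a morphism $\epsilon^2:Y\to\mathbb P^1=\mathbb C\cup\{\infty\}$ whose value at the class of $t$ is $\epsilon(t,c)^2$ for every solution $(t,c)$ of the Bethe ansatz equations with the class of $t$ in $Y$. It is a two-fold ramified covering: it is surjective, and there is a finite non-empty set $B\subset\mathbb P^1$ such that $\epsilon^2$ is a covering with fibres of two points over $\mathbb P^1\setminus B$ (for the classical topology), while the fibre over each point of $B$ is a single point. 2. The involution $\sigma:(t_1,\dots,t_m)\mapsto(2\eta-t_1,\dots,2\eta-t_m)$ of $S^mE_\tau$ maps $Y$ to itself, preserves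 $\epsilon^2$ and permutes the sheets, i.e. it exchanges the two points of each fibre over $\mathbb P^1\setminus B$. 3. For every $t\in\mathbb C^m$ whose class lies in $Y$ outside a certain finite subset, the class of $t$ lies in $X$, and there is $c\in\mathbb C$ such that, with $c'=c+\frac{i\pi}{2\eta}$, the $d\in\mathbb C$ for which $(t,d)$ solves the Bethe ansatz equations are exactly those congruent to $c$ or $c'$ modulo $\pi i\eta^{-1}\mathbb Z$, where $c$ and $c'$ are not congruent. The functions $\psi_{t,c}$ and $\psi_{t,c'}$ are non-zero entire eigenfunctions of $L$ with eigenvalues $\epsilon(t,c)$ and $\epsilon(t,c')$, they are related by $\psi_{t,c'}(\lambda)=e^{\pi i\lambda/(2\eta)}\psi_{t,c}(\lambda)$, and $\epsilon(t,c)\ne\epsilon(t,c')$ are the two square roots of $\epsilon^2(t)$. -/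

import Mathlib

open Complex Topology

noncomputable section

namespace HermiteBethe

/-- Jacobi's (odd) theta function `θ(t)` with modular parameter `τ`. -/
def theta (τ t : ℂ) : ℂ :=
  -∑' j : ℤ, exp (Real.pi * I * ((j : ℂ) + 1 / 2) ^ 2 * τ
      + 2 * Real.pi * I * ((j : ℂ) + 1 / 2) * (t + 1 / 2))

/-- The lattice `ℤ + τℤ`. -/
def lattice (τ : ℂ) : AddSubgroup ℂ := AddSubgroup.closure {1, τ}

/-- The elliptic curve `E_τ = ℂ / (ℤ + τℤ)`. -/
abbrev Ell (τ : ℂ) : Type := ℂ ⧸ lattice τ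

/-- The symmetric power `S^m E_τ`. -/
abbrev SymEll (τ : ℂ) (m : ℕ) : Type := Sym (Ell τ) m

/-- The projection `ℂ^m → S^m E_τ`. -/
def proj (τ : ℂ) {m : ℕ} (t : Fin m → ℂ) : SymEll τ m :=
  ⟨(Finset.univ : Finset (Fin m)).val.map fun i => (QuotientAddGroup.mk (t i) : Ell τ), by simp⟩

/-- The classical topology of `S^m E_τ`: the quotient topology from `ℂ^m`. -/
instance symTopology (τ : ℂ) (m : ℕ) : TopologicalSpace (SymEll τ m) :=
  TopologicalSpace.coinduced (proj τ) inferInstance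

/-! ### The algebraic structure of `S^m E_τ` -/

/-- `F` is a holomorphic section of the line bundle `L₁ ⊠ ⋯ ⊠ L_m` on `E_τ^m` with multipliers
`a i` for `t_i ↦ t_i + 1` and `b i * exp (-2πi n_i t_i)` for `t_i ↦ t_i + τ`
(so `L_i` has degree `n i`). -/
structure IsSection (τ : ℂ) {m : ℕ} (a b : Fin m → ℂ) (n : Fin m → ℤ)
    (F : (Fin m → ℂ) → ℂ) : Prop where
  holomorphic : Differentiable ℂ F
  add_one : ∀ i t, F (t + Pi.single i 1) = a i * F t
  add_tau : ∀ i t, F (t + Pi.single i τ) = b i * exp (-(2 * Real.pi * I * (n i) * t i)) * F t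

/-- The Zariski topology of `E_τ^m`, pulled back to `ℂ^m`. The line bundles of `IsSection` include
all powers of an ample line bundle, hence the complements of the zero sets of their sections form
a basis of the Zariski topology. -/
abbrev zariskiCover (τ : ℂ) (m : ℕ) : TopologicalSpace (Fin m → ℂ) :=
  TopologicalSpace.generateFrom
    {U | ∃ a b n F, IsSection τ a b n F ∧ U = {t | F t ≠ 0}}

/-- The Zariski topology of the algebraic variety `S^m E_τ = E_τ^m / S_m`. -/
abbrev zariski (τ : ℂ) (m : ℕ) : TopologicalSpace (SymEll τ m) :=
  TopologicalSpace.coinduced (proj τ) (zariskiCover τ m)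

/-- The (Krull) dimension of a subset of `S^m E_τ` in the Zariski topology. -/
def zariskiDim (τ : ℂ) {m : ℕ} (Z : Set (SymEll τ m)) : WithBot ℕ∞ :=
  @topologicalKrullDim Z ((zariski τ m).induced Subtype.val)

/-- `Y` is an algebraic curve in `S^m E_τ`: a non-empty Zariski closed subset all of whose
irreducible components have dimension one. -/
structure IsAlgebraicCurve (τ : ℂ) {m : ℕ} (Y : Set (SymEll τ m)) : Prop where
  nonempty : Y.Nonempty
  closed : IsClosed[zariski τ m] Y
  dim : ∀ Z : Set (SymEll τ m),
    Maximal (fun Z' => @IsIrreducible _ (zariski τ m) Z' ∧ Z' ⊆ Y) Z → zariskiDim τ Z = 1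

open Classical in
/-- The point `[p : q]` of the Riemann sphere `ℙ¹ = ℂ ∪ {∞}`, for `(p, q) ≠ (0, 0)`. -/
def ratio (p q : ℂ) : OnePoint ℂ := if q = 0 then OnePoint.infty else ((p / q : ℂ) : OnePoint ℂ)

/-- `f` restricts to a morphism of algebraic varieties `Y → ℙ¹`: near each point of `Y` it is of
the form `[p : q]` with `p`, `q` sections of one and the same line bundle. -/
def IsMorphism (τ : ℂ) {m : ℕ} (Y : Set (SymEll τ m)) (f : SymEll τ m → OnePoint ℂ) : Prop :=
  ∀ t₀ : Fin m → ℂ, proj τ t₀ ∈ Y → ∃ a b n p q, IsSection τ a b n p ∧ IsSection τ a b n q ∧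
    (p t₀, q t₀) ≠ (0, 0) ∧
    ∀ t : Fin m → ℂ, proj τ t ∈ Y → (p t, q t) ≠ (0, 0) → f (proj τ t) = ratio (p t) (q t)

/-- `f` is a two-fold covering ramified exactly over the finite non-empty set `B`. -/
structure IsTwoFoldRamifiedCovering {Y Z : Type*} [TopologicalSpace Y] [TopologicalSpace Z]
    (f : Y → Z) (B : Set Z) : Prop where
  continuous : Continuous f
  surjective : Function.Surjective f
  finite : B.Finite
  nonempty : B.Nonempty
  covering : IsCoveringMapOn f Bᶜ
  card_fiber : ∀ z, z ∉ B → (f ⁻¹' {z}).ncard = 2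
  card_fiber_branch : ∀ z, z ∈ B → (f ⁻¹' {z}).ncard = 1

/-! ### Bethe ansatz equations and the `q`-deformed Lamé operator -/

/-- The function `b_i(t)`, the left-hand side of the `i`-th Bethe ansatz equation. -/
def betheFun (τ η : ℂ) {m : ℕ} (t : Fin m → ℂ) (i : Fin m) : ℂ :=
  theta τ (t i - η * (1 + 2 * m)) / theta τ (t i - η * (1 - 2 * m)) *
    ∏ j ∈ Finset.univ.erase i, theta τ (t j - t i - 2 * η) / theta τ (t j - t i + 2 * η)

/-- The `t_i` are pairwise distinct modulo `ℤ + τℤ` and all `b_i(t)` are finite. -/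
structure IsAdmissible (τ η : ℂ) {m : ℕ} (t : Fin m → ℂ) : Prop where
  distinct : ∀ i j, i ≠ j → t i - t j ∉ lattice τ
  denom_one : ∀ i, theta τ (t i - η * (1 - 2 * m)) ≠ 0
  denom_two : ∀ i j, i ≠ j → theta τ (t j - t i + 2 * η) ≠ 0

/-- `(t, c)` is a solution of the Bethe ansatz equations `b_i(t) = e^{4ηc}`. -/
def IsBetheSolution (τ η : ℂ) {m : ℕ} (t : Fin m → ℂ) (c : ℂ) : Prop :=
  IsAdmissible τ η t ∧ ∀ i, betheFun τ η t i = exp (4 * η * c)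

/-- The Hermite–Bethe variety `X ⊆ S^m E_τ`. -/
def hermiteBetheVariety (τ η : ℂ) (m : ℕ) : Set (SymEll τ m) :=
  {x | ∃ t : Fin m → ℂ, proj τ t = x ∧ IsAdmissible τ η t ∧
    ∀ i j, betheFun τ η t i = betheFun τ η t j}

/-- The eigenvalue `ε(t, c)` attached to a solution of the Bethe ansatz equations. -/
def eigenvalue (τ η : ℂ) {m : ℕ} (t : Fin m → ℂ) (c : ℂ) : ℂ :=
  exp (-(2 * η * c)) * (theta τ (4 * η * m) / theta τ (2 * η * m)) *
    ∏ j, theta τ (t j + (2 * m - 3) * η) / theta τ (t j + (2 * m - 1) * η)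

/-- The eigenfunction `ψ(λ)` attached to a solution of the Bethe ansatz equations. -/
def psi (τ η : ℂ) {m : ℕ} (t : Fin m → ℂ) (c : ℂ) (l : ℂ) : ℂ :=
  exp (c * l) * ∏ j, theta τ (l + t j - η)

/-- The `q`-deformed Lamé operator `L`. -/
def lameOp (τ η : ℂ) (m : ℕ) (f : ℂ → ℂ) (l : ℂ) : ℂ :=
  theta τ (l + 2 * η * m) / theta τ l * f (l - 2 * η) +
    theta τ (l - 2 * η * m) / theta τ l * f (l + 2 * η)

/-- The entire function `f` is an eigenfunction of the operator `L` with eigenvalue `ε`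
(an identity of meromorphic functions of `λ`). -/
structure IsLameEigenfunction (τ η : ℂ) (m : ℕ) (f : ℂ → ℂ) (ε : ℂ) : Prop where
  holomorphic : Differentiable ℂ f
  ne_zero : f ≠ 0
  eq : ∀ l, theta τ l ≠ 0 → lameOp τ η m f l = ε * f l

/-- The reflection `σ : (t_1, …, t_m) ↦ (2η - t_1, …, 2η - t_m)` of `S^m E_τ`. -/
def reflection (τ η : ℂ) (m : ℕ) (x : SymEll τ m) : SymEll τ m :=
  x.map fun u => (QuotientAddGroup.mk (2 * η) : Ell τ) - u

/-- The group `ℂ / πi η⁻¹ ℤ` in which the parameter `c` is considered. -/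
abbrev ParamC (η : ℂ) : Type := ℂ ⧸ AddSubgroup.zmultiples (Real.pi * I / η)

/-- The class of `c` in `ℂ / πi η⁻¹ ℤ`. -/
def paramMk (η c : ℂ) : ParamC η := QuotientAddGroup.mk c

end HermiteBethe

end

open Complex Topology

noncomputable section

namespace HermiteBethe

section

/-! ### Entire functions -/

/-! An eigenfunction of the form exponential times `m` theta factors is controlled by its values on
the grid `2ηk`, `|k| ≤ m`. There the eigenvalue equation is a three-term recursion which closes up,
because `θ(l ± 2ηm)` vanishes at the two ends. With the normalization `ψ(2ηm) = 1` it forces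
`ψ(2ηk)` to be a polynomial in the eigenvalue `e`, even in `k` (`IsEigen.grid`). A theta function of
degree `n` with more than `n` inequivalent zeros is zero (`IsTheta.eq_zero_of_zeros`), so
`ψ(l)ψ(-l)` depends on `e` alone: it is `qFun`, written `q`. Similarly `ψ(l)ψ(2η-l) + ψ(-l)ψ(l-2η) =
2v`, with `v` the function `vFun`. The two summands thus have sum `2v` and product `q(l)q(l-2η)`.
The discriminant of this quadratic equation factors as `v² - q(l)q(l-2η) = S(e)w²`, with `S` a
polynomial and `w` a fixed theta function (`vFun_sq`). Hence `ψ(l)ψ(2η-l) = v ± yw` with `y² =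
S(e)`: this is the spectral curve, and `ψ(l) ↦ ψ(-l)` changes the sign of `y`.

Conversely, `e` and the sign of `y` determine the divisor of `ψ` (`IsEigen.divClass_eq`): the ratio
of two candidates would be `2η`-periodic, and `2η` has infinite order on `E_τ`. For all but finitely
many `e` the eigenfunction exists (`exists_isRel`), by distributing the zeros of `q` between the
factors `v + yw` and `v - yw`.

To include infinity, the eigenvalue equation is replaced by the relation `αθ(l+2ηm)Θ(l-2η) +
βθ(l-2ηm)Θ(l+2η) = γθ(l)Θ(l)` between shifts of the theta product `Θ` of a divisor. Its solution is
unique up to scale (`IsRel.proportional`), and `ε² = γ²/(αβ)`. The curve `Y` is the locus of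
divisors admitting a nontrivial relation, cut out by determinants. Over infinity lie the divisor
`{2η, …, 2ηm}` and its negative. Each fibre of `ε²` is one orbit of the reflection. Compactness
makes the map closed, density of the regular values makes it onto, and the fibre description makes
it open; off the fixed points it is therefore a double covering. Zero is a branch value, since
multiplication of `ψ` by `e^{πil/(2η)}` changes the sign of `e` but not the divisor.

The dimension statement is an identity theorem on the curve. A section symmetric under permutations
and reflection, divided by a power of a fixed one, descends to a function of `ε²` that is
holomorphic in suitable charts. If it has infinitely many zeros on the curve, it vanishes there
(`IsSymSec.eq_zero`). Consequently an infinite Zariski closed subset of `Y` and its reflection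
together fill `Y`, and a topological argument gives dimension one.

Finally, at a zero of `ψ` the eigenvalue equation is a Bethe ansatz equation, and evaluation at
`2ηm` gives the formula for the eigenvalue. Admissibility holds off finitely many points, by
nonvanishing of a discriminant and `IsEigen.zero_not_shift`. -/

/-- A quotient of entire functions is entire when the denominator has simple zeros at which the
numerator vanishes. -/
lemma exists_entire_quotient {f h : ℂ → ℂ} (hf : Differentiable ℂ f) (hh : Differentiable ℂ h)
    (H : ∀ p, h p = 0 → deriv h p ≠ 0 ∧ f p = 0) :
    ∃ g : ℂ → ℂ, Differentiable ℂ g ∧ ∀ x, f x = h x * g x := by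
  classical
  refine ⟨fun x => if h x = 0 then deriv f x / deriv h x else f x / h x, ?_, ?_⟩
  · intro p
    by_cases hp : h p = 0
    · obtain ⟨h1, h2⟩ := H p hp
      have d1 : DifferentiableAt ℂ (dslope f p) p :=
        ((differentiableOn_dslope (c := p) (s := Set.univ) Filter.univ_mem).2
          hf.differentiableOn).differentiableAt Filter.univ_mem
      have d2 : DifferentiableAt ℂ (dslope h p) p :=
        ((differentiableOn_dslope (c := p) (s := Set.univ) Filter.univ_mem).2
          hh.differentiableOn).differentiableAt Filter.univ_mem
      have h3 : dslope h p p ≠ 0 := by rwa [dslope_same]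
      have d3 : DifferentiableAt ℂ (fun x => dslope f p x / dslope h p x) p := d1.div d2 h3
      refine d3.congr_of_eventuallyEq ?_
      have h4 : ∀ᶠ x in 𝓝 p, dslope h p x ≠ 0 := d2.continuousAt.eventually_ne h3
      filter_upwards [h4] with x hx
      by_cases hxp : x = p
      · subst hxp; simp [hp]
      · have e1 : dslope f p x = (x - p)⁻¹ * f x := by
          rw [dslope_of_ne _ hxp, slope_def_field, h2]; ring
        have e2 : dslope h p x = (x - p)⁻¹ * h x := by
          rw [dslope_of_ne _ hxp, slope_def_field, hp]; ring
        have hx0 : h x ≠ 0 := by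
          intro h0; rw [e2, h0] at hx; simp at hx
        have : x - p ≠ 0 := sub_ne_zero.2 hxp
        rw [if_neg hx0, e1, e2]
        field_simp
    · have h4 : ∀ᶠ x in 𝓝 p, h x ≠ 0 := hh.continuous.continuousAt.eventually_ne hp
      have d3 : DifferentiableAt ℂ (fun x => f x / h x) p := (hf p).div (hh p) hp
      refine d3.congr_of_eventuallyEq ?_
      filter_upwards [h4] with x hx
      rw [if_neg hx]
  · intro x
    by_cases hx : h x = 0
    · simp [hx, (H x hx).2]
    · simp only [if_neg hx]; field_simp

lemma eq_zero_or_eq_zero_of_entire_mul {f g : ℂ → ℂ} (hf : Differentiable ℂ f)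
    (hg : Differentiable ℂ g) (h : ∀ x, f x * g x = 0) : f = 0 ∨ g = 0 := by
  have := AnalyticOnNhd.eq_zero_or_eq_zero_of_mul_eq_zero (U := Set.univ)
    (fun x _ => hf.analyticAt x) (fun x _ => hg.analyticAt x) (fun x _ => h x)
    isPreconnected_univ
  rcases this with h | h
  · left; ext x; exact h x trivial
  · right; ext x; exact h x trivial

/-- Entire functions form an integral domain. This cancellation rule replaces all discussions of
zeros when identities are divided by theta functions. -/
lemma eq_of_entire_mul_eq {f g h : ℂ → ℂ} (hf : Differentiable ℂ f) (hg : Differentiable ℂ g)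
    (hh : Differentiable ℂ h) (hf0 : f ≠ 0) (H : ∀ x, f x * g x = f x * h x) : g = h := by
  rcases eq_zero_or_eq_zero_of_entire_mul hf (hg.sub hh)
    (fun x => by simp [mul_sub, H x]) with h1 | h1
  · exact absurd h1 hf0
  · ext x; simpa [sub_eq_zero] using congrFun h1 x

lemma exists_reduction {τ : ℂ} (hτ : 0 < τ.im) (l : ℂ) :
    ∃ (s t : ℝ) (n k : ℤ), s ∈ Set.Icc (0 : ℝ) 1 ∧ t ∈ Set.Icc (0 : ℝ) 1 ∧
      l = s + t * τ + n + k * τ := by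
  set y := l.im / τ.im
  set x := l.re - y * τ.re
  refine ⟨Int.fract x, Int.fract y, ⌊x⌋, ⌊y⌋, ⟨Int.fract_nonneg _, (Int.fract_lt_one _).le⟩,
    ⟨Int.fract_nonneg _, (Int.fract_lt_one _).le⟩, ?_⟩
  have hx : ((Int.fract x : ℝ) : ℂ) + (⌊x⌋ : ℂ) = (x : ℂ) := by
    exact_mod_cast congrArg (fun r : ℝ => (r : ℂ)) (Int.fract_add_floor x)
  have hy : ((Int.fract y : ℝ) : ℂ) + (⌊y⌋ : ℂ) = (y : ℂ) := by
    exact_mod_cast congrArg (fun r : ℝ => (r : ℂ)) (Int.fract_add_floor y)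
  have : ((Int.fract x : ℝ) : ℂ) + (Int.fract y : ℝ) * τ + ⌊x⌋ + ⌊y⌋ * τ = x + y * τ := by
    rw [← hx, ← hy]; ring
  rw [this]
  apply Complex.ext
  · simp [x]
  · simp [y, hτ.ne']

lemma bounded_of_periodic {τ : ℂ} (hτ : 0 < τ.im) {h : ℂ → ℝ} (hc : Continuous h)
    (h1 : Function.Periodic h 1) (h2 : Function.Periodic h τ) : ∃ C, ∀ l, h l ≤ C := by
  have hK : IsCompact ((fun p : ℝ × ℝ => (p.1 : ℂ) + p.2 * τ) ''
      (Set.Icc (0 : ℝ) 1 ×ˢ Set.Icc (0 : ℝ) 1)) :=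
    (isCompact_Icc.prod isCompact_Icc).image (by fun_prop)
  obtain ⟨C, hC⟩ := hK.bddAbove_image hc.continuousOn
  refine ⟨C, fun l => ?_⟩
  obtain ⟨s, t, n, k, hs, ht, rfl⟩ := exists_reduction hτ l
  have e1 := h2.int_mul k (s + t * τ + n)
  have e2 := h1.int_mul n (s + t * τ)
  rw [mul_one] at e2
  rw [e1, e2]
  exact hC ⟨_, ⟨(s, t), ⟨hs, ht⟩, rfl⟩, rfl⟩

/-- An entire function with constant multipliers is an exponential. -/
lemma exists_eq_exp_of_quasiperiodic {τ : ℂ} (hτ : 0 < τ.im) {f : ℂ → ℂ} {a b : ℂ} (ha : a ≠ 0)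
    (hb : b ≠ 0) (hf : Differentiable ℂ f) (h1 : ∀ l, f (l + 1) = a * f l)
    (h2 : ∀ l, f (l + τ) = b * f l) : ∃ C c, ∀ l, f l = C * exp (c * l) := by
  -- The exponent `c` is chosen so that `|e^c| = |a|` and `|e^{cτ}| = |b|`. Then `f(l) e^{-cl}` has
  -- doubly periodic norm, hence is bounded and constant by Liouville.
  set x := Real.log ‖a‖
  set y := (x * τ.re - Real.log ‖b‖) / τ.im
  set c : ℂ := ⟨x, y⟩
  have hd : Differentiable ℂ fun l => f l * exp (-(c * l)) := by fun_prop
  have hca : ‖exp (-c)‖ = ‖a‖⁻¹ := by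
    rw [Complex.norm_exp]
    simp [c, x, Real.exp_neg, Real.exp_log (norm_pos_iff.2 ha)]
  have hcb : ‖exp (-(c * τ))‖ = ‖b‖⁻¹ := by
    rw [Complex.norm_exp]
    have : (-(c * τ)).re = -Real.log ‖b‖ := by
      simp only [neg_re, mul_re, c, y]; field_simp; ring
    rw [this, Real.exp_neg, Real.exp_log (norm_pos_iff.2 hb)]
  obtain ⟨C, hC⟩ := bounded_of_periodic hτ (h := fun l => ‖f l * exp (-(c * l))‖)
    (hd.continuous.norm) (fun l => by
      have : exp (-(c * (l + 1))) = exp (-(c * l)) * exp (-c) := by rw [← exp_add]; ring_nf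
      simp only [h1, this, norm_mul, hca]
      have := norm_ne_zero_iff.2 ha
      field_simp) (fun l => by
      have : exp (-(c * (l + τ))) = exp (-(c * l)) * exp (-(c * τ)) := by
        rw [← exp_add]; ring_nf
      simp only [h2, this, norm_mul, hcb]
      have := norm_ne_zero_iff.2 hb
      field_simp)
  obtain ⟨D, hD⟩ := hd.exists_const_forall_eq_of_bounded
    ((Metric.isBounded_iff_subset_closedBall 0).2 ⟨C, by
      rintro _ ⟨l, rfl⟩; simpa using hC l⟩)
  refine ⟨D, c, fun l => ?_⟩
  rw [← hD l, mul_assoc, ← exp_add]; simp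

lemma exp_add_pi_mul_I (z : ℂ) : exp (z + Real.pi * I) = -exp z := by
  rw [exp_add, exp_pi_mul_I, mul_neg_one]

/-! ### The theta function -/

variable {τ : ℂ}

/-- Completing the square in the exponent turns the half-integer characteristics into a translation
of the argument by `1/2 + τ/2`. -/
lemma theta_eq (τ t : ℂ) : theta τ t =
    -(exp (Real.pi * I * (τ / 4 + t + 1 / 2)) * jacobiTheta₂ (t + 1 / 2 + τ / 2) τ) := by
  rw [theta, jacobiTheta₂, ← tsum_mul_left]
  congr 2; ext j
  rw [jacobiTheta₂_term, ← exp_add]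
  congr 1; ring

lemma theta_differentiable (hτ : 0 < τ.im) : Differentiable ℂ (theta τ) := by
  have : theta τ = fun t =>
      -(exp (Real.pi * I * (τ / 4 + t + 1 / 2)) * jacobiTheta₂ (t + 1 / 2 + τ / 2) τ) :=
    funext (theta_eq τ)
  rw [this]
  intro t
  have h1 : DifferentiableAt ℂ (fun t : ℂ => jacobiTheta₂ (t + 1 / 2 + τ / 2) τ) t :=
    (differentiableAt_jacobiTheta₂_fst (t + 1 / 2 + τ / 2) hτ).comp t
      (f := fun t : ℂ => t + 1 / 2 + τ / 2) (by fun_prop)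
  fun_prop

lemma theta_add_one (τ t : ℂ) : theta τ (t + 1) = -theta τ t := by
  rw [theta_eq, theta_eq, show t + 1 + 1 / 2 + τ / 2 = (t + 1 / 2 + τ / 2) + 1 by ring,
    jacobiTheta₂_add_left, show Real.pi * I * (τ / 4 + (t + 1) + 1 / 2) =
      Real.pi * I * (τ / 4 + t + 1 / 2) + Real.pi * I by ring, exp_add, exp_pi_mul_I]
  ring

lemma theta_add_tau (τ t : ℂ) :
    theta τ (t + τ) = -exp (-(Real.pi * I * (τ + 2 * t))) * theta τ t := by
  rw [theta_eq, theta_eq, show t + τ + 1 / 2 + τ / 2 = (t + 1 / 2 + τ / 2) + τ by ring,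
    jacobiTheta₂_add_left']
  have : exp (Real.pi * I * (τ / 4 + (t + τ) + 1 / 2)) *
      exp (-Real.pi * I * (τ + 2 * (t + 1 / 2 + τ / 2))) =
      -(exp (-(Real.pi * I * (τ + 2 * t))) * exp (Real.pi * I * (τ / 4 + t + 1 / 2))) := by
    rw [← exp_add, ← exp_add, ← exp_add_pi_mul_I]
    refine Complex.exp_eq_exp_iff_exists_int.2 ⟨-1, ?_⟩
    push_cast; ring
  linear_combination (-jacobiTheta₂ (t + 1 / 2 + τ / 2) τ) * this

lemma theta_neg (τ t : ℂ) : theta τ (-t) = -theta τ t := by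
  rw [theta_eq, theta_eq]
  have h1 : jacobiTheta₂ (-t + 1 / 2 + τ / 2) τ = jacobiTheta₂ (t - 1 / 2 - τ / 2) τ := by
    rw [← jacobiTheta₂_neg_left]; congr 1; ring
  have h2 : jacobiTheta₂ (t + 1 / 2 + τ / 2) τ =
      exp (-Real.pi * I * (2 * t - 1)) * jacobiTheta₂ (t - 1 / 2 - τ / 2) τ := by
    rw [show t + 1 / 2 + τ / 2 = (t - 1 / 2 - τ / 2) + τ + 1 by ring, jacobiTheta₂_add_left,
      jacobiTheta₂_add_left']
    congr 2; ring
  have h3 : exp (Real.pi * I * (τ / 4 + t + 1 / 2)) * exp (-Real.pi * I * (2 * t - 1)) =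
      -exp (Real.pi * I * (τ / 4 + -t + 1 / 2)) := by
    rw [← exp_add, ← exp_add_pi_mul_I]
    congr 1; ring
  rw [h1, h2]
  linear_combination (-jacobiTheta₂ (t - 1 / 2 - τ / 2) τ) * h3

lemma theta_zero (τ : ℂ) : theta τ 0 = 0 := by
  have := theta_neg τ 0
  simp only [neg_zero] at this
  exact self_eq_neg.1 this

lemma mem_lattice_iff (τ x : ℂ) : x ∈ lattice τ ↔ ∃ n k : ℤ, x = n + k * τ := by
  rw [lattice, AddSubgroup.mem_closure_pair]
  constructor
  · rintro ⟨a, b, h⟩; exact ⟨a, b, by simpa using h.symm⟩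
  · rintro ⟨a, b, h⟩; exact ⟨a, b, by simpa using h.symm⟩

/-- Integration of the Jacobi series over `[0, 1]` leaves only its constant term `1`, so the series
cannot vanish identically. -/
lemma exists_theta_ne_zero (hτ : 0 < τ.im) : ∃ t, theta τ t ≠ 0 := by
  by_contra! h
  have hJ : ∀ z, jacobiTheta₂ z τ = 0 := by
    intro z
    have := h (z - 1 / 2 - τ / 2)
    rw [theta_eq, show z - 1 / 2 - τ / 2 + 1 / 2 + τ / 2 = z by ring] at this
    simpa using this
  let f : ℤ → C(ℝ, ℂ) := fun n => ⟨fun x => jacobiTheta₂_term n x τ, by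
    unfold jacobiTheta₂_term; fun_prop⟩
  have hn : ∀ n, ‖(f n).restrict (⟨Set.uIcc (0 : ℝ) 1, isCompact_uIcc⟩ :
      TopologicalSpace.Compacts ℝ)‖ ≤ ‖jacobiTheta₂_term n 0 τ‖ := by
    intro n
    rw [ContinuousMap.norm_le _ (norm_nonneg _)]
    intro x
    simp only [ContinuousMap.restrict_apply, f, ContinuousMap.coe_mk]
    rw [norm_jacobiTheta₂_term, norm_jacobiTheta₂_term]
    simp
  have hs : Summable fun n => ‖(f n).restrict (⟨Set.uIcc (0 : ℝ) 1, isCompact_uIcc⟩ :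
      TopologicalSpace.Compacts ℝ)‖ :=
    Summable.of_nonneg_of_le (fun _ => norm_nonneg _) hn
      ((summable_jacobiTheta₂_term_iff 0 τ).2 hτ).norm
  have h2 := intervalIntegral.hasSum_intervalIntegral_of_summable_norm hs
  have h3 : ∀ n : ℤ, n ≠ 0 → ∫ x in (0 : ℝ)..1, f n x = 0 := by
    intro n hn
    have e : ∀ x : ℝ, f n x = exp (Real.pi * I * n ^ 2 * τ) * exp (2 * Real.pi * I * n * x) := by
      intro x
      simp only [f, ContinuousMap.coe_mk, jacobiTheta₂_term]
      rw [← exp_add]; ring_nf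
    simp_rw [e]
    rw [intervalIntegral.integral_const_mul, integral_exp_mul_complex]
    · have : exp (2 * Real.pi * I * n * ((1 : ℝ) : ℂ)) = 1 :=
        Complex.exp_eq_one_iff.2 ⟨n, by push_cast; ring⟩
      rw [this]; simp
    · have := Real.pi_ne_zero
      simp [hn, I_ne_zero, this]
  have h4 : ∫ x in (0 : ℝ)..1, f 0 x = 1 := by
    simp [f, jacobiTheta₂_term]
  have h5 := (hasSum_single (f := fun n => ∫ x in (0 : ℝ)..1, f n x) 0 h3).unique h2
  have h6 : ∀ x : ℝ, ∑' n, f n x = 0 := fun x => hJ x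
  simp [h4, h6] at h5

/-! ### An infinite product with simple zeros exactly on the lattice -/

/-- The product `∏ (1 - q ^ n z)`. -/
def qProd (q z : ℂ) : ℂ := ∏' n : ℕ, (1 - q ^ n * z)

lemma summable_qProd {q : ℂ} (hq : ‖q‖ < 1) (z : ℂ) : Summable fun n : ℕ => ‖-(q ^ n * z)‖ := by
  simp only [norm_neg, norm_mul, norm_pow]
  exact (summable_geometric_of_lt_one (norm_nonneg _) hq).mul_right _

lemma qProd_differentiable {q : ℂ} (hq : ‖q‖ < 1) : Differentiable ℂ (qProd q) := by
  intro z
  have hs : Summable fun n : ℕ => ‖q‖ ^ n * (‖z‖ + 1) :=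
    (summable_geometric_of_lt_one (norm_nonneg _) hq).mul_right _
  have := Summable.hasProdLocallyUniformlyOn_nat_one_add (K := Metric.ball (0 : ℂ) (‖z‖ + 1))
    (f := fun n x => -(q ^ n * x)) Metric.isOpen_ball hs
    (.of_forall fun n x hx => by
      simp only [norm_neg, norm_mul, norm_pow]
      gcongr
      simpa using (mem_ball_zero_iff.1 hx).le) (fun n => by fun_prop)
  have h2 := this.differentiableOn
    (.of_forall fun _ ↦ by simpa [Finset.prod_fn] using
      DifferentiableOn.finsetProd (fun _ _ ↦ by fun_prop)) Metric.isOpen_ball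
  have h3 := h2.differentiableAt (Metric.isOpen_ball.mem_nhds (by simp : z ∈ Metric.ball 0 (‖z‖ + 1)))
  simpa [qProd, sub_eq_add_neg] using! h3

lemma qProd_eq {q : ℂ} (hq : ‖q‖ < 1) (z : ℂ) : qProd q z = (1 - z) * qProd q (q * z) := by
  have hm : Multipliable fun n : ℕ => 1 - q ^ (n + 1) * z := by
    simpa [sub_eq_add_neg] using multipliable_one_add_of_summable (f := fun n : ℕ => -(q ^ (n + 1) * z))
      ((summable_nat_add_iff (f := fun n : ℕ => ‖-(q ^ n * z)‖) 1).2 (summable_qProd hq z))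
  unfold qProd
  rw [tprod_eq_zero_mul' (f := fun n : ℕ => 1 - q ^ n * z) hm]
  congr 1
  · simp
  · exact tprod_congr fun n => by rw [pow_succ, mul_assoc]

lemma qProd_ne_zero {q : ℂ} (hq : ‖q‖ < 1) {z : ℂ} (h : ∀ n : ℕ, q ^ n * z ≠ 1) :
    qProd q z ≠ 0 := by
  have := tprod_one_add_ne_zero_of_summable (f := fun n : ℕ => -(q ^ n * z))
    (fun i => by rw [← sub_eq_add_neg, sub_ne_zero]; exact (h i).symm) (summable_qProd hq z)
  simpa [qProd, sub_eq_add_neg] using this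

/-- A product with the same zeros as the theta function. -/
def thetaProd (τ l : ℂ) : ℂ :=
  qProd (exp (2 * Real.pi * I * τ)) (exp (2 * Real.pi * I * l)) *
    qProd (exp (2 * Real.pi * I * τ)) (exp (2 * Real.pi * I * (τ - l)))

lemma norm_nome_lt_one (hτ : 0 < τ.im) : ‖exp (2 * Real.pi * I * τ)‖ < 1 := by
  rw [Complex.norm_exp]
  simp only [Real.exp_lt_one_iff]
  simp
  positivity

lemma thetaProd_differentiable (hτ : 0 < τ.im) : Differentiable ℂ (thetaProd τ) := by
  have h := qProd_differentiable (norm_nome_lt_one hτ)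
  unfold thetaProd
  refine Differentiable.mul (h.comp (by fun_prop)) (h.comp (by fun_prop))

lemma exp_two_pi_add (z : ℂ) (n : ℤ) :
    exp (2 * Real.pi * I * (z + n)) = exp (2 * Real.pi * I * z) :=
  Complex.exp_eq_exp_iff_exists_int.2 ⟨n, by ring⟩

lemma thetaProd_add_one (l : ℂ) : thetaProd τ (l + 1) = thetaProd τ l := by
  unfold thetaProd
  rw [show l + 1 = l + (1 : ℤ) by simp, exp_two_pi_add,
    show τ - (l + (1 : ℤ)) = (τ - l) + (-1 : ℤ) by push_cast; ring, exp_two_pi_add]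

lemma thetaProd_eq (hτ : 0 < τ.im) (l : ℂ) : thetaProd τ l =
    (1 - exp (2 * Real.pi * I * l)) * (qProd (exp (2 * Real.pi * I * τ))
      (exp (2 * Real.pi * I * (τ + l))) * qProd (exp (2 * Real.pi * I * τ))
      (exp (2 * Real.pi * I * (τ - l)))) := by
  rw [thetaProd, qProd_eq (norm_nome_lt_one hτ) (exp (2 * Real.pi * I * l)), ← exp_add]
  ring_nf

/-- Translation by `τ` shifts the index in both products: one loses the factor `1 - e^{2πil}`, the
other gains `1 - e^{-2πil}`, and the quotient of these two is the multiplier. -/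
lemma thetaProd_add_tau (hτ : 0 < τ.im) (l : ℂ) :
    thetaProd τ (l + τ) = -exp (-(2 * Real.pi * I * l)) * thetaProd τ l := by
  rw [thetaProd_eq hτ l, thetaProd, show τ - (l + τ) = -l by ring,
    qProd_eq (norm_nome_lt_one hτ) (exp (2 * Real.pi * I * (-l))), ← exp_add]
  have h1 : 1 - exp (2 * Real.pi * I * (-l)) =
      -exp (-(2 * Real.pi * I * l)) * (1 - exp (2 * Real.pi * I * l)) := by
    have : exp (-(2 * Real.pi * I * l)) * exp (2 * Real.pi * I * l) = 1 := by
      rw [← exp_add]; simp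
    rw [show 2 * Real.pi * I * (-l) = -(2 * Real.pi * I * l) by ring]
    linear_combination (-1 : ℂ) * this
  rw [h1]
  ring_nf

lemma thetaProd_ne_zero (hτ : 0 < τ.im) {l : ℂ} (hl : l ∉ lattice τ) : thetaProd τ l ≠ 0 := by
  have key : ∀ (n : ℕ) (z : ℂ), exp (2 * Real.pi * I * τ) ^ n * exp (2 * Real.pi * I * z) = 1 →
      z ∈ lattice τ := by
    intro n z h
    rw [← exp_nat_mul, ← exp_add, Complex.exp_eq_one_iff] at h
    obtain ⟨k, hk⟩ := h
    have : z = (k : ℂ) + (-n : ℤ) * τ := by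
      have h0 : (2 * Real.pi * I : ℂ) ≠ 0 := two_pi_I_ne_zero
      apply mul_left_cancel₀ h0
      push_cast
      linear_combination hk
    exact (mem_lattice_iff _ _).2 ⟨k, -n, this⟩
  refine mul_ne_zero (qProd_ne_zero (norm_nome_lt_one hτ) fun n h => hl (key n l h))
    (qProd_ne_zero (norm_nome_lt_one hτ) fun n h => hl ?_)
  have h1 := key n _ h
  have h2 : τ ∈ lattice τ := AddSubgroup.subset_closure (by simp)
  simpa using sub_mem h2 h1

/-- Only the factor `1 - e^{2πil}` vanishes at `0`, and to first order. -/
lemma thetaProd_zero_deriv (hτ : 0 < τ.im) : thetaProd τ 0 = 0 ∧ deriv (thetaProd τ) 0 ≠ 0 := by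
  refine ⟨by rw [thetaProd_eq hτ]; simp, ?_⟩
  have hq := norm_nome_lt_one hτ
  set G : ℂ → ℂ := fun l => qProd (exp (2 * Real.pi * I * τ))
      (exp (2 * Real.pi * I * (τ + l))) * qProd (exp (2 * Real.pi * I * τ))
      (exp (2 * Real.pi * I * (τ - l))) with hG
  have hGd : Differentiable ℂ G :=
    Differentiable.mul ((qProd_differentiable hq).comp (by fun_prop))
      ((qProd_differentiable hq).comp (by fun_prop))
  have e : thetaProd τ = fun l => (1 - exp (2 * Real.pi * I * l)) * G l :=
    funext fun l => thetaProd_eq hτ l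
  have hne : qProd (exp (2 * Real.pi * I * τ)) (exp (2 * Real.pi * I * τ)) ≠ 0 := by
    refine qProd_ne_zero hq fun n h => ?_
    have := congrArg norm h
    rw [← pow_succ, norm_pow, norm_one] at this
    have h2 := pow_lt_one₀ (norm_nonneg _) hq (Nat.succ_ne_zero n)
    exact absurd this h2.ne
  have hd : HasDerivAt (fun l : ℂ => 1 - exp (2 * Real.pi * I * l))
      (-(exp (2 * Real.pi * I * 0) * (2 * Real.pi * I * 1))) 0 :=
    (((hasDerivAt_id (0 : ℂ)).const_mul (2 * Real.pi * I)).cexp).const_sub 1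
  have := (hd.mul (hGd 0).hasDerivAt).deriv
  rw [e]
  have e2 : deriv (fun l => (1 - exp (2 * Real.pi * I * l)) * G l) 0 =
    -(exp (2 * Real.pi * I * 0) * (2 * Real.pi * I * 1)) * G 0 := by
    refine this.trans ?_
    simp
  rw [e2, hG]
  simp only [mul_zero, exp_zero, add_zero, sub_zero, one_mul, mul_one]
  exact mul_ne_zero (neg_ne_zero.2 two_pi_I_ne_zero) (mul_ne_zero hne hne)

/-- If translations by `1` and `τ` multiply `f` by exponentials, so do all lattice translations. -/
lemma exists_multiplier {f : ℂ → ℂ}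
    (hf : ∀ x ∈ ({1, τ} : Set ℂ), ∃ C c : ℂ, C ≠ 0 ∧ ∀ t, f (t + x) = C * exp (c * t) * f t)
    {x : ℂ} (hx : x ∈ lattice τ) :
    ∃ C c : ℂ, C ≠ 0 ∧ ∀ t, f (t + x) = C * exp (c * t) * f t := by
  induction hx using AddSubgroup.closure_induction with
  | mem x h => exact hf x h
  | zero => exact ⟨1, 0, one_ne_zero, fun t => by simp⟩
  | add x y _ _ hx hy =>
    obtain ⟨C, c, hC, h1⟩ := hx
    obtain ⟨D, d, hD, h2⟩ := hy
    refine ⟨C * D * exp (d * x), c + d, mul_ne_zero (mul_ne_zero hC hD) (exp_ne_zero _),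
      fun t => ?_⟩
    rw [← add_assoc, h2, h1, mul_add, add_mul, exp_add, exp_add]; ring
  | neg x _ hx =>
    obtain ⟨C, c, hC, h1⟩ := hx
    refine ⟨C⁻¹ * exp (c * x), -c, mul_ne_zero (inv_ne_zero hC) (exp_ne_zero _), fun t => ?_⟩
    have := h1 (t + -x)
    rw [neg_add_cancel_right] at this
    rw [this, mul_add, exp_add]
    have h3 : exp (c * x) * exp (c * -x) = 1 := by rw [← exp_add]; simp
    have h4 : exp (-c * t) * exp (c * t) = 1 := by rw [← exp_add]; simp
    have h5 := mul_inv_cancel₀ hC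
    calc f (t + -x) = (C * C⁻¹) * (exp (c * x) * exp (c * -x)) *
        (exp (-c * t) * exp (c * t)) * f (t + -x) := by rw [h3, h4, h5]; ring
      _ = _ := by ring

/-- Translation by a lattice vector multiplies the theta function by an exponential. -/
lemma theta_add_lattice {x : ℂ} (hx : x ∈ lattice τ) :
    ∃ C c : ℂ, C ≠ 0 ∧ ∀ t, theta τ (t + x) = C * exp (c * t) * theta τ t := by
  refine exists_multiplier (fun x h => ?_) hx
  rcases h with rfl | rfl
  · exact ⟨-1, 0, by norm_num, fun t => by rw [theta_add_one]; simp⟩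
  · refine ⟨-exp (-(Real.pi * I * x)), -(2 * Real.pi * I), neg_ne_zero.2 (exp_ne_zero _),
      fun t => ?_⟩
    rw [theta_add_tau, neg_mul, neg_mul, neg_mul, ← exp_add]
    ring_nf

lemma theta_lattice {x : ℂ} (hx : x ∈ lattice τ) : theta τ x = 0 := by
  obtain ⟨C, c, -, h⟩ := theta_add_lattice hx
  simpa [theta_zero] using h 0

/-- The theta function is a multiple of a product with simple zeros on the lattice. -/
lemma exists_theta_eq_thetaProd (hτ : 0 < τ.im) :
    ∃ C c, C ≠ 0 ∧ ∀ l, theta τ l = C * exp (c * l) * thetaProd τ l := by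
  have hd := thetaProd_differentiable hτ
  obtain ⟨hz, hz'⟩ := thetaProd_zero_deriv hτ
  have hper : ∀ x ∈ lattice τ, ∃ C c : ℂ, C ≠ 0 ∧
      ∀ t, thetaProd τ (t + x) = C * exp (c * t) * thetaProd τ t := by
    refine fun x hx => exists_multiplier (fun x h => ?_) hx
    rcases h with rfl | rfl
    · exact ⟨1, 0, by norm_num, fun t => by rw [thetaProd_add_one]; simp⟩
    · refine ⟨-1, -(2 * Real.pi * I), by norm_num, fun t => ?_⟩
      rw [thetaProd_add_tau hτ]; ring_nf
  -- The zeros of the product are simple and lie on the lattice, where `theta` vanishes by oddness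
  -- and quasi-periodicity. The quotient is thus entire; its multipliers are constant, so it is an
  -- exponential.
  obtain ⟨g, hg, hgt⟩ := exists_entire_quotient (theta_differentiable hτ) hd (fun p hp => by
    have hpl : p ∈ lattice τ := by
      by_contra h; exact thetaProd_ne_zero hτ h hp
    refine ⟨?_, theta_lattice hpl⟩
    obtain ⟨C, c, hC, h⟩ := hper p hpl
    have e : thetaProd τ = fun l => C * exp (c * (l - p)) * thetaProd τ (l - p) :=
      funext fun l => by rw [← h (l - p)]; simp
    have h1 : HasDerivAt (fun l => thetaProd τ (l - p)) (deriv (thetaProd τ) 0) p :=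
      HasDerivAt.comp_sub_const p p (by simpa using (hd 0).hasDerivAt)
    have h2 : DifferentiableAt ℂ (fun l => C * exp (c * (l - p))) p := by fun_prop
    have h3 := (h2.hasDerivAt.mul h1).deriv
    rw [e]
    refine ne_of_eq_of_ne h3 ?_
    simp [hz, hC, hz'])
  have hne : thetaProd τ ≠ 0 := fun h => hz' (by rw [h]; simp)
  have q1 : ∀ l, g (l + 1) = (-1) * g l := by
    refine congrFun (eq_of_entire_mul_eq hd (hg.comp (by fun_prop : Differentiable ℂ (· + (1 : ℂ))))
      (hg.const_mul (-1)) hne fun l => ?_)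
    have h1 := hgt (l + 1)
    rw [theta_add_one, thetaProd_add_one, hgt l] at h1
    rw [← h1]; ring
  have q2 : ∀ l, g (l + τ) = exp (-(Real.pi * I * τ)) * g l := by
    refine congrFun (eq_of_entire_mul_eq hd (hg.comp (by fun_prop : Differentiable ℂ (· + τ)))
      (hg.const_mul _) hne fun l => ?_)
    have h1 := hgt (l + τ)
    rw [theta_add_tau, thetaProd_add_tau hτ, hgt l,
      show -(Real.pi * I * (τ + 2 * l)) = -(2 * Real.pi * I * l) + -(Real.pi * I * τ) by ring,
      exp_add] at h1
    have h0 := exp_ne_zero (-(2 * Real.pi * I * l))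
    apply mul_left_cancel₀ h0
    linear_combination h1
  obtain ⟨C, c, hCc⟩ := exists_eq_exp_of_quasiperiodic hτ (by norm_num) (exp_ne_zero _) hg q1 q2
  refine ⟨C, c, ?_, fun l => by rw [hgt, hCc]; ring⟩
  rintro rfl
  obtain ⟨t, ht⟩ := exists_theta_ne_zero hτ
  exact ht (by rw [hgt, hCc]; simp)

lemma theta_eq_zero_iff (hτ : 0 < τ.im) (x : ℂ) : theta τ x = 0 ↔ x ∈ lattice τ := by
  refine ⟨fun h => ?_, theta_lattice⟩
  by_contra hx
  obtain ⟨C, c, hC, e⟩ := exists_theta_eq_thetaProd hτ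
  rw [e] at h
  exact mul_ne_zero (mul_ne_zero hC (exp_ne_zero _)) (thetaProd_ne_zero hτ hx) h

lemma deriv_theta_zero (hτ : 0 < τ.im) : deriv (theta τ) 0 ≠ 0 := by
  obtain ⟨C, c, hC, e⟩ := exists_theta_eq_thetaProd hτ
  obtain ⟨hz, hz'⟩ := thetaProd_zero_deriv hτ
  have h2 : DifferentiableAt ℂ (fun l => C * exp (c * l)) 0 := by fun_prop
  have h3 := (h2.hasDerivAt.mul (thetaProd_differentiable hτ 0).hasDerivAt).deriv
  rw [funext e]
  refine ne_of_eq_of_ne h3 ?_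
  simp [hz, hC, hz']

lemma deriv_theta_lattice (hτ : 0 < τ.im) {p : ℂ} (hp : p ∈ lattice τ) :
    deriv (theta τ) p ≠ 0 := by
  obtain ⟨C, c, hC, h⟩ := theta_add_lattice hp
  have e : theta τ = fun l => C * exp (c * (l - p)) * theta τ (l - p) :=
    funext fun l => by rw [← h (l - p)]; simp
  have h1 : HasDerivAt (fun l => theta τ (l - p)) (deriv (theta τ) 0) p :=
    HasDerivAt.comp_sub_const p p (by simpa using (theta_differentiable hτ 0).hasDerivAt)
  have h2 : DifferentiableAt ℂ (fun l => C * exp (c * (l - p))) p := by fun_prop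
  have h3 := (h2.hasDerivAt.mul h1).deriv
  rw [e]
  refine ne_of_eq_of_ne h3 ?_
  simp [theta_zero, hC, deriv_theta_zero hτ]

end

section

variable {τ : ℂ}

/-! ### Theta functions of higher degree -/

/-- `f` is a theta function of degree `n` and characteristic `s`, like the product of the
`θ(l + s_j)`, `j = 1, …, n`, with `∑ s_j = s`. -/
structure IsTheta (τ : ℂ) (n : ℕ) (s : ℂ) (f : ℂ → ℂ) : Prop where
  diff : Differentiable ℂ f
  add_one : ∀ l, f (l + 1) = (-1) ^ n * f l
  add_tau : ∀ l, f (l + τ) = (-1) ^ n * exp (-(Real.pi * I * (n * τ + 2 * n * l + 2 * s))) * f l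

namespace IsTheta

lemma congr {n n' : ℕ} {s s' : ℂ} {f g : ℂ → ℂ} (hf : IsTheta τ n s f) (hn : n = n') (hs : s = s')
    (hfg : ∀ l, f l = g l) : IsTheta τ n' s' g := by
  subst hn hs
  obtain rfl : f = g := funext hfg
  exact hf

lemma add {n : ℕ} {s : ℂ} {f g : ℂ → ℂ} (hf : IsTheta τ n s f) (hg : IsTheta τ n s g) :
    IsTheta τ n s fun l => f l + g l :=
  ⟨hf.diff.add hg.diff, fun l => by rw [hf.add_one, hg.add_one]; ring,
    fun l => by rw [hf.add_tau, hg.add_tau]; ring⟩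

lemma sub {n : ℕ} {s : ℂ} {f g : ℂ → ℂ} (hf : IsTheta τ n s f) (hg : IsTheta τ n s g) :
    IsTheta τ n s fun l => f l - g l :=
  ⟨hf.diff.sub hg.diff, fun l => by rw [hf.add_one, hg.add_one]; ring,
    fun l => by rw [hf.add_tau, hg.add_tau]; ring⟩

lemma const_mul {n : ℕ} {s : ℂ} {f : ℂ → ℂ} (c : ℂ) (hf : IsTheta τ n s f) :
    IsTheta τ n s fun l => c * f l :=
  ⟨hf.diff.const_mul c, fun l => by rw [hf.add_one]; ring, fun l => by rw [hf.add_tau]; ring⟩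

lemma zero (n : ℕ) (s : ℂ) : IsTheta τ n s fun _ => 0 :=
  ⟨differentiable_const _, by simp, by simp⟩

lemma sum {ι : Type*} (S : Finset ι) {n : ℕ} {s : ℂ} {f : ι → ℂ → ℂ}
    (hf : ∀ i ∈ S, IsTheta τ n s (f i)) : IsTheta τ n s fun l => ∑ i ∈ S, f i l := by
  classical
  induction S using Finset.induction_on with
  | empty => simpa using zero n s
  | insert a S ha ih =>
    simp only [Finset.sum_insert ha]
    exact (hf a (by simp)).add (ih fun i hi => hf i (by simp [hi]))

lemma mul {n n' : ℕ} {s s' : ℂ} {f g : ℂ → ℂ} (hf : IsTheta τ n s f) (hg : IsTheta τ n' s' g) :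
    IsTheta τ (n + n') (s + s') fun l => f l * g l :=
  ⟨hf.diff.mul hg.diff, fun l => by rw [hf.add_one, hg.add_one]; ring,
    fun l => by
      rw [hf.add_tau, hg.add_tau, show -(Real.pi * I * (((n + n' : ℕ) : ℂ) * τ +
        2 * ((n + n' : ℕ) : ℂ) * l + 2 * (s + s'))) =
        -(Real.pi * I * (n * τ + 2 * n * l + 2 * s)) +
        -(Real.pi * I * (n' * τ + 2 * n' * l + 2 * s')) by push_cast; ring, exp_add]
      ring⟩

lemma one : IsTheta τ 0 0 fun _ => 1 := ⟨differentiable_const _, by simp, by simp⟩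

lemma prod {ι : Type*} (S : Finset ι) {n : ι → ℕ} {s : ι → ℂ} {f : ι → ℂ → ℂ}
    (hf : ∀ i ∈ S, IsTheta τ (n i) (s i) (f i)) :
    IsTheta τ (∑ i ∈ S, n i) (∑ i ∈ S, s i) fun l => ∏ i ∈ S, f i l := by
  classical
  induction S using Finset.induction_on with
  | empty => simpa using one
  | insert a S ha ih =>
    simp only [Finset.sum_insert ha, Finset.prod_insert ha]
    exact (hf a (by simp)).mul (ih fun i hi => hf i (by simp [hi]))

lemma comp_add {n : ℕ} {s : ℂ} {f : ℂ → ℂ} (hf : IsTheta τ n s f) (c : ℂ) :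
    IsTheta τ n (s + n * c) fun l => f (l + c) :=
  ⟨hf.diff.comp (by fun_prop), fun l => by rw [add_right_comm, hf.add_one],
    fun l => by rw [add_right_comm, hf.add_tau]; ring_nf⟩

lemma comp_sub {n : ℕ} {s : ℂ} {f : ℂ → ℂ} (hf : IsTheta τ n s f) (c : ℂ) :
    IsTheta τ n (s - n * c) fun l => f (l - c) :=
  (hf.comp_add (-c)).congr rfl (by ring) fun l => by rw [← sub_eq_add_neg]

lemma comp_neg {n : ℕ} {s : ℂ} {f : ℂ → ℂ} (hf : IsTheta τ n s f) :
    IsTheta τ n (-s) fun l => f (-l) := by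
  have h1 : ((-1 : ℂ)) ^ n * (-1) ^ n = 1 := by rw [← mul_pow]; simp
  refine ⟨hf.diff.comp (by fun_prop), fun l => ?_, fun l => ?_⟩
  · have := hf.add_one (-(l + 1))
    rw [show -(l + 1) + 1 = -l by ring] at this
    rw [this, ← mul_assoc, h1, one_mul]
  · have := hf.add_tau (-(l + τ))
    rw [show -(l + τ) + τ = -l by ring] at this
    rw [this]
    have h2 : exp (-(Real.pi * I * (n * τ + 2 * n * l + 2 * -s))) *
        exp (-(Real.pi * I * (n * τ + 2 * n * -(l + τ) + 2 * s))) = 1 := by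
      rw [← exp_add, ← exp_zero]; congr 1; ring
    calc f (-(l + τ)) = ((-1 : ℂ) ^ n * (-1) ^ n) *
        (exp (-(Real.pi * I * (n * τ + 2 * n * l + 2 * -s))) *
        exp (-(Real.pi * I * (n * τ + 2 * n * -(l + τ) + 2 * s)))) * f (-(l + τ)) := by
          rw [h1, h2]; ring
      _ = _ := by ring

lemma comp_const_sub {n : ℕ} {s : ℂ} {f : ℂ → ℂ} (hf : IsTheta τ n s f) (c : ℂ) :
    IsTheta τ n (-s - n * c) fun l => f (c - l) :=
  (hf.comp_neg.comp_sub c).congr rfl rfl fun l => by simp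

lemma theta_add (hτ : 0 < τ.im) (a : ℂ) : IsTheta τ 1 a fun l => theta τ (l + a) :=
  ⟨(theta_differentiable hτ).comp (by fun_prop),
    fun l => by rw [add_right_comm, theta_add_one]; simp,
    fun l => by rw [add_right_comm, theta_add_tau]; push_cast; ring_nf⟩

lemma theta_sub (hτ : 0 < τ.im) (a : ℂ) : IsTheta τ 1 (-a) fun l => theta τ (l - a) :=
  (theta_add hτ (-a)).congr rfl rfl fun l => by rw [sub_eq_add_neg]

lemma theta_self (hτ : 0 < τ.im) : IsTheta τ 1 0 (theta τ) :=
  (theta_add hτ 0).congr rfl rfl fun l => by rw [add_zero]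

end IsTheta

lemma theta_sub_ne_zero (hτ : 0 < τ.im) (a : ℂ) : (fun l => theta τ (l - a)) ≠ 0 := by
  obtain ⟨t, ht⟩ := exists_theta_ne_zero hτ
  intro h
  exact ht (by simpa using congrFun h (t + a))

lemma theta_sub_diff (hτ : 0 < τ.im) (a : ℂ) : Differentiable ℂ fun l => theta τ (l - a) :=
  (theta_differentiable hτ).comp (by fun_prop)

namespace IsTheta

lemma exists_exp {s : ℂ} {f : ℂ → ℂ} (hτ : 0 < τ.im) (hf : IsTheta τ 0 s f) :
    ∃ C c, ∀ l, f l = C * exp (c * l) :=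
  exists_eq_exp_of_quasiperiodic hτ one_ne_zero (exp_ne_zero (-(Real.pi * I * (2 * s)))) hf.diff
    (fun l => by simpa using hf.add_one l) (fun l => by simpa using hf.add_tau l)

lemma exists_const {f : ℂ → ℂ} (hτ : 0 < τ.im) (hf : IsTheta τ 0 0 f) :
    ∃ C, ∀ l, f l = C := by
  obtain ⟨C, hC⟩ := bounded_of_periodic hτ (h := fun l => ‖f l‖) hf.diff.continuous.norm
    (fun l => by simpa using congrArg norm (hf.add_one l))
    (fun l => by simpa using congrArg norm (hf.add_tau l))
  exact hf.diff.exists_const_forall_eq_of_bounded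
    ((Metric.isBounded_iff_subset_closedBall 0).2 ⟨C, by rintro _ ⟨l, rfl⟩; simpa using hC l⟩)

/-- If `f` vanishes at `z`, then it vanishes on `z + Λ`. -/
lemma zero_of_sub_mem {n : ℕ} {s : ℂ} {f : ℂ → ℂ} (hf : IsTheta τ n s f) {z w : ℂ}
    (hz : f z = 0) (hw : w - z ∈ lattice τ) : f w = 0 := by
  obtain ⟨C, c, -, h⟩ := exists_multiplier (f := f) (fun x h => by
    rcases h with rfl | rfl
    · exact ⟨(-1) ^ n, 0, by simp, fun t => by rw [hf.add_one]; simp⟩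
    · refine ⟨(-1) ^ n * exp (-(Real.pi * I * (n * x + 2 * s))), -(2 * Real.pi * I * n),
        mul_ne_zero (by simp) (exp_ne_zero _), fun t => ?_⟩
      rw [hf.add_tau, mul_assoc ((-1 : ℂ) ^ n) (exp _) (exp _), ← exp_add]
      ring_nf) hw
  simpa [hz] using h z

/-- The divisor `θ(l - z)` has simple zeros on `z + Λ`, where `f` vanishes by quasi-periodicity.
This is the induction step for every count of zeros: the degree drops by one, and comparison of
multipliers gives the new characteristic. -/
lemma div_theta {n : ℕ} {s : ℂ} {f : ℂ → ℂ} (hτ : 0 < τ.im) (hf : IsTheta τ (n + 1) s f) {z : ℂ}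
    (hz : f z = 0) : ∃ g, IsTheta τ n (s + z) g ∧ ∀ l, f l = theta τ (l - z) * g l := by
  obtain ⟨g, hg, e⟩ := exists_entire_quotient hf.diff (theta_sub_diff hτ z) (fun p hp => by
    have hp' := (theta_eq_zero_iff hτ _).1 hp
    refine ⟨?_, hf.zero_of_sub_mem hz hp'⟩
    rw [deriv_comp_sub_const]
    exact deriv_theta_lattice hτ hp')
  refine ⟨g, ⟨hg, ?_, ?_⟩, e⟩
  · refine congrFun (eq_of_entire_mul_eq (theta_sub_diff hτ z)
      (hg.comp (by fun_prop : Differentiable ℂ (· + (1 : ℂ)))) (hg.const_mul ((-1) ^ n))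
      (theta_sub_ne_zero hτ z) fun l => ?_)
    have := hf.add_one l
    rw [e, e, show l + 1 - z = l - z + 1 by ring, theta_add_one] at this
    linear_combination (-1 : ℂ) * this
  · intro l
    have := congrFun (eq_of_entire_mul_eq (theta_sub_diff hτ z)
      (hg.comp (by fun_prop : Differentiable ℂ (· + τ)))
      (h := fun l => (-1) ^ n * exp (-(Real.pi * I * (n * τ + 2 * n * l + 2 * (s + z)))) * g l)
      (by fun_prop)
      (theta_sub_ne_zero hτ z) fun l => ?_) l
    · exact this
    · have := hf.add_tau l
      rw [e, e, show l + τ - z = l - z + τ by ring, theta_add_tau,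
        show -(Real.pi * I * (((n + 1 : ℕ) : ℂ) * τ + 2 * ((n + 1 : ℕ) : ℂ) * l + 2 * s)) =
        -(Real.pi * I * (τ + 2 * (l - z))) +
          -(Real.pi * I * (n * τ + 2 * n * l + 2 * (s + z))) by push_cast; ring, exp_add] at this
      apply mul_left_cancel₀ (exp_ne_zero (-(Real.pi * I * (τ + 2 * (l - z)))))
      rw [Function.comp_apply]
      linear_combination (-1 : ℂ) * this

/-- A theta function of degree `n` with more than `n` zeros vanishes. -/
lemma eq_zero_of_zeros {ι : Type*} (hτ : 0 < τ.im) (z : ι → ℂ) {n : ℕ} {s : ℂ} {f : ℂ → ℂ}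
    (hf : IsTheta τ n s f) (S : Finset ι) (hS : n < S.card)
    (hz : ∀ i ∈ S, ∀ j ∈ S, i ≠ j → z i - z j ∉ lattice τ) (h0 : ∀ i ∈ S, f (z i) = 0) :
    f = 0 := by
  classical
  induction n generalizing s f S with
  | zero =>
    obtain ⟨i, hi⟩ := Finset.card_pos.1 hS
    obtain ⟨C, c, hC⟩ := hf.exists_exp hτ
    have := h0 i hi
    rw [hC] at this
    have hC0 : C = 0 := (mul_eq_zero.1 this).resolve_right (exp_ne_zero _)
    ext l; simp [hC, hC0]
  | succ n ih =>
    obtain ⟨i, hi⟩ : S.Nonempty := Finset.card_pos.1 (by omega)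
    obtain ⟨g, hg, e⟩ := hf.div_theta hτ (h0 i hi)
    have := ih hg (S.erase i) (by rw [Finset.card_erase_of_mem hi]; omega)
      (fun a ha b hb => hz a (Finset.mem_of_mem_erase ha) b (Finset.mem_of_mem_erase hb))
      (fun a ha => by
        have h1 := h0 a (Finset.mem_of_mem_erase ha)
        rw [e] at h1
        refine (mul_eq_zero.1 h1).resolve_left fun h2 => ?_
        exact hz a (Finset.mem_of_mem_erase ha) i hi (Finset.ne_of_mem_erase ha)
          ((theta_eq_zero_iff hτ _).1 h2))
    ext l; simp [e, this]

/-- If `f` had no zero, `θ^{n+1}/f` would be an entire theta function of degree `0` vanishing at the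
origin, hence zero. -/
lemma exists_zero {n : ℕ} {s : ℂ} {f : ℂ → ℂ} (hτ : 0 < τ.im) (hf : IsTheta τ (n + 1) s f) :
    ∃ z, f z = 0 := by
  by_contra! h
  have hth := IsTheta.prod (τ := τ) (Finset.range (n + 1)) (f := fun _ => theta τ)
    (fun i _ => theta_self hτ)
  simp only [Finset.sum_const, Finset.card_range, Finset.prod_const, smul_eq_mul, mul_one,
    smul_zero] at hth
  have h1 : ((-1 : ℂ)) ^ (n + 1) ≠ 0 := by simp
  have hg : IsTheta τ 0 (-s) fun l => theta τ l ^ (n + 1) / f l := by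
    refine ⟨hth.diff.div hf.diff h, fun l => ?_, fun l => ?_⟩
    · rw [hth.add_one, hf.add_one, mul_div_mul_left _ _ h1]; simp
    · rw [hth.add_tau, hf.add_tau]
      rw [show -(Real.pi * I * (((n + 1 : ℕ) : ℂ) * τ + 2 * ((n + 1 : ℕ) : ℂ) * l + 2 * 0)) =
        -(Real.pi * I * (((n + 1 : ℕ) : ℂ) * τ + 2 * ((n + 1 : ℕ) : ℂ) * l + 2 * s)) +
        -(Real.pi * I * (2 * -s)) by ring, exp_add]
      have h2 := exp_ne_zero (-(Real.pi * I * (((n + 1 : ℕ) : ℂ) * τ +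
        2 * ((n + 1 : ℕ) : ℂ) * l + 2 * s)))
      have h3 := h l
      simp only [pow_zero, CharP.cast_eq_zero, zero_mul, mul_zero, zero_add, one_mul]
      field_simp
  have := hg.eq_zero_of_zeros hτ (fun _ : Unit => 0) {()} (by simp) (by simp)
    (by simp [theta_zero])
  obtain ⟨t, ht⟩ := exists_theta_ne_zero hτ
  have h3 := congrFun this t
  simp [h t, ht] at h3

end IsTheta

/-! ### Products of theta functions and divisors on the elliptic curve -/

/-- The product of the `θ(l - a)`, `a ∈ A`. -/
def divTheta (τ : ℂ) (A : Multiset ℂ) (l : ℂ) : ℂ := (A.map fun a => theta τ (l - a)).prod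

lemma divTheta_cons (a : ℂ) (A : Multiset ℂ) (l : ℂ) :
    divTheta τ (a ::ₘ A) l = theta τ (l - a) * divTheta τ A l := by simp [divTheta]

lemma divTheta_add (A B : Multiset ℂ) (l : ℂ) :
    divTheta τ (A + B) l = divTheta τ A l * divTheta τ B l := by simp [divTheta]

lemma divTheta_isTheta (hτ : 0 < τ.im) (A : Multiset ℂ) :
    IsTheta τ A.card (-A.sum) (divTheta τ A) := by
  induction A using Multiset.induction_on with
  | empty => exact IsTheta.one.congr (by simp) (by simp) fun l => by simp [divTheta]
  | cons a A ih =>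
    exact ((IsTheta.theta_sub hτ a).mul ih).congr (by simp [add_comm]) (by simp; ring)
      fun l => (divTheta_cons a A l).symm

lemma divTheta_eq_zero_iff (hτ : 0 < τ.im) (A : Multiset ℂ) (l : ℂ) :
    divTheta τ A l = 0 ↔ ∃ a ∈ A, l - a ∈ lattice τ := by
  simp [divTheta, Multiset.prod_eq_zero_iff, theta_eq_zero_iff hτ]

lemma ne_zero_of_mul_ne {f g : ℂ → ℂ} (hf : Differentiable ℂ f) (hg : Differentiable ℂ g)
    (hf0 : f ≠ 0) (hg0 : g ≠ 0) : (fun l => f l * g l) ≠ 0 := fun h =>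
  (eq_zero_or_eq_zero_of_entire_mul hf hg (congrFun h)).elim hf0 hg0

lemma divTheta_ne_zero (hτ : 0 < τ.im) (A : Multiset ℂ) : divTheta τ A ≠ 0 := by
  induction A using Multiset.induction_on with
  | empty => exact fun h => by simpa [divTheta] using congrFun h 0
  | cons a A ih =>
    have := ne_zero_of_mul_ne (theta_sub_diff hτ a) (divTheta_isTheta hτ A).diff
      (theta_sub_ne_zero hτ a) ih
    rwa [← funext (divTheta_cons a A)] at this

lemma mk_eq_mk_iff {a b : ℂ} : (QuotientAddGroup.mk a : Ell τ) = QuotientAddGroup.mk b ↔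
    a - b ∈ lattice τ := by
  rw [eq_comm, QuotientAddGroup.eq, neg_add_eq_sub]

/-- The divisor on `E_τ` of a multiset of points of `ℂ`. -/
def divClass (τ : ℂ) (A : Multiset ℂ) : Multiset (Ell τ) :=
  A.map fun a => (QuotientAddGroup.mk a : Ell τ)

lemma theta_sub_congr {a b : ℂ} (h : a - b ∈ lattice τ) :
    ∃ C c : ℂ, C ≠ 0 ∧ ∀ l, theta τ (l - b) = C * exp (c * l) * theta τ (l - a) := by
  obtain ⟨C, c, hC, e⟩ := theta_add_lattice h
  refine ⟨C * exp (-(c * a)), c, mul_ne_zero hC (exp_ne_zero _), fun l => ?_⟩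
  have := e (l - a)
  rw [show l - a + (a - b) = l - b by ring] at this
  rw [this, mul_assoc C (exp _) (exp _), ← exp_add]; ring_nf

/-- The divisor of a product of theta functions determines it up to an exponential factor. -/
lemma divTheta_congr {A B : Multiset ℂ} (h : divClass τ A = divClass τ B) :
    ∃ C c : ℂ, C ≠ 0 ∧ ∀ l, divTheta τ A l = C * exp (c * l) * divTheta τ B l := by
  induction A using Multiset.induction_on generalizing B with
  | empty =>
    obtain rfl : B = 0 := by simpa [divClass, eq_comm] using h
    exact ⟨1, 0, one_ne_zero, fun l => by simp⟩
  | cons a A ih =>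
    obtain ⟨b, hb, hab⟩ : ∃ b ∈ B, (QuotientAddGroup.mk b : Ell τ) = QuotientAddGroup.mk a := by
      have : (QuotientAddGroup.mk a : Ell τ) ∈ divClass τ B := by rw [← h]; simp [divClass]
      simpa [divClass] using this
    obtain ⟨B', rfl⟩ := Multiset.exists_cons_of_mem hb
    obtain ⟨C, c, hC, e⟩ := ih (B := B') (by simpa [divClass, hab] using h)
    obtain ⟨D, d, hD, e'⟩ := theta_sub_congr (mk_eq_mk_iff.1 hab)
    refine ⟨C * D, c + d, mul_ne_zero hC hD, fun l => ?_⟩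
    rw [divTheta_cons, divTheta_cons, e, e', add_mul, exp_add]; ring

/-- Unique factorization of theta functions. -/
lemma divClass_eq_of_divTheta (hτ : 0 < τ.im) {A B : Multiset ℂ} {C c : ℂ} (hC : C ≠ 0)
    (h : ∀ l, divTheta τ A l = C * exp (c * l) * divTheta τ B l) :
    divClass τ A = divClass τ B := by
  induction A using Multiset.induction_on generalizing B C c with
  | empty =>
    rcases Multiset.empty_or_exists_mem B with rfl | ⟨b, hb⟩
    · rfl
    · have h1 := h b
      rw [(divTheta_eq_zero_iff hτ B b).2 ⟨b, hb, by simp [zero_mem]⟩] at h1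
      simp [divTheta] at h1
  | cons a A ih =>
    have h1 := h a
    rw [(divTheta_eq_zero_iff hτ (a ::ₘ A) a).2 ⟨a, by simp, by simp [zero_mem]⟩] at h1
    have h2 : divTheta τ B a = 0 :=
      (mul_eq_zero.1 h1.symm).resolve_left (mul_ne_zero hC (exp_ne_zero _))
    obtain ⟨b, hb, hab⟩ := (divTheta_eq_zero_iff hτ B a).1 h2
    obtain ⟨B', rfl⟩ := Multiset.exists_cons_of_mem hb
    obtain ⟨D, d, hD, e'⟩ := theta_sub_congr hab
    have := ih (B := B') (C := C * D) (c := c + d) (mul_ne_zero hC hD)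
      (congrFun (eq_of_entire_mul_eq (theta_sub_diff hτ a) (divTheta_isTheta hτ A).diff
        (h := fun l => C * D * exp ((c + d) * l) * divTheta τ B' l)
        (((by fun_prop : Differentiable ℂ fun l : ℂ => C * D * exp ((c + d) * l)).mul
          (divTheta_isTheta hτ B').diff)) (theta_sub_ne_zero hτ a)
        (fun l => by
          have := h l
          rw [divTheta_cons, divTheta_cons, e'] at this
          rw [this, add_mul, exp_add]; ring)))
    simp only [divClass, Multiset.map_cons] at this ⊢
    rw [this, mk_eq_mk_iff.2 hab]

end

section

/-! ### Polynomial functions -/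

/-- `f` is a polynomial function. -/
def IsPoly (f : ℂ → ℂ) : Prop := ∃ p : Polynomial ℂ, ∀ x, f x = p.eval x

namespace IsPoly

lemma const (c : ℂ) : IsPoly fun _ => c := ⟨Polynomial.C c, by simp⟩

lemma id : IsPoly fun x => x := ⟨Polynomial.X, by simp⟩

lemma add {f g : ℂ → ℂ} (hf : IsPoly f) (hg : IsPoly g) : IsPoly fun x => f x + g x := by
  obtain ⟨p, hp⟩ := hf
  obtain ⟨q, hq⟩ := hg
  exact ⟨p + q, by simp [hp, hq]⟩

lemma mul {f g : ℂ → ℂ} (hf : IsPoly f) (hg : IsPoly g) : IsPoly fun x => f x * g x := by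
  obtain ⟨p, hp⟩ := hf
  obtain ⟨q, hq⟩ := hg
  exact ⟨p * q, by simp [hp, hq]⟩

lemma const_mul {f : ℂ → ℂ} (c : ℂ) (hf : IsPoly f) : IsPoly fun x => c * f x :=
  (const c).mul hf

lemma sub {f g : ℂ → ℂ} (hf : IsPoly f) (hg : IsPoly g) : IsPoly fun x => f x - g x := by
  obtain ⟨p, hp⟩ := hf
  obtain ⟨q, hq⟩ := hg
  exact ⟨p - q, by simp [hp, hq]⟩

lemma pow {f : ℂ → ℂ} (hf : IsPoly f) (n : ℕ) : IsPoly fun x => f x ^ n := by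
  obtain ⟨p, hp⟩ := hf
  exact ⟨p ^ n, by simp [hp]⟩

lemma sum {ι : Type*} (S : Finset ι) {f : ι → ℂ → ℂ} (hf : ∀ i ∈ S, IsPoly (f i)) :
    IsPoly fun x => ∑ i ∈ S, f i x := by
  classical
  induction S using Finset.induction_on with
  | empty => simpa using const 0
  | insert a S ha ih =>
    simp only [Finset.sum_insert ha]
    exact (hf a (by simp)).add (ih fun i hi => hf i (by simp [hi]))

lemma differentiable {f : ℂ → ℂ} (hf : IsPoly f) : Differentiable ℂ f := by
  obtain ⟨p, hp⟩ := hf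
  rw [funext hp]
  exact p.differentiable

lemma finite_zeros {f : ℂ → ℂ} (hf : IsPoly f) {x₀ : ℂ} (h : f x₀ ≠ 0) : {x | f x = 0}.Finite := by
  obtain ⟨p, hp⟩ := hf
  have h0 : p ≠ 0 := by rintro rfl; exact h (by simp [hp])
  refine p.roots.toFinset.finite_toSet.subset fun x hx => ?_
  have hx' : p.eval x = 0 := by rw [← hp]; exact hx
  simpa [h0] using hx'

end IsPoly

/-! ### The three-term recursion -/

section Recursion

variable (τ η : ℂ) (m : ℕ) {A B : Type*} [CommRing A] [Algebra ℂ A] [CommRing B] [Algebra ℂ B]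

/-- The solution of the three-term recursion satisfied by the values `ψ(2ηm - 2ηj)` of an
eigenfunction, where `e` is the eigenvalue; `d` is a homogenizing parameter. -/
def pRec (e d : A) : ℕ → A
  | 0 => 1
  | 1 => algebraMap ℂ A (theta τ (2 * η * m) / theta τ (4 * η * m)) * e
  | j + 2 => algebraMap ℂ A (theta τ (2 * η * (m - (j + 1))) / theta τ (2 * η * (2 * m - (j + 1)))) *
      e * pRec e d (j + 1) +
      algebraMap ℂ A (theta τ (2 * η * (j + 1)) / theta τ (2 * η * (2 * m - (j + 1)))) *
      d * pRec e d j

lemma map_pRec (φ : A →ₐ[ℂ] B) (e d : A) (j : ℕ) :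
    φ (pRec τ η m e d j) = pRec τ η m (φ e) (φ d) j := by
  induction j using Nat.twoStepInduction with
  | zero => simp [pRec]
  | one => simp [pRec]
  | more j h1 h2 => simp only [pRec, map_add, map_mul, h1, h2, AlgHom.commutes]

/-- The recursion is homogeneous for the weights `1` of `e` and `2` of `d`. This makes the leading
coefficient in `e` accessible as the value at `e = 1`, `d = 0`. -/
lemma pRec_homogeneous (s e d : A) (j : ℕ) :
    pRec τ η m (s * e) (s ^ 2 * d) j = s ^ j * pRec τ η m e d j := by
  induction j using Nat.twoStepInduction with
  | zero => simp [pRec]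
  | one => simp [pRec]; ring
  | more j h1 h2 => simp only [pRec, h1, h2]; ring

end Recursion

variable {τ η : ℂ} {m : ℕ}

lemma theta_int_ne (hτ : 0 < τ.im) (hη : ∀ k : ℤ, k ≠ 0 → (k : ℂ) * η ∉ lattice τ) {x : ℂ} {k : ℤ}
    (hk : k ≠ 0) (hx : x = 2 * η * k) : theta τ x ≠ 0 := by
  rw [Ne, theta_eq_zero_iff hτ, hx, show 2 * η * k = ((2 * k : ℤ) : ℂ) * η by push_cast; ring]
  exact hη _ (by omega)

lemma two_eta_sub (hη : ∀ k : ℤ, k ≠ 0 → (k : ℂ) * η ∉ lattice τ) {i j : ℤ} (h : i ≠ j) :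
    2 * η * i - 2 * η * j ∉ lattice τ := by
  rw [show 2 * η * i - 2 * η * j = ((2 * (i - j) : ℤ) : ℂ) * η by push_cast; ring]
  exact hη _ (by omega)

lemma one_half_notMem (hτ : 0 < τ.im) : (1 / 2 : ℂ) ∉ lattice τ := by
  rw [mem_lattice_iff]
  rintro ⟨n, k, h⟩
  have h1 := congrArg Complex.im h
  simp [hτ.ne'] at h1
  subst h1
  have h2 := congrArg Complex.re h
  simp at h2
  have h3 : (1 : ℝ) = (2 * n : ℤ) := by push_cast; linarith
  have h4 : (1 : ℤ) = 2 * n := by exact_mod_cast h3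
  omega

lemma tau_half_notMem (hτ : 0 < τ.im) : (τ / 2 : ℂ) ∉ lattice τ := by
  rw [mem_lattice_iff]
  rintro ⟨n, k, h⟩
  have h1 := congrArg Complex.im h
  simp at h1
  have h3 : (1 : ℝ) = (2 * k : ℤ) := by
    push_cast; field_simp at h1; linarith
  have h4 : (1 : ℤ) = 2 * k := by exact_mod_cast h3
  omega

lemma one_sub_tau_half_notMem (hτ : 0 < τ.im) : (1 / 2 - τ / 2 : ℂ) ∉ lattice τ := by
  rw [mem_lattice_iff]
  rintro ⟨n, k, h⟩
  have h1 := congrArg Complex.im h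
  simp at h1
  have h3 : (-1 : ℝ) = (2 * k : ℤ) := by
    push_cast; field_simp at h1; linarith
  have h4 : (-1 : ℤ) = 2 * k := by exact_mod_cast h3
  omega

lemma one_mem_lattice : (1 : ℂ) ∈ lattice τ := AddSubgroup.subset_closure (by simp)

lemma tau_mem_lattice : τ ∈ lattice τ := AddSubgroup.subset_closure (by simp)

/-- If `z - 2ηk` were a lattice point, then so would be `2z - 2(z - 2ηk) = 4kη`. Half periods other
than `0` thus stay off the grid and serve as additional test points. -/
lemma half_sub_notMem (hη : ∀ k : ℤ, k ≠ 0 → (k : ℂ) * η ∉ lattice τ) {z : ℂ} (hz : z ∉ lattice τ)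
    (h2z : 2 * z ∈ lattice τ) (k : ℤ) : z - 2 * η * k ∉ lattice τ := by
  intro h
  by_cases hk : k = 0
  · subst hk; simp at h; exact hz h
  · refine hη (4 * k) (by omega) ?_
    have h1 := sub_mem h2z (add_mem h h)
    convert h1 using 1; push_cast; ring

lemma one_half_sub_notMem (hτ : 0 < τ.im) (hη : ∀ k : ℤ, k ≠ 0 → (k : ℂ) * η ∉ lattice τ) (k : ℤ) :
    1 / 2 - 2 * η * k ∉ lattice τ :=
  half_sub_notMem hη (one_half_notMem hτ) (by norm_num; exact one_mem_lattice) k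

lemma tau_half_sub_notMem (hτ : 0 < τ.im) (hη : ∀ k : ℤ, k ≠ 0 → (k : ℂ) * η ∉ lattice τ) (k : ℤ) :
    τ / 2 - 2 * η * k ∉ lattice τ :=
  half_sub_notMem hη (tau_half_notMem hτ)
    (by rw [show 2 * (τ / 2) = τ by ring]; exact tau_mem_lattice) k

/-- The value at `2ηk` of an eigenfunction with eigenvalue `e`, normalized at `2ηm`. -/
def pVal (τ η : ℂ) (m : ℕ) (e : ℂ) (k : ℤ) : ℂ := pRec τ η m e 1 (m - k.natAbs)

lemma pVal_neg (e : ℂ) (k : ℤ) : pVal τ η m e (-k) = pVal τ η m e k := by simp [pVal]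

lemma pVal_top (e : ℂ) : pVal τ η m e m = 1 := by simp [pVal, pRec]

lemma pVal_isPoly (k : ℤ) : IsPoly fun e => pVal τ η m e k := by
  refine ⟨pRec τ η m Polynomial.X 1 (m - k.natAbs), fun e => ?_⟩
  have := map_pRec τ η m (Polynomial.aeval (R := ℂ) e) Polynomial.X 1 (m - k.natAbs)
  simp only [Polynomial.aeval_X, map_one] at this
  show pRec τ η m e 1 (m - k.natAbs) = _
  rw [← this, Polynomial.coe_aeval_eq_eval]

/-- For `k > 0` this is the recursion defining `pRec`, for `k < 0` its mirror image, and for `k = 0`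
both sides vanish by parity. -/
lemma pVal_recursion (hτ : 0 < τ.im) (hη : ∀ k : ℤ, k ≠ 0 → (k : ℂ) * η ∉ lattice τ) (hm : 0 < m)
    (e : ℂ) {k : ℤ} (hk : |k| ≤ m) :
    theta τ (2 * η * k + 2 * η * m) * pVal τ η m e (k - 1) +
      theta τ (2 * η * k - 2 * η * m) * pVal τ η m e (k + 1) =
      e * theta τ (2 * η * k) * pVal τ η m e k := by
  have key : ∀ k : ℤ, 0 < k → k ≤ m → theta τ (2 * η * k + 2 * η * m) * pVal τ η m e (k - 1) +
      theta τ (2 * η * k - 2 * η * m) * pVal τ η m e (k + 1) =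
      e * theta τ (2 * η * k) * pVal τ η m e k := by
    intro k h0 h1
    obtain ⟨j, hj⟩ : ∃ j : ℕ, k = m - j := ⟨(m - k).toNat, by omega⟩
    have hjm : j < m := by omega
    have e1 : m - (k - 1).natAbs = j + 1 := by omega
    have e2 : m - k.natAbs = j := by omega
    have hne : theta τ (2 * η * (2 * m - j)) ≠ 0 :=
      theta_int_ne hτ hη (k := 2 * m - j) (by omega) (by push_cast; ring)
    have hkc : (k : ℂ) = m - j := by rw [hj]; push_cast; ring
    rw [pVal, pVal, pVal, e1, e2, hkc, show 2 * η * ((m : ℂ) - j) + 2 * η * m =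
      2 * η * (2 * m - j) by ring, show 2 * η * ((m : ℂ) - j) - 2 * η * m = -(2 * η * j) by ring,
      theta_neg]
    rcases j with _ | j
    -- At the end `k = m` truncated subtraction gives an arbitrary value at `m + 1`; it is
    -- multiplied by `θ(0) = 0`.
    · have h4 : theta τ (4 * η * m) ≠ 0 :=
        theta_int_ne hτ hη (k := 2 * m) (by omega) (by push_cast; ring)
      simp only [CharP.cast_eq_zero, sub_zero, mul_zero, theta_zero, neg_zero, zero_mul, add_zero,
        pRec, Algebra.algebraMap_self, RingHom.id_apply]
      rw [show 2 * η * (2 * (m : ℂ)) = 4 * η * m by ring]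
      field_simp
    · have e3 : m - (k + 1).natAbs = j := by omega
      rw [e3]
      push_cast at hne ⊢
      simp only [pRec, Algebra.algebraMap_self, RingHom.id_apply]
      field_simp
      ring
  rcases lt_trichotomy k 0 with h | h | h
  · have h1 := key (-k) (by omega) (by have := abs_of_neg h; omega)
    rw [show -k - 1 = -(k + 1) by ring, show -k + 1 = -(k - 1) by ring, pVal_neg, pVal_neg,
      pVal_neg] at h1
    push_cast at h1
    rw [show 2 * η * -(k : ℂ) + 2 * η * m = -(2 * η * k - 2 * η * m) by ring,
      show 2 * η * -(k : ℂ) - 2 * η * m = -(2 * η * k + 2 * η * m) by ring,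
      show 2 * η * -(k : ℂ) = -(2 * η * k) by ring, theta_neg, theta_neg, theta_neg] at h1
    linear_combination -h1
  · subst h
    rw [show (0 : ℤ) - 1 = -1 by ring, pVal_neg]
    simp only [Int.cast_zero, mul_zero, zero_add, zero_sub, theta_neg, theta_zero]
    ring
  · exact key k h (by have := abs_of_pos h; omega)

/-! ### Even theta functions and interpolation -/

/-- The even theta function `θ(l - a) θ(l + a)` of degree two. -/
def evenTheta (τ a l : ℂ) : ℂ := theta τ (l - a) * theta τ (l + a)

lemma evenTheta_isTheta (hτ : 0 < τ.im) (a : ℂ) : IsTheta τ 2 0 (evenTheta τ a) :=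
  ((IsTheta.theta_sub hτ a).mul (IsTheta.theta_add hτ a)).congr rfl (by ring) fun _ => rfl

lemma evenTheta_neg (a l : ℂ) : evenTheta τ a (-l) = evenTheta τ a l := by
  rw [evenTheta, evenTheta, show -l - a = -(l + a) by ring, show -l + a = -(l - a) by ring,
    theta_neg, theta_neg]; ring

lemma evenTheta_self (a : ℂ) : evenTheta τ a a = 0 := by simp [evenTheta, theta_zero]

lemma evenTheta_ne_zero (hτ : 0 < τ.im) {a l : ℂ} (h1 : l - a ∉ lattice τ)
    (h2 : l + a ∉ lattice τ) : evenTheta τ a l ≠ 0 :=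
  mul_ne_zero (by rwa [Ne, theta_eq_zero_iff hτ]) (by rwa [Ne, theta_eq_zero_iff hτ])

/-- Lagrange interpolation polynomials in the space of even theta functions. -/
def lagrange (τ : ℂ) (S : Finset ℕ) (x : ℕ → ℂ) (i : ℕ) (l : ℂ) : ℂ :=
  ∏ j ∈ S.erase i, evenTheta τ (x j) l / evenTheta τ (x j) (x i)

lemma lagrange_isTheta (hτ : 0 < τ.im) (S : Finset ℕ) (x : ℕ → ℂ) {i : ℕ} (hi : i ∈ S) {n : ℕ}
    (hS : S.card = n + 1) : IsTheta τ (2 * n) 0 (lagrange τ S x i) := by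
  have := IsTheta.prod (τ := τ) (S.erase i)
    (f := fun j l => (evenTheta τ (x j) (x i))⁻¹ * evenTheta τ (x j) l)
    (fun j _ => (evenTheta_isTheta hτ (x j)).const_mul _)
  refine this.congr ?_ (by simp) fun l => ?_
  · rw [Finset.sum_const, Finset.card_erase_of_mem hi, hS]; simp [mul_comm]
  · simp only [lagrange]
    exact Finset.prod_congr rfl fun j _ => by rw [div_eq_mul_inv, mul_comm]

lemma lagrange_neg (S : Finset ℕ) (x : ℕ → ℂ) (i : ℕ) (l : ℂ) :
    lagrange τ S x i (-l) = lagrange τ S x i l := by simp [lagrange, evenTheta_neg]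

lemma sum_lagrange (S : Finset ℕ) (x : ℕ → ℂ)
    (hx : ∀ i ∈ S, ∀ j ∈ S, i ≠ j → evenTheta τ (x j) (x i) ≠ 0) (c : ℕ → ℂ) (T : Finset ℕ)
    (hT : T ⊆ S) {i : ℕ} (hi : i ∈ T) : ∑ k ∈ T, c k * lagrange τ S x k (x i) = c i := by
  rw [Finset.sum_eq_single i]
  · rw [lagrange, Finset.prod_eq_one, mul_one]
    intro j hj
    exact div_self (hx i (hT hi) j (Finset.mem_of_mem_erase hj) (Finset.ne_of_mem_erase hj).symm)
  · intro k hk hki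
    rw [lagrange, Finset.prod_eq_zero (i := i), mul_zero]
    · exact Finset.mem_erase.2 ⟨hki.symm, hT hi⟩
    · rw [evenTheta_self, zero_div]
  · exact fun h => absurd hi h

/-! ### The products of values of the two eigenfunctions -/

section Spectral

variable (τ η m)

/-- The even theta function of degree `2m` which is `ψ(l) ψ(-l)` for an eigenfunction `ψ`. -/
def qFun (e l : ℂ) : ℂ :=
  ∑ k ∈ Finset.range (m + 1), pVal τ η m e k ^ 2 *
    lagrange τ (Finset.range (m + 1)) (fun j => 2 * η * j) k l

/-- The product of the `θ(l - 2ηk)`, `-m < k ≤ m`. -/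
def wFun (l : ℂ) : ℂ := ∏ k ∈ Finset.Icc (1 - m : ℤ) m, theta τ (l - 2 * η * k)

/-- The product of the `θ(l - 2ηk)`, `-m ≤ k ≤ m`. -/
def piFun (l : ℂ) : ℂ := ∏ k ∈ Finset.Icc (-m : ℤ) m, theta τ (l - 2 * η * k)

/-- A first approximation of `vFun`. -/
def vFunAux (e l : ℂ) : ℂ :=
  ∑ k ∈ Finset.Icc 1 m, (pVal τ η m e k * pVal τ η m e (k - 1)) *
    lagrange τ (Finset.Icc 1 (m + 1)) (fun j => 2 * η * j - η) k (l - η)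

/-- The defect of `vFunAux` in the linear relation between `vFun` and `qFun`. -/
def vDefect (e l : ℂ) : ℂ :=
  theta τ (l + 2 * η * m) * vFunAux τ η m e l +
    theta τ (l - 2 * η * m) * vFunAux τ η m e (l + 2 * η) - e * theta τ l * qFun τ η m e l

/-- The theta function of degree `2m` which is `(ψ(l) ψ(2η - l) + ψ(-l) ψ(l - 2η)) / 2` for an
eigenfunction `ψ`. -/
def vFun (e l : ℂ) : ℂ :=
  vFunAux τ η m e l - vDefect τ η m e (1 / 2) / (2 * piFun τ η m (1 / 2)) * wFun τ η m l

/-- The polynomial defining the spectral curve. -/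
def specPoly (e : ℂ) : ℂ :=
  (vFun τ η m e (1 / 2) ^ 2 - qFun τ η m e (1 / 2) * qFun τ η m e (1 / 2 - 2 * η)) /
    wFun τ η m (1 / 2) ^ 2

end Spectral

lemma theta_mul_wFun (l : ℂ) : theta τ (l + 2 * η * m) * wFun τ η m l = piFun τ η m l := by
  have : Finset.Icc (-m : ℤ) m = insert (-m : ℤ) (Finset.Icc (1 - m : ℤ) m) := by
    ext k; simp only [Finset.mem_Icc, Finset.mem_insert]; omega
  rw [piFun, wFun, this, Finset.prod_insert (by simp)]
  congr 2; push_cast; ring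

/-- Together with `theta_mul_wFun` this shows that adding a multiple of `wFun` to `vFunAux` changes
the defect by twice that multiple of `piFun`. It also gives `θ(l-2ηm) w(l+2η) = θ(l+2ηm) w(l)`, on
which the spectral equation rests. -/
lemma theta_mul_wFun_add (l : ℂ) :
    theta τ (l - 2 * η * m) * wFun τ η m (l + 2 * η) = piFun τ η m l := by
  have : Finset.Icc (-m : ℤ) m =
      insert (m : ℤ) ((Finset.Icc (1 - m : ℤ) m).image fun k => k - 1) := by
    ext k; simp only [Finset.mem_Icc, Finset.mem_insert, Finset.mem_image]
    constructor
    · intro h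
      by_cases hk : k = m
      · exact Or.inl hk
      · exact Or.inr ⟨k + 1, by omega, by ring⟩
    · rintro (h | ⟨j, hj, rfl⟩) <;> omega
  rw [piFun, wFun, this, Finset.prod_insert (by
    simp only [Finset.mem_image, Finset.mem_Icc]; rintro ⟨j, hj, h⟩; omega),
    Finset.prod_image (by intro a _ b _ h; simpa using h)]
  congr 1
  refine Finset.prod_congr rfl fun k _ => ?_
  congr 1; push_cast; ring

lemma prod_Icc_reflect (f : ℤ → ℂ) :
    ∏ k ∈ Finset.Icc (1 - m : ℤ) m, f (1 - k) = ∏ k ∈ Finset.Icc (1 - m : ℤ) m, f k := by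
  refine Finset.prod_bij' (fun k _ => 1 - k) (fun k _ => 1 - k) ?_ ?_ ?_ ?_ ?_ <;>
    simp only [Finset.mem_Icc] <;> intros <;> first | omega | trivial

lemma wFun_reflect (l : ℂ) : wFun τ η m (2 * η - l) = wFun τ η m l := by
  rw [wFun, wFun, ← prod_Icc_reflect]
  have : ∀ k : ℤ, theta τ (2 * η - l - 2 * η * ((1 - k : ℤ) : ℂ)) =
      (-1) * theta τ (l - 2 * η * k) := by
    intro k
    rw [show 2 * η - l - 2 * η * ((1 - k : ℤ) : ℂ) = -(l - 2 * η * k) by push_cast; ring,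
      theta_neg]; ring
  simp only [this]
  rw [Finset.prod_mul_distrib, Finset.prod_const, Int.card_Icc,
    show ((m : ℤ) + 1 - (1 - m)).toNat = 2 * m by omega, pow_mul]
  simp

lemma wFun_isTheta (hτ : 0 < τ.im) : IsTheta τ (2 * m) (-(2 * m * η)) (wFun τ η m) := by
  have := IsTheta.prod (τ := τ) (Finset.Icc (1 - m : ℤ) m)
    (f := fun k l => theta τ (l - 2 * η * k)) (fun k _ => IsTheta.theta_sub hτ _)
  refine this.congr ?_ ?_ fun l => rfl
  · simp; omega
  · have h1 : ∑ k ∈ Finset.Icc (1 - m : ℤ) m, (-(2 * η * ((1 - k : ℤ) : ℂ))) =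
        ∑ k ∈ Finset.Icc (1 - m : ℤ) m, -(2 * η * (k : ℂ)) := by
      refine Finset.sum_bij' (fun k _ => 1 - k) (fun k _ => 1 - k) ?_ ?_ ?_ ?_ ?_ <;>
        simp only [Finset.mem_Icc] <;> intros <;> first | omega | trivial
    have h2 : ∑ k ∈ Finset.Icc (1 - m : ℤ) m, (-(2 * η * ((1 - k : ℤ) : ℂ))) +
        ∑ k ∈ Finset.Icc (1 - m : ℤ) m, -(2 * η * (k : ℂ)) = -(4 * m * η) := by
      rw [← Finset.sum_add_distrib]
      have : ∀ k : ℤ, -(2 * η * ((1 - k : ℤ) : ℂ)) + -(2 * η * (k : ℂ)) = -(2 * η) := by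
        intro k; push_cast; ring
      simp only [this]
      rw [Finset.sum_const, Int.card_Icc, show ((m : ℤ) + 1 - (1 - m)).toNat = 2 * m by omega]
      simp; ring
    rw [h1] at h2
    linear_combination h2 / 2

lemma wFun_eq_zero (hτ : 0 < τ.im) {l : ℂ} (h : wFun τ η m l = 0) :
    ∃ k : ℤ, |k| ≤ m ∧ l - 2 * η * k ∈ lattice τ := by
  obtain ⟨k, hk, h0⟩ := Finset.prod_eq_zero_iff.1 h
  refine ⟨k, ?_, (theta_eq_zero_iff hτ _).1 h0⟩
  simp only [Finset.mem_Icc] at hk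
  rw [abs_le]; omega

lemma wFun_zero {k : ℤ} (hk : k ∈ Finset.Icc (1 - m : ℤ) m) : wFun τ η m (2 * η * k) = 0 :=
  Finset.prod_eq_zero hk (by simp [theta_zero])

lemma wFun_half_ne (hτ : 0 < τ.im) (hη : ∀ k : ℤ, k ≠ 0 → (k : ℂ) * η ∉ lattice τ) :
    wFun τ η m (1 / 2) ≠ 0 :=
  Finset.prod_ne_zero_iff.2 fun k _ => by
    rw [Ne, theta_eq_zero_iff hτ]; exact one_half_sub_notMem hτ hη k

lemma piFun_half_ne (hτ : 0 < τ.im) (hη : ∀ k : ℤ, k ≠ 0 → (k : ℂ) * η ∉ lattice τ) :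
    piFun τ η m (1 / 2) ≠ 0 :=
  Finset.prod_ne_zero_iff.2 fun k _ => by
    rw [Ne, theta_eq_zero_iff hτ]; exact one_half_sub_notMem hτ hη k

lemma qFun_isTheta (hτ : 0 < τ.im) (e : ℂ) : IsTheta τ (2 * m) 0 (qFun τ η m e) :=
  IsTheta.sum _ fun _ hk => (lagrange_isTheta hτ _ _ hk (by simp)).const_mul _

lemma qFun_neg (e l : ℂ) : qFun τ η m e (-l) = qFun τ η m e l := by simp [qFun, lagrange_neg]

lemma evenTheta_grid_ne (hτ : 0 < τ.im) (hη : ∀ k : ℤ, k ≠ 0 → (k : ℂ) * η ∉ lattice τ) {i j : ℕ}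
    (h : i ≠ j) : evenTheta τ (2 * η * j) (2 * η * i) ≠ 0 :=
  evenTheta_ne_zero hτ (by exact_mod_cast two_eta_sub hη (i := i) (j := j) (by omega)) (by
    have := two_eta_sub hη (i := i) (j := -j) (by omega)
    push_cast at this
    rwa [show 2 * η * (i : ℂ) - 2 * η * -(j : ℂ) = 2 * η * i + 2 * η * j by ring] at this)

lemma qFun_grid (hτ : 0 < τ.im) (hη : ∀ k : ℤ, k ≠ 0 → (k : ℂ) * η ∉ lattice τ) (e : ℂ) {k : ℤ}
    (hk : |k| ≤ m) : qFun τ η m e (2 * η * k) = pVal τ η m e k ^ 2 := by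
  have key : ∀ j : ℕ, j ≤ m → qFun τ η m e (2 * η * j) = pVal τ η m e j ^ 2 := by
    intro j hj
    exact sum_lagrange _ (fun j : ℕ => 2 * η * (j : ℂ))
      (fun i _ j _ h => evenTheta_grid_ne hτ hη h) (fun k => pVal τ η m e k ^ 2) _
      (Finset.Subset.refl _) (by simp; omega : j ∈ Finset.range (m + 1))
  obtain ⟨j, rfl | rfl⟩ := k.eq_nat_or_neg
  · exact key j (by simpa using hk)
  · rw [pVal_neg]
    push_cast
    rw [mul_neg, qFun_neg]
    exact key j (by simpa using hk)

/-- Degree `2m` requires `m + 1` interpolation nodes, while the grid prescribes values at `m` of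
them. The value at the extra node is set to `0` here and corrected later by a multiple of `wFun`,
which vanishes at the prescribed nodes. -/
lemma vFunAux_isTheta (hτ : 0 < τ.im) (e : ℂ) :
    IsTheta τ (2 * m) (-(2 * m * η)) (vFunAux τ η m e) := by
  refine IsTheta.sum _ fun k hk => IsTheta.const_mul _ ?_
  refine ((lagrange_isTheta hτ (Finset.Icc 1 (m + 1)) (fun j => 2 * η * j - η) (i := k) ?_
    (n := m) (by simp)).comp_sub η).congr rfl (by push_cast; ring) fun _ => rfl
  simp only [Finset.mem_Icc] at hk ⊢; omega

lemma vFunAux_reflect (e l : ℂ) : vFunAux τ η m e (2 * η - l) = vFunAux τ η m e l := by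
  unfold vFunAux
  refine Finset.sum_congr rfl fun k _ => ?_
  rw [show 2 * η - l - η = -(l - η) by ring, lagrange_neg]

lemma vFunAux_grid (hτ : 0 < τ.im) (hη : ∀ k : ℤ, k ≠ 0 → (k : ℂ) * η ∉ lattice τ) (e : ℂ) {k : ℤ}
    (hk : k ∈ Finset.Icc (1 - m : ℤ) m) :
    vFunAux τ η m e (2 * η * k) = pVal τ η m e k * pVal τ η m e (k - 1) := by
  have key : ∀ j : ℕ, 1 ≤ j → j ≤ m →
      vFunAux τ η m e (2 * η * j) = pVal τ η m e j * pVal τ η m e (j - 1) := by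
    intro j hj hjm
    refine sum_lagrange _ (fun j : ℕ => 2 * η * (j : ℂ) - η) ?_
      (fun k => pVal τ η m e k * pVal τ η m e (k - 1)) (Finset.Icc 1 m)
      (Finset.Icc_subset_Icc le_rfl (by omega)) (by simp; omega : j ∈ Finset.Icc 1 m)
    intro i hi j hj h
    simp only [Finset.mem_Icc] at hi hj
    refine evenTheta_ne_zero hτ ?_ ?_
    · have := two_eta_sub hη (i := i) (j := j) (by omega)
      push_cast at this
      rwa [show 2 * η * (i : ℂ) - η - (2 * η * j - η) = 2 * η * i - 2 * η * j by ring]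
    · have := two_eta_sub hη (i := i) (j := 1 - j) (by omega)
      push_cast at this
      rwa [show 2 * η * (i : ℂ) - η + (2 * η * j - η) = 2 * η * i - 2 * η * (1 - j) by ring]
  simp only [Finset.mem_Icc] at hk
  by_cases h : 1 ≤ k
  · obtain ⟨j, rfl⟩ : ∃ j : ℕ, k = j := ⟨k.toNat, by omega⟩
    exact_mod_cast key j (by omega) (by omega)
  · obtain ⟨j, rfl⟩ : ∃ j : ℕ, k = 1 - j := ⟨(1 - k).toNat, by omega⟩
    have := key j (by omega) (by omega)
    rw [← vFunAux_reflect] at this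
    push_cast
    rw [show 2 * η * (1 - (j : ℂ)) = 2 * η - 2 * η * j by ring, this,
      show (1 : ℤ) - j - 1 = -j by ring, pVal_neg, show (1 : ℤ) - j = -(j - 1) by ring, pVal_neg]
    ring

lemma eq_zero_of_grid (hτ : 0 < τ.im) (hη : ∀ k : ℤ, k ≠ 0 → (k : ℂ) * η ∉ lattice τ) {n : ℕ}
    {s : ℂ} {f : ℂ → ℂ} (hf : IsTheta τ n s f) (S : Finset ℤ) (hn : n < S.card)
    (h : ∀ k ∈ S, f (2 * η * k) = 0) : f = 0 :=
  hf.eq_zero_of_zeros hτ (fun k : ℤ => 2 * η * (k : ℂ)) S hn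
    (fun _ _ _ _ hij => two_eta_sub hη hij) h

lemma eq_zero_of_grid_half (hτ : 0 < τ.im) (hη : ∀ k : ℤ, k ≠ 0 → (k : ℂ) * η ∉ lattice τ) {n : ℕ}
    {s : ℂ} {f : ℂ → ℂ} (hf : IsTheta τ n s f) (S : Finset ℤ) (hn : n ≤ S.card)
    (h : ∀ k ∈ S, f (2 * η * k) = 0) (h' : f (1 / 2) = 0) : f = 0 := by
  refine hf.eq_zero_of_zeros hτ (fun k : Option ℤ => k.elim (1 / 2) fun k => 2 * η * (k : ℂ))
    (Finset.insertNone S) (by rw [Finset.card_insertNone]; omega) ?_ ?_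
  · rintro (_ | i) _ (_ | j) _ hij
    · exact absurd rfl hij
    · exact one_half_sub_notMem hτ hη j
    · intro h; rw [← neg_mem_iff] at h
      exact one_half_sub_notMem hτ hη i (by simpa using h)
    · exact two_eta_sub hη (fun h => hij (by rw [h]))
  · rintro (_ | i) hi
    · exact h'
    · exact h i (by simpa using hi)

lemma vDefect_isTheta (hτ : 0 < τ.im) (e : ℂ) : IsTheta τ (2 * m + 1) 0 (vDefect τ η m e) := by
  have h1 := (IsTheta.theta_add hτ (2 * η * m)).mul (vFunAux_isTheta (η := η) (m := m) hτ e)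
  have h2 := (IsTheta.theta_sub hτ (2 * η * m)).mul
    ((vFunAux_isTheta (η := η) (m := m) hτ e).comp_add (2 * η))
  have h3 := ((IsTheta.theta_self hτ).mul (qFun_isTheta (η := η) (m := m) hτ e)).const_mul e
  refine (((h1.congr (by ring) (by ring) fun _ => rfl).add
    (h2.congr (by ring) (by push_cast; ring) fun _ => rfl)).sub
    (h3.congr (by ring) (by ring) fun _ => rfl)).congr rfl rfl fun l => ?_
  simp only [vDefect]; ring

/-- On the grid the defect is `p_k` times the three-term recursion. At `k = ±m` a theta factor kills
the value of `vFunAux` outside the range where it is prescribed. -/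
lemma vDefect_grid (hτ : 0 < τ.im) (hη : ∀ k : ℤ, k ≠ 0 → (k : ℂ) * η ∉ lattice τ) (hm : 0 < m)
    (e : ℂ) {k : ℤ} (hk : k ∈ Finset.Icc (-m : ℤ) m) : vDefect τ η m e (2 * η * k) = 0 := by
  simp only [Finset.mem_Icc] at hk
  have hk' : |k| ≤ m := by rw [abs_le]; omega
  have h1 : theta τ (2 * η * k + 2 * η * m) * vFunAux τ η m e (2 * η * k) =
      theta τ (2 * η * k + 2 * η * m) * (pVal τ η m e k * pVal τ η m e (k - 1)) := by
    by_cases h : k = -m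
    · subst h; push_cast; rw [show 2 * η * -(m : ℂ) + 2 * η * m = 0 by ring, theta_zero]; ring
    · rw [vFunAux_grid hτ hη e (by simp only [Finset.mem_Icc]; omega)]
  have h2 : theta τ (2 * η * k - 2 * η * m) * vFunAux τ η m e (2 * η * k + 2 * η) =
      theta τ (2 * η * k - 2 * η * m) * (pVal τ η m e k * pVal τ η m e (k + 1)) := by
    by_cases h : k = m
    · subst h; push_cast; rw [sub_self, theta_zero]; ring
    · have := vFunAux_grid (m := m) hτ hη e (k := k + 1) (by simp only [Finset.mem_Icc]; omega)
      rw [show 2 * η * ((k + 1 : ℤ) : ℂ) = 2 * η * k + 2 * η by push_cast; ring] at this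
      rw [this, show k + 1 - 1 = k by ring]; ring
  rw [vDefect, h1, h2, qFun_grid hτ hη e hk']
  linear_combination pVal τ η m e k * pVal_recursion hτ hη hm e hk'

/-- The defect and `piFun` are theta functions of the same type, of degree `2m + 1`, and share the
`2m + 1` grid zeros. They are therefore proportional; the factor is read off at `1/2`, and the
correction by `wFun` in `vFun` cancels the defect. -/
lemma vFun_rel (hτ : 0 < τ.im) (hη : ∀ k : ℤ, k ≠ 0 → (k : ℂ) * η ∉ lattice τ) (hm : 0 < m)
    (e l : ℂ) :
    theta τ (l + 2 * η * m) * vFun τ η m e l +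
      theta τ (l - 2 * η * m) * vFun τ η m e (l + 2 * η) = e * theta τ l * qFun τ η m e l := by
  set c := vDefect τ η m e (1 / 2) / piFun τ η m (1 / 2)
  have hpi : IsTheta τ (2 * m + 1) 0 (piFun τ η m) :=
    ((IsTheta.theta_add hτ (2 * η * m)).mul (wFun_isTheta hτ)).congr (by ring) (by ring)
      fun l => theta_mul_wFun l
  have h0 := eq_zero_of_grid_half hτ hη ((vDefect_isTheta hτ e).sub (hpi.const_mul c))
    (Finset.Icc (-m : ℤ) m) (by simp; omega) (fun k hk => by
      have : piFun τ η m (2 * η * k) = 0 := Finset.prod_eq_zero hk (by simp [theta_zero])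
      rw [vDefect_grid hτ hη hm e hk, this]; ring)
    (by have := piFun_half_ne (m := m) hτ hη
        simp only [c]; field_simp; ring)
  have h1 := congrFun h0 l
  have h2 : vDefect τ η m e l = c * piFun τ η m l := by
    simpa [sub_eq_zero] using h1
  have hc : vDefect τ η m e (1 / 2) / (2 * piFun τ η m (1 / 2)) = c / 2 := by
    simp only [c]; rw [div_div, mul_comm]
  simp only [vFun, hc]
  rw [vDefect] at h2
  linear_combination h2 - c / 2 * theta_mul_wFun l - c / 2 * theta_mul_wFun_add l

lemma vFun_isTheta (hτ : 0 < τ.im) (e : ℂ) :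
    IsTheta τ (2 * m) (-(2 * m * η)) (vFun τ η m e) :=
  (vFunAux_isTheta hτ e).sub ((wFun_isTheta hτ).const_mul _)

lemma vFun_reflect (e l : ℂ) : vFun τ η m e (2 * η - l) = vFun τ η m e l := by
  rw [vFun, vFun, vFunAux_reflect, wFun_reflect]

lemma vFun_grid (hτ : 0 < τ.im) (hη : ∀ k : ℤ, k ≠ 0 → (k : ℂ) * η ∉ lattice τ) (e : ℂ) {k : ℤ}
    (hk : k ∈ Finset.Icc (1 - m : ℤ) m) :
    vFun τ η m e (2 * η * k) = pVal τ η m e k * pVal τ η m e (k - 1) := by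
  rw [vFun, vFunAux_grid hτ hη e hk, wFun_zero hk]; ring

/-- The nonlinear relation between `qFun` and `vFun`. -/
lemma qFun_rel (hτ : 0 < τ.im) (hη : ∀ k : ℤ, k ≠ 0 → (k : ℂ) * η ∉ lattice τ) (hm : 0 < m)
    (e l : ℂ) :
    theta τ (l - 2 * η * m) ^ 2 * qFun τ η m e (l + 2 * η) -
      theta τ (l + 2 * η * m) ^ 2 * qFun τ η m e (l - 2 * η) =
      e * theta τ l * (theta τ (l - 2 * η * m) * vFun τ η m e (l + 2 * η) -
        theta τ (l + 2 * η * m) * vFun τ η m e l) := by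
  have hp := IsTheta.theta_add hτ (2 * η * m)
  have hq := IsTheta.theta_sub hτ (2 * η * m)
  have hQ := qFun_isTheta (η := η) (m := m) hτ e
  have hV := vFun_isTheta (η := η) (m := m) hτ e
  have h1 := ((hq.mul hq).mul (hQ.comp_add (2 * η))).congr (n' := 2 * m + 2) (s' := 0)
    (by ring) (by push_cast; ring) fun _ => rfl
  have h2 := ((hp.mul hp).mul (hQ.comp_sub (2 * η))).congr (n' := 2 * m + 2) (s' := 0)
    (by ring) (by push_cast; ring) fun _ => rfl
  have h3 := (((IsTheta.theta_self hτ).mul (hq.mul (hV.comp_add (2 * η)))).const_mul e).congr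
    (n' := 2 * m + 2) (s' := 0) (by ring) (by push_cast; ring) fun _ => rfl
  have h4 := (((IsTheta.theta_self hτ).mul (hp.mul hV)).const_mul e).congr
    (n' := 2 * m + 2) (s' := 0) (by ring) (by ring) fun _ => rfl
  set E : ℂ → ℂ := fun l => theta τ (l - 2 * η * m) ^ 2 * qFun τ η m e (l + 2 * η) -
      theta τ (l + 2 * η * m) ^ 2 * qFun τ η m e (l - 2 * η) -
      e * theta τ l * (theta τ (l - 2 * η * m) * vFun τ η m e (l + 2 * η) -
        theta τ (l + 2 * η * m) * vFun τ η m e l) with hE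
  have hEt : IsTheta τ (2 * m + 2) 0 E :=
    ((h1.sub h2).sub (h3.sub h4)).congr rfl rfl fun l => by simp only [hE]; ring
  -- Oddness supplies zeros at the half periods `1/2` and `τ/2`. With the `2m + 1` grid points this
  -- makes `2m + 3` zeros, one more than the degree.
  have hodd : ∀ l, E (-l) = -E l := by
    intro l
    have t1 : theta τ (-l - 2 * η * m) = -theta τ (l + 2 * η * m) := by
      rw [← theta_neg]; congr 1; ring
    have t2 : theta τ (-l + 2 * η * m) = -theta τ (l - 2 * η * m) := by
      rw [← theta_neg]; congr 1; ring
    have q1 : qFun τ η m e (-l + 2 * η) = qFun τ η m e (l - 2 * η) := by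
      rw [← qFun_neg]; congr 1; ring
    have q2 : qFun τ η m e (-l - 2 * η) = qFun τ η m e (l + 2 * η) := by
      rw [← qFun_neg]; congr 1; ring
    have v1 : vFun τ η m e (-l + 2 * η) = vFun τ η m e l := by
      rw [← vFun_reflect]; congr 1; ring
    have v2 : vFun τ η m e (-l) = vFun τ η m e (l + 2 * η) := by
      rw [← vFun_reflect]; congr 1; ring
    simp only [hE, t1, t2, q1, q2, v1, v2, theta_neg τ l]
    ring
  have hhalf : E (1 / 2) = 0 := by
    have a1 := hEt.add_one (-(1 / 2))
    rw [hodd, show -(1 / 2 : ℂ) + 1 = 1 / 2 by norm_num,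
      show ((-1 : ℂ)) ^ (2 * m + 2) = 1 by rw [← mul_add_one, pow_mul]; simp] at a1
    linear_combination a1 / 2
  have htau : E (τ / 2) = 0 := by
    have a1 := hEt.add_tau (-(τ / 2))
    rw [hodd, show -(τ / 2) + τ = τ / 2 by ring,
      show ((-1 : ℂ)) ^ (2 * m + 2) = 1 by rw [← mul_add_one, pow_mul]; simp,
      show -(Real.pi * I * (((2 * m + 2 : ℕ) : ℂ) * τ +
        2 * ((2 * m + 2 : ℕ) : ℂ) * (-(τ / 2)) + 2 * 0)) = 0 by ring, exp_zero] at a1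
    linear_combination a1 / 2
  have hgrid : ∀ k ∈ Finset.Icc (-m : ℤ) m, E (2 * η * k) = 0 := by
    intro k hk
    simp only [Finset.mem_Icc] at hk
    have hk' : |k| ≤ m := by rw [abs_le]; omega
    have b1 : theta τ (2 * η * k + 2 * η * m) * vFun τ η m e (2 * η * k) =
        theta τ (2 * η * k + 2 * η * m) * (pVal τ η m e k * pVal τ η m e (k - 1)) := by
      by_cases h : k = -m
      · subst h; push_cast; rw [show 2 * η * -(m : ℂ) + 2 * η * m = 0 by ring, theta_zero]; ring
      · rw [vFun_grid hτ hη e (by simp only [Finset.mem_Icc]; omega)]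
    have b2 : theta τ (2 * η * k - 2 * η * m) * vFun τ η m e (2 * η * k + 2 * η) =
        theta τ (2 * η * k - 2 * η * m) * (pVal τ η m e k * pVal τ η m e (k + 1)) := by
      by_cases h : k = m
      · subst h; push_cast; rw [sub_self, theta_zero]; ring
      · have := vFun_grid (m := m) hτ hη e (k := k + 1) (by simp only [Finset.mem_Icc]; omega)
        rw [show 2 * η * ((k + 1 : ℤ) : ℂ) = 2 * η * k + 2 * η by push_cast; ring] at this
        rw [this, show k + 1 - 1 = k by ring]; ring
    have b3 : theta τ (2 * η * k - 2 * η * m) ^ 2 * qFun τ η m e (2 * η * k + 2 * η) =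
        theta τ (2 * η * k - 2 * η * m) ^ 2 * pVal τ η m e (k + 1) ^ 2 := by
      by_cases h : k = m
      · subst h; push_cast; rw [sub_self, theta_zero]; ring
      · have := qFun_grid hτ hη e (k := k + 1) (m := m) (by rw [abs_le]; omega)
        rw [show 2 * η * ((k + 1 : ℤ) : ℂ) = 2 * η * k + 2 * η by push_cast; ring] at this
        rw [this]
    have b4 : theta τ (2 * η * k + 2 * η * m) ^ 2 * qFun τ η m e (2 * η * k - 2 * η) =
        theta τ (2 * η * k + 2 * η * m) ^ 2 * pVal τ η m e (k - 1) ^ 2 := by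
      by_cases h : k = -m
      · subst h; push_cast; rw [show 2 * η * -(m : ℂ) + 2 * η * m = 0 by ring, theta_zero]; ring
      · have := qFun_grid hτ hη e (k := k - 1) (m := m) (by rw [abs_le]; omega)
        rw [show 2 * η * ((k - 1 : ℤ) : ℂ) = 2 * η * k - 2 * η by push_cast; ring] at this
        rw [this]
    have b5 := pVal_recursion hτ hη hm e hk'
    simp only [hE]
    rw [b1, b2, b3, b4]
    -- Difference of squares: with `X = θ(2ηk-2ηm) p_{k+1}` and `Y = θ(2ηk+2ηm) p_{k-1}`, the
    -- recursion says `X + Y = eθ(2ηk) p_k`, and it is multiplied by `X - Y`.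
    linear_combination (theta τ (2 * η * k - 2 * η * m) * pVal τ η m e (k + 1) -
      theta τ (2 * η * k + 2 * η * m) * pVal τ η m e (k - 1)) * b5
  have hzero : E = 0 := by
    refine hEt.eq_zero_of_zeros hτ
      (Sum.elim (fun k : ℤ => 2 * η * (k : ℂ)) fun b : Bool => if b = true then 1 / 2 else τ / 2)
      ((Finset.Icc (-m : ℤ) m).disjSum Finset.univ)
      (by simp [Finset.card_disjSum]; omega) ?_ ?_
    · rintro (i | i) _ (j | j) _ hij
      · exact two_eta_sub hη fun h => hij (congrArg Sum.inl h)
      · rw [← neg_mem_iff, neg_sub]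
        cases j
        · exact tau_half_sub_notMem hτ hη i
        · exact one_half_sub_notMem hτ hη i
      · cases i
        · exact tau_half_sub_notMem hτ hη j
        · exact one_half_sub_notMem hτ hη j
      · cases i <;> cases j
        · exact absurd rfl hij
        · rw [← neg_mem_iff, neg_sub]
          exact one_sub_tau_half_notMem hτ
        · exact one_sub_tau_half_notMem hτ
        · exact absurd rfl hij
    · rintro (i | i) hi
      · exact hgrid i (by simpa using hi)
      · cases i
        · exact htau
        · exact hhalf
  have := congrFun hzero l
  simp only [hE, Pi.zero_apply] at this
  linear_combination this

/-- The equation of the spectral curve. -/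
lemma vFun_sq (hτ : 0 < τ.im) (hη : ∀ k : ℤ, k ≠ 0 → (k : ℂ) * η ∉ lattice τ) (hm : 0 < m)
    (e l : ℂ) : vFun τ η m e l ^ 2 - qFun τ η m e l * qFun τ η m e (l - 2 * η) =
      specPoly τ η m e * wFun τ η m l ^ 2 := by
  have hQ := qFun_isTheta (η := η) (m := m) hτ e
  have hV := vFun_isTheta (η := η) (m := m) hτ e
  have hw := wFun_isTheta (η := η) (m := m) hτ
  set H : ℂ → ℂ := fun l => vFun τ η m e l * vFun τ η m e l -
    qFun τ η m e l * qFun τ η m e (l - 2 * η) -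
    specPoly τ η m e * (wFun τ η m l * wFun τ η m l) with hH
  have hHt : IsTheta τ (4 * m) (-(4 * m * η)) H := by
    refine (((hV.mul hV).congr (by ring) (by ring) fun _ => rfl).sub
      ((hQ.mul (hQ.comp_sub (2 * η))).congr (by ring) (by push_cast; ring) fun _ => rfl)).sub
      (((hw.mul hw).const_mul _).congr (by ring) (by ring) fun _ => rfl)
  have h0 : H (1 / 2) = 0 := by
    have := wFun_half_ne (m := m) hτ hη
    simp only [hH, specPoly]
    field_simp
    ring
  -- The product of the linear relation `vFun_rel` with the corresponding difference, combined with
  -- `qFun_rel`, shows that `v² - q(l)q(l-2η)` transforms under `l ↦ l + 2η` exactly as `w²` does.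
  have hstep : ∀ l, theta τ (l - 2 * η * m) ^ 2 * H (l + 2 * η) =
      theta τ (l + 2 * η * m) ^ 2 * H l := by
    intro l
    have r1 := vFun_rel hτ hη hm e l
    have r2 := qFun_rel hτ hη hm e l
    have r3 : theta τ (l - 2 * η * m) * wFun τ η m (l + 2 * η) =
        theta τ (l + 2 * η * m) * wFun τ η m l := by rw [theta_mul_wFun, theta_mul_wFun_add]
    simp only [hH, show l + 2 * η - 2 * η = l by ring]
    linear_combination (theta τ (l - 2 * η * m) * vFun τ η m e (l + 2 * η) -
      theta τ (l + 2 * η * m) * vFun τ η m e l) * r1 - qFun τ η m e l * r2 -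
      specPoly τ η m e * (theta τ (l - 2 * η * m) * wFun τ η m (l + 2 * η) +
        theta τ (l + 2 * η * m) * wFun τ η m l) * r3
  -- The constant `specPoly` is defined so that `H` vanishes at `1/2`. The zero propagates to all
  -- translates by `2η`, and `4m + 1` of them exceed the degree.
  have hall : ∀ k : ℕ, H (1 / 2 + 2 * η * k) = 0 := by
    intro k
    induction k with
    | zero => simpa using h0
    | succ k ih =>
      have := hstep (1 / 2 + 2 * η * k)
      rw [ih, mul_zero] at this
      have hne : theta τ (1 / 2 + 2 * η * k - 2 * η * m) ≠ 0 := by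
        rw [Ne, theta_eq_zero_iff hτ]
        have := one_half_sub_notMem hτ hη (m - k)
        push_cast at this
        rwa [show (1 / 2 : ℂ) - 2 * η * (m - k) = 1 / 2 + 2 * η * k - 2 * η * m by ring] at this
      rw [show (1 / 2 : ℂ) + 2 * η * ((k + 1 : ℕ) : ℂ) = 1 / 2 + 2 * η * k + 2 * η by
        push_cast; ring]
      exact (mul_eq_zero.1 this).resolve_left (pow_ne_zero 2 hne)
  have := hHt.eq_zero_of_zeros hτ (fun k : ℕ => 1 / 2 + 2 * η * (k : ℂ))
    (Finset.range (4 * m + 1)) (by simp) (fun i _ j _ hij => by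
      have := two_eta_sub hη (i := i) (j := j) (by omega)
      push_cast at this
      rwa [show 1 / 2 + 2 * η * (i : ℂ) - (1 / 2 + 2 * η * j) = 2 * η * i - 2 * η * j by ring])
    (fun k _ => hall k)
  have h1 := congrFun this l
  simp only [hH, Pi.zero_apply] at h1
  linear_combination h1

/-! ### Polynomial dependence on the eigenvalue -/

lemma IsPoly.finset_sum_mul {ι : Type*} (S : Finset ι) {f : ι → ℂ → ℂ} (c : ι → ℂ)
    (hf : ∀ i ∈ S, IsPoly (f i)) : IsPoly fun x => ∑ i ∈ S, f i x * c i :=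
  IsPoly.sum S fun i hi => (hf i hi).mul (IsPoly.const (c i))

lemma qFun_isPoly (l : ℂ) : IsPoly fun e => qFun τ η m e l :=
  IsPoly.finset_sum_mul _ _ fun _ _ => (pVal_isPoly _).pow 2

lemma vFunAux_isPoly (l : ℂ) : IsPoly fun e => vFunAux τ η m e l :=
  IsPoly.finset_sum_mul _ _ fun _ _ => (pVal_isPoly _).mul (pVal_isPoly _)

lemma vDefect_isPoly (l : ℂ) : IsPoly fun e => vDefect τ η m e l :=
  (((vFunAux_isPoly l).const_mul _).add ((vFunAux_isPoly _).const_mul _)).sub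
    ((IsPoly.id.mul (IsPoly.const _)).mul (qFun_isPoly l))

lemma vFun_isPoly (l : ℂ) : IsPoly fun e => vFun τ η m e l := by
  have h := (vFunAux_isPoly (τ := τ) (η := η) (m := m) l).sub
    ((vDefect_isPoly (τ := τ) (η := η) (m := m) (1 / 2)).mul
      (IsPoly.const ((2 * piFun τ η m (1 / 2))⁻¹ * wFun τ η m l)))
  refine (funext fun e => ?_ : (fun e => vFun τ η m e l) = _) ▸ h
  simp only [vFun, div_eq_mul_inv]; ring

lemma specPoly_isPoly : IsPoly (specPoly τ η m) := by
  have h := (((vFun_isPoly (τ := τ) (η := η) (m := m) (1 / 2)).pow 2).sub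
    ((qFun_isPoly (τ := τ) (η := η) (m := m) (1 / 2)).mul (qFun_isPoly (τ := τ) (η := η) (m := m) (1 / 2 - 2 * η)))).mul
      (IsPoly.const (wFun τ η m (1 / 2) ^ 2)⁻¹)
  refine (funext fun e => ?_ : specPoly τ η m = _) ▸ h
  simp only [specPoly, div_eq_mul_inv]

lemma pRec_zero_odd (d : ℂ) (j : ℕ) : pRec τ η m (0 : ℂ) d (2 * j + 1) = 0 := by
  induction j with
  | zero => simp [pRec]
  | succ j ih => rw [show 2 * (j + 1) + 1 = (2 * j + 1) + 2 by ring, pRec, ih]; simp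

/-- At `e = 0` the recursion proceeds in steps of two, so its terms of odd index vanish. One of two
neighbouring indices is odd. -/
lemma pVal_zero_mul {k : ℤ} (hk : 1 ≤ k) (hkm : k ≤ m) :
    pVal τ η m 0 k * pVal τ η m 0 (k - 1) = 0 := by
  unfold pVal
  rcases Nat.even_or_odd' (m - k.natAbs) with ⟨j, h | h⟩
  · rw [show m - (k - 1).natAbs = 2 * j + 1 by omega, pRec_zero_odd, mul_zero]
  · rw [h, pRec_zero_odd, zero_mul]

lemma vFun_zero (l : ℂ) : vFun τ η m 0 l = 0 := by
  have h : ∀ l, vFunAux τ η m 0 l = 0 := fun l => Finset.sum_eq_zero fun k hk => by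
    simp only [Finset.mem_Icc] at hk
    rw [pVal_zero_mul (by omega) (by omega), zero_mul]
  simp [vFun, vDefect, h]

lemma qFun_top (hτ : 0 < τ.im) (hη : ∀ k : ℤ, k ≠ 0 → (k : ℂ) * η ∉ lattice τ) (e : ℂ) :
    qFun τ η m e (2 * η * m) = 1 := by
  have := qFun_grid (m := m) hτ hη e (k := m) (by simp)
  rw [pVal_top] at this
  simpa using this

lemma qFun_ne_zero (hτ : 0 < τ.im) (hη : ∀ k : ℤ, k ≠ 0 → (k : ℂ) * η ∉ lattice τ) (e : ℂ) :
    qFun τ η m e ≠ 0 := fun h => by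
  have := qFun_top (m := m) hτ hη e
  rw [h] at this
  simp at this

/-- Since `v = 0` at `e = 0`, the spectral equation becomes `-q(l)q(l-2η) = S(0)w²`. The left side
is not identically zero because `q(2ηm) = 1`. -/
lemma specPoly_zero_ne (hτ : 0 < τ.im) (hη : ∀ k : ℤ, k ≠ 0 → (k : ℂ) * η ∉ lattice τ)
    (hm : 0 < m) : specPoly τ η m 0 ≠ 0 := by
  intro h
  have hQ := (qFun_isTheta (η := η) (m := m) hτ 0).diff
  have key := vFun_sq hτ hη hm 0
  simp only [h, vFun_zero] at key
  rcases eq_zero_or_eq_zero_of_entire_mul hQ (hQ.comp (differentiable_id.sub_const (2 * η)))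
    (fun l => by have := key l; simp at this; simpa using this) with h0 | h0
  · exact qFun_ne_zero hτ hη 0 h0
  · refine qFun_ne_zero (m := m) hτ hη 0 (funext fun l => ?_)
    have := congrFun h0 (l + 2 * η)
    simpa using this

lemma pRec_one_zero_ne (hτ : 0 < τ.im) (hη : ∀ k : ℤ, k ≠ 0 → (k : ℂ) * η ∉ lattice τ) {j : ℕ}
    (hj : j ≤ m) : pRec τ η m (1 : ℂ) 0 j ≠ 0 := by
  induction j using Nat.twoStepInduction with
  | zero => simp [pRec]
  | one =>
    simp only [pRec, Algebra.algebraMap_self, RingHom.id_apply, mul_one]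
    exact div_ne_zero (theta_int_ne hτ hη (k := m) (by omega) (by push_cast; ring))
      (theta_int_ne hτ hη (k := 2 * m) (by omega) (by push_cast; ring))
  | more j _ h2 =>
    simp only [pRec, Algebra.algebraMap_self, RingHom.id_apply, mul_one, mul_zero, zero_mul,
      add_zero]
    exact mul_ne_zero (div_ne_zero
      (theta_int_ne hτ hη (k := m - (j + 1)) (by omega) (by push_cast; ring))
      (theta_int_ne hτ hη (k := 2 * m - (j + 1)) (by omega) (by push_cast; ring))) (h2 (by omega))

/-- By homogeneity, vanishing for every `e` would give a polynomial in `d` vanishing for all `d ≠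
0`. At `d = 0`, however, its value is a product of nonzero quotients of theta values. -/
lemma exists_pVal_ne (hτ : 0 < τ.im) (hη : ∀ k : ℤ, k ≠ 0 → (k : ℂ) * η ∉ lattice τ) (k : ℤ) :
    ∃ e, pVal τ η m e k ≠ 0 := by
  by_contra! h
  set j := m - k.natAbs with hj
  have hp : IsPoly fun d => pRec τ η m (1 : ℂ) d j := by
    refine ⟨pRec τ η m 1 Polynomial.X j, fun d => ?_⟩
    have := map_pRec τ η m (Polynomial.aeval (R := ℂ) d) 1 Polynomial.X j
    simp only [Polynomial.aeval_X, map_one] at this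
    show pRec τ η m (1 : ℂ) d j = _
    rw [← this, Polynomial.coe_aeval_eq_eval]
  have hfin := hp.finite_zeros (pRec_one_zero_ne hτ hη (by omega))
  refine Set.infinite_of_finite_compl (s := {d : ℂ | pRec τ η m (1 : ℂ) d j = 0}) ?_ hfin
  refine (Set.finite_singleton (0 : ℂ)).subset fun d hd => ?_
  by_contra hd0
  refine hd ?_
  obtain ⟨s, hs⟩ := IsAlgClosed.exists_pow_nat_eq d (n := 2) (by norm_num)
  have hs0 : s ≠ 0 := by rintro rfl; exact hd0 (by simpa using hs.symm)
  have h1 := h s⁻¹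
  have h2 := pRec_homogeneous τ η m s (s⁻¹ : ℂ) 1 j
  rw [mul_inv_cancel₀ hs0, mul_one, hs] at h2
  show pRec τ η m (1 : ℂ) d j = 0
  rw [h2]
  exact mul_eq_zero_of_right _ h1

/-! ### Regular eigenvalues -/

/-- The eigenvalues `e` for which the solutions can be constructed directly. -/
def IsRegular (τ η : ℂ) (m : ℕ) (e : ℂ) : Prop :=
  specPoly τ η m e ≠ 0 ∧ (∀ k : ℤ, |k| ≤ m → pVal τ η m e k ≠ 0) ∧
    ∀ z, 2 * z ∈ lattice τ → z ∉ lattice τ → qFun τ η m e z ≠ 0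

/-- Every condition is the nonvanishing of a polynomial in `e`, so one good value each suffices. For
the half periods `e = 0` works: there `-q(z)q(z-2η) = S(0)w(z)²` is nonzero. -/
lemma finite_not_isRegular (hτ : 0 < τ.im) (hη : ∀ k : ℤ, k ≠ 0 → (k : ℂ) * η ∉ lattice τ)
    (hm : 0 < m) : {e | ¬ IsRegular τ η m e}.Finite := by
  have hz : ∀ z, 2 * z ∈ lattice τ → z ∉ lattice τ → {e | qFun τ η m e z = 0}.Finite := by
    intro z hz hz'
    refine (qFun_isPoly z).finite_zeros (x₀ := 0) fun h => ?_
    have := vFun_sq hτ hη hm 0 z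
    rw [vFun_zero, h] at this
    have hw : wFun τ η m z ≠ 0 := Finset.prod_ne_zero_iff.2 fun k _ => by
      rw [Ne, theta_eq_zero_iff hτ]; exact half_sub_notMem hη hz' hz k
    have h2 := mul_ne_zero (specPoly_zero_ne hτ hη hm) (pow_ne_zero 2 hw)
    rw [← this] at h2
    simp at h2
  have h1 := (hz (1 / 2) (by norm_num; exact one_mem_lattice) (one_half_notMem hτ)).union
    ((hz (τ / 2) (by rw [show 2 * (τ / 2) = τ by ring]; exact tau_mem_lattice)
      (tau_half_notMem hτ)).union (hz (1 / 2 - τ / 2)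
      (by rw [show 2 * (1 / 2 - τ / 2) = 1 - τ by ring]
          exact sub_mem one_mem_lattice tau_mem_lattice) (one_sub_tau_half_notMem hτ)))
  have h2 := (Finset.Icc (-m : ℤ) m).finite_toSet.biUnion fun k _ => by
    obtain ⟨e, he⟩ := exists_pVal_ne (m := m) hτ hη k
    exact (pVal_isPoly (τ := τ) (η := η) (m := m) k).finite_zeros he
  refine (((specPoly_isPoly.finite_zeros (specPoly_zero_ne hτ hη hm)).union h2).union h1).subset
    fun e he => ?_
  by_contra hcon
  simp only [Set.mem_union, not_or, Set.mem_iUnion, not_exists, Set.mem_ofPred_eq,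
    Finset.coe_Icc, Set.mem_Icc] at hcon
  obtain ⟨⟨c1, c2⟩, c3, c4, c5⟩ := hcon
  refine he ⟨c1, fun k hk => c2 k (abs_le.1 hk), fun z h2z hz0 h0 => ?_⟩
  have hred : ∀ w, z - w ∈ lattice τ → qFun τ η m e w = 0 := fun w hw =>
    (qFun_isTheta hτ e).zero_of_sub_mem h0 (by rw [← neg_mem_iff, neg_sub]; exact hw)
  obtain ⟨a, b, hab⟩ := (mem_lattice_iff τ _).1 h2z
  have hlat : ∀ a b : ℤ, (a : ℂ) + b * τ ∈ lattice τ := fun a b =>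
    (mem_lattice_iff τ _).2 ⟨a, b, rfl⟩
  -- The parities of the coordinates of `2z` reduce all nonzero half periods to three classes.
  rcases Int.even_or_odd' a with ⟨a', rfl | rfl⟩ <;> rcases Int.even_or_odd' b with ⟨b', rfl | rfl⟩
  · refine hz0 ?_
    convert hlat a' b' using 1; push_cast at hab; linear_combination hab / 2
  · refine c4 (hred _ ?_)
    convert hlat a' b' using 1; push_cast at hab; linear_combination hab / 2
  · refine c3 (hred _ ?_)
    convert hlat a' b' using 1; push_cast at hab; linear_combination hab / 2
  · refine c5 (hred _ ?_)
    convert hlat a' (b' + 1) using 1; push_cast at hab ⊢; linear_combination hab / 2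

lemma IsRegular.half_notMem (hτ : 0 < τ.im) (hη : ∀ k : ℤ, k ≠ 0 → (k : ℂ) * η ∉ lattice τ)
    {e a : ℂ} (he : IsRegular τ η m e) (ha : qFun τ η m e a = 0) : 2 * a ∉ lattice τ := by
  intro h
  by_cases h0 : a ∈ lattice τ
  · have h1 := (qFun_isTheta (η := η) (m := m) hτ e).zero_of_sub_mem (w := 0) ha (by simpa using h0)
    have h2 := qFun_grid (m := m) hτ hη e (k := 0) (by simp)
    simp only [Int.cast_zero, mul_zero] at h2
    rw [h1] at h2
    exact he.2.1 0 (by simp) (pow_eq_zero_iff (by norm_num) |>.1 h2.symm)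
  · exact he.2.2 a h h0 ha

lemma IsRegular.grid_notMem (hτ : 0 < τ.im) (hη : ∀ k : ℤ, k ≠ 0 → (k : ℂ) * η ∉ lattice τ)
    {e a : ℂ} (he : IsRegular τ η m e) (ha : qFun τ η m e a = 0) {k : ℤ} (hk : |k| ≤ m) :
    a - 2 * η * k ∉ lattice τ := fun h => by
  have h1 := (qFun_isTheta hτ e).zero_of_sub_mem ha (by rw [← neg_mem_iff, neg_sub]; exact h)
  rw [qFun_grid hτ hη e hk] at h1
  exact he.2.1 k hk (pow_eq_zero_iff (by norm_num) |>.1 h1)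

end

section

variable {τ η : ℂ} {m : ℕ}

/-! ### Multisets and translations -/

/-- The difference of the multiplicities in `A` and `B` is invariant under translation by `u`. It
has finite support and `u` has infinite order, so it is zero. -/
lemma multiset_eq_of_shift {G : Type*} [AddCommGroup G] {A B : Multiset G} {u : G}
    (hu : ∀ k : ℕ, k ≠ 0 → k • u ≠ 0)
    (h : A + B.map (fun x => x + u) = B + A.map (fun x => x + u)) : A = B := by
  classical
  have hc : ∀ (C : Multiset G) x, (C.map fun x => x + u).count (x + u) = C.count x := fun C x =>
    Multiset.count_map_eq_count' _ C (add_left_injective u) x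
  have hstep : ∀ x, (A.count (x + u) : ℤ) - B.count (x + u) = A.count x - B.count x := by
    intro x
    have := congrArg (Multiset.count (x + u)) h
    rw [Multiset.count_add, Multiset.count_add, hc, hc] at this
    omega
  have hall : ∀ x (k : ℕ), (A.count (x + k • u) : ℤ) - B.count (x + k • u) =
      A.count x - B.count x := by
    intro x k
    induction k with
    | zero => simp
    | succ k ih => rw [succ_nsmul, ← add_assoc, hstep, ih]
  ext x
  by_contra hne
  refine Set.infinite_of_injective_forall_mem (s := (↑(A + B).toFinset : Set G))
    (f := fun k : ℕ => x + k • u) ?_ (fun k => ?_) (A + B).toFinset.finite_toSet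
  · intro i j hij
    have hij' : i • u = j • u := add_left_cancel hij
    by_contra hne'
    rcases lt_or_gt_of_ne hne' with hlt | hlt
    · refine hu (j - i) (by omega) ?_
      rw [sub_nsmul _ hlt.le, hij', ← sub_eq_add_neg, sub_self]
    · refine hu (i - j) (by omega) ?_
      rw [sub_nsmul _ hlt.le, hij', ← sub_eq_add_neg, sub_self]
  · by_contra hk
    have h1 : x + k • u ∉ A ∧ x + k • u ∉ B := by simpa using hk
    have := hall x k
    rw [Multiset.count_eq_zero_of_notMem h1.1, Multiset.count_eq_zero_of_notMem h1.2] at this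
    omega

lemma divTheta_map_add (A : Multiset ℂ) (c l : ℂ) :
    divTheta τ (A.map fun a => a + c) l = divTheta τ A (l - c) := by
  simp only [divTheta, Multiset.map_map, Function.comp_def]
  congr 2; ext a; congr 1; ring

lemma divTheta_map_neg (A : Multiset ℂ) (l : ℂ) :
    divTheta τ (A.map fun a => -a) l = (-1) ^ A.card * divTheta τ A (-l) := by
  induction A using Multiset.induction_on with
  | empty => simp [divTheta]
  | cons a A ih =>
    rw [Multiset.map_cons, divTheta_cons, divTheta_cons, ih, Multiset.card_cons,
      show l - -a = -(-l - a) by ring, theta_neg]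
    ring

lemma divClass_map_add (A : Multiset ℂ) (c : ℂ) : divClass τ (A.map fun a => a + c) =
    (divClass τ A).map fun x => x + QuotientAddGroup.mk c := by
  simp [divClass, Multiset.map_map, Function.comp_def]

lemma divClass_map_neg (A : Multiset ℂ) : divClass τ (A.map fun a => -a) =
    (divClass τ A).map fun x => -x := by
  simp [divClass, Multiset.map_map, Function.comp_def]

lemma divClass_card (A : Multiset ℂ) : (divClass τ A).card = A.card := by simp [divClass]

/-! ### Normalized eigenfunctions -/

/-- `ψ` is an eigenfunction with eigenvalue `e` and divisor `A`, normalized by `ψ(2ηm) = 1`. -/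
structure IsEigen (τ η : ℂ) (m : ℕ) (e : ℂ) (A : Multiset ℂ) (ψ : ℂ → ℂ) : Prop where
  card : A.card = m
  form : ∃ C c : ℂ, C ≠ 0 ∧ ∀ l, ψ l = C * exp (c * l) * divTheta τ A l
  rel : ∀ l, theta τ (l + 2 * η * m) * ψ (l - 2 * η) + theta τ (l - 2 * η * m) * ψ (l + 2 * η) =
    e * theta τ l * ψ l
  top : ψ (2 * η * m) = 1

namespace IsEigen

variable {e : ℂ} {A B : Multiset ℂ} {ψ φ : ℂ → ℂ}

lemma diff (hτ : 0 < τ.im) (h : IsEigen τ η m e A ψ) : Differentiable ℂ ψ := by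
  obtain ⟨C, c, -, hf⟩ := h.form
  rw [funext hf]
  exact (by fun_prop : Differentiable ℂ fun l : ℂ => C * exp (c * l)).mul
    (divTheta_isTheta hτ A).diff

lemma ne_zero (h : IsEigen τ η m e A ψ) : ψ ≠ 0 := fun h0 => by
  have := h.top
  rw [h0] at this
  simp at this

lemma eq_zero_iff (hτ : 0 < τ.im) (h : IsEigen τ η m e A ψ) (l : ℂ) :
    ψ l = 0 ↔ ∃ a ∈ A, l - a ∈ lattice τ := by
  obtain ⟨C, c, hC, hf⟩ := h.form
  rw [hf, ← divTheta_eq_zero_iff hτ, mul_eq_zero]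
  simp [hC]

/-- The recursion is run downwards from `ψ(2ηm) = 1`. The coefficient `θ(2ηk + 2ηm)` of the next
value stays nonzero until `k = -m`, so the whole grid is reached, including its negative half;
evenness in `k` is thus a consequence. -/
lemma grid (hτ : 0 < τ.im) (hη : ∀ k : ℤ, k ≠ 0 → (k : ℂ) * η ∉ lattice τ) (hm : 0 < m)
    (h : IsEigen τ η m e A ψ) {k : ℤ} (hk : |k| ≤ m) : ψ (2 * η * k) = pVal τ η m e k := by
  have key : ∀ j : ℕ, j < 2 * m → ψ (2 * η * (m - j : ℤ)) = pVal τ η m e (m - j) ∧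
      ψ (2 * η * (m - j - 1 : ℤ)) = pVal τ η m e (m - j - 1) := by
    have step : ∀ j : ℕ, j < 2 * m → ψ (2 * η * (m - j : ℤ)) = pVal τ η m e (m - j) →
        (j ≠ 0 → ψ (2 * η * (m - j + 1 : ℤ)) = pVal τ η m e (m - j + 1)) →
        ψ (2 * η * (m - j - 1 : ℤ)) = pVal τ η m e (m - j - 1) := by
      intro j hj h1 h2
      have r1 := h.rel (2 * η * (m - j : ℤ))
      have r2 := pVal_recursion hτ hη hm e (k := m - j) (by rw [abs_le]; omega)
      rw [show 2 * η * ((m - j : ℤ) : ℂ) - 2 * η = 2 * η * (m - j - 1 : ℤ) by push_cast; ring,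
        show 2 * η * ((m - j : ℤ) : ℂ) + 2 * η = 2 * η * (m - j + 1 : ℤ) by push_cast; ring,
        h1, ← r2] at r1
      have r3 : theta τ (2 * η * (m - j : ℤ) - 2 * η * m) * ψ (2 * η * (m - j + 1 : ℤ)) =
          theta τ (2 * η * (m - j : ℤ) - 2 * η * m) * pVal τ η m e (m - j + 1) := by
        by_cases hj0 : j = 0
        · subst hj0
          rw [show 2 * η * (((m : ℤ) - (0 : ℕ) : ℤ) : ℂ) - 2 * η * m = 0 by push_cast; ring,
            theta_zero, zero_mul, zero_mul]
        · rw [h2 hj0]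
      rw [r3] at r1
      refine mul_left_cancel₀ (theta_int_ne hτ hη (k := 2 * m - j) (by omega) ?_)
        (add_right_cancel r1)
      push_cast; ring
    intro j
    induction j with
    | zero =>
      intro hj
      have h0 : ψ (2 * η * (m - (0 : ℕ) : ℤ)) = pVal τ η m e (m - (0 : ℕ)) := by
        simpa [pVal_top] using h.top
      exact ⟨h0, step 0 hj h0 (fun h => absurd rfl h)⟩
    | succ j ih =>
      intro hj
      obtain ⟨i1, i2⟩ := ih (by omega)
      rw [show (m : ℤ) - j - 1 = m - (j + 1 : ℕ) by push_cast; ring] at i2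
      refine ⟨i2, step (j + 1) hj i2 fun _ => ?_⟩
      rw [show (m : ℤ) - (j + 1 : ℕ) + 1 = m - j by push_cast; ring]
      exact i1
  rw [abs_le] at hk
  by_cases hkm : k = -m
  · have := (key (2 * m - 1) (by omega)).2
    rwa [show (m : ℤ) - (2 * m - 1 : ℕ) - 1 = k by omega] at this
  · have := (key (m - k).toNat (by omega)).1
    rwa [show (m : ℤ) - ((m - k).toNat : ℤ) = k by omega] at this

lemma neg (hτ : 0 < τ.im) (hη : ∀ k : ℤ, k ≠ 0 → (k : ℂ) * η ∉ lattice τ) (hm : 0 < m)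
    (h : IsEigen τ η m e A ψ) : IsEigen τ η m e (A.map fun a => -a) fun l => ψ (-l) := by
  refine ⟨by simpa using h.card, ?_, fun l => ?_, ?_⟩
  · obtain ⟨C, c, hC, hf⟩ := h.form
    refine ⟨C * (-1) ^ A.card, -c, mul_ne_zero hC (by simp), fun l => ?_⟩
    have h1 : ((-1 : ℂ)) ^ A.card * (-1) ^ A.card = 1 := by rw [← mul_pow]; simp
    rw [divTheta_map_neg, hf, show c * -l = -c * l by ring]
    linear_combination -(C * exp (-c * l) * divTheta τ A (-l)) * h1
  · have := h.rel (-l)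
    rw [show -l + 2 * η * m = -(l - 2 * η * m) by ring, show -l - 2 * η * m = -(l + 2 * η * m) by
      ring, theta_neg, theta_neg, theta_neg, show -l - 2 * η = -(l + 2 * η) by ring,
      show -l + 2 * η = -(l - 2 * η) by ring] at this
    linear_combination -this
  · have := h.grid hτ hη hm (k := -m) (by simp)
    rw [pVal_neg, pVal_top] at this
    rw [← this]; push_cast; ring_nf

/-- The exponential factors of `ψ(l)` and `ψ(c - l)` multiply to a constant, so the unknown exponent
disappears. -/
lemma mul_reflect_isTheta (hτ : 0 < τ.im) (h : IsEigen τ η m e A ψ) (c : ℂ) :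
    IsTheta τ (2 * m) (-(m * c)) fun l => ψ l * ψ (c - l) := by
  obtain ⟨C, d, -, hf⟩ := h.form
  have hA := divTheta_isTheta hτ A
  refine ((hA.mul (hA.comp_const_sub c)).const_mul (C ^ 2 * exp (d * c))).congr
    (by rw [h.card]; ring) (by rw [h.card]; ring) fun l => ?_
  rw [hf, hf, show d * c = d * l + d * (c - l) by ring, exp_add]; ring

/-- Both sides are theta functions of degree `2m` and characteristic `0`, and they agree at the `2m
+ 1` grid points. -/
lemma mul_neg_eq (hτ : 0 < τ.im) (hη : ∀ k : ℤ, k ≠ 0 → (k : ℂ) * η ∉ lattice τ) (hm : 0 < m)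
    (h : IsEigen τ η m e A ψ) (l : ℂ) : ψ l * ψ (-l) = qFun τ η m e l := by
  have h0 := eq_zero_of_grid hτ hη (((h.mul_reflect_isTheta hτ 0).congr rfl (by ring)
    fun _ => rfl).sub (qFun_isTheta (η := η) (m := m) hτ e)) (Finset.Icc (-m : ℤ) m)
    (by simp; omega) (fun k hk => by
      simp only [Finset.mem_Icc] at hk
      have h1 := h.grid hτ hη hm (k := k) (abs_le.2 hk)
      have h2 := h.grid hτ hη hm (k := -k) (by rw [abs_neg]; exact abs_le.2 hk)
      rw [pVal_neg] at h2
      push_cast at h2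
      rw [qFun_grid hτ hη e (abs_le.2 hk), zero_sub, ← mul_neg, h1, h2]; ring)
  have := congrFun h0 l
  simp only [Pi.zero_apply, zero_sub] at this
  linear_combination this

/-- The grid gives only `2m` zeros of the difference, which is not enough in degree `2m`. The
missing one is the half period `1/2`: there reflection and periodicity identify the two values in
the homogeneous linear relation, and their coefficients are equal and nonzero. -/
lemma add_eq (hτ : 0 < τ.im) (hη : ∀ k : ℤ, k ≠ 0 → (k : ℂ) * η ∉ lattice τ) (hm : 0 < m)
    (h : IsEigen τ η m e A ψ) (l : ℂ) :
    ψ l * ψ (2 * η - l) + ψ (-l) * ψ (l - 2 * η) = 2 * vFun τ η m e l := by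
  set D : ℂ → ℂ := fun l => ψ l * ψ (2 * η - l) + ψ (-l) * ψ (l - 2 * η) - 2 * vFun τ η m e l
    with hD
  have hn := h.neg hτ hη hm
  have hDt : IsTheta τ (2 * m) (-(2 * m * η)) D :=
    ((((h.mul_reflect_isTheta hτ (2 * η)).add (hn.mul_reflect_isTheta hτ (2 * η))).congr rfl
      (by ring) fun _ => rfl).sub ((vFun_isTheta hτ e).const_mul 2)).congr rfl rfl fun l => by
        simp only [hD, neg_sub]
  have hrel : ∀ l, theta τ (l + 2 * η * m) * D l + theta τ (l - 2 * η * m) * D (l + 2 * η) = 0 := by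
    intro l
    have r1 := h.rel l
    have r2 := hn.rel l
    have r3 := vFun_rel hτ hη hm e l
    have r4 := h.mul_neg_eq hτ hη hm l
    simp only [hD, show 2 * η - (l + 2 * η) = -l by ring, show l + 2 * η - 2 * η = l by ring]
    simp only [neg_sub] at r2
    linear_combination ψ (-l) * r1 + ψ l * r2 - 2 * r3 + 2 * e * theta τ l * r4
  have hrefl : ∀ l, D (2 * η - l) = D l := by
    intro l
    simp only [hD, vFun_reflect, show 2 * η - (2 * η - l) = l by ring,
      show 2 * η - l - 2 * η = -l by ring, neg_sub]
    ring
  have hhalf : D (1 / 2) = 0 := by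
    have a1 := hrel (1 / 2)
    have a2 : D (1 / 2 + 2 * η) = D (1 / 2) := by
      have b1 := hrefl (1 / 2 + 2 * η)
      rw [show 2 * η - (1 / 2 + 2 * η) = -(1 / 2) by ring] at b1
      have b2 := hDt.add_one (-(1 / 2))
      rw [show -(1 / 2 : ℂ) + 1 = 1 / 2 by norm_num, pow_mul] at b2
      rw [← b1, b2]; simp
    have a3 : theta τ (1 / 2 - 2 * η * m) = theta τ (1 / 2 + 2 * η * m) := by
      rw [show (1 / 2 : ℂ) - 2 * η * m = -(1 / 2 + 2 * η * m) + 1 by ring, theta_add_one,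
        theta_neg, neg_neg]
    have a4 : theta τ (1 / 2 + 2 * η * m) ≠ 0 := by
      rw [Ne, theta_eq_zero_iff hτ]
      have := one_half_sub_notMem hτ hη (-m)
      push_cast at this
      rwa [mul_neg, sub_neg_eq_add] at this
    rw [a2, a3] at a1
    have : 2 * theta τ (1 / 2 + 2 * η * m) * D (1 / 2) = 0 := by linear_combination a1
    exact (mul_eq_zero.1 this).resolve_left (by simpa using a4)
  have h0 := eq_zero_of_grid_half hτ hη hDt (Finset.Icc (1 - m : ℤ) m) (by simp; omega)
    (fun k hk => by
      have h5 := vFun_grid hτ hη e hk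
      simp only [Finset.mem_Icc] at hk
      have h1 := h.grid hτ hη hm (k := k) (by rw [abs_le]; omega)
      have h2 := h.grid hτ hη hm (k := 1 - k) (by rw [abs_le]; omega)
      have h3 := h.grid hτ hη hm (k := -k) (by rw [abs_le]; omega)
      have h4 := h.grid hτ hη hm (k := k - 1) (by rw [abs_le]; omega)
      rw [show 1 - k = -(k - 1) by ring, pVal_neg] at h2
      rw [pVal_neg] at h3
      push_cast at h2 h3 h4
      rw [show 2 * η * -((k : ℂ) - 1) = 2 * η - 2 * η * k by ring] at h2
      rw [show 2 * η * -(k : ℂ) = -(2 * η * k) by ring] at h3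
      rw [show 2 * η * ((k : ℂ) - 1) = 2 * η * k - 2 * η by ring] at h4
      simp only [hD]
      rw [h1, h2, h3, h4, h5]; ring) hhalf
  have := congrFun h0 l
  simp only [hD, Pi.zero_apply] at this
  linear_combination this

/-- The functions `ψ(l)ψ(2η-l)` and `ψ(-l)ψ(l-2η)` have sum `2v` and product `q(l)q(l-2η)`, so they
are the roots `v ± yw` of a quadratic equation. The sign does not depend on `l`, because entire
functions have no zero divisors. -/
lemma eq_or_eq (hτ : 0 < τ.im) (hη : ∀ k : ℤ, k ≠ 0 → (k : ℂ) * η ∉ lattice τ) (hm : 0 < m)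
    (h : IsEigen τ η m e A ψ) {y : ℂ} (hy : y ^ 2 = specPoly τ η m e) :
    (∀ l, ψ l * ψ (2 * η - l) = vFun τ η m e l + y * wFun τ η m l) ∨
      ∀ l, ψ l * ψ (2 * η - l) = vFun τ η m e l - y * wFun τ η m l := by
  have hG := (h.mul_reflect_isTheta hτ (2 * η)).diff
  have hV := (vFun_isTheta (η := η) (m := m) hτ e).diff
  have hw := (wFun_isTheta (η := η) (m := m) hτ).diff.const_mul y
  rcases eq_zero_or_eq_zero_of_entire_mul ((hG.sub hV).sub hw) ((hG.sub hV).add hw)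
    (fun l => by
      have r1 := h.add_eq hτ hη hm l
      have r2 := h.mul_neg_eq hτ hη hm l
      have r3 := h.mul_neg_eq hτ hη hm (l - 2 * η)
      have r4 := vFun_sq hτ hη hm e l
      rw [neg_sub] at r3
      rw [← r2, ← r3] at r4
      simp only [Pi.sub_apply, Pi.add_apply]
      linear_combination (-ψ l * ψ (2 * η - l)) * r1 * (-1) + r4 + wFun τ η m l ^ 2 * (-1) * hy)
    with h0 | h0
  · left; intro l
    have := congrFun h0 l
    simp only [Pi.sub_apply, Pi.zero_apply] at this
    linear_combination this
  · right; intro l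
    have := congrFun h0 l
    simp only [Pi.sub_apply, Pi.add_apply, Pi.zero_apply] at this
    linear_combination this

/-- Division of the two hypotheses gives `ψ(-l)φ(2η-l) = φ(-l)ψ(2η-l)`, so `ψ/φ` is `2η`-periodic.
Its divisor is finite on `E_τ` and invariant under a translation of infinite order, hence zero. -/
lemma divClass_eq (hτ : 0 < τ.im) (hη : ∀ k : ℤ, k ≠ 0 → (k : ℂ) * η ∉ lattice τ) (hm : 0 < m)
    (h : IsEigen τ η m e A ψ) {e' : ℂ} (h' : IsEigen τ η m e' B φ)
    (hQ : ∀ l, qFun τ η m e l = qFun τ η m e' l)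
    (hG : ∀ l, ψ l * ψ (2 * η - l) = φ l * φ (2 * η - l)) : divClass τ A = divClass τ B := by
  have hd : ∀ (f : ℂ → ℂ) (c : ℂ), Differentiable ℂ f → Differentiable ℂ fun l => f (c - l) :=
    fun f c hf => hf.comp (by fun_prop)
  have h1 := h.diff hτ
  have h2 := h'.diff hτ
  have hper := eq_of_entire_mul_eq (h1.mul h2) ((hd ψ 0 h1).mul (hd φ (2 * η) h2))
    ((hd φ 0 h2).mul (hd ψ (2 * η) h1)) (ne_zero_of_mul_ne h1 h2 h.ne_zero h'.ne_zero)
    (fun l => by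
      have r1 := h.mul_neg_eq hτ hη hm l
      have r2 := h'.mul_neg_eq hτ hη hm l
      have r3 := hG l
      have r4 := hQ l
      simp only [Pi.mul_apply, zero_sub]
      linear_combination φ l * φ (2 * η - l) * r1 - ψ l * ψ (2 * η - l) * r2 -
        qFun τ η m e' l * r3 + φ l * φ (2 * η - l) * r4)
  obtain ⟨C, c, hC, hf⟩ := h.form
  obtain ⟨D, d, hD, hg⟩ := h'.form
  have key : ∀ l, divTheta τ (A + B.map fun b => b + -(2 * η)) l = exp ((c - d) * (2 * η)) *
      exp (0 * l) * divTheta τ (B + A.map fun b => b + -(2 * η)) l := by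
    intro l
    have := congrFun hper (-l)
    simp only [Pi.mul_apply, zero_sub, neg_neg, sub_neg_eq_add] at this
    rw [hf, hg, hf, hg] at this
    rw [divTheta_add, divTheta_add, divTheta_map_add, divTheta_map_add, sub_neg_eq_add,
      add_comm l (2 * η), zero_mul, exp_zero]
    refine mul_left_cancel₀ (mul_ne_zero (mul_ne_zero hC hD)
      (exp_ne_zero (c * l + d * (2 * η + l)))) ?_
    have e1 : exp (c * l + d * (2 * η + l)) * exp ((c - d) * (2 * η)) =
        exp (d * l) * exp (c * (2 * η + l)) := by
      rw [← exp_add, ← exp_add]; congr 1; ring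
    have e2 : exp (c * l + d * (2 * η + l)) = exp (c * l) * exp (d * (2 * η + l)) := exp_add _ _
    calc _ = C * exp (c * l) * divTheta τ A l *
          (D * exp (d * (2 * η + l)) * divTheta τ B (2 * η + l)) := by rw [e2]; ring
      _ = _ := by rw [this]
      _ = C * D * (exp (d * l) * exp (c * (2 * η + l))) * (divTheta τ B l *
          divTheta τ A (2 * η + l)) := by ring
      _ = _ := by rw [← e1]; ring
  have := divClass_eq_of_divTheta hτ (exp_ne_zero _) key
  simp only [divClass, Multiset.map_add] at this
  refine multiset_eq_of_shift (u := QuotientAddGroup.mk (-(2 * η))) (fun k hk h0 => ?_) ?_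
  · rw [← QuotientAddGroup.mk_nsmul, QuotientAddGroup.eq_zero_iff] at h0
    refine hη (-(2 * k)) (by omega) ?_
    convert h0 using 1; simp; ring
  · rw [← divClass_map_add, ← divClass_map_add]
    exact this

/-- By `add_eq`, replacing `ψ(l)` by `ψ(-l)` exchanges the two signs of `y`. -/
lemma eq_or_eq_neg (hτ : 0 < τ.im) (hη : ∀ k : ℤ, k ≠ 0 → (k : ℂ) * η ∉ lattice τ) (hm : 0 < m)
    (h : IsEigen τ η m e A ψ) (h' : IsEigen τ η m e B φ) :
    divClass τ B = divClass τ A ∨ divClass τ B = divClass τ (A.map fun a => -a) := by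
  obtain ⟨y, hy⟩ := IsAlgClosed.exists_pow_nat_eq (specPoly τ η m e) (n := 2) (by norm_num)
  have hn := h.neg hτ hη hm
  have hGn : ∀ l, ψ (-l) * ψ (-(2 * η - l)) = 2 * vFun τ η m e l - ψ l * ψ (2 * η - l) := by
    intro l
    rw [neg_sub]
    linear_combination h.add_eq hτ hη hm l
  rcases h.eq_or_eq hτ hη hm hy with h1 | h1 <;> rcases h'.eq_or_eq hτ hη hm hy with h2 | h2
  · exact Or.inl (h'.divClass_eq hτ hη hm h (fun _ => rfl) fun l => by rw [h1, h2])
  · exact Or.inr (h'.divClass_eq hτ hη hm hn (fun _ => rfl) fun l => by rw [hGn, h1, h2]; ring)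
  · exact Or.inr (h'.divClass_eq hτ hη hm hn (fun _ => rfl) fun l => by rw [hGn, h1, h2]; ring)
  · exact Or.inl (h'.divClass_eq hτ hη hm h (fun _ => rfl) fun l => by rw [h1, h2])

end IsEigen

end

section

variable {τ η : ℂ} {m : ℕ}

lemma eta_ne_zero (hη : ∀ k : ℤ, k ≠ 0 → (k : ℂ) * η ∉ lattice τ) : η ≠ 0 := by
  rintro rfl
  exact hη 1 one_ne_zero (by simp [zero_mem])

namespace IsEigen

variable {e : ℂ} {A B : Multiset ℂ} {ψ φ : ℂ → ℂ}

/-- The factor `e^{πil/(2η)}` changes sign under both shifts `l ↦ l ± 2η` and has no zeros. The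
divisor therefore determines the eigenvalue at best up to sign, which is why `ε²` is the function on
the curve. -/
lemma flip (hη : ∀ k : ℤ, k ≠ 0 → (k : ℂ) * η ∉ lattice τ) (h : IsEigen τ η m e A ψ) :
    IsEigen τ η m (-e) A fun l => exp (Real.pi * I * (l - 2 * η * m) / (2 * η)) * ψ l := by
  have hη0 := eta_ne_zero hη
  refine ⟨h.card, ?_, fun l => ?_, ?_⟩
  · obtain ⟨C, c, hC, hf⟩ := h.form
    refine ⟨C * exp (-(Real.pi * I * m)), c + Real.pi * I / (2 * η),
      mul_ne_zero hC (exp_ne_zero _), fun l => ?_⟩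
    have : exp (Real.pi * I * (l - 2 * η * m) / (2 * η)) * exp (c * l) =
        exp (-(Real.pi * I * m)) * exp ((c + Real.pi * I / (2 * η)) * l) := by
      rw [← exp_add, ← exp_add]; congr 1; field_simp; ring
    rw [hf]
    linear_combination C * divTheta τ A l * this
  · have e1 : exp (Real.pi * I * (l - 2 * η - 2 * η * m) / (2 * η)) =
        -exp (Real.pi * I * (l - 2 * η * m) / (2 * η)) := by
      rw [show Real.pi * I * (l - 2 * η - 2 * η * m) / (2 * η) =
        Real.pi * I * (l - 2 * η * m) / (2 * η) - Real.pi * I by field_simp; ring, exp_sub,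
        exp_pi_mul_I]; ring
    have e2 : exp (Real.pi * I * (l + 2 * η - 2 * η * m) / (2 * η)) =
        -exp (Real.pi * I * (l - 2 * η * m) / (2 * η)) := by
      rw [show Real.pi * I * (l + 2 * η - 2 * η * m) / (2 * η) =
        Real.pi * I * (l - 2 * η * m) / (2 * η) + Real.pi * I by field_simp; ring, exp_add,
        exp_pi_mul_I]; ring
    rw [e1, e2]
    linear_combination -exp (Real.pi * I * (l - 2 * η * m) / (2 * η)) * h.rel l
  · simp [h.top]

/-- At `e = 0` the flipped function has the same eigenvalue and the same divisor, but the opposite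
product `ψ(l)ψ(2η-l)`. Since `v = 0`, both signs of `y` thus lead to one divisor. -/
lemma divClass_eq_of_zero (hτ : 0 < τ.im) (hη : ∀ k : ℤ, k ≠ 0 → (k : ℂ) * η ∉ lattice τ)
    (hm : 0 < m) (h : IsEigen τ η m 0 A ψ) (h' : IsEigen τ η m 0 B φ) :
    divClass τ B = divClass τ A := by
  obtain ⟨y, hy⟩ := IsAlgClosed.exists_pow_nat_eq (specPoly τ η m 0) (n := 2) (by norm_num)
  have hη0 := eta_ne_zero hη
  have hn := h.flip hη
  rw [neg_zero] at hn
  have hGn : ∀ l, (exp (Real.pi * I * (l - 2 * η * m) / (2 * η)) * ψ l) *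
      (exp (Real.pi * I * (2 * η - l - 2 * η * m) / (2 * η)) * ψ (2 * η - l)) =
      -(ψ l * ψ (2 * η - l)) := by
    intro l
    have : exp (Real.pi * I * (l - 2 * η * m) / (2 * η)) *
        exp (Real.pi * I * (2 * η - l - 2 * η * m) / (2 * η)) = -1 := by
      rw [← exp_add, show Real.pi * I * (l - 2 * η * m) / (2 * η) +
        Real.pi * I * (2 * η - l - 2 * η * m) / (2 * η) =
        Real.pi * I - (m : ℤ) * (2 * Real.pi * I) by push_cast; field_simp; ring, exp_sub,
        exp_int_mul_two_pi_mul_I, exp_pi_mul_I, div_one]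
    linear_combination ψ l * ψ (2 * η - l) * this
  rcases h.eq_or_eq hτ hη hm hy with h1 | h1 <;> rcases h'.eq_or_eq hτ hη hm hy with h2 | h2
  · exact h'.divClass_eq hτ hη hm h (fun _ => rfl) fun l => by rw [h1, h2]
  · exact h'.divClass_eq hτ hη hm hn (fun _ => rfl) fun l => by rw [hGn, h1, h2, vFun_zero]; ring
  · exact h'.divClass_eq hτ hη hm hn (fun _ => rfl) fun l => by rw [hGn, h1, h2, vFun_zero]; ring
  · exact h'.divClass_eq hτ hη hm h (fun _ => rfl) fun l => by rw [h1, h2]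

/-- A symmetric divisor occurs only over `0` and the zeros of `specPoly`. -/
lemma specPoly_eq_zero (hτ : 0 < τ.im) (hη : ∀ k : ℤ, k ≠ 0 → (k : ℂ) * η ∉ lattice τ)
    (hm : 0 < m) (h : IsEigen τ η m e A ψ) (he : e ≠ 0)
    (hs : divClass τ (A.map fun a => -a) = divClass τ A) : specPoly τ η m e = 0 := by
  obtain ⟨C, c, hC, hf⟩ := h.form
  obtain ⟨D, d, hD, hg⟩ := (h.neg hτ hη hm).form
  obtain ⟨E, k, hE, hk⟩ := divTheta_congr hs
  obtain ⟨K, κ, hK, hneg⟩ : ∃ K κ : ℂ, K ≠ 0 ∧ ∀ l, ψ (-l) = K * exp (κ * l) * ψ l := by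
    refine ⟨D * E / C, d + k - c, div_ne_zero (mul_ne_zero hD hE) hC, fun l => ?_⟩
    rw [hg, hk, hf, sub_mul, add_mul, exp_sub, exp_add]
    field_simp
  have hψ := h.diff hτ
  set q := exp (κ * (2 * η)) with hq
  have hq0 : q ≠ 0 := exp_ne_zero _
  have hrel2 : ∀ l, q⁻¹ * (theta τ (l + 2 * η * m) * ψ (l - 2 * η)) +
      q * (theta τ (l - 2 * η * m) * ψ (l + 2 * η)) = e * theta τ l * ψ l := by
    intro l
    have r := (h.neg hτ hη hm).rel l
    rw [hneg, hneg, hneg, show κ * (l - 2 * η) = κ * l - κ * (2 * η) by ring, exp_sub,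
      show κ * (l + 2 * η) = κ * l + κ * (2 * η) by ring, exp_add, ← hq] at r
    refine mul_left_cancel₀ (mul_ne_zero hK (exp_ne_zero (κ * l))) ?_
    rw [div_eq_mul_inv] at r
    linear_combination r
  -- At `l = 2ηm` only the backward shift survives. The two relations differ there by the factor
  -- `q⁻¹`, and their common right side is nonzero since `e ≠ 0`.
  have hq1 : q = 1 := by
    have t1 := h.rel (2 * η * m)
    have t2 := hrel2 (2 * η * m)
    rw [sub_self, theta_zero] at t1 t2
    have g1 : theta τ (2 * η * m) ≠ 0 := theta_int_ne hτ hη (k := m) (by omega) (by push_cast; ring)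
    have hne : e * theta τ (2 * η * m) * ψ (2 * η * m) ≠ 0 := by
      rw [h.top]; simp [he, g1]
    have t3 : theta τ (2 * η * m + 2 * η * m) * ψ (2 * η * m - 2 * η) ≠ 0 := fun h0 =>
      hne (by rw [← t1, h0]; ring)
    have t4 : q⁻¹ = 1 := by
      refine mul_right_cancel₀ t3 ?_
      linear_combination t2 - t1
    exact inv_eq_one.1 t4
  obtain ⟨y, hy⟩ := IsAlgClosed.exists_pow_nat_eq (specPoly τ η m e) (n := 2) (by norm_num)
  -- With `q = 1` the two summands in `add_eq` are equal, so each equals `v`. This leaves no room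
  -- for `±yw` unless `y = 0`.
  have hGG : ∀ l, ψ l * ψ (2 * η - l) = vFun τ η m e l := by
    intro l
    have r1 := h.add_eq hτ hη hm l
    have r2 := hneg l
    have r3 := hneg (l - 2 * η)
    rw [neg_sub, mul_sub, exp_sub, ← hq, hq1, div_one] at r3
    rw [r2, r3] at r1
    rw [r3]
    linear_combination r1 / 2
  have hyw : ∀ l, y * wFun τ η m l = 0 := by
    intro l
    rcases h.eq_or_eq hτ hη hm hy with h1 | h1 <;>
    · have := h1 l
      rw [hGG] at this
      first | linear_combination this | linear_combination -this
  have := (mul_eq_zero.1 (hyw (1 / 2))).resolve_right (wFun_half_ne hτ hη)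
  rw [← hy, this]; simp

/-- If `ψ` vanished at `a` and `a + 2η`, both summands in `add_eq` would vanish at `a + 2η`, hence
`v` and `yw` as well. Regularity excludes `y = 0`, and a zero of `w` lies on the grid, where `q =
p_k²` is nonzero. This later yields `θ(t_j - t_i + 2η) ≠ 0`. -/
lemma zero_not_shift (hτ : 0 < τ.im) (hη : ∀ k : ℤ, k ≠ 0 → (k : ℂ) * η ∉ lattice τ)
    (hm : 0 < m) (he : IsRegular τ η m e) (h : IsEigen τ η m e A ψ) {a : ℂ} (ha : ψ a = 0) :
    ψ (a + 2 * η) ≠ 0 := by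
  intro ha'
  obtain ⟨y, hy⟩ := IsAlgClosed.exists_pow_nat_eq (specPoly τ η m e) (n := 2) (by norm_num)
  have hQ := h.mul_neg_eq hτ hη hm (a + 2 * η)
  rw [ha', zero_mul] at hQ
  have r1 := h.add_eq hτ hη hm (a + 2 * η)
  rw [ha', show a + 2 * η - 2 * η = a by ring, ha] at r1
  have hv : vFun τ η m e (a + 2 * η) = 0 := by linear_combination -r1 / 2
  have hyw : y * wFun τ η m (a + 2 * η) = 0 := by
    rcases h.eq_or_eq hτ hη hm hy with h1 | h1 <;>
    · have := h1 (a + 2 * η)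
      rw [ha', hv] at this
      first | linear_combination this | linear_combination -this
  rcases mul_eq_zero.1 hyw with h0 | h0
  · exact he.1 (by rw [← hy, h0]; simp)
  · obtain ⟨k, hk, hl⟩ := wFun_eq_zero hτ h0
    exact he.grid_notMem hτ hη hQ.symm hk hl

end IsEigen

/-! ### Existence -/

/-- The zeros of an even function come in pairs `±a`, inequivalent because `2a ∉ Λ`. One
representative satisfying `p` is taken from each pair, and `evenTheta τ a` is divided out. -/
lemma exists_even_factorization (hτ : 0 < τ.im) (p : ℂ → Prop) {n : ℕ} {f : ℂ → ℂ}
    (hf : IsTheta τ (2 * n) 0 f) (hf0 : f ≠ 0) (heven : ∀ l, f (-l) = f l)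
    (hhalf : ∀ a, f a = 0 → 2 * a ∉ lattice τ) (hp : ∀ a, f a = 0 → p a ∨ p (-a)) :
    ∃ (A : Multiset ℂ) (C : ℂ), A.card = n ∧ C ≠ 0 ∧ (∀ a ∈ A, p a) ∧
      ∀ l, f l = C * (divTheta τ A l * divTheta τ A (-l)) := by
  induction n generalizing f with
  | zero =>
    obtain ⟨C, hC⟩ := hf.exists_const hτ
    refine ⟨0, C, rfl, ?_, by simp, fun l => by simp [hC, divTheta]⟩
    rintro rfl
    exact hf0 (funext hC)
  | succ n ih =>
    obtain ⟨b, hb⟩ := IsTheta.exists_zero (n := 2 * n + 1) hτ hf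
    obtain ⟨a, ha, hpa⟩ : ∃ a, f a = 0 ∧ p a := (hp b hb).elim (fun h => ⟨b, hb, h⟩)
      fun h => ⟨-b, by rw [heven, hb], h⟩
    have h2a := hhalf a ha
    obtain ⟨g, hg, e1⟩ := IsTheta.div_theta (n := 2 * n + 1) hτ hf ha
    have hga : g (-a) = 0 := by
      have := e1 (-a)
      rw [heven, ha] at this
      refine (mul_eq_zero.1 this.symm).resolve_left ?_
      rw [theta_eq_zero_iff hτ, show -a - a = -(2 * a) by ring, neg_mem_iff]
      exact h2a
    obtain ⟨k, hk, e2⟩ := IsTheta.div_theta (n := 2 * n) hτ hg hga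
    have e3 : ∀ l, f l = evenTheta τ a l * k l := by
      intro l; rw [e1, e2, evenTheta, sub_neg_eq_add]; ring
    have hK := (evenTheta_isTheta hτ a).diff
    have hK0 : evenTheta τ a ≠ 0 := by
      intro h0; exact hf0 (funext fun l => by rw [e3, h0]; simp)
    have hkeven : ∀ l, k (-l) = k l := congrFun (eq_of_entire_mul_eq hK
      (hk.diff.comp differentiable_neg) hk.diff hK0 fun l => by
        have := heven l
        rw [e3, e3, evenTheta_neg] at this
        exact this)
    obtain ⟨A, C, hA, hC, hAp, hk'⟩ := ih (hk.congr rfl (by ring) fun _ => rfl)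
      (fun h0 => hf0 (funext fun l => by rw [e3, h0]; simp)) hkeven
      (fun x hx => hhalf x (by rw [e3, hx, mul_zero])) (fun x hx => hp x (by rw [e3, hx, mul_zero]))
    refine ⟨a ::ₘ A, -C, by simp [hA], neg_ne_zero.2 hC, ?_, fun l => ?_⟩
    · intro x hx
      rcases Multiset.mem_cons.1 hx with rfl | hx
      · exact hpa
      · exact hAp x hx
    · rw [e3, hk', divTheta_cons, divTheta_cons, evenTheta, show -l - a = -(l + a) by ring,
        theta_neg]
      ring

/-- Each zero `b` of the right side must be absorbed by `G`, because `F` does not vanish there.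
Removing the zeros one at a time takes care of multiplicities. -/
lemma exists_quotient_divTheta (hτ : 0 < τ.im) {B : Multiset ℂ} {n : ℕ} {s : ℂ} {G F h : ℂ → ℂ}
    (hG : IsTheta τ (B.card + n) s G) (hF : Differentiable ℂ F) (hh : Differentiable ℂ h)
    (hB : ∀ b ∈ B, F b ≠ 0) (e : ∀ l, G l * F l = divTheta τ B l * h l) :
    ∃ g, IsTheta τ n (s + B.sum) g ∧ ∀ l, G l = divTheta τ B l * g l := by
  induction B using Multiset.induction_on generalizing G s with
  | empty => exact ⟨G, hG.congr (by simp) (by simp) fun _ => rfl, fun l => by simp [divTheta]⟩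
  | cons b B ih =>
    have hGb : G b = 0 := by
      have := e b
      rw [divTheta_cons, sub_self, theta_zero, zero_mul, zero_mul] at this
      exact (mul_eq_zero.1 this).resolve_right (hB b (by simp))
    obtain ⟨G₁, hG₁, e₁⟩ := IsTheta.div_theta (n := B.card + n) hτ
      (hG.congr (by simp; ring) rfl fun _ => rfl) hGb
    obtain ⟨g, hg, e₂⟩ := ih hG₁ (fun x hx => hB x (by simp [hx])) (congrFun
      (eq_of_entire_mul_eq (theta_sub_diff hτ b) (hG₁.diff.mul hF)
        ((divTheta_isTheta hτ B).diff.mul hh) (theta_sub_ne_zero hτ b) fun l => by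
          have := e l
          rw [e₁, divTheta_cons] at this
          linear_combination this))
    exact ⟨g, hg.congr rfl (by simp; ring) fun _ => rfl, fun l => by
      rw [e₁, e₂, divTheta_cons]; ring⟩

/-- The linear relation satisfied by a theta function whose multiples by exponential functions
include an eigenfunction, or a limit of such functions. -/
def IsRel (τ η : ℂ) (m : ℕ) (A : Multiset ℂ) (α β γ : ℂ) : Prop :=
  ∀ l, α * (theta τ (l + 2 * η * m) * divTheta τ A (l - 2 * η)) +
    β * (theta τ (l - 2 * η * m) * divTheta τ A (l + 2 * η)) = γ * (theta τ l * divTheta τ A l)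

/-- With `G = v + yw` and `F = v - yw` one has `GF = q(l)q(l-2η)`. From each pair of zeros `±a` of
`q` the one with `F(a) ≠ 0` is collected in `A`. Then `A` and its reflection `2η - A` both divide
`G`, and the degrees leave only a constant: `G = c'Θ(l)Θ(2η-l)`, hence `F = (κ²/c')Θ(-l)Θ(l-2η)`.
Substitution into the linear relation between `F`, `G` and `q` and cancellation of `Θ(-l)` give the
claim. -/
lemma exists_isRel (hτ : 0 < τ.im) (hη : ∀ k : ℤ, k ≠ 0 → (k : ℂ) * η ∉ lattice τ) (hm : 0 < m)
    {e : ℂ} (he : IsRegular τ η m e) : ∃ (A : Multiset ℂ) (α β γ : ℂ), A.card = m ∧ α ≠ 0 ∧ β ≠ 0 ∧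
      IsRel τ η m A α β γ ∧ γ ^ 2 = e ^ 2 * (α * β) := by
  obtain ⟨y, hy⟩ := IsAlgClosed.exists_pow_nat_eq (specPoly τ η m e) (n := 2) (by norm_num)
  have hy0 : y ≠ 0 := by rintro rfl; exact he.1 (by rw [← hy]; simp)
  have hQt := qFun_isTheta (η := η) (m := m) hτ e
  have hVt := vFun_isTheta (η := η) (m := m) hτ e
  have hwt := (wFun_isTheta (η := η) (m := m) hτ).const_mul y
  set G : ℂ → ℂ := fun l => vFun τ η m e l + y * wFun τ η m l with hGdef
  set F : ℂ → ℂ := fun l => vFun τ η m e l - y * wFun τ η m l with hFdef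
  have hGt : IsTheta τ (2 * m) (-(2 * m * η)) G := hVt.add hwt
  have hFt : IsTheta τ (2 * m) (-(2 * m * η)) F := hVt.sub hwt
  have hGF : ∀ l, G l * F l = qFun τ η m e l * qFun τ η m e (l - 2 * η) := by
    intro l
    have := vFun_sq hτ hη hm e l
    rw [← hy] at this
    simp only [hGdef, hFdef]
    linear_combination this
  have hGr : ∀ l, G (2 * η - l) = G l := fun l => by
    simp only [hGdef]; rw [vFun_reflect, wFun_reflect]
  have hFr : ∀ l, F (2 * η - l) = F l := fun l => by
    simp only [hFdef]; rw [vFun_reflect, wFun_reflect]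
  have hrel : ∀ l, theta τ (l + 2 * η * m) * F l + theta τ (l - 2 * η * m) * G (l + 2 * η) =
      e * theta τ l * qFun τ η m e l := by
    intro l
    have r1 := vFun_rel hτ hη hm e l
    have r2 := theta_mul_wFun (τ := τ) (η := η) (m := m) l
    have r3 := theta_mul_wFun_add (τ := τ) (η := η) (m := m) l
    simp only [hGdef, hFdef]
    linear_combination r1 - y * r2 + y * r3
  -- If `F` vanished at both `a` and `-a`, the linear relation and the reflection symmetry would
  -- give `G(-a) = 0`, hence `w(-a) = 0`. Then `-a` would lie on the grid, where a regular `e` has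
  -- `q ≠ 0`.
  have hsign : ∀ a, qFun τ η m e a = 0 → F a ≠ 0 ∨ F (-a) ≠ 0 := by
    intro a ha
    by_contra! hcon
    have r1 := hrel a
    rw [hcon.1, ha, mul_zero, mul_zero, zero_add] at r1
    have hne : theta τ (a - 2 * η * m) ≠ 0 := by
      rw [Ne, theta_eq_zero_iff hτ]
      exact_mod_cast he.grid_notMem hτ hη ha (k := m) (by simp)
    have r2 := (mul_eq_zero.1 r1).resolve_left hne
    have r3 : G (-a) = 0 := by rw [← hGr, show 2 * η - -a = a + 2 * η by ring, r2]
    have r4 : 2 * y * wFun τ η m (-a) = 0 := by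
      have h1 := hcon.2
      simp only [hGdef, hFdef] at h1 r3
      linear_combination r3 - h1
    have hw0 := (mul_eq_zero.1 r4).resolve_left (by simp [hy0])
    obtain ⟨k, hk, hl⟩ := wFun_eq_zero hτ hw0
    exact he.grid_notMem hτ hη (by rw [qFun_neg, ha]) hk hl
  obtain ⟨A, κ, hA, hκ, hAp, hQ⟩ := exists_even_factorization hτ (fun a => F a ≠ 0) hQt
    (qFun_ne_zero hτ hη e) (qFun_neg e) (fun a ha => he.half_notMem hτ hη ha) hsign
  have hD := (divTheta_isTheta hτ A)
  have hd : ∀ c : ℂ, Differentiable ℂ fun l => divTheta τ A (c - l) :=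
    fun c => hD.diff.comp (by fun_prop)
  have hds : ∀ c : ℂ, Differentiable ℂ fun l => divTheta τ A (l - c) :=
    fun c => hD.diff.comp (by fun_prop)
  set B : Multiset ℂ := A.map fun a => 2 * η - a with hBdef
  have hBA : ∀ l, divTheta τ B l = (-1) ^ m * divTheta τ A (2 * η - l) := by
    intro l
    have : B = (A.map fun a => -a).map fun a => a + 2 * η := by
      rw [Multiset.map_map]
      exact Multiset.map_congr rfl fun a _ => by simp [sub_eq_neg_add]
    rw [this, divTheta_map_add, divTheta_map_neg, hA, neg_sub]
  have hsq : ((-1 : ℂ)) ^ m * (-1) ^ m = 1 := by rw [← mul_pow]; simp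
  have hBcard : B.card = m := by simp [hBdef, hA]
  have hBsum : B.sum = 2 * η * m - A.sum := by
    rw [hBdef, Multiset.sum_map_sub, Multiset.map_const', Multiset.sum_replicate, hA,
      Multiset.map_id', nsmul_eq_mul]; ring
  obtain ⟨g, hg, e1⟩ := exists_quotient_divTheta (n := m) hτ (B := A)
    (hGt.congr (by rw [hA]; ring) rfl fun _ => rfl) hFt.diff
    (h := fun l => κ * (divTheta τ A (0 - l) * qFun τ η m e (l - 2 * η)))
    (((hd 0).mul (hQt.diff.comp (by fun_prop))).const_mul κ) hAp
    (fun l => by rw [hGF, hQ l, zero_sub]; ring)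
  have e2 : ∀ l, g l * F l = divTheta τ B l * (κ ^ 2 * (-1) ^ m *
      (divTheta τ A (0 - l) * divTheta τ A (l - 2 * η))) :=
    congrFun (eq_of_entire_mul_eq hD.diff (hg.diff.mul hFt.diff)
      ((divTheta_isTheta hτ B).diff.mul
        (((hd 0).mul (hds (2 * η))).const_mul (κ ^ 2 * (-1) ^ m)))
      (divTheta_ne_zero hτ A) fun l => by
        have := hGF l
        rw [e1, hQ l, hQ (l - 2 * η), neg_sub] at this
        simp only [zero_sub, hBA]
        linear_combination this - κ ^ 2 * divTheta τ A l * divTheta τ A (-l) *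
          divTheta τ A (l - 2 * η) * divTheta τ A (2 * η - l) * hsq)
  obtain ⟨k, hk, e3⟩ := exists_quotient_divTheta (n := 0) hτ (B := B)
    (hg.congr (by rw [hBcard, add_zero]) rfl fun _ => rfl) hFt.diff
    (((hd 0).mul (hds (2 * η))).const_mul (κ ^ 2 * (-1) ^ m))
    (fun b hb => by
      obtain ⟨a, ha, rfl⟩ := Multiset.mem_map.1 hb
      rw [hFr]; exact hAp a ha) e2
  obtain ⟨c, hc⟩ := (hk.congr rfl (s' := 0) (by rw [hBsum]; ring) fun _ => rfl).exists_const hτ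
  set c' := c * (-1) ^ m with hc'
  have hG' : ∀ l, G l = c' * (divTheta τ A l * divTheta τ A (2 * η - l)) := by
    intro l; rw [e1, e3, hc, hBA]; ring
  have hc0 : c' ≠ 0 := by
    intro h0
    have hz : ∀ l, qFun τ η m e l * qFun τ η m e (l - 2 * η) = 0 := by
      intro l; rw [← hGF, hG', h0]; ring
    rcases eq_zero_or_eq_zero_of_entire_mul hQt.diff
      (hQt.diff.comp (differentiable_id.sub_const (2 * η))) hz with h1 | h1
    · exact qFun_ne_zero hτ hη e h1
    · refine qFun_ne_zero (m := m) hτ hη e (funext fun l => ?_)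
      have := congrFun h1 (l + 2 * η)
      simpa using this
  have hGne : G ≠ 0 := by
    intro h0
    have h1 := divTheta_ne_zero hτ A
    refine ne_zero_of_mul_ne hD.diff (hd (2 * η)) h1 (fun h2 => h1 (funext fun l => ?_))
      (funext fun l => ?_)
    · have := congrFun h2 (2 * η - l)
      simpa using this
    · have := hG' l
      rw [h0] at this
      exact (mul_eq_zero.1 this.symm).resolve_left hc0
  have hF' : ∀ l, F l = κ ^ 2 / c' * (divTheta τ A (0 - l) * divTheta τ A (l - 2 * η)) :=
    congrFun (eq_of_entire_mul_eq hGt.diff hFt.diff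
      (((hd 0).mul (hds (2 * η))).const_mul (κ ^ 2 / c')) hGne fun l => by
        rw [hGF, hG', hQ l, hQ (l - 2 * η), zero_sub, neg_sub]
        field_simp)
  refine ⟨A, κ ^ 2 / c', c', e * κ, hA, div_ne_zero (pow_ne_zero 2 hκ) hc0, hc0, ?_, ?_⟩
  · have hn0 : (fun l => divTheta τ A (0 - l)) ≠ 0 := fun h2 => divTheta_ne_zero hτ A
      (funext fun l => by have := congrFun h2 (-l); simpa using this)
    have hdiff1 : Differentiable ℂ fun l => divTheta τ A (l + 2 * η) := hD.diff.comp (by fun_prop)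
    have ht : ∀ c, Differentiable ℂ fun l => theta τ (l + c) := fun c =>
      (theta_differentiable hτ).comp (by fun_prop)
    exact congrFun (eq_of_entire_mul_eq (hd 0)
      ((((ht (2 * η * m)).mul (hds (2 * η))).const_mul (κ ^ 2 / c')).add
        (((theta_sub_diff hτ (2 * η * m)).mul hdiff1).const_mul c'))
      (((theta_differentiable hτ).mul hD.diff).const_mul (e * κ)) hn0 fun l => by
        have := hrel l
        rw [hF', hG' (l + 2 * η), hQ l, show 2 * η - (l + 2 * η) = 0 - l by ring] at this
        simp only [zero_sub] at this ⊢
        linear_combination this)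
  · field_simp

end

section

variable {τ η : ℂ} {m : ℕ}

/-! ### The relation defining the curve -/

lemma mul_eq_zero_of_entire {f g : ℂ → ℂ} (hf : Differentiable ℂ f) (hg : Differentiable ℂ g)
    (hf0 : f ≠ 0) (hg0 : g ≠ 0) {c : ℂ} (h : ∀ l, c * (f l * g l) = 0) : c = 0 := by
  by_contra hc
  exact ne_zero_of_mul_ne hf hg hf0 hg0 (funext fun l => (mul_eq_zero.1 (h l)).resolve_left hc)

lemma divTheta_shift_ne_zero (hτ : 0 < τ.im) (A : Multiset ℂ) (c : ℂ) :
    (fun l => divTheta τ A (l + c)) ≠ 0 := fun h => divTheta_ne_zero hτ A (funext fun l => by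
  have := congrFun h (l - c)
  simpa using this)

namespace IsRel

variable {A B : Multiset ℂ} {α β γ α' β' γ' : ℂ}

lemma neg (h : IsRel τ η m A α β γ) : IsRel τ η m (A.map fun a => -a) β α γ := by
  intro l
  have := h (-l)
  rw [show -l + 2 * η * m = -(l - 2 * η * m) by ring, show -l - 2 * η * m = -(l + 2 * η * m) by
    ring, theta_neg, theta_neg, theta_neg, show -l - 2 * η = -(l + 2 * η) by ring,
    show -l + 2 * η = -(l - 2 * η) by ring] at this
  rw [divTheta_map_neg, divTheta_map_neg, divTheta_map_neg]
  linear_combination (-(-1) ^ A.card) * this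

/-- Moving points by lattice vectors multiplies `Θ` by an exponential, which rescales `α` and `β`
inversely. The quotient `γ²/(αβ)` is unaffected. -/
lemma congr (h : IsRel τ η m A α β γ) (hAB : divClass τ A = divClass τ B) :
    ∃ q : ℂ, q ≠ 0 ∧ IsRel τ η m B (α * q⁻¹) (β * q) γ := by
  obtain ⟨C, c, hC, e⟩ := divTheta_congr hAB
  refine ⟨exp (c * (2 * η)), exp_ne_zero _, fun l => ?_⟩
  have := h l
  rw [e, e, e, mul_sub, mul_add, exp_sub, exp_add, div_eq_mul_inv] at this
  refine mul_left_cancel₀ (mul_ne_zero hC (exp_ne_zero (c * l))) ?_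
  linear_combination this

lemma smul (h : IsRel τ η m A α β γ) (s : ℂ) : IsRel τ η m A (s * α) (s * β) (s * γ) := fun l => by
  linear_combination s * h l

lemma sub (h : IsRel τ η m A α β γ) (h' : IsRel τ η m A α' β' γ') :
    IsRel τ η m A (α - α') (β - β') (γ - γ') := fun l => by
  linear_combination h l - h' l

variable (hτ : 0 < τ.im) (hη : ∀ k : ℤ, k ≠ 0 → (k : ℂ) * η ∉ lattice τ) (hm : 0 < m)
include hτ hη hm

/-- If `α ≠ 0`, a zero at `2ηm` would propagate down the grid through the recursion and produce more
than `m` zeros of `Θ`. -/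
lemma top_ne_zero (h : IsRel τ η m A α β γ) (hA : A.card = m) (hα : α ≠ 0) :
    divTheta τ A (2 * η * m) ≠ 0 := by
  intro h0
  have key : ∀ j : ℕ, j < 2 * m → divTheta τ A (2 * η * (m - j : ℤ)) = 0 ∧
      divTheta τ A (2 * η * (m - j - 1 : ℤ)) = 0 := by
    have step : ∀ j : ℕ, j < 2 * m → divTheta τ A (2 * η * (m - j : ℤ)) = 0 →
        (j ≠ 0 → divTheta τ A (2 * η * (m - j + 1 : ℤ)) = 0) →
        divTheta τ A (2 * η * (m - j - 1 : ℤ)) = 0 := by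
      intro j hj h1 h2
      have r1 := h (2 * η * (m - j : ℤ))
      rw [show 2 * η * ((m - j : ℤ) : ℂ) - 2 * η = 2 * η * (m - j - 1 : ℤ) by push_cast; ring,
        show 2 * η * ((m - j : ℤ) : ℂ) + 2 * η = 2 * η * (m - j + 1 : ℤ) by push_cast; ring,
        h1] at r1
      have r3 : theta τ (2 * η * (m - j : ℤ) - 2 * η * m) *
          divTheta τ A (2 * η * (m - j + 1 : ℤ)) = 0 := by
        by_cases hj0 : j = 0
        · subst hj0
          rw [show 2 * η * (((m : ℤ) - (0 : ℕ) : ℤ) : ℂ) - 2 * η * m = 0 by push_cast; ring,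
            theta_zero, zero_mul]
        · rw [h2 hj0, mul_zero]
      rw [r3, mul_zero, add_zero, mul_zero, mul_zero] at r1
      refine (mul_eq_zero.1 ((mul_eq_zero.1 r1).resolve_left hα)).resolve_left
        (theta_int_ne hτ hη (k := 2 * m - j) (by omega) ?_)
      push_cast; ring
    intro j
    induction j with
    | zero =>
      intro hj
      have h0' : divTheta τ A (2 * η * (m - (0 : ℕ) : ℤ)) = 0 := by simpa using h0
      exact ⟨h0', step 0 hj h0' (fun h => absurd rfl h)⟩
    | succ j ih =>
      intro hj
      obtain ⟨i1, i2⟩ := ih (by omega)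
      rw [show (m : ℤ) - j - 1 = m - (j + 1 : ℕ) by push_cast; ring] at i2
      refine ⟨i2, step (j + 1) hj i2 fun _ => ?_⟩
      rw [show (m : ℤ) - (j + 1 : ℕ) + 1 = m - j by push_cast; ring]
      exact i1
  refine divTheta_ne_zero hτ A (eq_zero_of_grid hτ hη (divTheta_isTheta hτ A)
    (Finset.Icc (1 - m : ℤ) m) (by simp; omega) fun k hk => ?_)
  simp only [Finset.mem_Icc] at hk
  have := (key (m - k).toNat (by omega)).1
  rwa [show (m : ℤ) - ((m - k).toNat : ℤ) = k by omega] at this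

lemma trivial_of_top (h : IsRel τ η m A 0 β γ) (h0 : divTheta τ A (2 * η * m) ≠ 0) :
    β = 0 ∧ γ = 0 := by
  have hγ : γ = 0 := by
    have := h (2 * η * m)
    rw [sub_self, theta_zero] at this
    have h1 : γ * (theta τ (2 * η * m) * divTheta τ A (2 * η * m)) = 0 := by rw [← this]; ring
    exact (mul_eq_zero.1 h1).resolve_right (mul_ne_zero
      (theta_int_ne hτ hη (k := m) (by omega) (by push_cast; ring)) h0)
  refine ⟨mul_eq_zero_of_entire (theta_sub_diff hτ (2 * η * m))
    ((divTheta_isTheta hτ A).comp_add (2 * η)).diff (theta_sub_ne_zero hτ _)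
    (divTheta_shift_ne_zero hτ A _) fun l => ?_, hγ⟩
  have := h l
  rw [hγ] at this
  linear_combination this

lemma alpha_ne_zero_iff (h : IsRel τ η m A α β γ) (hA : A.card = m)
    (hne : ¬(α = 0 ∧ β = 0 ∧ γ = 0)) : α ≠ 0 ↔ divTheta τ A (2 * η * m) ≠ 0 := by
  refine ⟨h.top_ne_zero hτ hη hm hA, fun h0 hα => hne ?_⟩
  subst hα
  exact ⟨rfl, h.trivial_of_top hτ hη hm h0⟩

omit hτ hη hm in
lemma bot_ne_zero_iff : divTheta τ (A.map fun a => -a) (2 * η * m) ≠ 0 ↔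
    divTheta τ A (-(2 * η * m)) ≠ 0 := by
  rw [divTheta_map_neg]; simp

lemma beta_ne_zero_iff (h : IsRel τ η m A α β γ) (hA : A.card = m)
    (hne : ¬(α = 0 ∧ β = 0 ∧ γ = 0)) : β ≠ 0 ↔ divTheta τ A (-(2 * η * m)) ≠ 0 := by
  rw [← bot_ne_zero_iff]
  exact h.neg.alpha_ne_zero_iff hτ hη hm (by simpa using hA) (by tauto)

omit hη hm in
lemma gamma_ne_zero (h : IsRel τ η m A α β γ) (hne : ¬(α = 0 ∧ β = 0 ∧ γ = 0)) (hαβ : α * β = 0) :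
    γ ≠ 0 := by
  rintro rfl
  rcases mul_eq_zero.1 hαβ with rfl | rfl
  · refine hne ⟨rfl, mul_eq_zero_of_entire (theta_sub_diff hτ (2 * η * m))
      ((divTheta_isTheta hτ A).comp_add (2 * η)).diff (theta_sub_ne_zero hτ _)
      (divTheta_shift_ne_zero hτ A _) fun l => ?_, rfl⟩
    linear_combination h l
  · refine hne ⟨mul_eq_zero_of_entire (IsTheta.theta_add hτ (2 * η * m)).diff
      ((divTheta_isTheta hτ A).comp_sub (2 * η)).diff (fun h0 => theta_sub_ne_zero hτ
        (-(2 * η * m)) (by simpa [sub_neg_eq_add] using h0))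
      (by simpa [sub_eq_add_neg] using divTheta_shift_ne_zero hτ A (-(2 * η))) fun l => ?_,
      rfl, rfl⟩
    linear_combination h l

/-- When `Θ(2ηm) ≠ 0`, subtracting a multiple eliminates `α`, and a relation with `α = 0` is then
trivial. The case `Θ(-2ηm) ≠ 0` is its mirror image. If both values vanish, then `α = β = 0` and no
nontrivial relation exists. This uniqueness makes `ε²` well defined on divisors. -/
lemma proportional (h : IsRel τ η m A α β γ) (h' : IsRel τ η m A α' β' γ') (hA : A.card = m)
    (hne : ¬(α = 0 ∧ β = 0 ∧ γ = 0)) (hne' : ¬(α' = 0 ∧ β' = 0 ∧ γ' = 0)) :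
    ∃ s : ℂ, s ≠ 0 ∧ α' = s * α ∧ β' = s * β ∧ γ' = s * γ := by
  have key : ∀ (A : Multiset ℂ) (α β γ α' β' γ' : ℂ), IsRel τ η m A α β γ →
      IsRel τ η m A α' β' γ' → A.card = m → ¬(α = 0 ∧ β = 0 ∧ γ = 0) →
      ¬(α' = 0 ∧ β' = 0 ∧ γ' = 0) → divTheta τ A (2 * η * m) ≠ 0 →
      ∃ s : ℂ, s ≠ 0 ∧ α' = s * α ∧ β' = s * β ∧ γ' = s * γ := by
    intro A α β γ α' β' γ' h h' hA hne hne' h0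
    have hα := (h.alpha_ne_zero_iff hτ hη hm hA hne).2 h0
    have hα' := (h'.alpha_ne_zero_iff hτ hη hm hA hne').2 h0
    have h1 := h'.sub (h.smul (α' / α))
    rw [div_mul_cancel₀ _ hα, sub_self] at h1
    obtain ⟨h2, h3⟩ := h1.trivial_of_top hτ hη hm h0
    exact ⟨α' / α, div_ne_zero hα' hα, by field_simp, sub_eq_zero.1 h2, sub_eq_zero.1 h3⟩
  by_cases h0 : divTheta τ A (2 * η * m) = 0
  · by_cases h1 : divTheta τ A (-(2 * η * m)) = 0
    · have hα : α = 0 := by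
        by_contra hα; exact (h.alpha_ne_zero_iff hτ hη hm hA hne).1 hα h0
      have hβ : β = 0 := by
        by_contra hβ; exact (h.beta_ne_zero_iff hτ hη hm hA hne).1 hβ h1
      exfalso
      refine hne ⟨hα, hβ, mul_eq_zero_of_entire (theta_differentiable hτ)
        (divTheta_isTheta hτ A).diff (fun h2 => theta_sub_ne_zero hτ 0 (by simpa using h2))
        (divTheta_ne_zero hτ A) fun l => ?_⟩
      have := h l
      rw [hα, hβ] at this
      linear_combination -this
    · obtain ⟨s, hs, h2, h3, h4⟩ := key _ _ _ _ _ _ _ h.neg h'.neg (by simpa using hA) (by tauto)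
        (by tauto) (bot_ne_zero_iff.2 h1)
      exact ⟨s, hs, h3, h2, h4⟩
  · exact key _ _ _ _ _ _ _ h h' hA hne hne' h0

/-- The relation is rescaled so that `αβ = 1` and `γ = e`. An exponential `e^{cl}` with `e^{2ηc} =
β` then absorbs both coefficients. -/
lemma exists_isEigen (h : IsRel τ η m A α β γ) (hA : A.card = m) (hα : α ≠ 0) (hβ : β ≠ 0) {e : ℂ}
    (he : γ ^ 2 = e ^ 2 * (α * β)) : ∃ ψ, IsEigen τ η m e A ψ := by
  have hη0 := eta_ne_zero hη
  obtain ⟨s, hs, hγ⟩ : ∃ s : ℂ, s ^ 2 * (α * β) = 1 ∧ s * γ = e := by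
    obtain ⟨s, hs⟩ := IsAlgClosed.exists_pow_nat_eq (α * β)⁻¹ (n := 2) (by norm_num)
    have h1 : s ^ 2 * (α * β) = 1 := by rw [hs, inv_mul_cancel₀ (mul_ne_zero hα hβ)]
    have h2 : (s * γ - e) * (s * γ + e) = 0 := by linear_combination s ^ 2 * he + e ^ 2 * h1
    rcases mul_eq_zero.1 h2 with h3 | h3
    · exact ⟨s, h1, sub_eq_zero.1 h3⟩
    · exact ⟨-s, by linear_combination h1, by linear_combination -h3⟩
  have hs0 : s ≠ 0 := by rintro rfl; simp at hs
  set c := log (s * β) / (2 * η)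
  have hc : exp (c * (2 * η)) = s * β := by
    rw [div_mul_cancel₀ _ (by simpa using hη0), exp_log (mul_ne_zero hs0 hβ)]
  have hc' : exp (c * (2 * η)) * (s * α) = 1 := by rw [hc, ← hs]; ring
  have h0 := h.top_ne_zero hτ hη hm hA hα
  set C := (exp (c * (2 * η * m)) * divTheta τ A (2 * η * m))⁻¹
  have hC : C ≠ 0 := inv_ne_zero (mul_ne_zero (exp_ne_zero _) h0)
  refine ⟨fun l => C * exp (c * l) * divTheta τ A l, hA, ⟨C, c, hC, fun l => rfl⟩, fun l => ?_, ?_⟩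
  · have e1 : exp (c * (l - 2 * η)) = exp (c * l) * (s * α) := by
      rw [mul_sub, exp_sub, div_eq_iff (exp_ne_zero _)]
      linear_combination -exp (c * l) * hc'
    have e2 : exp (c * (l + 2 * η)) = exp (c * l) * (s * β) := by rw [mul_add, exp_add, hc]
    simp only [e1, e2]
    rw [← hγ]
    linear_combination C * exp (c * l) * s * h l
  · simp only [C]
    rw [mul_assoc]
    exact inv_mul_cancel₀ (mul_ne_zero (exp_ne_zero _) h0)

end IsRel

/-- The divisor `{2η, 4η, …, 2ηm}`. -/
def infDiv (η : ℂ) (m : ℕ) : Multiset ℂ := (Finset.range m).val.map fun k : ℕ => 2 * η * ((k + 1 : ℕ) : ℂ)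

lemma infDiv_card : (infDiv η m).card = m := by simp [infDiv]

/-- The quotient `Θ(l+2η)/Θ(l)` telescopes to `θ(l)/θ(l-2ηm)`. -/
lemma infDiv_isRel : IsRel τ η m (infDiv η m) 0 1 1 := by
  intro l
  have key : ∀ n : ℕ, theta τ (l - 2 * η * n) * divTheta τ (infDiv η n) (l + 2 * η) =
      theta τ l * divTheta τ (infDiv η n) l := by
    intro n
    have h1 : ∀ n x, divTheta τ (infDiv η n) x = ∏ k ∈ Finset.range n,
        theta τ (x - 2 * η * ((k + 1 : ℕ) : ℂ)) := by
      intro n x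
      rw [divTheta, infDiv, Multiset.map_map]
      rfl
    induction n with
    | zero => simp [infDiv, divTheta]
    | succ n ih =>
      rw [h1, h1, Finset.prod_range_succ, Finset.prod_range_succ, ← h1, ← h1,
        show l + 2 * η - 2 * η * ((n + 1 : ℕ) : ℂ) = l - 2 * η * n by push_cast; ring]
      linear_combination theta τ (l - 2 * η * ((n + 1 : ℕ) : ℂ)) * ih
  linear_combination key m

/-- For `α = 0` a nontrivial relation forces a zero of `Θ` at `2ηm`, and the relation carries it
down to `2η`, where it stops because `θ(0) = 0`. These `m` inequivalent zeros exhaust the divisor.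
-/
lemma IsRel.divClass_eq_infDiv (hτ : 0 < τ.im) (hη : ∀ k : ℤ, k ≠ 0 → (k : ℂ) * η ∉ lattice τ)
    (hm : 0 < m) {A : Multiset ℂ} {β γ : ℂ} (h : IsRel τ η m A 0 β γ) (hA : A.card = m)
    (hne : ¬(β = 0 ∧ γ = 0)) : divClass τ A = divClass τ (infDiv η m) := by
  have h0 : divTheta τ A (2 * η * m) = 0 := by
    by_contra h0; exact hne (h.trivial_of_top hτ hη hm h0)
  have hγ := h.gamma_ne_zero hτ (by tauto) (by ring)
  have key : ∀ j : ℕ, j < m → divTheta τ A (2 * η * (m - j : ℕ)) = 0 := by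
    intro j
    induction j with
    | zero => intro _; simpa using h0
    | succ j ih =>
      intro hj
      have h1 := ih (by omega)
      have h2 := h (2 * η * (m - (j + 1) : ℕ))
      rw [show 2 * η * ((m - (j + 1) : ℕ) : ℂ) + 2 * η = 2 * η * (m - j : ℕ) by
        rw [show m - j = (m - (j + 1)) + 1 by omega]; push_cast; ring, h1] at h2
      have h3 : γ * (theta τ (2 * η * (m - (j + 1) : ℕ)) *
        divTheta τ A (2 * η * (m - (j + 1) : ℕ))) = 0 := by rw [← h2]; ring
      exact (mul_eq_zero.1 ((mul_eq_zero.1 h3).resolve_left hγ)).resolve_left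
        (theta_int_ne hτ hη (k := (m - (j + 1) : ℕ)) (by omega) (by push_cast; ring))
  have hnodup : (divClass τ (infDiv η m)).Nodup := by
    rw [divClass, infDiv, Multiset.map_map]
    refine (Multiset.nodup_map_iff_of_inj_on ?_).2 (Finset.range m).nodup
    intro i _ j _ hij
    by_contra hne
    have := two_eta_sub hη (i := (i + 1 : ℕ)) (j := (j + 1 : ℕ)) (by omega)
    exact this (by exact_mod_cast mk_eq_mk_iff.1 hij)
  refine (Multiset.eq_of_le_of_card_le ((Multiset.le_iff_subset hnodup).2 fun x hx => ?_) ?_).symm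
  · simp only [divClass, infDiv, Multiset.map_map, Multiset.mem_map] at hx
    obtain ⟨k, hk, rfl⟩ := hx
    have hk' : k < m := by simpa using hk
    have := key (m - (k + 1)) (by omega)
    rw [show m - (m - (k + 1)) = k + 1 by omega] at this
    obtain ⟨a, ha, hl⟩ := (divTheta_eq_zero_iff hτ A _).1 this
    exact Multiset.mem_map.2 ⟨a, ha, (mk_eq_mk_iff.2 hl).symm⟩
  · rw [divClass_card, divClass_card, hA, infDiv_card]

/-! ### The values of the covering map -/

/-- `z` is the value of the square of the eigenvalue at the divisor `A`. -/
def IsValue (τ η : ℂ) (m : ℕ) (A : Multiset ℂ) (z : OnePoint ℂ) : Prop :=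
  ∃ α β γ, ¬(α = 0 ∧ β = 0 ∧ γ = 0) ∧ IsRel τ η m A α β γ ∧ z = ratio (γ ^ 2) (α * β)

lemma ratio_mul {s : ℂ} (hs : s ≠ 0) (p q : ℂ) : ratio (s * p) (s * q) = ratio p q := by
  unfold ratio
  by_cases hq : q = 0
  · simp [hq]
  · simp [hq, hs, mul_div_mul_left]

lemma ratio_eq_coe_iff {p q z : ℂ} : ratio p q = (z : OnePoint ℂ) ↔ q ≠ 0 ∧ p = z * q := by
  unfold ratio
  by_cases hq : q = 0
  · simp [hq]
  · simp [hq, div_eq_iff]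

lemma ratio_eq_infty_iff {p q : ℂ} : ratio p q = OnePoint.infty ↔ q = 0 := by
  unfold ratio
  by_cases hq : q = 0 <;> simp [hq]

namespace IsValue

variable {A B : Multiset ℂ} {z w : OnePoint ℂ}

lemma congr (h : IsValue τ η m A z) (hAB : divClass τ A = divClass τ B) : IsValue τ η m B z := by
  obtain ⟨α, β, γ, hne, h, rfl⟩ := h
  obtain ⟨q, hq, h'⟩ := h.congr hAB
  refine ⟨_, _, _, by simpa [hq] using hne, h', ?_⟩
  congr 1; field_simp

lemma neg (h : IsValue τ η m A z) : IsValue τ η m (A.map fun a => -a) z := by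
  obtain ⟨α, β, γ, hne, h, rfl⟩ := h
  exact ⟨β, α, γ, by tauto, h.neg, by rw [mul_comm]⟩

variable (hτ : 0 < τ.im) (hη : ∀ k : ℤ, k ≠ 0 → (k : ℂ) * η ∉ lattice τ) (hm : 0 < m)
include hτ hη hm

lemma unique (h : IsValue τ η m A z) (h' : IsValue τ η m A w) (hA : A.card = m) : z = w := by
  obtain ⟨α, β, γ, hne, h, rfl⟩ := h
  obtain ⟨α', β', γ', hne', h', rfl⟩ := h'
  obtain ⟨s, hs, rfl, rfl, rfl⟩ := h.proportional hτ hη hm h' hA hne hne'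
  rw [show (s * γ) ^ 2 = s ^ 2 * γ ^ 2 by ring, show s * α * (s * β) = s ^ 2 * (α * β) by ring,
    ratio_mul (pow_ne_zero 2 hs)]

lemma exists_isEigen {e : ℂ} (h : IsValue τ η m A ((e ^ 2 : ℂ) : OnePoint ℂ)) (hA : A.card = m) :
    ∃ ψ, IsEigen τ η m e A ψ := by
  obtain ⟨α, β, γ, hne, h, h1⟩ := h
  obtain ⟨h2, h3⟩ := ratio_eq_coe_iff.1 h1.symm
  exact h.exists_isEigen hτ hη hm hA (left_ne_zero_of_mul h2) (right_ne_zero_of_mul h2) h3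

lemma of_infty (h : IsValue τ η m A OnePoint.infty) (hA : A.card = m) :
    divClass τ A = divClass τ (infDiv η m) ∨
      divClass τ A = divClass τ ((infDiv η m).map fun a => -a) := by
  obtain ⟨α, β, γ, hne, h, h1⟩ := h
  rcases mul_eq_zero.1 (ratio_eq_infty_iff.1 h1.symm) with rfl | rfl
  · exact Or.inl (h.divClass_eq_infDiv hτ hη hm hA (by tauto))
  · have h2 := h.neg.divClass_eq_infDiv hτ hη hm (by simpa using hA) (by tauto)
    right
    rw [divClass_map_neg, ← h2, divClass_map_neg, Multiset.map_map]
    simp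

omit hτ in
lemma infty_ne_neg : divClass τ ((infDiv η m).map fun a => -a) ≠ divClass τ (infDiv η m) := by
  intro h
  have h1 : (QuotientAddGroup.mk (-(2 * η)) : Ell τ) ∈ divClass τ (infDiv η m) := by
    rw [← h]
    refine Multiset.mem_map.2 ⟨-(2 * η), Multiset.mem_map.2 ⟨2 * η, ?_, rfl⟩, rfl⟩
    exact Multiset.mem_map.2 ⟨0, by simpa using hm, by simp⟩
  simp only [divClass, infDiv, Multiset.map_map, Multiset.mem_map] at h1
  obtain ⟨k, hk, hl⟩ := h1
  have := two_eta_sub hη (i := (k + 1 : ℕ)) (j := -1) (by omega)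
  refine this ?_
  have h2 := mk_eq_mk_iff.1 hl
  push_cast at h2 ⊢
  rwa [mul_neg, mul_one]

/-- The fibres are orbits of the reflection. -/
lemma eq_or_eq_neg (h : IsValue τ η m A z) (h' : IsValue τ η m B z) (hA : A.card = m)
    (hB : B.card = m) :
    divClass τ B = divClass τ A ∨ divClass τ B = divClass τ (A.map fun a => -a) := by
  induction z using OnePoint.rec with
  | infty =>
    rcases h.of_infty hτ hη hm hA with h1 | h1 <;> rcases h'.of_infty hτ hη hm hB with h2 | h2
    · exact Or.inl (h2.trans h1.symm)
    · right; rw [h2, divClass_map_neg, divClass_map_neg, h1]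
    · right; rw [h2, divClass_map_neg, h1, divClass_map_neg, Multiset.map_map]; simp
    · exact Or.inl (h2.trans h1.symm)
  | coe z =>
    obtain ⟨e, rfl⟩ := IsAlgClosed.exists_pow_nat_eq z (n := 2) (by norm_num)
    obtain ⟨ψ, hψ⟩ := h.exists_isEigen hτ hη hm hA
    obtain ⟨φ, hφ⟩ := h'.exists_isEigen hτ hη hm hB
    exact hψ.eq_or_eq_neg hτ hη hm hφ

/-- The values with a symmetric divisor. -/
lemma of_symmetric (h : IsValue τ η m A z) (hA : A.card = m)
    (hs : divClass τ (A.map fun a => -a) = divClass τ A) :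
    ∃ e : ℂ, z = ((e ^ 2 : ℂ) : OnePoint ℂ) ∧ (e = 0 ∨ specPoly τ η m e = 0) := by
  induction z using OnePoint.rec with
  | infty =>
    exfalso
    rcases h.of_infty hτ hη hm hA with h1 | h1
    · rw [divClass_map_neg, h1, ← divClass_map_neg] at hs
      exact infty_ne_neg hη hm hs
    · rw [divClass_map_neg, h1, divClass_map_neg, Multiset.map_map] at hs
      simp only [Function.comp_def, neg_neg, Multiset.map_id'] at hs
      rw [← divClass_map_neg] at hs
      exact infty_ne_neg hη hm hs.symm
  | coe z =>
    obtain ⟨e, rfl⟩ := IsAlgClosed.exists_pow_nat_eq z (n := 2) (by norm_num)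
    obtain ⟨ψ, hψ⟩ := h.exists_isEigen hτ hη hm hA
    refine ⟨e, rfl, ?_⟩
    by_cases he : e = 0
    · exact Or.inl he
    · exact Or.inr (hψ.specPoly_eq_zero hτ hη hm he hs)

lemma symmetric_of_zero (h : IsValue τ η m A ((0 : ℂ) : OnePoint ℂ)) (hA : A.card = m) :
    divClass τ (A.map fun a => -a) = divClass τ A := by
  rw [show (0 : ℂ) = 0 ^ 2 by norm_num] at h
  obtain ⟨ψ, hψ⟩ := h.exists_isEigen hτ hη hm hA
  exact hψ.divClass_eq_of_zero hτ hη hm (hψ.neg hτ hη hm)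

end IsValue

lemma infDiv_isValue : IsValue τ η m (infDiv η m) OnePoint.infty :=
  ⟨0, 1, 1, by simp, infDiv_isRel, by simp [ratio]⟩

lemma exists_isValue (hτ : 0 < τ.im) (hη : ∀ k : ℤ, k ≠ 0 → (k : ℂ) * η ∉ lattice τ) (hm : 0 < m)
    {e : ℂ} (he : IsRegular τ η m e) :
    ∃ A : Multiset ℂ, A.card = m ∧ IsValue τ η m A ((e ^ 2 : ℂ) : OnePoint ℂ) := by
  obtain ⟨A, α, β, γ, hA, hα, hβ, h, hγ⟩ := exists_isRel hτ hη hm he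
  exact ⟨A, hA, α, β, γ, by tauto, h, (ratio_eq_coe_iff.2 ⟨mul_ne_zero hα hβ, hγ⟩).symm⟩

/-! ### The curve -/

/-- The divisor of the function `ψ` attached to `t`. -/
def tDiv (η : ℂ) (t : Fin m → ℂ) : Multiset ℂ := Finset.univ.val.map fun j => η - t j

lemma tDiv_card (t : Fin m → ℂ) : (tDiv η t).card = m := by simp [tDiv]

lemma divTheta_tDiv (t : Fin m → ℂ) (l : ℂ) :
    divTheta τ (tDiv η t) l = ∏ j, theta τ (l + t j - η) := by
  rw [divTheta, tDiv, Multiset.map_map, Finset.prod]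
  congr 1
  refine Multiset.map_congr rfl fun j _ => ?_
  simp only [Function.comp]
  congr 1; ring

/-- The zeros of `ψ` are recorded as `η - t_j`; in this coordinate the involution `t ↦ 2η - t` is
negation. -/
lemma tDiv_reflect (t : Fin m → ℂ) : tDiv η (fun j => 2 * η - t j) = (tDiv η t).map fun a => -a := by
  rw [tDiv, tDiv, Multiset.map_map]
  refine Multiset.map_congr rfl fun j _ => ?_
  simp only [Function.comp]
  ring

lemma proj_val (t : Fin m → ℂ) : (proj τ t).1 =
    (Finset.univ : Finset (Fin m)).val.map fun i => (QuotientAddGroup.mk (t i) : Ell τ) := rfl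

lemma reflection_val (x : SymEll τ m) : (reflection τ η m x).1 =
    x.1.map fun u => (QuotientAddGroup.mk (2 * η) : Ell τ) - u := rfl

lemma proj_reflect (t : Fin m → ℂ) :
    proj τ (fun j => 2 * η - t j) = reflection τ η m (proj τ t) := by
  refine Subtype.ext ?_
  rw [proj_val, reflection_val, proj_val, Multiset.map_map]
  rfl

lemma divClass_tDiv (t : Fin m → ℂ) : divClass τ (tDiv η t) =
    (proj τ t).1.map fun u => (QuotientAddGroup.mk η : Ell τ) - u := by
  rw [proj_val, divClass, tDiv, Multiset.map_map, Multiset.map_map]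
  rfl

lemma proj_eq_iff (η : ℂ) (t t' : Fin m → ℂ) :
    proj τ t = proj τ t' ↔ divClass τ (tDiv η t) = divClass τ (tDiv η t') := by
  rw [divClass_tDiv, divClass_tDiv, (Multiset.map_injective (sub_right_injective)).eq_iff]
  exact ⟨fun h => by rw [h], fun h => Subtype.ext h⟩

lemma exists_tDiv (A : Multiset ℂ) (hA : A.card = m) : ∃ t : Fin m → ℂ, tDiv η t = A := by
  subst hA
  obtain ⟨L, rfl⟩ := Quot.exists_rep A
  refine ⟨fun j : Fin L.length => η - L.get j, ?_⟩
  simp only [tDiv, sub_sub_cancel]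
  have h : Multiset.map (fun j : Fin L.length => L.get j) Finset.univ.val = (L : Multiset ℂ) := by
    rw [Fin.univ_val_map, List.ofFn_get]
  exact h

lemma proj_surjective : Function.Surjective (proj τ (m := m)) := by
  rintro ⟨x, hx⟩
  obtain ⟨A, rfl⟩ : ∃ A : Multiset ℂ, A.map (fun a => (QuotientAddGroup.mk a : Ell τ)) = x := by
    obtain ⟨L, rfl⟩ := Quot.exists_rep x
    refine ⟨(L.map Quotient.out : List ℂ), ?_⟩
    simp [Function.comp_def]
  rw [Multiset.card_map] at hx
  obtain ⟨t, ht⟩ := exists_tDiv (η := 0) (A.map fun a => -a) (by simpa using hx)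
  refine ⟨t, Subtype.ext ?_⟩
  have h2 : Multiset.map t Finset.univ.val = A := by
    have := congrArg (Multiset.map fun a => -a) ht
    simpa [tDiv, Multiset.map_map, Function.comp_def] using this
  rw [proj_val]
  simp only [← h2, Multiset.map_map]
  rfl

/-- The spectral curve in the symmetric power. -/
def curve (τ η : ℂ) (m : ℕ) : Set (SymEll τ m) :=
  {x | ∃ t z, proj τ t = x ∧ IsValue τ η m (tDiv η t) z}

open Classical in
/-- The square of the eigenvalue as a function on the curve. -/
def curveMap (τ η : ℂ) (m : ℕ) (x : SymEll τ m) : OnePoint ℂ :=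
  if h : ∃ z t, proj τ t = x ∧ IsValue τ η m (tDiv η t) z then h.choose else OnePoint.infty

lemma proj_mem_curve {t : Fin m → ℂ} : proj τ t ∈ curve τ η m ↔ ∃ z, IsValue τ η m (tDiv η t) z :=
  ⟨fun ⟨t', z, h, hz⟩ => ⟨z, hz.congr ((proj_eq_iff η t' t).1 h)⟩, fun ⟨z, hz⟩ => ⟨t, z, rfl, hz⟩⟩

section

variable (hτ : 0 < τ.im) (hη : ∀ k : ℤ, k ≠ 0 → (k : ℂ) * η ∉ lattice τ) (hm : 0 < m)
include hτ hη hm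

lemma curveMap_eq {t : Fin m → ℂ} {z : OnePoint ℂ} (h : IsValue τ η m (tDiv η t) z) :
    curveMap τ η m (proj τ t) = z := by
  have hex : ∃ z t', proj τ t' = proj τ t ∧ IsValue τ η m (tDiv η t') z := ⟨z, t, rfl, h⟩
  rw [curveMap, dif_pos hex]
  obtain ⟨t', h1, h2⟩ := hex.choose_spec
  exact (h2.congr ((proj_eq_iff η t' t).1 h1)).unique hτ hη hm h (tDiv_card t)

lemma isValue_curveMap {t : Fin m → ℂ} (h : proj τ t ∈ curve τ η m) :
    IsValue τ η m (tDiv η t) (curveMap τ η m (proj τ t)) := by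
  obtain ⟨z, hz⟩ := proj_mem_curve.1 h
  rwa [curveMap_eq hτ hη hm hz]

omit hτ hη hm in
lemma reflection_reflection (x : SymEll τ m) : reflection τ η m (reflection τ η m x) = x := by
  obtain ⟨t, rfl⟩ := proj_surjective x
  rw [← proj_reflect, ← proj_reflect]
  simp

lemma reflection_mem_curve {x : SymEll τ m} (h : x ∈ curve τ η m) :
    reflection τ η m x ∈ curve τ η m ∧
      curveMap τ η m (reflection τ η m x) = curveMap τ η m x := by
  obtain ⟨t, rfl⟩ := proj_surjective x
  have h1 := (isValue_curveMap hτ hη hm h).neg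
  rw [← tDiv_reflect] at h1
  rw [← proj_reflect]
  exact ⟨proj_mem_curve.2 ⟨_, h1⟩, curveMap_eq hτ hη hm h1⟩

lemma eq_or_eq_reflection {x y : SymEll τ m} (hx : x ∈ curve τ η m) (hy : y ∈ curve τ η m)
    (h : curveMap τ η m y = curveMap τ η m x) : y = x ∨ y = reflection τ η m x := by
  obtain ⟨t, rfl⟩ := proj_surjective x
  obtain ⟨t', rfl⟩ := proj_surjective y
  have h1 := isValue_curveMap hτ hη hm hx
  have h2 := isValue_curveMap hτ hη hm hy
  rw [h] at h2
  rw [← proj_reflect, proj_eq_iff η, proj_eq_iff η, tDiv_reflect]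
  exact h1.eq_or_eq_neg hτ hη hm h2 (tDiv_card t) (tDiv_card t')

/-- The branch points of the covering. -/
def branchSet (τ η : ℂ) (m : ℕ) : Set (OnePoint ℂ) :=
  {z | ∃ x ∈ curve τ η m, curveMap τ η m x = z ∧ reflection τ η m x = x}

lemma finite_branchSet : (branchSet τ η m).Finite := by
  refine ((((Set.finite_singleton (0 : ℂ)).union (specPoly_isPoly.finite_zeros
    (specPoly_zero_ne hτ hη hm)))).image fun e => ((e ^ 2 : ℂ) : OnePoint ℂ)).subset ?_
  rintro z ⟨x, hx, rfl, hs⟩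
  obtain ⟨t, rfl⟩ := proj_surjective x
  rw [← proj_reflect, proj_eq_iff η, tDiv_reflect] at hs
  obtain ⟨e, h1, h2⟩ := (isValue_curveMap hτ hη hm hx).of_symmetric hτ hη hm (tDiv_card t) hs
  exact ⟨e, h2, h1.symm⟩

lemma reflection_eq_of_mem_branchSet {x : SymEll τ m} (hx : x ∈ curve τ η m)
    (h : curveMap τ η m x ∈ branchSet τ η m) : reflection τ η m x = x := by
  obtain ⟨y, hy, h1, h2⟩ := h
  rcases eq_or_eq_reflection hτ hη hm hx hy h1 with rfl | rfl
  · exact h2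
  · rw [reflection_reflection] at h2; exact h2.symm

lemma zero_mem_branchSet {x : SymEll τ m} (hx : x ∈ curve τ η m)
    (h : curveMap τ η m x = ((0 : ℂ) : OnePoint ℂ)) : ((0 : ℂ) : OnePoint ℂ) ∈ branchSet τ η m := by
  refine ⟨x, hx, h, ?_⟩
  obtain ⟨t, rfl⟩ := proj_surjective x
  have h1 := isValue_curveMap hτ hη hm hx
  rw [h] at h1
  rw [← proj_reflect, proj_eq_iff η, tDiv_reflect]
  exact h1.symmetric_of_zero hτ hη hm (tDiv_card t)

end

end

section

variable {τ η : ℂ} {m : ℕ}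

/-! ### Theta functions of several variables -/

/-- `F` is a theta function of degree `n` and characteristic `s` in each of its variables. -/
structure IsSec (τ : ℂ) (n : ℕ) (s : ℂ) (F : (Fin m → ℂ) → ℂ) : Prop where
  diff : Differentiable ℂ F
  add_one : ∀ i t, F (t + Pi.single i 1) = (-1) ^ n * F t
  add_tau : ∀ i t, F (t + Pi.single i τ) =
    (-1) ^ n * exp (-(Real.pi * I * (n * τ + 2 * n * t i + 2 * s))) * F t

namespace IsSec

variable {n n' : ℕ} {s s' : ℂ} {F G : (Fin m → ℂ) → ℂ}

lemma congr (hF : IsSec τ n s F) (hn : n = n') (hs : s = s') (h : ∀ t, F t = G t) :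
    IsSec τ n' s' G := by
  subst hn hs
  obtain rfl : F = G := funext h
  exact hF

lemma isSection (hF : IsSec τ n s F) : IsSection τ (fun _ => (-1) ^ n)
    (fun _ => (-1) ^ n * exp (-(Real.pi * I * (n * τ + 2 * s)))) (fun _ => n) F :=
  ⟨hF.diff, hF.add_one, fun i t => by
    rw [hF.add_tau, mul_assoc _ (exp _) (exp _), ← exp_add]; push_cast; ring_nf⟩

lemma add (hF : IsSec τ n s F) (hG : IsSec τ n s G) : IsSec τ n s fun t => F t + G t :=
  ⟨hF.diff.add hG.diff, fun i t => by rw [hF.add_one, hG.add_one]; ring,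
    fun i t => by rw [hF.add_tau, hG.add_tau]; ring⟩

lemma const_mul (c : ℂ) (hF : IsSec τ n s F) : IsSec τ n s fun t => c * F t :=
  ⟨hF.diff.const_mul c, fun i t => by rw [hF.add_one]; ring, fun i t => by rw [hF.add_tau]; ring⟩

lemma zero (n : ℕ) (s : ℂ) : IsSec τ n s fun _ : Fin m → ℂ => 0 :=
  ⟨differentiable_const _, by simp, by simp⟩

lemma one : IsSec τ 0 0 fun _ : Fin m → ℂ => 1 := ⟨differentiable_const _, by simp, by simp⟩

lemma mul (hF : IsSec τ n s F) (hG : IsSec τ n' s' G) :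
    IsSec τ (n + n') (s + s') fun t => F t * G t :=
  ⟨hF.diff.mul hG.diff, fun i t => by rw [hF.add_one, hG.add_one]; ring,
    fun i t => by
      rw [hF.add_tau, hG.add_tau, show -(Real.pi * I * (((n + n' : ℕ) : ℂ) * τ +
        2 * ((n + n' : ℕ) : ℂ) * t i + 2 * (s + s'))) =
        -(Real.pi * I * (n * τ + 2 * n * t i + 2 * s)) +
        -(Real.pi * I * (n' * τ + 2 * n' * t i + 2 * s')) by push_cast; ring, exp_add]
      ring⟩

lemma prod {ι : Type*} (S : Finset ι) {n : ι → ℕ} {s : ι → ℂ} {F : ι → (Fin m → ℂ) → ℂ}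
    (hF : ∀ i ∈ S, IsSec τ (n i) (s i) (F i)) :
    IsSec τ (∑ i ∈ S, n i) (∑ i ∈ S, s i) fun t => ∏ i ∈ S, F i t := by
  classical
  induction S using Finset.induction_on with
  | empty => simpa using one
  | insert a S ha ih =>
    simp only [Finset.sum_insert ha, Finset.prod_insert ha]
    exact (hF a (by simp)).mul (ih fun i hi => hF i (by simp [hi]))

lemma pow (hF : IsSec τ n s F) (k : ℕ) : IsSec τ (k * n) (k * s) fun t => F t ^ k := by
  have := prod (Finset.range k) (fun _ _ => hF)
  exact this.congr (by simp) (by simp) fun t => by simp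

lemma comp_perm (hF : IsSec τ n s F) (g : Equiv.Perm (Fin m)) :
    IsSec τ n s fun t => F fun i => t (g i) := by
  have hs : ∀ (t : Fin m → ℂ) i c, (fun j => (t + (Pi.single i c : Fin m → ℂ)) (g j)) =
      (fun j => t (g j)) + Pi.single (g.symm i) c := by
    intro t i c
    ext j
    simp only [Pi.add_apply, Pi.single_apply, Equiv.eq_symm_apply]
  refine ⟨hF.diff.comp (by fun_prop), fun i t => by rw [hs, hF.add_one], fun i t => ?_⟩
  rw [hs, hF.add_tau, Equiv.apply_symm_apply]

lemma comp_reflect (hF : IsSec τ n s F) (c : ℂ) :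
    IsSec τ n (-s - n * c) fun t => F fun i => c - t i := by
  have h1 : ((-1 : ℂ)) ^ n * (-1) ^ n = 1 := by rw [← mul_pow]; simp
  have hs : ∀ (t : Fin m → ℂ) i x, (fun j => c - (t + (Pi.single i x : Fin m → ℂ)) j) + Pi.single i x =
      fun j => c - t j := by
    intro t i x
    ext j
    simp only [Pi.add_apply]
    ring
  refine ⟨hF.diff.comp (by fun_prop), fun i t => ?_, fun i t => ?_⟩
  · have := hF.add_one i (fun j => c - (t + (Pi.single i 1 : Fin m → ℂ)) j)
    rw [hs] at this
    rw [this, ← mul_assoc, h1, one_mul]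
  · have := hF.add_tau i (fun j => c - (t + (Pi.single i τ : Fin m → ℂ)) j)
    rw [hs] at this
    simp only [Pi.add_apply, Pi.single_eq_same] at this
    rw [this]
    have h2 : exp (-(Real.pi * I * (n * τ + 2 * n * t i + 2 * (-s - n * c)))) *
        exp (-(Real.pi * I * (n * τ + 2 * n * (c - (t i + τ)) + 2 * s))) = 1 := by
      rw [← exp_add, ← exp_zero]; congr 1; ring
    set X := F fun j => c - (t + (Pi.single i τ : Fin m → ℂ)) j
    change X = _
    linear_combination (-X) * h1 -
      (X * ((-1) ^ n * (-1) ^ n)) * h2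

end IsSec

lemma differentiable_prod {E ι : Type*} [NormedAddCommGroup E] [NormedSpace ℂ E] (S : Finset ι)
    {f : ι → E → ℂ} (hf : ∀ i ∈ S, Differentiable ℂ (f i)) :
    Differentiable ℂ fun t => ∏ i ∈ S, f i t := by
  classical
  induction S using Finset.induction_on with
  | empty => simp
  | insert a S ha ih =>
    simp only [Finset.prod_insert ha]
    exact (hf a (by simp)).mul (ih fun i hi => hf i (by simp [hi]))

lemma divTheta_tDiv_isSec (hτ : 0 < τ.im) (l : ℂ) :
    IsSec τ 1 (l - η) fun t : Fin m → ℂ => divTheta τ (tDiv η t) l := by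
  have hd := theta_differentiable hτ
  have hfac : ∀ (i : Fin m) (t : Fin m → ℂ) c, divTheta τ (tDiv η (t + Pi.single i c)) l =
      theta τ (l + (t i + c) - η) * ∏ j ∈ Finset.univ.erase i, theta τ (l + t j - η) := by
    intro i t c
    rw [divTheta_tDiv, ← Finset.mul_prod_erase _ _ (Finset.mem_univ i)]
    congr 1
    · simp
    · refine Finset.prod_congr rfl fun j hj => ?_
      simp [Finset.ne_of_mem_erase hj]
  have hfac0 : ∀ (i : Fin m) (t : Fin m → ℂ), divTheta τ (tDiv η t) l =
      theta τ (l + t i - η) * ∏ j ∈ Finset.univ.erase i, theta τ (l + t j - η) := by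
    intro i t
    rw [divTheta_tDiv, ← Finset.mul_prod_erase _ _ (Finset.mem_univ i)]
  refine ⟨?_, fun i t => ?_, fun i t => ?_⟩
  · simp only [divTheta_tDiv]
    refine differentiable_prod _ fun j _ => ?_
    exact hd.comp (f := fun t : Fin m → ℂ => l + t j - η) (by fun_prop)
  · rw [hfac, hfac0 i, show l + (t i + 1) - η = (l + t i - η) + 1 by ring, theta_add_one]
    ring
  · rw [hfac, hfac0 i, show l + (t i + τ) - η = (l + t i - η) + τ by ring, theta_add_tau]
    push_cast
    ring_nf

/-! ### The classical topology of the symmetric power -/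

lemma exists_perm_of_map_eq {X : Type*} {f g : Fin m → X}
    (h : (Finset.univ : Finset (Fin m)).val.map f = (Finset.univ : Finset (Fin m)).val.map g) :
    ∃ σ : Equiv.Perm (Fin m), ∀ i, f i = g (σ i) := by
  classical
  have hc : ∀ x, Fintype.card {i // f i = x} = Fintype.card {i // g i = x} := by
    intro x
    have := congrArg (Multiset.count x) h
    rw [Multiset.count_map, Multiset.count_map] at this
    rw [Fintype.card_subtype, Fintype.card_subtype]
    simpa [Finset.card_def, Finset.filter_val, eq_comm] using this
  let e : ∀ x, {i // f i = x} ≃ {i // g i = x} := fun x => Fintype.equivOfCardEq (hc x)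
  refine ⟨(Equiv.sigmaFiberEquiv f).symm.trans
    ((Equiv.sigmaCongrRight e).trans (Equiv.sigmaFiberEquiv g)), fun i => ?_⟩
  simp only [Equiv.trans_apply, Equiv.sigmaCongrRight_apply, Equiv.sigmaFiberEquiv]
  exact ((e (f i) ⟨i, rfl⟩).2).symm

lemma proj_eq_proj_iff {t t' : Fin m → ℂ} :
    proj τ t = proj τ t' ↔ ∃ g : Equiv.Perm (Fin m), ∀ i, t i - t' (g i) ∈ lattice τ := by
  constructor
  · intro h
    obtain ⟨g, hg⟩ := exists_perm_of_map_eq (congrArg Subtype.val h)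
    exact ⟨g, fun i => mk_eq_mk_iff.1 (hg i)⟩
  · rintro ⟨g, hg⟩
    refine Subtype.ext ?_
    rw [proj_val, proj_val]
    conv_rhs => rw [← Multiset.map_univ_val_equiv g, Multiset.map_map]
    exact Multiset.map_congr rfl fun i _ => mk_eq_mk_iff.2 (hg i)

/-- The saturation of an open set is the union of its images under permutations and lattice
translations. -/
lemma proj_isOpenQuotientMap : IsOpenQuotientMap (proj τ (m := m)) := by
  refine ⟨proj_surjective, continuous_coinduced_rng, fun U hU => ?_⟩
  rw [isOpen_coinduced]
  have : proj τ ⁻¹' (proj τ '' U) = ⋃ (g : Equiv.Perm (Fin m)) (x : Fin m → lattice τ),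
      {t | (fun i => t (g i) + (x i : ℂ)) ∈ U} := by
    ext t
    simp only [Set.mem_preimage, Set.mem_image, Set.mem_iUnion, Set.mem_ofPred_eq]
    constructor
    · rintro ⟨t', ht', h⟩
      obtain ⟨g, hg⟩ := proj_eq_proj_iff.1 h
      exact ⟨g, fun i => ⟨_, hg i⟩, by simpa using ht'⟩
    · rintro ⟨g, x, h⟩
      exact ⟨_, h, proj_eq_proj_iff.2 ⟨g, fun i => by simp⟩⟩
  rw [this]
  refine isOpen_iUnion fun g => isOpen_iUnion fun x => hU.preimage ?_
  fun_prop

lemma compactSpace_symEll (hτ : 0 < τ.im) : CompactSpace (SymEll τ m) := by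
  let φ : (Fin m → ℝ × ℝ) → SymEll τ m := fun p => proj τ fun i => (p i).1 + (p i).2 * τ
  have hφ : Continuous φ := proj_isOpenQuotientMap.continuous.comp (by fun_prop)
  have hK : IsCompact (Set.univ.pi fun _ : Fin m => Set.Icc (0 : ℝ) 1 ×ˢ Set.Icc (0 : ℝ) 1) :=
    isCompact_univ_pi fun _ => isCompact_Icc.prod isCompact_Icc
  refine ⟨?_⟩
  rw [← Set.univ_subset_iff.1 (fun x _ => ?_ : Set.univ ⊆ φ '' _)]
  · exact hK.image hφ
  obtain ⟨t, rfl⟩ := proj_surjective x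
  choose a b n k ha hb h using fun i => exists_reduction hτ (t i)
  refine ⟨fun i => (a i, b i), fun i _ => ⟨ha i, hb i⟩, proj_eq_proj_iff.2 ⟨1, fun i => ?_⟩⟩
  rw [mem_lattice_iff]
  refine ⟨-n i, -k i, ?_⟩
  simp only [Equiv.Perm.coe_one, id_eq]
  rw [h i]; push_cast; ring

/-- A continuous function on `E_τ` with the zero of `theta`. -/
def thetaNorm (τ s : ℂ) : ℝ := ‖theta τ s‖ * Real.exp (-(Real.pi * s.im ^ 2 / τ.im))

lemma thetaNorm_add (hτ : 0 < τ.im) {c : ℂ} (hc : c ∈ lattice τ) (s : ℂ) :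
    thetaNorm τ (s + c) = thetaNorm τ s := by
  induction hc using AddSubgroup.closure_induction generalizing s with
  | mem c hc =>
    rcases hc with rfl | rfl
    · rw [thetaNorm, thetaNorm, theta_add_one]; simp
    · rw [thetaNorm, thetaNorm, theta_add_tau, norm_mul, norm_neg, norm_exp]
      have : (-(Real.pi * I * (c + 2 * s))).re = Real.pi * (c.im + 2 * s.im) := by simp
      rw [this, mul_right_comm, ← Real.exp_add, mul_comm]
      congr 2
      rw [add_im]; field_simp; ring
  | zero => simp
  | add a b _ _ ha hb => rw [← add_assoc, hb, ha]
  | neg a _ ha => rw [← ha, neg_add_cancel_right]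

lemma thetaNorm_eq_zero_iff (hτ : 0 < τ.im) (s : ℂ) : thetaNorm τ s = 0 ↔ s ∈ lattice τ := by
  rw [thetaNorm, ← theta_eq_zero_iff hτ]
  simp [(Real.exp_pos _).ne']

lemma thetaNorm_continuous (hτ : 0 < τ.im) : Continuous (thetaNorm τ) :=
  (theta_differentiable hτ).continuous.norm.mul (by fun_prop)

/-- Two classes differ in the multiplicity of some point `z`. A symmetric continuous function `∑
h(t_i)`, with `h` vanishing at all occurring points other than `z`, has value multiplicity times
`h(z)` and separates them. -/
lemma t2Space_symEll (hτ : 0 < τ.im) : T2Space (SymEll τ m) := by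
  classical
  refine ⟨fun x y hxy => ?_⟩
  obtain ⟨t, rfl⟩ := proj_surjective x
  obtain ⟨t', rfl⟩ := proj_surjective y
  obtain ⟨z, hz⟩ : ∃ z, (proj τ t).1.count z ≠ (proj τ t').1.count z := by
    by_contra! h
    exact hxy (Subtype.ext (Multiset.ext.2 h))
  obtain ⟨z, rfl⟩ := QuotientAddGroup.mk_surjective z
  let Q : Finset ℂ := (Finset.univ.image t ∪ Finset.univ.image t').filter
    fun q => q - z ∉ lattice τ
  let h : ℂ → ℝ := fun s => ∏ q ∈ Q, thetaNorm τ (s - q)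
  have hcont : Continuous h := continuous_finsetProd _ fun q _ =>
    (thetaNorm_continuous hτ).comp (by fun_prop)
  have hlat : ∀ s c, c ∈ lattice τ → h (s + c) = h s := fun s c hc =>
    Finset.prod_congr rfl fun q _ => by rw [add_sub_right_comm, thetaNorm_add hτ hc]
  have hH : h z ≠ 0 := Finset.prod_ne_zero_iff.2 fun q hq => by
    rw [Ne, thetaNorm_eq_zero_iff hτ, ← neg_mem_iff, neg_sub]
    exact (Finset.mem_filter.1 hq).2
  have hz0 : ∀ q, (∃ i, t i = q) ∨ (∃ i, t' i = q) →
      h q = if (QuotientAddGroup.mk z : Ell τ) = QuotientAddGroup.mk q then h z else 0 := by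
    intro q hq
    split_ifs with hqz
    · have := hlat z (q - z) (mk_eq_mk_iff.1 hqz.symm)
      rw [← this]; congr 1; ring
    · refine Finset.prod_eq_zero (i := q) (Finset.mem_filter.2 ⟨by simpa using hq, fun h0 =>
        hqz (mk_eq_mk_iff.2 h0).symm⟩) ?_
      rw [thetaNorm_eq_zero_iff hτ, sub_self]; exact zero_mem _
  let S : (Fin m → ℂ) → ℝ := fun t => ∑ i, h (t i)
  have hS : Continuous S := continuous_finsetSum _ fun i _ => hcont.comp (continuous_apply i)
  have hSp : ∀ u v, proj τ u = proj τ v → S u = S v := by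
    intro u v huv
    obtain ⟨g, hg⟩ := proj_eq_proj_iff.1 huv
    simp only [S]
    rw [← Equiv.sum_comp g fun i => h (v i)]
    refine Finset.sum_congr rfl fun i _ => ?_
    rw [← hlat (v (g i)) _ (hg i)]; congr 1; ring
  have hval : ∀ u : Fin m → ℂ, (∀ i, (∃ j, t j = u i) ∨ (∃ j, t' j = u i)) →
      S u = (proj τ u).1.count (QuotientAddGroup.mk z) * h z := by
    intro u hu
    simp only [S]
    rw [Finset.sum_congr rfl fun i _ => hz0 (u i) (hu i), ← Finset.sum_filter, Finset.sum_const,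
      nsmul_eq_mul, proj_val, Multiset.count_map]
    rfl
  have hne : S t ≠ S t' := by
    rw [hval t fun i => Or.inl ⟨i, rfl⟩, hval t' fun i => Or.inr ⟨i, rfl⟩]
    intro h0
    exact hz (by exact_mod_cast mul_right_cancel₀ hH h0)
  obtain ⟨U, V, hU, hV, htU, htV, hd⟩ := t2_separation hne
  refine ⟨proj τ '' (S ⁻¹' U), proj τ '' (S ⁻¹' V),
    proj_isOpenQuotientMap.isOpenMap _ (hU.preimage hS),
    proj_isOpenQuotientMap.isOpenMap _ (hV.preimage hS), ⟨t, htU, rfl⟩, ⟨t', htV, rfl⟩, ?_⟩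
  rw [Set.disjoint_left]
  rintro _ ⟨u, hu, rfl⟩ ⟨v, hv, huv⟩
  refine Set.disjoint_left.1 hd hu ?_
  rw [← hSp v u huv]
  exact hv

end

section

variable {τ η : ℂ} {m : ℕ}

/-! ### Linear dependence through determinants -/

/-- Functions are linearly dependent exactly when their evaluation vectors span a proper subspace.
This converts the existence of `α, β, γ` into equations in `t`, so the curve is closed in both
topologies. -/
lemma exists_relation_iff_det {X K : Type*} [Field K] {n : ℕ} (v : X → Fin n → K) :
    (∃ c : Fin n → K, c ≠ 0 ∧ ∀ x, ∑ i, c i * v x i = 0) ↔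
      ∀ p : Fin n → X, (Matrix.of fun i => v (p i)).det = 0 := by
  constructor
  · rintro ⟨c, hc, h⟩ p
    refine Matrix.exists_mulVec_eq_zero_iff.1 ⟨c, hc, ?_⟩
    ext i
    simp only [Matrix.mulVec, dotProduct, Matrix.of_apply, Pi.zero_apply]
    rw [← h (p i)]
    exact Finset.sum_congr rfl fun j _ => mul_comm _ _
  · intro h
    by_cases htop : Submodule.span K (Set.range v) = ⊤
    · exfalso
      obtain ⟨f, hf, -, hli⟩ := Submodule.exists_fun_fin_finrank_span_eq K (Set.range v)
      have hn : Module.finrank K (Submodule.span K (Set.range v)) = n := by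
        rw [htop, finrank_top, Module.finrank_fintype_fun_eq_card, Fintype.card_fin]
      have hf' : ∀ i : Fin n, ∃ x, v x = f (Fin.cast hn.symm i) := fun i => hf _
      choose p hp using hf'
      have hli' : LinearIndependent K (Matrix.of fun i => v (p i)).row := by
        have := hli.comp (Fin.cast hn.symm) (Fin.cast_injective _)
        have e : (Matrix.of fun i => v (p i)).row = f ∘ Fin.cast hn.symm := funext hp
        rw [e]; exact this
      have := Matrix.linearIndependent_rows_iff_isUnit.1 hli'
      rw [Matrix.isUnit_iff_isUnit_det, h p] at this
      exact not_isUnit_zero this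
    · obtain ⟨f, hf0, hf⟩ := Submodule.exists_le_ker_of_lt_top _ (lt_top_iff_ne_top.2 htop)
      refine ⟨fun i => f (Pi.single i 1), fun h0 => hf0 ?_, fun x => ?_⟩
      · refine LinearMap.pi_ext' fun i => LinearMap.ext_ring ?_
        simpa using congrFun h0 i
      · have h1 : f (v x) = 0 := hf (Submodule.subset_span ⟨x, rfl⟩)
        rw [pi_eq_sum_univ' (v x), map_sum] at h1
        rw [← h1]
        refine Finset.sum_congr rfl fun i _ => ?_
        rw [map_smul, smul_eq_mul, mul_comm]

lemma IsSec.sum {ι : Type*} (S : Finset ι) {n : ℕ} {s : ℂ} {F : ι → (Fin m → ℂ) → ℂ}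
    (hF : ∀ i ∈ S, IsSec τ n s (F i)) : IsSec τ n s fun t => ∑ i ∈ S, F i t := by
  classical
  induction S using Finset.induction_on with
  | empty => simpa using IsSec.zero n s
  | insert a S ha ih =>
    simp only [Finset.sum_insert ha]
    exact (hF a (by simp)).add (ih fun i hi => hF i (by simp [hi]))

/-- The three functions whose linear dependence defines the curve. -/
def relVec (τ η : ℂ) (m : ℕ) (A : Multiset ℂ) (l : ℂ) (i : Fin 3) : ℂ :=
  theta τ (l + ![2 * η * m, -(2 * η * m), 0] i) * divTheta τ A (l + ![-(2 * η), 2 * η, 0] i)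

lemma isRel_iff_relVec {A : Multiset ℂ} {α β γ : ℂ} :
    IsRel τ η m A α β γ ↔ ∀ l, ∑ i, ![α, β, -γ] i * relVec τ η m A l i = 0 := by
  refine forall_congr' fun l => ?_
  simp only [Fin.sum_univ_three, relVec, Matrix.cons_val_zero, Matrix.cons_val_one,
    Matrix.cons_val, add_zero, ← sub_eq_add_neg]
  constructor
  · intro h; linear_combination h
  · intro h; linear_combination h

/-- The determinants defining the curve. -/
def relDet (τ η : ℂ) (p : Fin 3 → ℂ) (t : Fin m → ℂ) : ℂ :=
  (Matrix.of fun i => relVec τ η m (tDiv η t) (p i)).det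

lemma proj_mem_curve_iff_relDet {t : Fin m → ℂ} :
    proj τ t ∈ curve τ η m ↔ ∀ p, relDet τ η p t = 0 := by
  rw [proj_mem_curve]
  simp only [relDet]
  rw [← exists_relation_iff_det]
  constructor
  · rintro ⟨z, α, β, γ, hne, h, -⟩
    refine ⟨![α, β, -γ], fun h0 => hne ?_, isRel_iff_relVec.1 h⟩
    have h1 := congrFun h0 0
    have h2 := congrFun h0 1
    have h3 := congrFun h0 2
    simp at h1 h2 h3
    exact ⟨h1, h2, h3⟩
  · rintro ⟨c, hc, h⟩
    refine ⟨_, c 0, c 1, -c 2, fun h0 => hc ?_, isRel_iff_relVec.2 ?_, rfl⟩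
    · ext i
      fin_cases i
      · exact h0.1
      · exact h0.2.1
      · simpa using h0.2.2
    · intro l
      rw [← h l]
      refine Finset.sum_congr rfl fun i _ => ?_
      fin_cases i <;> simp

/-- Each term of the Leibniz expansion contains three theta products in `t`. The shifts `-2η, 2η, 0`
add up to zero, so the characteristic is the same for all permutations. -/
lemma relDet_isSec (hτ : 0 < τ.im) (p : Fin 3 → ℂ) :
    IsSec τ 3 (∑ i, p i - 3 * η) (relDet (m := m) τ η p) := by
  have h : ∀ g : Equiv.Perm (Fin 3), IsSec τ 3 (∑ i, p i - 3 * η) fun t : Fin m → ℂ =>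
      ((Equiv.Perm.sign g : ℤ) : ℂ) * ∏ i, relVec τ η m (tDiv η t) (p (g i)) i := by
    intro g
    refine IsSec.const_mul _ ?_
    have h1 := IsSec.prod (τ := τ) (m := m) (Finset.univ : Finset (Fin 3)) (fun i _ =>
      (divTheta_tDiv_isSec (η := η) (m := m) hτ (p (g i) + ![-(2 * η), 2 * η, 0] i)).const_mul
        (theta τ (p (g i) + ![2 * η * m, -(2 * η * m), 0] i)))
    refine h1.congr (by simp) ?_ fun t => rfl
    rw [Finset.sum_sub_distrib, Finset.sum_add_distrib, Equiv.sum_comp g p]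
    simp [Fin.sum_univ_three]
  refine (IsSec.sum Finset.univ fun g _ => h g).congr rfl rfl fun t => ?_
  rw [relDet, Matrix.det_apply']
  rfl

lemma isClosed_curve (hτ : 0 < τ.im) : IsClosed (curve τ η m) := by
  rw [← proj_isOpenQuotientMap.isQuotientMap.isClosed_preimage]
  have : proj τ ⁻¹' curve τ η m = ⋂ p, {t | relDet τ η p t = 0} := by
    ext t; simp [proj_mem_curve_iff_relDet]
  rw [this]
  exact isClosed_iInter fun p => isClosed_eq (relDet_isSec hτ p).diff.continuous continuous_const

/-! ### The covering map as a morphism -/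

lemma ratio_eq_of_cross {p q p' q' : ℂ} (h : (p, q) ≠ (0, 0)) (h' : (p', q') ≠ (0, 0))
    (e : p * q' = p' * q) : ratio p q = ratio p' q' := by
  unfold ratio
  by_cases hq : q = 0
  · subst hq
    have hp : p ≠ 0 := fun h0 => h (by rw [h0])
    have hq' : q' = 0 := (mul_eq_zero.1 (by rw [e, mul_zero] : p * q' = 0)).resolve_left hp
    simp [hq']
  · by_cases hq' : q' = 0
    · subst hq'
      have hp : p' ≠ 0 := fun h0 => h' (by rw [h0])
      rw [mul_zero] at e
      exact absurd ((mul_eq_zero.1 e.symm).resolve_left hp) hq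
    · rw [if_neg hq, if_neg hq', OnePoint.coe_eq_coe, div_eq_div_iff hq hq', e]

lemma continuousAt_ratio {X : Type*} [TopologicalSpace X] {p q : X → ℂ} {x : X} {s : Set X}
    (hp : ContinuousWithinAt p s x) (hq : ContinuousWithinAt q s x) (h : (p x, q x) ≠ (0, 0)) :
    ContinuousWithinAt (fun y => ratio (p y) (q y)) s x := by
  by_cases hq0 : q x = 0
  · have hp0 : p x ≠ 0 := fun h0 => h (by rw [h0, hq0])
    have hval : ratio (p x) (q x) = OnePoint.infty := by simp [ratio, hq0]
    rw [ContinuousWithinAt, hval, Filter.Tendsto, OnePoint.le_nhds_infty]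
    intro K _ hK
    obtain ⟨R, hR⟩ := hK.isBounded.exists_norm_le
    have h1 : Filter.Tendsto (fun y => ‖p y‖ - R * ‖q y‖) (𝓝[s] x) (𝓝 (‖p x‖ - R * ‖q x‖)) :=
      hp.norm.sub (hq.norm.const_mul R)
    rw [hq0, norm_zero, mul_zero, sub_zero] at h1
    rw [Filter.mem_map]
    filter_upwards [h1.eventually (lt_mem_nhds (norm_pos_iff.2 hp0))] with y hy
    by_cases hqy : q y = 0
    · right; simp [ratio, hqy]
    · left
      refine ⟨p y / q y, fun hK' => ?_, by simp [ratio, hqy]⟩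
      have h2 := hR _ hK'
      rw [norm_div, div_le_iff₀ (norm_pos_iff.2 hqy)] at h2
      linarith
  · have h1 : ContinuousWithinAt (fun y => ((p y / q y : ℂ) : OnePoint ℂ)) s x :=
      OnePoint.continuous_coe.continuousAt.comp_continuousWithinAt (hp.div hq hq0)
    refine h1.congr_of_eventuallyEq ?_ (by simp [ratio, hq0])
    filter_upwards [hq.eventually_ne hq0] with y hy
    simp [ratio, hy]

section

variable (hτ : 0 < τ.im) (hη : ∀ k : ℤ, k ≠ 0 → (k : ℂ) * η ∉ lattice τ) (hm : 0 < m)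
include hτ hη hm

omit hm in
lemma divTheta_neg_ne_zero_of_infDiv {A : Multiset ℂ} (h : divClass τ A = divClass τ (infDiv η m)) :
    divTheta τ A (-(2 * η)) ≠ 0 := by
  obtain ⟨C, c, hC, e⟩ := divTheta_congr h
  rw [e]
  refine mul_ne_zero (mul_ne_zero hC (exp_ne_zero _)) fun h0 => ?_
  obtain ⟨a, ha, hl⟩ := (divTheta_eq_zero_iff hτ _ _).1 h0
  obtain ⟨k, hk, rfl⟩ := Multiset.mem_map.1 ha
  have := two_eta_sub hη (i := -1) (j := (k + 1 : ℕ)) (by omega)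
  push_cast at this hl
  exact this (by rwa [mul_neg, mul_one])

/-- The coefficients are eliminated from special evaluations of the relation. Where `αβ ≠ 0`, the
points `±2ηm` give `γ²/(αβ)` directly. This denominator vanishes at infinity, where instead `l = 0`
gives the ratio `α : β`, and one further `l` brings in `γ`. -/
lemma exists_local_form {t₀ : Fin m → ℂ} (h₀ : proj τ t₀ ∈ curve τ η m) :
    ∃ n s p q, IsSec τ n s p ∧ IsSec τ n s q ∧ (p t₀, q t₀) ≠ (0, 0) ∧
      ∀ t : Fin m → ℂ, proj τ t ∈ curve τ η m → (p t, q t) ≠ (0, 0) →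
        curveMap τ η m (proj τ t) = ratio (p t) (q t) := by
  have hΘ := fun l => divTheta_tDiv_isSec (η := η) (m := m) hτ l
  have key : ∀ p q : (Fin m → ℂ) → ℂ, (∀ t α β γ, IsRel τ η m (tDiv η t) α β γ →
      γ ^ 2 * q t = p t * (α * β)) → ∀ t : Fin m → ℂ, proj τ t ∈ curve τ η m →
      (p t, q t) ≠ (0, 0) → curveMap τ η m (proj τ t) = ratio (p t) (q t) := by
    intro p q hpq t ht hne
    obtain ⟨α, β, γ, hne', h, h1⟩ := isValue_curveMap hτ hη hm ht
    rw [h1]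
    refine ratio_eq_of_cross (fun h0 => ?_) hne (hpq t α β γ h)
    rw [Prod.mk.injEq] at h0
    exact h.gamma_ne_zero hτ hne' h0.2 (pow_eq_zero_iff (by norm_num) |>.1 h0.1)
  obtain ⟨α, β, γ, hne, h, h1⟩ := isValue_curveMap hτ hη hm h₀
  have hθ : theta τ (2 * η * m) ≠ 0 := theta_int_ne hτ hη (k := m) (by omega) (by push_cast; ring)
  by_cases hαβ : α * β = 0
  · have hγ := h.gamma_ne_zero hτ hne hαβ
    set N : ℂ → (Fin m → ℂ) → ℂ := fun l t =>
      divTheta τ (tDiv η t) (2 * η) * (theta τ (l + 2 * η * m) * divTheta τ (tDiv η t) (l - 2 * η)) +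
      divTheta τ (tDiv η t) (-(2 * η)) *
        (theta τ (l - 2 * η * m) * divTheta τ (tDiv η t) (l + 2 * η)) with hN
    -- If `N` vanished for all `l`, then `(Θ(2η), Θ(-2η), 0)` would be a second nontrivial relation,
    -- not proportional to the given one, whose `γ` is nonzero.
    obtain ⟨l, hl⟩ : ∃ l, N l t₀ ≠ 0 := by
      by_contra! hall
      have hrel : IsRel τ η m (tDiv η t₀) (divTheta τ (tDiv η t₀) (2 * η))
          (divTheta τ (tDiv η t₀) (-(2 * η))) 0 := fun l => by
        have := hall l
        simp only [hN] at this
        rw [this, zero_mul]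
      have hnz : ¬(divTheta τ (tDiv η t₀) (2 * η) = 0 ∧
          divTheta τ (tDiv η t₀) (-(2 * η)) = 0 ∧ (0 : ℂ) = 0) := by
        rintro ⟨h2, h3, -⟩
        rcases mul_eq_zero.1 hαβ with rfl | rfl
        · exact divTheta_neg_ne_zero_of_infDiv hτ hη
            (h.divClass_eq_infDiv hτ hη hm (tDiv_card t₀) (by tauto)) h3
        · refine divTheta_neg_ne_zero_of_infDiv hτ hη
            (h.neg.divClass_eq_infDiv hτ hη hm (by simpa using tDiv_card t₀) (by tauto)) ?_
          rw [divTheta_map_neg, neg_neg, h2, mul_zero]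
      obtain ⟨s, hs, -, -, h4⟩ := h.proportional hτ hη hm hrel (tDiv_card t₀) hne hnz
      exact mul_ne_zero hs hγ h4.symm
    have hNs : IsSec τ 2 (l - 2 * η) (N l) :=
      (((hΘ (2 * η)).mul ((hΘ (l - 2 * η)).const_mul _)).congr rfl (by ring) fun _ => rfl).add
        (((hΘ (-(2 * η))).mul ((hΘ (l + 2 * η)).const_mul _)).congr rfl (by ring) fun _ => rfl)
    refine ⟨4, 2 * l - 4 * η, fun t => N l t * N l t, fun t => divTheta τ (tDiv η t) (2 * η) *
      divTheta τ (tDiv η t) (-(2 * η)) * ((theta τ l * divTheta τ (tDiv η t) l) *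
        (theta τ l * divTheta τ (tDiv η t) l)), (hNs.mul hNs).congr rfl (by ring) fun _ => rfl,
      (((hΘ (2 * η)).mul (hΘ (-(2 * η)))).mul (((hΘ l).const_mul _).mul
        ((hΘ l).const_mul _))).congr rfl (by ring) fun _ => rfl, ?_, key _ _ ?_⟩
    · intro h0
      rw [Prod.mk.injEq] at h0
      exact mul_ne_zero hl hl h0.1
    · intro t α β γ h
      have e1 : α * divTheta τ (tDiv η t) (-(2 * η)) = β * divTheta τ (tDiv η t) (2 * η) := by
        have := h 0
        rw [theta_zero, zero_add, zero_sub, zero_sub, zero_add, theta_neg] at this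
        refine mul_left_cancel₀ hθ ?_
        linear_combination this
      have e2 := h l
      have e3 : α * N l t = divTheta τ (tDiv η t) (2 * η) *
          (γ * (theta τ l * divTheta τ (tDiv η t) l)) := by
        simp only [hN]
        linear_combination divTheta τ (tDiv η t) (2 * η) * e2 +
          (theta τ (l - 2 * η * m) * divTheta τ (tDiv η t) (l + 2 * η)) * e1
      have e4 : β * N l t = divTheta τ (tDiv η t) (-(2 * η)) *
          (γ * (theta τ l * divTheta τ (tDiv η t) l)) := by
        simp only [hN]
        linear_combination divTheta τ (tDiv η t) (-(2 * η)) * e2 -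
          (theta τ (l + 2 * η * m) * divTheta τ (tDiv η t) (l - 2 * η)) * e1
      linear_combination -(β * N l t) * e3 - divTheta τ (tDiv η t) (2 * η) *
          (γ * (theta τ l * divTheta τ (tDiv η t) l)) * e4
  · have hα := left_ne_zero_of_mul hαβ
    have hβ := right_ne_zero_of_mul hαβ
    set x := 2 * η * m - 2 * η with hx
    refine ⟨2, -(2 * η), fun t => (theta τ (4 * η * m) * divTheta τ (tDiv η t) x) *
      (theta τ (4 * η * m) * divTheta τ (tDiv η t) (-x)),
      fun t => (theta τ (2 * η * m) * divTheta τ (tDiv η t) (2 * η * m)) *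
        (theta τ (2 * η * m) * divTheta τ (tDiv η t) (-(2 * η * m))),
      (((hΘ x).const_mul _).mul ((hΘ (-x)).const_mul _)).congr rfl (by ring) fun _ => rfl,
      (((hΘ (2 * η * m)).const_mul _).mul ((hΘ (-(2 * η * m))).const_mul _)).congr rfl (by ring)
        fun _ => rfl, ?_, key _ _ ?_⟩
    · intro h0
      rw [Prod.mk.injEq] at h0
      exact mul_ne_zero (mul_ne_zero hθ ((h.alpha_ne_zero_iff hτ hη hm (tDiv_card t₀) hne).1 hα))
        (mul_ne_zero hθ ((h.beta_ne_zero_iff hτ hη hm (tDiv_card t₀) hne).1 hβ)) h0.2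
    · intro t α β γ h
      have e1 := h (2 * η * m)
      rw [sub_self, theta_zero, ← hx, show 2 * η * m + 2 * η * m = 4 * η * m by ring] at e1
      have e2 := h (-(2 * η * m))
      rw [neg_add_cancel, theta_zero, show -(2 * η * m) + 2 * η = -x by rw [hx]; ring,
        show -(2 * η * m) - 2 * η * m = -(4 * η * m) by ring, theta_neg, theta_neg] at e2
      linear_combination -(β * (theta τ (4 * η * m) * divTheta τ (tDiv η t) (-x))) * e1 +
        (γ * (theta τ (2 * η * m) * divTheta τ (tDiv η t) (2 * η * m))) * e2

lemma isMorphism_curveMap : IsMorphism τ (curve τ η m) (curveMap τ η m) := by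
  intro t₀ h₀
  obtain ⟨n, s, p, q, hp, hq, hne, h⟩ := exists_local_form hτ hη hm h₀
  exact ⟨_, _, _, p, q, hp.isSection, hq.isSection, hne, h⟩

/-! ### The double covering of the Riemann sphere -/

/-- The restriction of the covering map to the curve. -/
def curveProj (τ η : ℂ) (m : ℕ) (y : curve τ η m) : OnePoint ℂ := curveMap τ η m y

omit hτ hη hm in
lemma isOpenQuotientMap_restrict : IsOpenQuotientMap
    ((curve τ η m).restrictPreimage (proj τ (m := m))) :=
  ⟨Set.restrictPreimage_surjective _ proj_surjective,
    proj_isOpenQuotientMap.continuous.restrictPreimage,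
    proj_isOpenQuotientMap.isOpenMap.restrictPreimage _⟩

lemma continuous_curveProj : Continuous (curveProj τ η m) := by
  rw [← (isOpenQuotientMap_restrict).continuous_comp_iff]
  show Continuous ((proj τ ⁻¹' curve τ η m).domRestrict fun t => curveMap τ η m (proj τ t))
  rw [← continuousOn_iff_continuous_domRestrict]
  intro t₀ h₀
  obtain ⟨n, s, p, q, hp, hq, hne, h⟩ := exists_local_form hτ hη hm h₀
  have hp' := hp.diff.continuous
  have hq' := hq.diff.continuous
  refine (continuousAt_ratio (s := proj τ ⁻¹' curve τ η m) hp'.continuousWithinAt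
    hq'.continuousWithinAt hne).congr_of_eventuallyEq ?_ (h t₀ h₀ hne)
  have hopen : IsOpen {t | (p t, q t) ≠ (0, 0)} :=
    isOpen_ne_fun (hp'.prodMk hq') continuous_const
  filter_upwards [self_mem_nhdsWithin, mem_nhdsWithin_of_mem_nhds (hopen.mem_nhds hne)]
    with t ht ht' using h t ht ht'

omit hη hm in
lemma compactSpace_curve : CompactSpace (curve τ η m) :=
  have := compactSpace_symEll (m := m) hτ
  isCompact_iff_compactSpace.1 (isClosed_curve hτ).isCompact

lemma isClosedMap_curveProj : IsClosedMap (curveProj τ η m) :=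
  have := compactSpace_curve (η := η) (m := m) hτ
  (continuous_curveProj hτ hη hm).isClosedMap

/-- The image is closed by compactness. It contains infinity and the squares of all regular `e`,
which are dense. -/
lemma surjective_curveProj : Function.Surjective (curveProj τ η m) := by
  have hex : ∀ {z}, (∃ A : Multiset ℂ, A.card = m ∧ IsValue τ η m A z) →
      z ∈ Set.range (curveProj τ η m) := by
    rintro z ⟨A, hA, hz⟩
    obtain ⟨t, rfl⟩ := exists_tDiv (η := η) A hA
    exact ⟨⟨proj τ t, t, z, rfl, hz⟩, curveMap_eq hτ hη hm hz⟩
  have hcl : IsClosed (Set.range (curveProj τ η m)) := by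
    rw [← Set.image_univ]; exact isClosedMap_curveProj hτ hη hm _ isClosed_univ
  intro z
  induction z using OnePoint.rec with
  | infty => exact hex ⟨infDiv η m, infDiv_card, infDiv_isValue⟩
  | coe z =>
    obtain ⟨e, rfl⟩ := IsAlgClosed.exists_pow_nat_eq z (n := 2) (by norm_num)
    have hdense : Dense {e | ¬ IsRegular τ η m e}ᶜ :=
      (finite_not_isRegular hτ hη hm).countable.dense_compl ℂ
    have hc : Continuous fun e : ℂ => ((e ^ 2 : ℂ) : OnePoint ℂ) :=
      OnePoint.continuous_coe.comp (by fun_prop)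
    refine (hcl.preimage hc).closure_subset_iff.2 (fun x hx => ?_) (hdense e)
    exact hex (exists_isValue hτ hη hm (not_not.1 hx))

omit hτ hη hm in
lemma continuous_reflection : Continuous (reflection τ η m) := by
  rw [← proj_isOpenQuotientMap.continuous_comp_iff]
  have : reflection τ η m ∘ proj τ = fun t => proj τ fun j => 2 * η - t j :=
    funext fun t => (proj_reflect t).symm
  rw [this]
  exact proj_isOpenQuotientMap.continuous.comp (by fun_prop)

/-- The reflection of the curve. -/
def curveRefl (y : curve τ η m) : curve τ η m :=
  ⟨reflection τ η m y, (reflection_mem_curve hτ hη hm y.2).1⟩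

lemma continuous_curveRefl : Continuous (curveRefl hτ hη hm) :=
  (continuous_reflection.comp continuous_subtype_val).subtype_mk _

lemma curveProj_curveRefl (y : curve τ η m) :
    curveProj τ η m (curveRefl hτ hη hm y) = curveProj τ η m y :=
  (reflection_mem_curve hτ hη hm y.2).2

lemma curveProj_eq_iff (y z : curve τ η m) :
    curveProj τ η m z = curveProj τ η m y ↔ z = y ∨ z = curveRefl hτ hη hm y := by
  constructor
  · intro h
    rcases eq_or_eq_reflection hτ hη hm y.2 z.2 h with h | h
    · exact Or.inl (Subtype.ext h)
    · exact Or.inr (Subtype.ext h)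
  · rintro (rfl | rfl)
    · rfl
    · exact curveProj_curveRefl hτ hη hm y

/-- A continuous closed surjection is a quotient map, and by the fibre description the saturation of
`U` is `U` together with its reflection. -/
lemma isOpenMap_curveProj : IsOpenMap (curveProj τ η m) := by
  intro U hU
  have hq := (isClosedMap_curveProj hτ hη hm).isQuotientMap (continuous_curveProj hτ hη hm)
    (surjective_curveProj hτ hη hm)
  rw [← hq.isOpen_preimage]
  have : curveProj τ η m ⁻¹' (curveProj τ η m '' U) = U ∪ curveRefl hτ hη hm ⁻¹' U := by
    ext z
    simp only [Set.mem_preimage, Set.mem_image, Set.mem_union]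
    constructor
    · rintro ⟨y, hy, h⟩
      rcases (curveProj_eq_iff hτ hη hm z y).1 h with rfl | rfl
      · exact Or.inl hy
      · exact Or.inr hy
    · rintro (h | h)
      · exact ⟨z, h, rfl⟩
      · exact ⟨_, h, curveProj_curveRefl hτ hη hm z⟩
  rw [this]
  exact hU.union (hU.preimage (continuous_curveRefl hτ hη hm))

lemma curveRefl_ne {y : curve τ η m} (h : curveProj τ η m y ∉ branchSet τ η m) :
    curveRefl hτ hη hm y ≠ y :=
  fun h0 => h ⟨y, y.2, rfl, congrArg Subtype.val h0⟩

lemma fiber_eq (y : curve τ η m) :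
    curveProj τ η m ⁻¹' {curveProj τ η m y} = {y, curveRefl hτ hη hm y} := by
  ext z
  simp only [Set.mem_preimage, Set.mem_singleton_iff, Set.mem_insert_iff]
  exact curveProj_eq_iff hτ hη hm y z

lemma isTwoFoldRamifiedCovering_curveProj :
    IsTwoFoldRamifiedCovering (curveProj τ η m) (branchSet τ η m) := by
  have := compactSpace_curve (η := η) (m := m) hτ
  have := t2Space_symEll (m := m) hτ
  have hc := continuous_curveProj hτ hη hm
  have hs := surjective_curveProj hτ hη hm
  refine ⟨hc, hs, finite_branchSet hτ hη hm, ?_, ?_, fun z hz => ?_, fun z hz => ?_⟩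
  · obtain ⟨y, hy⟩ := hs ((0 : ℂ) : OnePoint ℂ)
    exact ⟨_, zero_mem_branchSet hτ hη hm y.2 hy⟩
  · refine IsCoveringMapOn.of_isLocalHomeomorphOn hc ?_
    rw [isLocalHomeomorphOn_iff_isOpenEmbedding_restrict]
    intro y hy
    -- A neighbourhood of `y` disjoint from its own reflection meets each fibre at most once. Being
    -- open and continuous, the map is a homeomorphism onto its image there.
    obtain ⟨U, V, hU, hV, hyU, hyV, hUV⟩ := t2_separation (curveRefl_ne hτ hη hm hy).symm
    have hW : IsOpen (U ∩ curveRefl hτ hη hm ⁻¹' V) :=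
      hU.inter (hV.preimage (continuous_curveRefl hτ hη hm))
    refine ⟨_, hW.mem_nhds ⟨hyU, hyV⟩, .of_continuous_injective_isOpenMap
      (hc.comp continuous_subtype_val) ?_
      ((isOpenMap_curveProj hτ hη hm).domRestrict hW)⟩
    rintro ⟨a, ha⟩ ⟨b, hb⟩ hab
    rcases (curveProj_eq_iff hτ hη hm b a).1 hab with h | h
    · exact Subtype.ext h
    · exact absurd hb.2 fun hbV => Set.disjoint_left.1 hUV ha.1 (by rw [h]; exact hbV)
  · obtain ⟨y, rfl⟩ := hs z
    rw [fiber_eq hτ hη hm]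
    exact Set.ncard_pair (curveRefl_ne hτ hη hm hz).symm
  · obtain ⟨y, rfl⟩ := hs z
    have : curveRefl hτ hη hm y = y :=
      Subtype.ext (reflection_eq_of_mem_branchSet hτ hη hm y.2 hz)
    rw [fiber_eq hτ hη hm, this]
    simp

end

end

section

variable {τ η : ℂ} {m : ℕ}

/-! ### Even theta functions as polynomials -/

/-- The linear polynomial representing `evenTheta τ c` in the coordinate
`evenTheta τ 0 / evenTheta τ p`. -/
def evenLin (τ p c : ℂ) : Polynomial ℂ :=
  Polynomial.C (evenTheta τ c p / evenTheta τ 0 p) * Polynomial.X +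
    Polynomial.C (evenTheta τ c 0 / evenTheta τ p 0)

section

variable (hτ : 0 < τ.im) {p : ℂ} (hp : 2 * p ∉ lattice τ)
include hτ hp

omit hτ in
lemma notMem_of_two_mul : p ∉ lattice τ := fun h => hp (by
  rw [two_mul]; exact add_mem h h)

lemma evenTheta_zero_ne : evenTheta τ 0 p ≠ 0 :=
  evenTheta_ne_zero hτ (by simpa using notMem_of_two_mul hp) (by simpa using notMem_of_two_mul hp)

lemma evenTheta_at_zero_ne : evenTheta τ p 0 ≠ 0 :=
  evenTheta_ne_zero hτ (by simpa using notMem_of_two_mul hp) (by simpa using notMem_of_two_mul hp)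

/-- Even theta functions of degree two are spanned by `evenTheta τ 0` and `evenTheta τ p`: the
difference from the interpolating combination vanishes at `0, p, -p`, one zero too many. -/
lemma evenTheta_eq_evenLin (c : ℂ) {l X : ℂ} (h : evenTheta τ 0 l = X * evenTheta τ p l) :
    evenTheta τ c l = evenTheta τ p l * (evenLin τ p c).eval X := by
  have h1 := evenTheta_zero_ne hτ hp
  have h2 := evenTheta_at_zero_ne hτ hp
  have h3 : ∀ l, evenTheta τ c l - (evenTheta τ c p / evenTheta τ 0 p * evenTheta τ 0 l +
      evenTheta τ c 0 / evenTheta τ p 0 * evenTheta τ p l) = 0 := by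
    have := ((evenTheta_isTheta hτ c).sub (((evenTheta_isTheta hτ 0).const_mul _).add
      ((evenTheta_isTheta hτ p).const_mul _))).eq_zero_of_zeros hτ ![0, p, -p] Finset.univ
        (by simp) ?_ ?_ (f := fun l => evenTheta τ c l - (evenTheta τ c p / evenTheta τ 0 p *
          evenTheta τ 0 l + evenTheta τ c 0 / evenTheta τ p 0 * evenTheta τ p l))
    · exact congrFun this
    · have := notMem_of_two_mul hp
      have h4 : p + p ∉ lattice τ := by rwa [← two_mul]
      have h5 : -p - p ∉ lattice τ := fun h => h4 (by simpa using neg_mem h)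
      intro i _ j _ hij
      fin_cases i <;> fin_cases j <;> simp_all
    · intro i _
      fin_cases i
      · simp [evenTheta_self, h2]
      · simp [evenTheta_self, h1]
      · simp [evenTheta_self, evenTheta_neg, h1]
  have := h3 l
  rw [h] at this
  simp only [evenLin, Polynomial.eval_add, Polynomial.eval_mul, Polynomial.eval_C,
    Polynomial.eval_X]
  linear_combination this

lemma exists_coordinate (X : ℂ) :
    ∃ l, evenTheta τ p l ≠ 0 ∧ evenTheta τ 0 l = X * evenTheta τ p l := by
  obtain ⟨l, hl⟩ := IsTheta.exists_zero (n := 1) hτ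
    ((evenTheta_isTheta hτ 0).sub ((evenTheta_isTheta hτ p).const_mul X))
  have hl' := sub_eq_zero.1 hl
  refine ⟨l, fun h0 => ?_, hl'⟩
  rw [h0, mul_zero] at hl'
  have hmem : l ∈ lattice τ := by
    by_contra hmem
    exact evenTheta_ne_zero hτ (by simpa using hmem) (by simpa using hmem) hl'
  exact evenTheta_at_zero_ne hτ hp
    ((evenTheta_isTheta hτ p).zero_of_sub_mem h0 (by simpa using neg_mem hmem))

lemma eval_evenLin_eq_zero {a b X : ℂ} (hb : evenTheta τ p b ≠ 0)
    (hX : evenTheta τ 0 b = X * evenTheta τ p b) :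
    (evenLin τ p a).eval X = 0 ↔ evenTheta τ a b = 0 := by
  rw [evenTheta_eq_evenLin hτ hp a hX]
  simp [hb]

end

variable (τ η m)

/-- The polynomial representing `qFun τ η m e`, as a polynomial in `e`. -/
def qBiPoly : Polynomial (Polynomial ℂ) :=
  ∑ k ∈ Finset.range (m + 1), Polynomial.C ((Classical.choose (pVal_isPoly (τ := τ) (η := η)
      (m := m) k)) ^ 2) *
    ∏ j ∈ (Finset.range (m + 1)).erase k, Polynomial.map Polynomial.C
      (Polynomial.C (evenTheta τ (2 * η * j) (2 * η * k))⁻¹ *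
        evenLin τ (2 * η * m) (2 * η * j))

/-- The polynomial representing `qFun τ η m e`. -/
def qPoly (e : ℂ) : Polynomial ℂ := (qBiPoly τ η m).map (Polynomial.evalRingHom e)

/-- The discriminant of `qPoly τ η m e`, as a polynomial in `e`. -/
def qDisc : Polynomial ℂ := Polynomial.resultant (qBiPoly τ η m) (qBiPoly τ η m).derivative m (m - 1)

variable {τ η m}

lemma qPoly_eq (e : ℂ) : qPoly τ η m e = ∑ k ∈ Finset.range (m + 1),
    Polynomial.C (pVal τ η m e k ^ 2) * ∏ j ∈ (Finset.range (m + 1)).erase k,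
      (Polynomial.C (evenTheta τ (2 * η * j) (2 * η * k))⁻¹ *
        evenLin τ (2 * η * m) (2 * η * j)) := by
  have hmap : ∀ f : Polynomial ℂ,
      (f.map Polynomial.C).map (Polynomial.evalRingHom e) = f := fun f => by
    rw [Polynomial.map_map]
    have : (Polynomial.evalRingHom e).comp Polynomial.C = RingHom.id ℂ :=
      RingHom.ext fun x => by simp
    rw [this, Polynomial.map_id]
  rw [qPoly, qBiPoly, Polynomial.map_sum]
  refine Finset.sum_congr rfl fun k _ => ?_
  rw [Polynomial.map_mul, Polynomial.map_prod, Polynomial.map_C]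
  congr 2
  · rw [map_pow, Polynomial.coe_evalRingHom,
      ← Classical.choose_spec (pVal_isPoly (τ := τ) (η := η) (m := m) k) e]
  · exact funext fun j => hmap _

/-- With the formal degrees fixed at `m` and `m - 1`, the resultant commutes with specialization of
`e`, even where the actual degree drops. -/
lemma eval_qDisc (e : ℂ) : (qDisc τ η m).eval e =
    Polynomial.resultant (qPoly τ η m e) (qPoly τ η m e).derivative m (m - 1) := by
  rw [qPoly, Polynomial.derivative_map, Polynomial.resultant_map_map]
  rfl

lemma natDegree_evenLin_le (p c : ℂ) : (evenLin τ p c).natDegree ≤ 1 :=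
  Polynomial.natDegree_linear_le

lemma natDegree_qPoly_le (e : ℂ) : (qPoly τ η m e).natDegree ≤ m := by
  rw [qPoly_eq]
  refine Polynomial.natDegree_sum_le_of_forall_le _ _ fun k hk => ?_
  refine (Polynomial.natDegree_C_mul_le _ _).trans ((Polynomial.natDegree_prod_le _ _).trans ?_)
  refine (Finset.sum_le_card_nsmul _ _ 1 fun j _ =>
    (Polynomial.natDegree_C_mul_le _ _).trans (natDegree_evenLin_le _ _)).trans ?_
  rw [Finset.card_erase_of_mem hk]
  simp

section

variable (hτ : 0 < τ.im) (hη : ∀ k : ℤ, k ≠ 0 → (k : ℂ) * η ∉ lattice τ) (hm : 0 < m)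
include hτ hη hm

omit hτ in
lemma two_mul_top_notMem : 2 * (2 * η * m) ∉ lattice τ := by
  have := two_eta_sub hη (i := 2 * m) (j := 0) (by omega)
  rwa [show 2 * (2 * η * m) = 2 * η * ((2 * m : ℤ) : ℂ) - 2 * η * ((0 : ℤ) : ℂ) by
    push_cast; ring]

lemma qFun_eq_qPoly (e : ℂ) {l X : ℂ} (h : evenTheta τ 0 l = X * evenTheta τ (2 * η * m) l) :
    qFun τ η m e l = evenTheta τ (2 * η * m) l ^ m * (qPoly τ η m e).eval X := by
  rw [qFun, qPoly_eq, Polynomial.eval_finsetSum, Finset.mul_sum]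
  refine Finset.sum_congr rfl fun k hk => ?_
  rw [Polynomial.eval_mul, Polynomial.eval_C, Polynomial.eval_prod, lagrange, mul_left_comm]
  congr 1
  have hcard : ((Finset.range (m + 1)).erase k).card = m := by
    rw [Finset.card_erase_of_mem hk]; simp
  have hpow : evenTheta τ (2 * η * m) l ^ m =
      ∏ _j ∈ (Finset.range (m + 1)).erase k, evenTheta τ (2 * η * m) l := by
    rw [Finset.prod_const, hcard]
  rw [hpow, ← Finset.prod_mul_distrib]
  refine Finset.prod_congr rfl fun j _ => ?_
  rw [evenTheta_eq_evenLin hτ (two_mul_top_notMem hη hm) _ h, Polynomial.eval_mul,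
    Polynomial.eval_C]
  ring

lemma qPoly_eq_prod {e : ℂ} {t : Fin m → ℂ} {C : ℂ}
    (h : ∀ l, qFun τ η m e l = C * ∏ j, evenTheta τ (η - t j) l) :
    qPoly τ η m e = Polynomial.C C * ∏ j, evenLin τ (2 * η * m) (η - t j) := by
  refine Polynomial.funext fun X => ?_
  have hp := two_mul_top_notMem hη hm
  obtain ⟨l, hl, hX⟩ := exists_coordinate hτ hp X
  have h1 := h l
  rw [qFun_eq_qPoly hτ hη hm e hX, Finset.prod_congr rfl fun j _ =>
    evenTheta_eq_evenLin hτ hp (η - t j) hX, Finset.prod_mul_distrib, Finset.prod_const,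
    Finset.card_univ, Fintype.card_fin] at h1
  refine mul_left_cancel₀ (pow_ne_zero m hl) ?_
  rw [h1, Polynomial.eval_mul, Polynomial.eval_C, Polynomial.eval_prod]
  ring

lemma IsEigen.qFun_eq {e : ℂ} {t : Fin m → ℂ} {ψ : ℂ → ℂ} (h : IsEigen τ η m e (tDiv η t) ψ) :
    ∃ C : ℂ, C ≠ 0 ∧ ∀ l, qFun τ η m e l = C * (divTheta τ (tDiv η t) l *
      divTheta τ (tDiv η t) (-l)) := by
  obtain ⟨C, c, hC, hψ⟩ := h.form
  refine ⟨C * C, mul_ne_zero hC hC, fun l => ?_⟩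
  rw [← h.mul_neg_eq hτ hη hm, hψ, hψ]
  have : exp (c * l) * exp (c * -l) = 1 := by rw [← exp_add]; simp
  linear_combination (C * C * (divTheta τ (tDiv η t) l * divTheta τ (tDiv η t) (-l))) * this

omit hτ hη hm in
lemma divTheta_mul_neg (t : Fin m → ℂ) (l : ℂ) : divTheta τ (tDiv η t) l *
    divTheta τ (tDiv η t) (-l) = (-1) ^ m * ∏ j, evenTheta τ (η - t j) l := by
  rw [divTheta_tDiv, divTheta_tDiv, ← Finset.prod_mul_distrib]
  have : (-1 : ℂ) ^ m = ∏ _j : Fin m, (-1 : ℂ) := by simp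
  rw [this, ← Finset.prod_mul_distrib]
  refine Finset.prod_congr rfl fun j _ => ?_
  rw [evenTheta, show -l + t j - η = -(l + (η - t j)) by ring, theta_neg,
    show l - (η - t j) = l + t j - η by ring]
  ring

lemma IsEigen.qPoly_eq_prod {e : ℂ} {t : Fin m → ℂ} {ψ : ℂ → ℂ}
    (h : IsEigen τ η m e (tDiv η t) ψ) : ∃ C : ℂ, C ≠ 0 ∧
      qPoly τ η m e = Polynomial.C C * ∏ j, evenLin τ (2 * η * m) (η - t j) := by
  obtain ⟨C, hC, h1⟩ := h.qFun_eq hτ hη hm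
  refine ⟨C * (-1) ^ m, mul_ne_zero hC (by simp), HermiteBethe.qPoly_eq_prod hτ hη hm fun l => ?_⟩
  rw [h1, divTheta_mul_neg]
  ring

/-- Since `q(2ηm) = 1`, no factor of `q` vanishes there. Hence no zero of `q` escapes to infinity in
the coordinate `evenTheta τ 0 / evenTheta τ (2ηm)`. -/
lemma IsEigen.evenTheta_top_ne {e : ℂ} {t : Fin m → ℂ} {ψ : ℂ → ℂ}
    (h : IsEigen τ η m e (tDiv η t) ψ) (j : Fin m) :
    evenTheta τ (2 * η * m) (η - t j) ≠ 0 ∧ evenTheta τ (η - t j) (2 * η * m) ≠ 0 := by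
  obtain ⟨C, hC, h1⟩ := h.qFun_eq hτ hη hm
  have h2 := h1 (2 * η * m)
  rw [qFun_top hτ hη, divTheta_mul_neg] at h2
  have h3 : evenTheta τ (η - t j) (2 * η * m) ≠ 0 := fun h0 => by
    rw [Finset.prod_eq_zero (Finset.mem_univ j) h0] at h2
    simp at h2
  refine ⟨fun h0 => h3 ?_, h3⟩
  rw [evenTheta] at h0 ⊢
  rw [← neg_sub, theta_neg, add_comm (2 * η * m)]
  linear_combination -h0

/-- The zeros of an eigenfunction with nonvanishing discriminant are simple, and no two of them
are opposite. -/
lemma IsEigen.distinct {e : ℂ} {t : Fin m → ℂ} {ψ : ℂ → ℂ} (he : (qDisc τ η m).eval e ≠ 0)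
    (h : IsEigen τ η m e (tDiv η t) ψ) {i j : Fin m} (hij : i ≠ j) :
    evenTheta τ (η - t i) (η - t j) ≠ 0 := by
  intro h0
  have hp := two_mul_top_notMem hη hm
  obtain ⟨C, hC, h1⟩ := h.qPoly_eq_prod hτ hη hm
  obtain ⟨h2, -⟩ := h.evenTheta_top_ne hτ hη hm j
  set b := η - t j with hb
  set X := evenTheta τ 0 b / evenTheta τ (2 * η * m) b with hX
  have hX' : evenTheta τ 0 b = X * evenTheta τ (2 * η * m) b := by rw [hX, div_mul_cancel₀ _ h2]
  have hi := (eval_evenLin_eq_zero hτ hp (a := η - t i) h2 hX').2 h0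
  have hj := (eval_evenLin_eq_zero hτ hp (a := b) h2 hX').2 (evenTheta_self _)
  rw [eval_qDisc] at he
  -- The resultant is a combination of the polynomial and its derivative. Both vanish at `X`, where
  -- two of the linear factors have a common root.
  obtain ⟨u, v, -, -, huv⟩ := Polynomial.exists_mul_add_mul_eq_C_resultant (m := m) (n := m - 1)
    (qPoly τ η m e) (qPoly τ η m e).derivative (natDegree_qPoly_le e)
    ((Polynomial.natDegree_derivative_le _).trans (Nat.sub_le_sub_right (natDegree_qPoly_le e) 1))
    (Or.inl hm.ne')
  apply he
  have h3 := congrArg (Polynomial.eval X) huv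
  rw [Polynomial.eval_C] at h3
  rw [← h3, h1, ← Finset.mul_prod_erase _ _ (Finset.mem_univ j),
    ← Finset.mul_prod_erase _ _ (Finset.mem_erase.2 ⟨hij, Finset.mem_univ i⟩)]
  simp only [Polynomial.derivative_mul, Polynomial.eval_add, Polynomial.eval_mul, ← hb, hi, hj]
  ring

/-- Pairwise distinct roots make the polynomial separable, and since none lies at infinity its
degree is exactly `m`; the formal resultant is then the actual one. -/
lemma IsEigen.qDisc_ne_zero {e : ℂ} {t : Fin m → ℂ} {ψ : ℂ → ℂ}
    (h : IsEigen τ η m e (tDiv η t) ψ)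
    (hd : ∀ i j, i ≠ j → evenTheta τ (η - t i) (η - t j) ≠ 0) : (qDisc τ η m).eval e ≠ 0 := by
  have hp := two_mul_top_notMem hη hm
  obtain ⟨C, hC, h1⟩ := h.qPoly_eq_prod hτ hη hm
  have hu : ∀ j, evenTheta τ (η - t j) (2 * η * m) / evenTheta τ 0 (2 * η * m) ≠ 0 := fun j =>
    div_ne_zero (h.evenTheta_top_ne hτ hη hm j).2 (evenTheta_zero_ne hτ hp)
  set u : Fin m → ℂ := fun j => evenTheta τ (η - t j) (2 * η * m) / evenTheta τ 0 (2 * η * m)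
  set r : Fin m → ℂ := fun j => -(evenTheta τ (η - t j) 0 / evenTheta τ (2 * η * m) 0) / u j with hr
  have hlin : ∀ j, evenLin τ (2 * η * m) (η - t j) =
      Polynomial.C (u j) * (Polynomial.X - Polynomial.C (r j)) := fun j => by
    rw [mul_sub, ← Polynomial.C_mul, hr, mul_div_cancel₀ _ (hu j), Polynomial.C_neg, sub_neg_eq_add]
    rfl
  have h2 : qPoly τ η m e = Polynomial.C (C * ∏ j, u j) *
      ∏ j, (Polynomial.X - Polynomial.C (r j)) := by
    rw [h1, Finset.prod_congr rfl fun j _ => hlin j, Finset.prod_mul_distrib, Polynomial.C_mul,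
      map_prod, ← mul_assoc]
  have hC' : C * ∏ j, u j ≠ 0 := mul_ne_zero hC (Finset.prod_ne_zero_iff.2 fun j _ => hu j)
  have hsep : (qPoly τ η m e).Separable := by
    rw [h2]
    refine Polynomial.Separable.unit_mul (Polynomial.isUnit_C.2 hC'.isUnit)
      (Polynomial.separable_prod_X_sub_C_iff.2 fun i j hij => ?_)
    by_contra hne
    obtain ⟨h3, -⟩ := h.evenTheta_top_ne hτ hη hm j
    set X := evenTheta τ 0 (η - t j) / evenTheta τ (2 * η * m) (η - t j) with hX
    have hX' : evenTheta τ 0 (η - t j) = X * evenTheta τ (2 * η * m) (η - t j) := by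
      rw [hX, div_mul_cancel₀ _ h3]
    have h4 := (eval_evenLin_eq_zero hτ hp (a := η - t j) h3 hX').2 (evenTheta_self _)
    refine hd i j hne ((eval_evenLin_eq_zero hτ hp (a := η - t i) h3 hX').1 ?_)
    rw [hlin] at h4 ⊢
    simp only [Polynomial.eval_mul, Polynomial.eval_sub, Polynomial.eval_C, Polynomial.eval_X] at h4 ⊢
    rw [hij, (mul_eq_zero.1 h4).resolve_left (hu j), mul_zero]
  have hdeg : (qPoly τ η m e).natDegree = m := by
    rw [h2, Polynomial.natDegree_C_mul hC', Polynomial.natDegree_finsetProd_X_sub_C_eq_card]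
    simp
  rw [eval_qDisc]
  intro h0
  have h3 : Polynomial.resultant (qPoly τ η m e) (qPoly τ η m e).derivative = 0 := by
    rw [Polynomial.natDegree_derivative, hdeg]; exact h0
  exact (Polynomial.resultant_eq_zero_iff.1 h3).2 hsep

end

end

section

variable {τ η : ℂ} {m : ℕ}

/-! ### Generic points of the base -/

/-- The standard point of the curve over infinity. -/
def infPoint (η : ℂ) (m : ℕ) (i : Fin m) : ℂ := η - 2 * η * ((i + 1 : ℕ) : ℂ)

lemma tDiv_infPoint : tDiv η (infPoint η m) = infDiv η m := by
  have h : Finset.range m = (Finset.univ : Finset (Fin m)).map Fin.valEmbedding := by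
    ext k; simp
  rw [infDiv, h, tDiv, Finset.map_val, Multiset.map_map]
  refine Multiset.map_congr rfl fun i _ => ?_
  simp [infPoint]

/-- `e` is regular and the discriminant of `qPoly τ η m e` does not vanish. -/
def IsGeneric (τ η : ℂ) (m : ℕ) (e : ℂ) : Prop :=
  IsRegular τ η m e ∧ (qDisc τ η m).eval e ≠ 0

section

variable (hτ : 0 < τ.im) (hη : ∀ k : ℤ, k ≠ 0 → (k : ℂ) * η ∉ lattice τ) (hm : 0 < m)
include hτ hη hm

/-- Openness of the covering map, lifted to `ℂ^m`: a value near `z₀` is attained at some `t` near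
`t₀`. This serves to transport open conditions and continuity between curve and base. -/
lemma eventually_exists_isValue {O : Set (Fin m → ℂ)} {t₀ : Fin m → ℂ} (hO : O ∈ 𝓝 t₀)
    {z₀ : OnePoint ℂ} (h : IsValue τ η m (tDiv η t₀) z₀) :
    ∀ᶠ z in 𝓝 z₀, ∃ t ∈ O, IsValue τ η m (tDiv η t) z := by
  have hopen := (isOpenMap_curveProj hτ hη hm).comp
    (isOpenQuotientMap_restrict (m := m)).isOpenMap
  have h₀ : proj τ t₀ ∈ curve τ η m := proj_mem_curve.2 ⟨z₀, h⟩
  have h1 := hopen.image_mem_nhds (x := ⟨t₀, h₀⟩) (continuous_subtype_val.continuousAt hO)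
  have h2 : curveProj τ η m ((curve τ η m).restrictPreimage (proj τ) ⟨t₀, h₀⟩) = z₀ :=
    curveMap_eq hτ hη hm h
  rw [Function.comp_apply, h2] at h1
  filter_upwards [h1]
  rintro z ⟨⟨t, ht⟩, htO, rfl⟩
  exact ⟨t, htO, isValue_curveMap hτ hη hm ht⟩

omit hτ hη hm in
lemma infPoint_isValue : IsValue τ η m (tDiv η (infPoint η m)) OnePoint.infty := by
  rw [tDiv_infPoint]; exact infDiv_isValue

omit hτ hη hm in
lemma tendsto_sq_cocompact : Filter.Tendsto (fun e : ℂ => ((e ^ 2 : ℂ) : OnePoint ℂ))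
    (Filter.cocompact ℂ) (𝓝 OnePoint.infty) := by
  have h1 := OnePoint.tendsto_coe_infty (X := ℂ)
  rw [Filter.coclosedCompact_eq_cocompact] at h1
  refine h1.comp ?_
  rw [← Metric.cobounded_eq_cocompact, ← tendsto_norm_atTop_iff_cobounded]
  simp only [norm_pow]
  exact (Filter.tendsto_pow_atTop two_ne_zero).comp tendsto_norm_cobounded_atTop

omit hm in
lemma evenTheta_infPoint_ne {i j : Fin m} (hij : i ≠ j) :
    evenTheta τ (η - infPoint η m i) (η - infPoint η m j) ≠ 0 := by
  have h1 := two_eta_sub hη (i := (j + 1 : ℕ)) (j := (i + 1 : ℕ))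
    (fun h => hij (Fin.ext (by omega)))
  have h2 := two_eta_sub hη (i := (j + 1 : ℕ)) (j := -((i + 1 : ℕ) : ℤ)) (by omega)
  refine evenTheta_ne_zero hτ ?_ ?_
  · convert h1 using 1
    simp [infPoint]
  · convert h2 using 2
    simp [infPoint]
    ring

/-- Over infinity the points `2η, …, 2ηm` are pairwise inequivalent and not opposite. This open
condition persists over large finite `e`. -/
lemma exists_qDisc_ne_zero : ∃ e, (qDisc τ η m).eval e ≠ 0 := by
  have hd := theta_differentiable hτ
  have hO : {t : Fin m → ℂ | ∀ i j, i ≠ j → evenTheta τ (η - t i) (η - t j) ≠ 0} ∈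
      𝓝 (infPoint η m) := by
    have : ∀ i j, ∀ᶠ t in 𝓝 (infPoint η m), i ≠ j → evenTheta τ (η - t i) (η - t j) ≠ 0 := by
      intro i j
      by_cases hij : i = j
      · simp [hij]
      · have hc : Continuous fun t : Fin m → ℂ => evenTheta τ (η - t i) (η - t j) := by
          have := hd.continuous
          unfold evenTheta
          fun_prop
        filter_upwards [hc.continuousAt.eventually_ne (evenTheta_infPoint_ne hτ hη hij)]
          with t ht _ using ht
    exact Filter.eventually_all.2 fun i => Filter.eventually_all.2 fun j => this i j
  have h1 := tendsto_sq_cocompact.eventually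
    (eventually_exists_isValue hτ hη hm hO infPoint_isValue)
  obtain ⟨e, t, ht, he⟩ := h1.exists
  obtain ⟨ψ, hψ⟩ := he.exists_isEigen hτ hη hm (tDiv_card t)
  exact ⟨e, hψ.qDisc_ne_zero hτ hη hm ht⟩

lemma finite_not_isGeneric : {e | ¬ IsGeneric τ η m e}.Finite := by
  obtain ⟨e, he⟩ := exists_qDisc_ne_zero hτ hη hm
  refine ((finite_not_isRegular hτ hη hm).union
    (IsPoly.finite_zeros (f := fun e => (qDisc τ η m).eval e) ⟨_, fun _ => rfl⟩ he)).subset ?_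
  intro x hx
  by_contra h
  simp only [Set.mem_union, Set.mem_ofPred_eq, not_or, not_not] at h
  exact hx h

/-! ### Local holomorphic lifts -/

omit hτ hη hm in
lemma exists_implicit {F : ℂ × ℂ → ℂ} (hF : ContDiff ℂ 1 F) {e₀ a : ℂ} (h0 : F (e₀, a) = 0)
    (h1 : deriv (fun l => F (e₀, l)) a ≠ 0) : ∃ φ : ℂ → ℂ, DifferentiableAt ℂ φ e₀ ∧
      ∃ U ∈ 𝓝 e₀, ∃ V ∈ 𝓝 a, ∀ e ∈ U, ∀ l ∈ V, F (e, l) = 0 → φ e = l := by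
  have hFa : ContDiffAt ℂ 1 F (e₀, a) := hF.contDiffAt
  have hinv : (fderiv ℂ F (e₀, a) ∘L .inr ℂ ℂ ℂ).IsInvertible := by
    refine ⟨ContinuousLinearEquiv.unitsEquivAut ℂ (Units.mk0 _ h1), ?_⟩
    ext
    have h2 : HasDerivAt (fun l : ℂ => (e₀, l)) ((0 : ℂ), (1 : ℂ)) a :=
      (hasDerivAt_const _ _).prodMk (hasDerivAt_id _)
    have h3 := ((hF.differentiable one_ne_zero (e₀, a)).hasFDerivAt.comp_hasDerivAt a h2).deriv
    have h4 : deriv (fun l => F (e₀, l)) a = _ := h3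
    simp [h4]
  have hd := (hFa.hasStrictFDerivAt_implicitFunction one_ne_zero hinv).hasFDerivAt
  have h5 := hFa.eventually_apply_eq_iff_implicitFunction one_ne_zero hinv
  generalize hFa.implicitFunction one_ne_zero hinv = φ at hd h5
  rw [nhds_prod_eq] at h5
  obtain ⟨U, hU, V, hV, hUV⟩ := Filter.mem_prod_iff.1 h5
  refine ⟨φ, hd.differentiableAt, U, hU, V, hV, fun e heU l hl hq => ?_⟩
  have h6 := hUV (Set.mk_mem_prod heU hl)
  rw [Set.mem_ofPred_eq] at h6
  exact h6.1 (by rw [hq, h0])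

lemma IsEigen.deriv_qFun_ne_zero {e : ℂ} (he : IsGeneric τ η m e) {t : Fin m → ℂ} {ψ : ℂ → ℂ}
    (h : IsEigen τ η m e (tDiv η t) ψ) (j : Fin m) :
    qFun τ η m e (η - t j) = 0 ∧ deriv (qFun τ η m e) (η - t j) ≠ 0 := by
  obtain ⟨C, hC, h1⟩ := h.qFun_eq hτ hη hm
  have hd := theta_differentiable hτ
  set a := η - t j with ha
  set g : ℂ → ℂ := fun l => C * ((-1) ^ m * (theta τ (l + a) *
    ∏ i ∈ Finset.univ.erase j, evenTheta τ (η - t i) l)) with hg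
  have h2 : ∀ l, qFun τ η m e l = theta τ (l - a) * g l := fun l => by
    rw [h1, divTheta_mul_neg, ← Finset.mul_prod_erase _ _ (Finset.mem_univ j), evenTheta, hg]
    ring
  have h0 : qFun τ η m e a = 0 := by rw [h2, sub_self, theta_zero, zero_mul]
  refine ⟨h0, ?_⟩
  have hgd : Differentiable ℂ g := by
    have : Differentiable ℂ fun l => ∏ i ∈ Finset.univ.erase j, evenTheta τ (η - t i) l :=
      differentiable_prod _ fun i _ => (evenTheta_isTheta hτ _).diff
    rw [hg]
    fun_prop
  have h3 : HasDerivAt (fun l => theta τ (l - a)) (deriv (theta τ) 0) a := by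
    have := (hd (a - a)).hasDerivAt.comp_sub_const a a
    simpa using this
  have h4 := (h3.mul (hgd a).hasDerivAt).deriv
  have h5 : qFun τ η m e = fun l => theta τ (l - a) * g l := funext h2
  rw [h5]
  have h6 : deriv (fun l => theta τ (l - a) * g l) a = deriv (theta τ) 0 * g a := by
    refine h4.trans ?_
    simp [theta_zero]
  rw [h6]
  refine mul_ne_zero (deriv_theta_zero hτ) (mul_ne_zero hC (mul_ne_zero (by simp)
    (mul_ne_zero ?_ (Finset.prod_ne_zero_iff.2 fun i hi => ?_))))
  · intro h7
    exact he.1.half_notMem hτ hη h0 (by rw [two_mul]; exact (theta_eq_zero_iff hτ _).1 h7)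
  · exact h.distinct hτ hη hm he.2 (Finset.ne_of_mem_erase hi)

omit hη hm in
lemma contDiff_qFun : ContDiff ℂ 1 fun x : ℂ × ℂ => qFun τ η m x.1 x.2 := by
  unfold qFun lagrange
  refine ContDiff.sum fun k _ => ?_
  refine ContDiff.mul ?_ (contDiff_prod fun j _ => ?_)
  · exact (((pVal_isPoly (k : ℤ)).differentiable).contDiff.comp contDiff_fst).pow 2
  · exact ((evenTheta_isTheta hτ _).diff.contDiff.comp contDiff_snd).div_const _

/-- The zeros `η - t_j` are simple zeros of `q(e₀, ·)`, so the implicit function theorem moves them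
holomorphically with `e`. By openness the curve has a point over `e²` near `t₀`; its coordinates are
zeros of `q(e, ·)` near the old ones and hence lie on these branches. -/
lemma exists_lift {e₀ : ℂ} (he : IsGeneric τ η m e₀) {t₀ : Fin m → ℂ}
    (h : IsValue τ η m (tDiv η t₀) ((e₀ ^ 2 : ℂ) : OnePoint ℂ)) :
    ∃ T : ℂ → Fin m → ℂ, DifferentiableAt ℂ T e₀ ∧
      ∀ᶠ e in 𝓝 e₀, IsValue τ η m (tDiv η (T e)) ((e ^ 2 : ℂ) : OnePoint ℂ) := by
  obtain ⟨ψ, hψ⟩ := h.exists_isEigen hτ hη hm (tDiv_card t₀)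
  have hF := contDiff_qFun (η := η) (m := m) hτ
  have key : ∀ j, ∃ φ : ℂ → ℂ, DifferentiableAt ℂ φ e₀ ∧ ∃ U ∈ 𝓝 e₀, ∃ V ∈ 𝓝 (η - t₀ j),
      ∀ e ∈ U, ∀ l ∈ V, qFun τ η m e l = 0 → φ e = l := fun j =>
    exists_implicit hF (hψ.deriv_qFun_ne_zero hτ hη hm he j).1
      (hψ.deriv_qFun_ne_zero hτ hη hm he j).2
  choose φ hφ U hU V hV hUV using key
  refine ⟨fun e j => η - φ j e, differentiableAt_pi.2 fun j => (hφ j).const_sub η, ?_⟩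
  have hO : {t : Fin m → ℂ | ∀ j, η - t j ∈ V j} ∈ 𝓝 t₀ := by
    refine Filter.eventually_all.2 fun j => ?_
    have hc : Continuous fun t : Fin m → ℂ => η - t j := by fun_prop
    exact hc.continuousAt.eventually_mem (hV j)
  have hsq : Continuous fun e : ℂ => ((e ^ 2 : ℂ) : OnePoint ℂ) :=
    OnePoint.continuous_coe.comp (by fun_prop)
  have h1 := (hsq.tendsto e₀).eventually (eventually_exists_isValue hτ hη hm hO h)
  have h2 : ∀ᶠ e in 𝓝 e₀, ∀ j, e ∈ U j := Filter.eventually_all.2 fun j => hU j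
  filter_upwards [h1, h2] with e he' heU
  obtain ⟨t, ht, hval⟩ := he'
  obtain ⟨ψ', hψ'⟩ := hval.exists_isEigen hτ hη hm (tDiv_card t)
  have : (fun j => η - φ j e) = t := funext fun j => by
    have hq : qFun τ η m e (η - t j) = 0 := by
      rw [← hψ'.mul_neg_eq hτ hη hm, (hψ'.eq_zero_iff hτ _).2 ⟨η - t j, ?_, by simp⟩, zero_mul]
      exact Multiset.mem_map.2 ⟨j, by simp, rfl⟩
    rw [hUV j e (heU j) _ (ht j) hq]; ring
  rw [this]
  exact hval

end

end

section

variable {τ η : ℂ} {m : ℕ}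

/-! ### Symmetric sections restricted to the curve -/

/-- The factor depends on `t` and `x` but not on `F`, so quotients of sections of the same type
descend to the torus. -/
lemma IsSec.exists_factor (n : ℕ) (s : ℂ) {x : Fin m → ℂ} (hx : ∀ i, x i ∈ lattice τ)
    (t : Fin m → ℂ) : ∃ c : ℂ, c ≠ 0 ∧ ∀ F, IsSec τ n s F → F (t + x) = c * F t := by
  have hone : ∀ i, ∀ a ∈ lattice τ, ∀ t : Fin m → ℂ, ∃ c : ℂ, c ≠ 0 ∧ ∀ F, IsSec τ n s F →
      F (t + Pi.single i a) = c * F t := by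
    intro i a ha
    induction ha using AddSubgroup.closure_induction with
    | mem a ha =>
      intro t
      rcases ha with rfl | rfl
      · exact ⟨_, pow_ne_zero n (by norm_num), fun F hF => hF.add_one i t⟩
      · exact ⟨_, mul_ne_zero (pow_ne_zero n (by norm_num)) (exp_ne_zero _),
          fun F hF => hF.add_tau i t⟩
    | zero => exact fun t => ⟨1, one_ne_zero, by simp⟩
    | add a b _ _ ha hb =>
      intro t
      obtain ⟨c, hc, h⟩ := ha t
      obtain ⟨d, hd, h'⟩ := hb (t + Pi.single i a)
      refine ⟨d * c, mul_ne_zero hd hc, fun F hF => ?_⟩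
      rw [Pi.single_add, ← add_assoc, h' F hF, h F hF, mul_assoc]
    | neg a _ ha =>
      intro t
      obtain ⟨c, hc, h⟩ := ha (t + Pi.single i (-a))
      refine ⟨c⁻¹, inv_ne_zero hc, fun F hF => ?_⟩
      have := h F hF
      rw [add_assoc, ← Pi.single_add, neg_add_cancel, Pi.single_zero, add_zero] at this
      rw [this, inv_mul_cancel_left₀ hc]
  have hall : ∀ S : Finset (Fin m), ∃ c : ℂ, c ≠ 0 ∧ ∀ F, IsSec τ n s F →
      F (t + ∑ i ∈ S, Pi.single i (x i)) = c * F t := by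
    intro S
    induction S using Finset.induction_on with
    | empty => exact ⟨1, one_ne_zero, by simp⟩
    | insert a S ha ih =>
      obtain ⟨c, hc, h⟩ := ih
      obtain ⟨d, hd, h'⟩ := hone a _ (hx a) (t + ∑ i ∈ S, Pi.single i (x i))
      refine ⟨d * c, mul_ne_zero hd hc, fun F hF => ?_⟩
      rw [Finset.sum_insert ha, show t + (Pi.single a (x a) + ∑ i ∈ S, Pi.single i (x i)) =
        t + ∑ i ∈ S, Pi.single i (x i) + Pi.single a (x a) by abel, h' F hF, h F hF, mul_assoc]
  have := hall Finset.univ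
  rwa [Finset.univ_sum_single] at this

/-- The even section `t ↦ Θ_t(l) Θ_t(-l)`. -/
def evenSec (τ η l : ℂ) (t : Fin m → ℂ) : ℂ := divTheta τ (tDiv η t) l * divTheta τ (tDiv η t) (-l)

lemma evenSec_isSec (hτ : 0 < τ.im) (l : ℂ) :
    IsSec τ 2 (-(2 * η)) (evenSec (m := m) τ η l) :=
  ((divTheta_tDiv_isSec hτ l).mul (divTheta_tDiv_isSec hτ (-l))).congr rfl (by ring) fun _ => rfl

lemma tDiv_perm (g : Equiv.Perm (Fin m)) (t : Fin m → ℂ) :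
    tDiv η (fun i => t (g i)) = tDiv η t := by
  have h := Finset.map_univ_equiv g
  conv_rhs => rw [tDiv, ← h, Finset.map_val, Multiset.map_map]
  rfl

lemma evenSec_perm (l : ℂ) (g : Equiv.Perm (Fin m)) (t : Fin m → ℂ) :
    evenSec τ η l (fun i => t (g i)) = evenSec τ η l t := by
  rw [evenSec, tDiv_perm, evenSec]

lemma evenSec_reflect (l : ℂ) (t : Fin m → ℂ) :
    evenSec τ η l (fun i => 2 * η - t i) = evenSec τ η l t := by
  rw [evenSec, tDiv_reflect, divTheta_map_neg, divTheta_map_neg, neg_neg, evenSec]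
  have : ((-1 : ℂ) ^ (tDiv η t).card) * (-1) ^ (tDiv η t).card = 1 := by
    rw [← mul_pow]; simp
  linear_combination (divTheta τ (tDiv η t) l * divTheta τ (tDiv η t) (-l)) * this

/-- A section invariant under permutations and the reflection, of the same type as the `M`-th power
of `evenSec`. -/
structure IsSymSec (τ η : ℂ) (M : ℕ) (R : (Fin m → ℂ) → ℂ) : Prop where
  isSec : IsSec τ (M * 2) (M * -(2 * η)) R
  perm : ∀ g : Equiv.Perm (Fin m), ∀ t, R (fun i => t (g i)) = R t
  reflect : ∀ t, R (fun i => 2 * η - t i) = R t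

open Classical in
/-- The quotient of `R` and a power of `evenSec τ η l`, as a function on the base. -/
def baseFun (τ η : ℂ) (M : ℕ) (R : (Fin m → ℂ) → ℂ) (l : ℂ) (z : OnePoint ℂ) : ℂ :=
  if h : ∃ t, IsValue τ η m (tDiv η t) z then
    R (Classical.choose h) / evenSec τ η l (Classical.choose h) ^ M else 0

section

variable (hτ : 0 < τ.im) (hη : ∀ k : ℤ, k ≠ 0 → (k : ℂ) * η ∉ lattice τ) (hm : 0 < m)
include hτ hη hm

variable {M : ℕ} {R : (Fin m → ℂ) → ℂ}

lemma IsSymSec.exists_factor (M : ℕ) {t t' : Fin m → ℂ} {z : OnePoint ℂ}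
    (h : IsValue τ η m (tDiv η t) z) (h' : IsValue τ η m (tDiv η t') z) :
    ∃ c : ℂ, c ≠ 0 ∧ ∀ R, IsSymSec τ η M R → R t' = c * R t := by
  have key : ∀ t t' : Fin m → ℂ, proj τ t' = proj τ t →
      ∃ c : ℂ, c ≠ 0 ∧ ∀ R, IsSymSec τ η M R → R t' = c * R t := by
    intro t t' h
    obtain ⟨g, hg⟩ := proj_eq_proj_iff.1 h
    obtain ⟨c, hc, hF⟩ := IsSec.exists_factor (M * 2) (M * -(2 * η))
      (x := fun i => t' i - t (g i)) hg (fun i => t (g i))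
    refine ⟨c, hc, fun R hR => ?_⟩
    have ht' : (fun i => t (g i)) + (fun i => t' i - t (g i)) = t' := by
      ext i; simp
    rw [← hR.perm g t, ← hF R hR.isSec, ht']
  rcases h.eq_or_eq_neg hτ hη hm h' (tDiv_card t) (tDiv_card t') with h1 | h1
  · exact key t t' ((proj_eq_iff η _ _).2 h1)
  · rw [← tDiv_reflect] at h1
    obtain ⟨c, hc, h2⟩ := key _ t' ((proj_eq_iff η _ _).2 h1)
    exact ⟨c, hc, fun R hR => by rw [h2 R hR, hR.reflect]⟩

lemma IsSymSec.ratio_eq (hR : IsSymSec τ η M R) (l : ℂ) {t t' : Fin m → ℂ} {z : OnePoint ℂ}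
    (h : IsValue τ η m (tDiv η t) z) (h' : IsValue τ η m (tDiv η t') z) :
    R t' / evenSec τ η l t' ^ M = R t / evenSec τ η l t ^ M := by
  obtain ⟨c, hc, hF⟩ := IsSymSec.exists_factor hτ hη hm M h h'
  have h2 := hF (fun t => evenSec τ η l t ^ M) ⟨(evenSec_isSec hτ l).pow M,
    fun g t => by rw [evenSec_perm], fun t => by rw [evenSec_reflect]⟩
  rw [hF R hR, h2, mul_div_mul_left _ _ hc]

lemma baseFun_eq (hR : IsSymSec τ η M R) (l : ℂ) {t : Fin m → ℂ} {z : OnePoint ℂ}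
    (h : IsValue τ η m (tDiv η t) z) : baseFun τ η M R l z = R t / evenSec τ η l t ^ M := by
  have hex : ∃ t, IsValue τ η m (tDiv η t) z := ⟨t, h⟩
  rw [baseFun, dif_pos hex]
  exact hR.ratio_eq hτ hη hm l h (Classical.choose_spec hex)

/-- The value does not depend on the chosen point of the fibre, and nearby base points have
representatives near `t`. -/
lemma continuousAt_baseFun (hR : IsSymSec τ η M R) {l : ℂ} {t : Fin m → ℂ} {z : OnePoint ℂ}
    (h : IsValue τ η m (tDiv η t) z) (hl : evenSec τ η l t ≠ 0) :
    ContinuousAt (baseFun τ η M R l) z := by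
  have hc : ContinuousAt (fun t => R t / evenSec τ η l t ^ M) t :=
    hR.isSec.diff.continuous.continuousAt.div
      ((evenSec_isSec hτ l).diff.continuous.continuousAt.pow M) (pow_ne_zero _ hl)
  intro W hW
  rw [baseFun_eq hτ hη hm hR l h] at hW
  have hev := eventually_exists_isValue hτ hη hm (hc hW) h
  rw [Filter.mem_map]
  filter_upwards [hev]
  rintro z' ⟨t', ht', h'⟩
  rw [Set.mem_preimage, baseFun_eq hτ hη hm hR l h']
  exact ht'

lemma exists_isValue_tDiv (z : OnePoint ℂ) : ∃ t : Fin m → ℂ, IsValue τ η m (tDiv η t) z := by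
  obtain ⟨⟨x, hx⟩, rfl⟩ := surjective_curveProj hτ hη hm z
  obtain ⟨t, rfl⟩ := proj_surjective x
  exact ⟨t, isValue_curveMap hτ hη hm hx⟩

lemma evenSec_top_ne {e : ℂ} {t : Fin m → ℂ}
    (h : IsValue τ η m (tDiv η t) ((e ^ 2 : ℂ) : OnePoint ℂ)) :
    evenSec τ η (2 * η * m) t ≠ 0 := by
  obtain ⟨ψ, hψ⟩ := h.exists_isEigen hτ hη hm (tDiv_card t)
  obtain ⟨C, hC, h1⟩ := hψ.qFun_eq hτ hη hm
  intro h0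
  have h2 := h1 (2 * η * m)
  rw [qFun_top hτ hη] at h2
  exact one_ne_zero (h2.trans (by rw [← evenSec, h0, mul_zero]))

lemma evenSec_div_top {e : ℂ} {t : Fin m → ℂ}
    (h : IsValue τ η m (tDiv η t) ((e ^ 2 : ℂ) : OnePoint ℂ)) (l : ℂ) :
    evenSec τ η l t = qFun τ η m e l * evenSec τ η (2 * η * m) t := by
  obtain ⟨ψ, hψ⟩ := h.exists_isEigen hτ hη hm (tDiv_card t)
  obtain ⟨C, hC, h1⟩ := hψ.qFun_eq hτ hη hm
  have h2 := h1 (2 * η * m)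
  have h3 := h1 l
  rw [← evenSec] at h2 h3
  rw [qFun_top hτ hη] at h2
  rw [h3]
  linear_combination evenSec τ η l t * h2

-- The point `η` is off the grid, so this section provides a denominator at infinity, where the one
-- at `2ηm` vanishes.
omit hm in
lemma evenSec_infPoint_ne : evenSec τ η η (infPoint η m) ≠ 0 := by
  have key : ∀ l, (∀ k : ℤ, l - 2 * η * k ∉ lattice τ) → divTheta τ (infDiv η m) l ≠ 0 := by
    intro l hl h0
    obtain ⟨a, ha, hl'⟩ := (divTheta_eq_zero_iff hτ _ _).1 h0
    obtain ⟨k, hk, rfl⟩ := Multiset.mem_map.1 ha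
    exact hl (k + 1 : ℕ) (by simpa using hl')
  rw [evenSec, tDiv_infPoint]
  refine mul_ne_zero (key _ fun k => ?_) (key _ fun k => ?_)
  · have := hη (1 - 2 * k) (by omega)
    convert this using 2
    push_cast; ring
  · have := hη (-1 - 2 * k) (by omega)
    convert this using 2
    push_cast; ring

/-- The denominator is nonzero over finite values because `q(2ηm) = 1`. Holomorphic lifts give
differentiability at generic `e`, and continuity removes the finitely many other singularities. -/
lemma differentiable_baseFun (hR : IsSymSec τ η M R) :
    Differentiable ℂ fun e : ℂ => baseFun τ η M R (2 * η * m) ((e ^ 2 : ℂ) : OnePoint ℂ) := by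
  have hcont : ∀ e : ℂ, ContinuousAt (fun e : ℂ =>
      baseFun τ η M R (2 * η * m) ((e ^ 2 : ℂ) : OnePoint ℂ)) e := by
    intro e
    obtain ⟨t, ht⟩ := exists_isValue_tDiv hτ hη hm ((e ^ 2 : ℂ) : OnePoint ℂ)
    have hsq : Continuous fun e : ℂ => ((e ^ 2 : ℂ) : OnePoint ℂ) :=
      OnePoint.continuous_coe.comp (by fun_prop)
    exact ContinuousAt.comp (f := fun e : ℂ => ((e ^ 2 : ℂ) : OnePoint ℂ))
      (continuousAt_baseFun hτ hη hm hR ht (evenSec_top_ne hτ hη hm ht)) hsq.continuousAt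
  have hdiff : ∀ e, IsGeneric τ η m e → DifferentiableAt ℂ (fun e : ℂ =>
      baseFun τ η M R (2 * η * m) ((e ^ 2 : ℂ) : OnePoint ℂ)) e := by
    intro e he
    obtain ⟨t, ht⟩ := exists_isValue_tDiv hτ hη hm ((e ^ 2 : ℂ) : OnePoint ℂ)
    obtain ⟨T, hT, hev⟩ := exists_lift hτ hη hm he ht
    have h1 : DifferentiableAt ℂ (fun e => R (T e) / evenSec τ η (2 * η * m) (T e) ^ M) e :=
      ((hR.isSec.diff _).comp e hT).div
        ((((evenSec_isSec hτ _).diff _).comp e hT).pow M)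
        (pow_ne_zero _ (evenSec_top_ne hτ hη hm hev.self_of_nhds))
    refine h1.congr_of_eventuallyEq ?_
    filter_upwards [hev] with e he' using baseFun_eq hτ hη hm hR _ he'
  intro c
  have hfin := finite_not_isGeneric (m := m) hτ hη hm
  refine (analyticAt_of_differentiable_on_punctured_nhds_of_continuousAt ?_
    (hcont c)).differentiableAt
  filter_upwards [nhdsNE_of_nhdsNE_sdiff_finite Filter.univ_mem hfin] with e he
    using hdiff e (not_not.1 he.2)

open Classical in
/-- A coordinate near infinity. -/
def infChart (s : ℂ) : OnePoint ℂ := if s = 0 then OnePoint.infty else ((s⁻¹ ^ 2 : ℂ) : OnePoint ℂ)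

omit hτ hη hm in
lemma continuousAt_infChart : ContinuousAt infChart 0 := by
  have h0 : infChart 0 = OnePoint.infty := by simp [infChart]
  rw [continuousAt_iff_punctured_nhds, h0]
  have h1 : Filter.Tendsto (fun s : ℂ => ((s⁻¹ ^ 2 : ℂ) : OnePoint ℂ)) (𝓝[≠] 0)
      (𝓝 OnePoint.infty) := by
    have := Filter.tendsto_inv₀_nhdsNE_zero (α := ℂ)
    rw [Metric.cobounded_eq_cocompact] at this
    exact tendsto_sq_cocompact.comp this
  refine h1.congr' ?_
  filter_upwards [self_mem_nhdsWithin] with s hs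
  rw [infChart, if_neg (by simpa using hs)]

-- If `g` vanishes identically near `0`, then `h` vanishes near infinity, in particular on an open
-- set. Otherwise the zeros of `h` are bounded and, being infinitely many, accumulate at a finite
-- point. Either way the identity theorem applies.
omit hτ hη hm in
lemma eq_zero_of_analyticAt_infty {h g : ℂ → ℂ} (hd : Differentiable ℂ h) (hg : AnalyticAt ℂ g 0)
    (hgh : ∀ᶠ s in 𝓝[≠] 0, g s = 0 ↔ h s⁻¹ = 0) (hinf : {e | h e = 0}.Infinite) (e : ℂ) :
    h e = 0 := by
  have han : AnalyticOnNhd ℂ h Set.univ := fun e _ => hd.analyticAt e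
  have hinv := Filter.tendsto_inv₀_cobounded' (α := ℂ)
  have h1 : ∀ᶠ x in Bornology.cobounded ℂ, g x⁻¹ = 0 ↔ h x = 0 := by
    filter_upwards [hinv.eventually hgh] with x hx
    rwa [inv_inv] at hx
  rcases hg.eventually_eq_zero_or_eventually_ne_zero with h2 | h2
  · have h3 : ∀ᶠ x in Bornology.cobounded ℂ, h x = 0 := by
      filter_upwards [hinv.eventually (h2.filter_mono nhdsWithin_le_nhds), h1] with x hx hx'
        using hx'.1 hx
    obtain ⟨r, -, hr⟩ := (Metric.hasBasis_cobounded_compl_closedBall (0 : ℂ)).mem_iff.1 h3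
    obtain ⟨x, hx⟩ := NormedField.exists_lt_norm ℂ r
    have hx' : (Metric.closedBall (0 : ℂ) r)ᶜ ∈ 𝓝 x :=
      Metric.isClosed_closedBall.isOpen_compl.mem_nhds (by simpa using hx)
    exact han.eqOn_zero_of_preconnected_of_eventuallyEq_zero isPreconnected_univ
      (Set.mem_univ x) (Filter.mem_of_superset hx' hr) (Set.mem_univ e)
  · have h3 : ∀ᶠ x in Bornology.cobounded ℂ, h x ≠ 0 := by
      filter_upwards [hinv.eventually h2, h1] with x hx hx' h0 using hx (hx'.2 h0)
    obtain ⟨r, -, hr⟩ := (Metric.hasBasis_cobounded_compl_closedBall (0 : ℂ)).mem_iff.1 h3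
    have hsub : {e | h e = 0} ⊆ Metric.closedBall (0 : ℂ) r := fun x hx => by
      by_contra hx'
      exact hr hx' hx
    obtain ⟨x, -, hx⟩ := hinf.exists_accPt_of_subset_isCompact (isCompact_closedBall 0 r) hsub
    exact han.eqOn_zero_of_preconnected_of_frequently_eq_zero isPreconnected_univ
      (Set.mem_univ x) (accPt_iff_frequently_nhdsNE.1 hx) (Set.mem_univ e)

lemma finite_preimage_curveProj {T : Set (OnePoint ℂ)} (hT : T.Finite) :
    (curveProj τ η m ⁻¹' T).Finite := by
  refine hT.preimage' fun z _ => ?_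
  obtain ⟨y, rfl⟩ := surjective_curveProj hτ hη hm z
  rw [fiber_eq hτ hη hm]
  exact Set.toFinite _

/-- A symmetric section with infinitely many zeros on the curve vanishes on the curve. -/
lemma IsSymSec.eq_zero (hR : IsSymSec τ η M R)
    (hinf : {x | x ∈ curve τ η m ∧ ∃ t, proj τ t = x ∧ R t = 0}.Infinite) {t : Fin m → ℂ}
    (ht : proj τ t ∈ curve τ η m) : R t = 0 := by
  set h : ℂ → ℂ := fun e => baseFun τ η M R (2 * η * m) ((e ^ 2 : ℂ) : OnePoint ℂ) with hh
  have hd : Differentiable ℂ h := differentiable_baseFun hτ hη hm hR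
  have hzero : ∀ {t : Fin m → ℂ} {e : ℂ}, IsValue τ η m (tDiv η t) ((e ^ 2 : ℂ) : OnePoint ℂ) →
      (h e = 0 ↔ R t = 0) := by
    intro t e hv
    rw [hh]
    simp only [baseFun_eq hτ hη hm hR _ hv]
    simp [evenSec_top_ne hτ hη hm hv]
  -- The same section in a chart at infinity, with denominator taken at `η`; for `s ≠ 0` it differs
  -- from `h s⁻¹` by the factor `qFun τ η m s⁻¹ η ^ M`.
  set g : ℂ → ℂ := fun s => baseFun τ η M R η (infChart s) with hg
  have hgcont : ContinuousAt g 0 := by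
    have h0 : infChart 0 = OnePoint.infty := by simp [infChart]
    have h1 := continuousAt_baseFun hτ hη hm hR infPoint_isValue
      (evenSec_infPoint_ne (m := m) hτ hη)
    rw [← h0] at h1
    exact ContinuousAt.comp h1 continuousAt_infChart
  have hgeq : ∀ s : ℂ, s ≠ 0 → g s = h s⁻¹ / qFun τ η m s⁻¹ η ^ M := by
    intro s hs
    obtain ⟨t, ht⟩ := exists_isValue_tDiv hτ hη hm (((s⁻¹) ^ 2 : ℂ) : OnePoint ℂ)
    simp only [hg, hh, infChart, if_neg hs]
    rw [baseFun_eq hτ hη hm hR _ ht, baseFun_eq hτ hη hm hR _ ht,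
      evenSec_div_top hτ hη hm ht η, mul_pow, div_div, mul_comm]
  have hq : ∀ᶠ s in 𝓝[≠] (0 : ℂ), qFun τ η m s⁻¹ η ≠ 0 := by
    have hO : ∀ᶠ t in 𝓝 (infPoint η m), evenSec τ η η t ≠ 0 :=
      (evenSec_isSec hτ η).diff.continuous.continuousAt.eventually_ne
        (evenSec_infPoint_ne (m := m) hτ hη)
    have h1 := eventually_exists_isValue hτ hη hm hO infPoint_isValue
    have h0 : infChart 0 = OnePoint.infty := by simp [infChart]
    rw [← h0] at h1
    filter_upwards [(continuousAt_infChart.eventually h1).filter_mono nhdsWithin_le_nhds,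
      self_mem_nhdsWithin] with s hs hs0 hq0
    rw [infChart, if_neg (by simpa using hs0)] at hs
    obtain ⟨t, ht, hv⟩ := hs
    exact ht (by rw [evenSec_div_top hτ hη hm hv, hq0, zero_mul])
  have hgan : AnalyticAt ℂ g 0 := by
    refine analyticAt_of_differentiable_on_punctured_nhds_of_continuousAt ?_ hgcont
    filter_upwards [hq, self_mem_nhdsWithin] with s hs hs0
    have h1 : DifferentiableAt ℂ (fun s => h s⁻¹ / qFun τ η m s⁻¹ η ^ M) s := by
      have hi : DifferentiableAt ℂ (fun s : ℂ => s⁻¹) s := differentiableAt_inv hs0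
      refine DifferentiableAt.div ((hd _).comp s hi) ?_ (pow_ne_zero _ hs)
      exact (((qFun_isPoly η).differentiable _).comp s hi).pow M
    refine h1.congr_of_eventuallyEq ?_
    filter_upwards [isOpen_ne.mem_nhds hs0] with s hs using hgeq s hs
  -- Fibres are finite, so infinitely many zeros on the curve lie over infinitely many finite
  -- values.
  have hinfz : {e | h e = 0}.Infinite := by
    intro hfin
    have h1 := finite_preimage_curveProj hτ hη hm
      ((hfin.image fun e : ℂ => ((e ^ 2 : ℂ) : OnePoint ℂ)).union (Set.finite_singleton OnePoint.infty))
    refine hinf ((h1.image Subtype.val).subset ?_)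
    rintro x ⟨hx, t, rfl, hRt⟩
    refine ⟨⟨_, hx⟩, ?_, rfl⟩
    have hv := isValue_curveMap hτ hη hm hx
    rw [Set.mem_preimage, curveProj]
    generalize curveMap τ η m (proj τ t) = z at hv
    induction z using OnePoint.rec with
    | infty => exact Or.inr rfl
    | coe z =>
      obtain ⟨e, rfl⟩ := IsAlgClosed.exists_pow_nat_eq z (n := 2) (by norm_num)
      exact Or.inl ⟨e, (hzero hv).2 hRt, rfl⟩
  have hall := eq_zero_of_analyticAt_infty hd hgan (by
    filter_upwards [hq, self_mem_nhdsWithin] with s hs hs0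
    rw [hgeq s hs0]
    simp [hs]) hinfz
  have hv := isValue_curveMap hτ hη hm ht
  generalize curveMap τ η m (proj τ t) = z at hv
  induction z using OnePoint.rec with
  | coe z =>
    obtain ⟨e, rfl⟩ := IsAlgClosed.exists_pow_nat_eq z (n := 2) (by norm_num)
    exact (hzero hv).1 (hall e)
  | infty =>
    have hg0 : g 0 = 0 := by
      refine tendsto_nhds_unique (hgcont.tendsto.mono_left nhdsWithin_le_nhds)
        ((tendsto_const_nhds (x := (0 : ℂ))).congr' ?_) (l := 𝓝[≠] (0 : ℂ))
      filter_upwards [self_mem_nhdsWithin] with s hs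
      rw [hgeq s hs, hall, zero_div]
    have h0 : infChart 0 = OnePoint.infty := by simp [infChart]
    simp only [hg, h0] at hg0
    rw [baseFun_eq hτ hη hm hR _ infPoint_isValue] at hg0
    have h1 := (div_eq_zero_iff.1 hg0).resolve_right
      (pow_ne_zero _ (evenSec_infPoint_ne (m := m) hτ hη))
    obtain ⟨c, -, hF⟩ := IsSymSec.exists_factor hτ hη hm M infPoint_isValue hv
    rw [hF R hR, h1, mul_zero]

end

end

section

variable {τ η : ℂ} {m : ℕ}

/-! ### A topological criterion for dimension one -/

section

variable {X : Type*} [TopologicalSpace X] [T1Space X] {Y : Set X} {σ : X → X}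

-- A minimal infinite closed subset is irreducible, since one piece of any closed decomposition is
-- infinite. If `Y` is not itself minimal, take a proper infinite closed `C` and, inside it, a `D`
-- with the fewest points in `C ∩ σ⁻¹C`.
omit [T1Space X] in
lemma exists_infinite_irreducible (hYc : IsClosed Y) (hYi : Y.Infinite) (hσ : Continuous σ)
    (hσσ : ∀ x, σ (σ x) = x)
    (hY : ∀ C ⊆ Y, IsClosed C → C.Infinite → ∀ y ∈ Y, y ∈ C ∨ σ y ∈ C) :
    ∃ C ⊆ Y, IsClosed C ∧ C.Infinite ∧ IsIrreducible C := by
  have hmin : ∃ C ⊆ Y, IsClosed C ∧ C.Infinite ∧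
      ∀ D ⊆ C, IsClosed D → D.Infinite → D = C := by
    by_cases hall : ∀ D ⊆ Y, IsClosed D → D.Infinite → D = Y
    · exact ⟨Y, subset_rfl, hYc, hYi, hall⟩
    push Not at hall
    obtain ⟨C, hCY, hCc, hCi, hne⟩ := hall
    -- Were this `σ`-stable closed set infinite, the hypothesis would put every point of `Y` into
    -- `C`.
    have hF : (C ∩ σ ⁻¹' C).Finite := by
      by_contra hinf
      refine hne (hCY.antisymm fun y hy => ?_)
      rcases hY _ (Set.inter_subset_left.trans hCY) (hCc.inter (hCc.preimage hσ)) hinf y hy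
        with h | h
      · exact h.1
      · simpa [hσσ] using h.2
    obtain ⟨D, ⟨hDC, hDc, hDi⟩, hDmin⟩ := (InvImage.wf
      (fun D : Set X => (D ∩ (C ∩ σ ⁻¹' C)).ncard) Nat.lt_wfRel.wf).has_min
      {D | D ⊆ C ∧ IsClosed D ∧ D.Infinite} ⟨C, subset_rfl, hCc, hCi⟩
    refine ⟨D, hDC.trans hCY, hDc, hDi, fun E hED hEc hEi => hED.antisymm fun x hx => ?_⟩
    rcases hY E (hED.trans (hDC.trans hCY)) hEc hEi x (hCY (hDC hx)) with h | h
    · exact h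
    -- In this case `σ x` lies in `E ⊆ C`, so `x` belongs to the finite overlap `C ∩ σ⁻¹C`; by
    -- minimality of the count, `E` misses no overlap point of `D`.
    · have h1 : E ∩ (C ∩ σ ⁻¹' C) = D ∩ (C ∩ σ ⁻¹' C) := by
        refine Set.eq_of_subset_of_ncard_le (Set.inter_subset_inter_left _ hED) ?_
          (hF.subset Set.inter_subset_right)
        exact not_lt.1 (hDmin E ⟨hED.trans hDC, hEc, hEi⟩)
      have h2 : x ∈ D ∩ (C ∩ σ ⁻¹' C) := ⟨hx, hDC hx, hDC (hED h)⟩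
      rw [← h1] at h2
      exact h2.1
  obtain ⟨C, hCY, hCc, hCi, hC⟩ := hmin
  refine ⟨C, hCY, hCc, hCi, hCi.nonempty, ?_⟩
  rw [isPreirreducible_iff_isClosed_union_isClosed]
  intro A B hA hB hAB
  have : C = (C ∩ A) ∪ (C ∩ B) := by
    rw [← Set.inter_union_distrib_left, Set.inter_eq_left.2 hAB]
  rw [this, Set.infinite_union] at hCi
  rcases hCi with h | h
  · exact Or.inl (Set.inter_eq_left.1 (hC _ Set.inter_subset_left (hCc.inter hA) h))
  · exact Or.inr (Set.inter_eq_left.1 (hC _ Set.inter_subset_left (hCc.inter hB) h))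

/-- If every infinite closed subset of `Y` together with its image under an involution fills `Y`,
then the irreducible components of `Y` have dimension one. -/
lemma topologicalKrullDim_eq_one (hYc : IsClosed Y) (hYi : Y.Infinite) (hσ : Continuous σ)
    (hσσ : ∀ x, σ (σ x) = x) (hσY : ∀ x ∈ Y, σ x ∈ Y)
    (hY : ∀ C ⊆ Y, IsClosed C → C.Infinite → ∀ y ∈ Y, y ∈ C ∨ σ y ∈ C) {Z : Set X}
    (hZ : Maximal (fun Z' => IsIrreducible Z' ∧ Z' ⊆ Y) Z) : topologicalKrullDim Z = 1 := by
  obtain ⟨⟨hZirr, hZY⟩, hZmax⟩ := hZ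
  have hZc : IsClosed Z := isClosed_of_closure_subset
    (hZmax ⟨hZirr.closure, closure_minimal hZY hYc⟩ subset_closure)
  have himg : ∀ A : Set X, σ '' A = σ ⁻¹' A := fun A =>
    congrFun (Set.image_eq_preimage_of_inverse hσσ hσσ) A
  -- An infinite closed `C ⊆ Z` satisfies `Z ⊆ C ∪ σ⁻¹C`. By irreducibility `Z` lies in one of the
  -- two sets, and in the second case `Z` is `σ`-stable, so again `C = Z`.
  have hfin : ∀ C ⊆ Z, IsClosed C → C ≠ Z → C.Finite := by
    intro C hCZ hC hne
    by_contra hinf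
    have h1 : Z ⊆ C ∪ σ ⁻¹' C := fun y hy => hY C (hCZ.trans hZY) hC hinf y (hZY hy)
    rcases isPreirreducible_iff_isClosed_union_isClosed.1 hZirr.2 _ _ hC (hC.preimage hσ) h1
      with h | h
    · exact hne (hCZ.antisymm h)
    · have h2 : σ ⁻¹' Z ⊆ Z := fun y hy => hCZ (by simpa [hσσ] using h hy)
      have h3 : Z ⊆ σ ⁻¹' Z := fun y hy => h2 (by simpa [hσσ] using hy)
      exact hne (hCZ.antisymm fun y hy => by simpa [hσσ] using h (h3 hy))
  -- A component is contained in an infinite irreducible set or in its image under `σ`; by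
  -- maximality it is not finite.
  have hZinf : Z.Infinite := by
    intro hZfin
    obtain ⟨C, hCY, hCc, hCi, hCirr⟩ := exists_infinite_irreducible hYc hYi hσ hσσ hY
    have h1 : Z ⊆ C ∪ σ ⁻¹' C := fun y hy => hY C hCY hCc hCi y (hZY hy)
    rcases isPreirreducible_iff_isClosed_union_isClosed.1 hZirr.2 _ _ hCc (hCc.preimage hσ) h1
      with h | h
    · exact hCi (hZfin.subset (hZmax ⟨hCirr, hCY⟩ h))
    · have h2 : IsIrreducible (σ ⁻¹' C) := by
        rw [← himg]; exact hCirr.image σ hσ.continuousOn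
      have h3 : σ ⁻¹' C ⊆ Y := fun y hy => by simpa [hσσ] using hσY _ (hCY hy)
      have h4 := hZfin.subset (hZmax ⟨h2, h3⟩ h)
      rw [← himg] at h4
      exact hCi (h4.of_finite_image (Function.Involutive.injective hσσ).injOn)
  have hsing : ∀ A : TopologicalSpace.IrreducibleCloseds Z, (A : Set Z) ≠ Set.univ →
      (A : Set Z).Subsingleton := by
    intro A hA
    have h1 : (Subtype.val '' (A : Set Z)).Finite := by
      refine hfin _ (Subtype.coe_image_subset _ _)
        (hZc.isClosedEmbedding_subtypeVal.isClosedMap _ A.isClosed) fun h => hA ?_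
      rw [← Set.image_eq_image Subtype.val_injective, h]
      simp
    have h2 : (A : Set Z).Finite := h1.of_finite_image Subtype.val_injective.injOn
    exact (Set.Finite.isDiscrete h2).subsingleton_of_isPreirreducible A.isIrreducible.2
  refine le_antisymm ?_ ?_
  · rw [topologicalKrullDim, Order.krullDim_le_one_iff]
    intro A
    by_cases hA : (A : Set Z) = Set.univ
    · right
      intro B _
      exact fun x _ => by
        have : x ∈ (A : Set Z) := by rw [hA]; trivial
        exact this
    · left
      intro B hBA x hx
      obtain ⟨y, hy⟩ := B.isIrreducible.1
      have := hsing A hA hx (hBA hy)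
      rw [this]; exact hy
  · rw [topologicalKrullDim, Order.one_le_krullDim_iff]
    obtain ⟨x, hx⟩ := hZirr.1
    have : IrreducibleSpace Z := Subtype.irreducibleSpace hZirr
    refine ⟨⟨{⟨x, hx⟩}, isIrreducible_singleton, isClosed_singleton⟩,
      ⟨Set.univ, IrreducibleSpace.isIrreducible_univ Z, isClosed_univ⟩, ?_⟩
    obtain ⟨y, hy, hyx⟩ := hZinf.exists_notMem_finset {x}
    refine lt_of_le_of_ne (fun _ _ => trivial) fun h => hyx ?_
    have h1 : (⟨y, hy⟩ : Z) ∈ ({⟨x, hx⟩} : Set Z) := by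
      have h2 := congrArg (fun A : TopologicalSpace.IrreducibleCloseds Z => (A : Set Z)) h
      have h3 : ({⟨x, hx⟩} : Set Z) = Set.univ := h2
      rw [h3]; trivial
    simpa using congrArg Subtype.val h1

end

/-! ### Sections and the Zariski topology -/

namespace IsSection

variable {a b a' b' : Fin m → ℂ} {n n' : Fin m → ℤ} {F G : (Fin m → ℂ) → ℂ}

lemma mul (hF : IsSection τ a b n F) (hG : IsSection τ a' b' n' G) :
    IsSection τ (a * a') (b * b') (n + n') fun t => F t * G t where
  holomorphic := hF.holomorphic.mul hG.holomorphic
  add_one i t := by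
    rw [hF.add_one, hG.add_one, Pi.mul_apply]; ring
  add_tau i t := by
    rw [hF.add_tau, hG.add_tau, Pi.mul_apply, Pi.add_apply]
    have : exp (-(2 * Real.pi * I * ((n i + n' i : ℤ) : ℂ) * t i)) =
        exp (-(2 * Real.pi * I * (n i) * t i)) * exp (-(2 * Real.pi * I * (n' i) * t i)) := by
      rw [← exp_add]; push_cast; ring_nf
    rw [this]; ring

lemma one : IsSection τ (m := m) 1 1 0 fun _ => 1 :=
  ⟨differentiable_const _, by simp, by simp⟩

lemma zero : IsSection τ (m := m) 1 1 0 fun _ => 0 :=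
  ⟨differentiable_const _, by simp, by simp⟩

lemma multipliers_ne (hF : IsSection τ a b n F) {t : Fin m → ℂ} (ht : F t ≠ 0) (i : Fin m) :
    a i ≠ 0 ∧ b i ≠ 0 := by
  constructor
  · intro h
    have := hF.add_one i (t - Pi.single i 1)
    rw [sub_add_cancel, h, zero_mul] at this
    exact ht this
  · intro h
    have := hF.add_tau i (t - Pi.single i τ)
    rw [sub_add_cancel, h, zero_mul, zero_mul] at this
    exact ht this

lemma comp_reflect (hF : IsSection τ a b n F) (c : ℂ) :
    ∃ a' b' n', IsSection τ a' b' n' fun t => F fun i => c - t i := by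
  by_cases h0 : ∀ t, F t = 0
  · exact ⟨1, 1, 0, by simpa only [h0] using zero⟩
  push Not at h0
  obtain ⟨t₀, ht₀⟩ := h0
  have hne := hF.multipliers_ne ht₀
  have hsub : ∀ (t : Fin m → ℂ) i x, (fun j => c - (t + Pi.single i x : Fin m → ℂ) j) + Pi.single i x =
      fun j => c - t j := fun t i x => by
    ext j; simp only [Pi.add_apply]; ring
  refine ⟨fun i => (a i)⁻¹, fun i => (b i)⁻¹ * exp (2 * Real.pi * I * n i * (c - τ)), n,
    ?_, fun i t => ?_, fun i t => ?_⟩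
  · exact hF.holomorphic.comp (by fun_prop)
  · have := hF.add_one i fun j => c - (t + Pi.single i 1 : Fin m → ℂ) j
    rw [hsub] at this
    rw [this, inv_mul_cancel_left₀ (hne i).1]
  · have := hF.add_tau i fun j => c - (t + Pi.single i τ : Fin m → ℂ) j
    rw [hsub] at this
    rw [this]
    have h1 : exp (2 * Real.pi * I * n i * (c - τ)) * exp (-(2 * Real.pi * I * n i * t i)) *
        exp (-(2 * Real.pi * I * n i * (c - (t + Pi.single i τ : Fin m → ℂ) i))) = 1 := by
      rw [← exp_add, ← exp_add, exp_eq_one_iff]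
      exact ⟨0, by simp; ring⟩
    have h2 := inv_mul_cancel₀ (hne i).2
    generalize F (fun j => c - (t + Pi.single i τ : Fin m → ℂ) j) = x at *
    linear_combination (-x) * h1 - (exp (2 * Real.pi * I * n i * (c - τ)) *
      exp (-(2 * Real.pi * I * n i * t i)) *
        exp (-(2 * Real.pi * I * n i * (c - (t + Pi.single i τ : Fin m → ℂ) i)))) * x * h2

end IsSection

/-- Products of sections are sections, so the nonvanishing loci form a basis and not merely a
subbasis. -/
lemma exists_section_of_isOpen {U : Set (Fin m → ℂ)} (hU : IsOpen[zariskiCover τ m] U)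
    {t : Fin m → ℂ} (ht : t ∈ U) :
    ∃ a b n F, IsSection τ a b n F ∧ F t ≠ 0 ∧ ∀ t', F t' ≠ 0 → t' ∈ U := by
  induction hU with
  | basic U h =>
    obtain ⟨a, b, n, F, hF, rfl⟩ := h
    exact ⟨a, b, n, F, hF, ht, fun _ h => h⟩
  | univ => exact ⟨1, 1, 0, _, IsSection.one, one_ne_zero, fun _ _ => trivial⟩
  | inter U V _ _ hU hV =>
    obtain ⟨a, b, n, F, hF, h1, h2⟩ := hU ht.1
    obtain ⟨a', b', n', G, hG, h1', h2'⟩ := hV ht.2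
    exact ⟨_, _, _, _, hF.mul hG, mul_ne_zero h1 h1', fun t' h =>
      ⟨h2 t' (left_ne_zero_of_mul h), h2' t' (right_ne_zero_of_mul h)⟩⟩
  | sUnion S _ ih =>
    obtain ⟨U, hU, htU⟩ := ht
    obtain ⟨a, b, n, F, hF, h1, h2⟩ := ih U hU htU
    exact ⟨a, b, n, F, hF, h1, fun t' h => ⟨U, hU, h2 t' h⟩⟩

lemma isClosed_zeros {a b : Fin m → ℂ} {n : Fin m → ℤ} {F : (Fin m → ℂ) → ℂ}
    (hF : IsSection τ a b n F) : IsClosed[zariskiCover τ m] {t | F t = 0} := by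
  rw [← @isOpen_compl_iff _ _ (zariskiCover τ m)]
  exact TopologicalSpace.isOpen_generateFrom_of_mem ⟨a, b, n, F, hF, rfl⟩

lemma isClosed_zariski_iff {C : Set (SymEll τ m)} :
    IsClosed[zariski τ m] C ↔ IsClosed[zariskiCover τ m] (proj τ ⁻¹' C) :=
  isClosed_coinduced

lemma zariski_isClosed_curve (hτ : 0 < τ.im) : IsClosed[zariski τ m] (curve τ η m) := by
  rw [isClosed_zariski_iff]
  have : proj τ ⁻¹' curve τ η m = ⋂ p, {t | relDet τ η p t = 0} := by
    ext t; simp [proj_mem_curve_iff_relDet]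
  rw [this]
  exact @isClosed_iInter _ _ (zariskiCover τ m) _ fun p => isClosed_zeros (relDet_isSec hτ p).isSection

lemma isSection_prod {H : Fin m → ℂ → ℂ} {a b : Fin m → ℂ} {n : Fin m → ℤ}
    (hd : ∀ i, Differentiable ℂ (H i)) (h1 : ∀ i s, H i (s + 1) = a i * H i s)
    (hτ : ∀ i s, H i (s + τ) = b i * exp (-(2 * Real.pi * I * n i * s)) * H i s) :
    IsSection τ a b n fun t => ∏ i, H i (t i) := by
  have key : ∀ i (t : Fin m → ℂ) x c, H i (t i + x) = c * H i (t i) →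
      ∏ j, H j ((t + Pi.single i x : Fin m → ℂ) j) = c * ∏ j, H j (t j) := by
    intro i t x c h
    rw [← Finset.mul_prod_erase _ _ (Finset.mem_univ i),
      ← Finset.mul_prod_erase _ (fun j => H j (t j)) (Finset.mem_univ i), ← mul_assoc, ← h]
    refine congrArg₂ (· * ·) (by simp) (Finset.prod_congr rfl fun j hj => ?_)
    simp [Finset.ne_of_mem_erase hj]
  exact ⟨differentiable_prod _ fun i _ => (hd i).comp (by fun_prop),
    fun i t => key i t 1 _ (h1 i _), fun i t => key i t τ _ (hτ i _)⟩

lemma isSection_coordinate (hτ : 0 < τ.im) (i : Fin m) (c : ℂ) :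
    ∃ a b n, IsSection τ (m := m) a b n fun t => theta τ (t i - c) := by
  have hs := IsTheta.theta_sub hτ c
  have := isSection_prod (τ := τ) (H := fun j s => if j = i then theta τ (s - c) else 1)
    (a := fun j => if j = i then -1 else 1)
    (b := fun j => if j = i then -exp (-(Real.pi * I * (τ + 2 * -c))) else 1)
    (n := fun j => if j = i then 1 else 0) (fun j => ?_) (fun j s => ?_) (fun j s => ?_)
  · have he : (fun t : Fin m → ℂ => ∏ j, if j = i then theta τ (t j - c) else 1) =
        fun t => theta τ (t i - c) := by ext t; simp
    exact ⟨_, _, _, he ▸ this⟩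
  · by_cases h : j = i
    · simpa [h] using hs.diff
    · simp [h]
  · by_cases h : j = i
    · have := hs.add_one s
      simpa [h] using this
    · simp [h]
  · by_cases h : j = i
    · have := hs.add_tau s
      simp only [h, if_true]
      rw [this, neg_mul, ← exp_add]
      simp only [pow_one, Nat.cast_one, neg_mul, one_mul, Int.cast_one]
      congr 3
      ring
    · simp [h]

lemma zariski_t1Space (hτ : 0 < τ.im) : @T1Space _ (zariski τ m) := by
  refine @T1Space.mk _ (zariski τ m) fun x => ?_
  obtain ⟨t₀, rfl⟩ := proj_surjective x
  rw [isClosed_zariski_iff]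
  have : proj τ ⁻¹' {proj τ t₀} = ⋃ g : Equiv.Perm (Fin m), ⋂ i,
      {t : Fin m → ℂ | theta τ (t i - t₀ (g i)) = 0} := by
    ext t
    simp only [Set.mem_preimage, Set.mem_singleton_iff, Set.mem_iUnion, Set.mem_iInter,
      Set.mem_ofPred_eq, proj_eq_proj_iff, theta_eq_zero_iff hτ]
  rw [this]
  refine @isClosed_iUnion_of_finite _ _ (zariskiCover τ m) _ _ fun g =>
    @isClosed_iInter _ _ (zariskiCover τ m) _ fun i => ?_
  obtain ⟨a, b, n, h⟩ := isSection_coordinate hτ i (t₀ (g i))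
  exact isClosed_zeros h

lemma zariski_continuous_reflection :
    @Continuous _ _ (zariski τ m) (zariski τ m) (reflection τ η m) := by
  have h1 : @Continuous _ _ (zariskiCover τ m) (zariskiCover τ m)
      (fun (t : Fin m → ℂ) i => 2 * η - t i) := by
    refine continuous_generateFrom_iff.2 ?_
    rintro _ ⟨a, b, n, F, hF, rfl⟩
    obtain ⟨a', b', n', h⟩ := hF.comp_reflect (2 * η)
    exact TopologicalSpace.isOpen_generateFrom_of_mem ⟨a', b', n', _, h, rfl⟩
  rw [continuous_coinduced_dom]
  have h2 : reflection τ η m ∘ proj τ = proj τ ∘ fun t i => 2 * η - t i :=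
    funext fun t => (proj_reflect t).symm
  rw [h2]
  exact @Continuous.comp _ _ _ (zariskiCover τ m) (zariskiCover τ m) (zariski τ m) _ _
    continuous_coinduced_rng h1

/-! ### Uniform multipliers -/

/-- The multipliers fix the degree, the exponential factor and the sum `S` of the zeros. In degree
at least two the zeros can still move: `v` with multiplicity `p` and `S - pv`, with `v` chosen so
that none of them hits `o`. -/
lemma exists_theta_multipliers (hτ : 0 < τ.im) {a b : ℂ} (ha : a ≠ 0) (hb : b ≠ 0) {p : ℕ}
    (hp : 0 < p) (o : ℂ) : ∃ H : ℂ → ℂ, Differentiable ℂ H ∧ (∀ s, H (s + 1) = a * H s) ∧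
      (∀ s, H (s + τ) = b * exp (-(2 * Real.pi * I * ((p + 1 : ℕ) : ℂ) * s)) * H s) ∧ H o ≠ 0 := by
  set N := p + 1
  have hsgn : ((-1 : ℂ) ^ N) * (-1) ^ N = 1 := by rw [← mul_pow]; simp
  have hsgn0 : ((-1 : ℂ) ^ N) ≠ 0 := by simp
  obtain ⟨c, hc⟩ : ∃ c, exp c = a * (-1) ^ N := ⟨_, exp_log (mul_ne_zero ha hsgn0)⟩
  obtain ⟨x, hx⟩ : ∃ x, exp x = b * (-1) ^ N * exp (-(c * τ)) * exp (Real.pi * I * (N * τ)) :=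
    ⟨_, exp_log (mul_ne_zero (mul_ne_zero (mul_ne_zero hb hsgn0) (exp_ne_zero _)) (exp_ne_zero _))⟩
  set S : ℂ := x / (2 * Real.pi * I) with hS
  have hxS : x = 2 * Real.pi * I * S := by
    rw [hS]; field_simp
  have hd := theta_differentiable hτ
  have hhalf : theta τ (1 / 2) ≠ 0 := fun h => one_half_notMem hτ ((theta_eq_zero_iff hτ _).1 h)
  have hp' : (p : ℂ) ≠ 0 := Nat.cast_ne_zero.2 hp.ne'
  obtain ⟨v, hv⟩ : ∃ v, theta τ (o - v) * theta τ (o - S + p * v) ≠ 0 := by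
    have := ne_zero_of_mul_ne (f := fun v => theta τ (o - v)) (g := fun v => theta τ (o - S + p * v))
      (hd.comp (by fun_prop)) (hd.comp (by fun_prop))
      (fun h => hhalf (by simpa using congrFun h (o - 1 / 2)))
      (fun h => hhalf (by
        have := congrFun h ((1 / 2 - (o - S)) / p)
        simpa [mul_div_cancel₀ _ hp'] using this))
    by_contra! h
    exact this (funext h)
  have hG := divTheta_isTheta hτ ((S - p * v) ::ₘ Multiset.replicate p v)
  have hcard : ((S - p * v) ::ₘ Multiset.replicate p v).card = N := by simp [N]
  have hsum : ((S - p * v) ::ₘ Multiset.replicate p v).sum = S := by simp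
  rw [hcard, hsum] at hG
  refine ⟨fun s => exp (c * s) * divTheta τ ((S - p * v) ::ₘ Multiset.replicate p v) s,
    (by fun_prop : Differentiable ℂ fun s => exp (c * s)).mul hG.diff, fun s => ?_, fun s => ?_, ?_⟩
  · beta_reduce
    rw [hG.add_one, mul_add, mul_one, exp_add, hc]
    linear_combination a * exp (c * s) *
      divTheta τ ((S - p * v) ::ₘ Multiset.replicate p v) s * hsgn
  · beta_reduce
    rw [hG.add_tau, mul_add, exp_add,
      show -(Real.pi * I * (N * τ + 2 * N * s + 2 * -S)) = x + -(Real.pi * I * (N * τ)) +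
        -(2 * Real.pi * I * N * s) by rw [hxS]; ring, exp_add, exp_add, hx]
    have h1 : exp (c * τ) * exp (-(c * τ)) = 1 := by rw [← exp_add]; simp
    have h2 : exp (Real.pi * I * (N * τ)) * exp (-(Real.pi * I * (N * τ))) = 1 := by
      rw [← exp_add]; simp
    generalize divTheta τ ((S - p * v) ::ₘ Multiset.replicate p v) s = D
    generalize exp (-(2 * Real.pi * I * N * s)) = E
    generalize exp (c * s) = E'
    linear_combination (b * E * E' * D * exp (c * τ) * exp (-(c * τ)) *
      (exp (Real.pi * I * (N * τ)) * exp (-(Real.pi * I * (N * τ))))) * hsgn +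
      (b * E * E' * D * (exp (Real.pi * I * (N * τ)) * exp (-(Real.pi * I * (N * τ))))) * h1 +
      (b * E * E' * D) * h2
  · refine mul_ne_zero (exp_ne_zero _) ?_
    rw [divTheta_cons]
    refine mul_ne_zero ?_ ?_
    · have := right_ne_zero_of_mul hv
      rwa [show o - (S - p * v) = o - S + p * v by ring]
    · simp [divTheta, left_ne_zero_of_mul hv]

/-- Multiplication by one-variable theta functions nonvanishing at `o` brings sections of different
line bundles to a common type. They can then be added. -/
lemma IsSection.exists_isSec (hτ : 0 < τ.im) {a b : Fin m → ℂ} {n : Fin m → ℤ}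
    {F : (Fin m → ℂ) → ℂ} (hF : IsSection τ a b n F) {o : Fin m → ℂ} (ho : F o ≠ 0) {N : ℕ}
    (hN : ∀ i, n i + 2 ≤ N) :
    ∃ G, IsSec τ N 0 G ∧ G o ≠ 0 ∧ ∀ t, F t = 0 → G t = 0 := by
  have hne := hF.multipliers_ne ho
  have hsgn0 : ((-1 : ℂ) ^ N) ≠ 0 := by simp
  choose H h1 h2 h3 h4 using fun i => exists_theta_multipliers hτ
    (mul_ne_zero hsgn0 (inv_ne_zero (hne i).1))
    (mul_ne_zero (mul_ne_zero hsgn0 (exp_ne_zero (-(Real.pi * I * (N * τ)))))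
      (inv_ne_zero (hne i).2)) (p := (N - n i - 1).toNat) (by have := hN i; omega) (o i)
  have hk : ∀ i, (((N - n i - 1).toNat + 1 : ℕ) : ℂ) = ((N - n i : ℤ) : ℂ) := fun i => by
    have h5 : (((N - n i - 1).toNat + 1 : ℕ) : ℤ) = N - n i := by have := hN i; omega
    rw [← h5]; simp
  have hH := isSection_prod (n := fun i => N - n i) h1 h2 fun i s => by rw [h3 i s, hk]
  have hG := hF.mul hH
  refine ⟨_, ⟨hG.holomorphic, fun i t => ?_, fun i t => ?_⟩,
    mul_ne_zero ho (Finset.prod_ne_zero_iff.2 fun i _ => h4 i), fun t ht => by rw [ht, zero_mul]⟩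
  · rw [hG.add_one, Pi.mul_apply, mul_left_comm (a i), mul_inv_cancel₀ (hne i).1, mul_one]
  · rw [hG.add_tau, Pi.mul_apply, Pi.add_apply]
    have h5 : exp (-(Real.pi * I * (N * τ + 2 * N * t i + 2 * 0))) =
        exp (-(Real.pi * I * (N * τ))) * exp (-(2 * Real.pi * I *
          ((n i + (N - n i) : ℤ) : ℂ) * t i)) := by
      rw [← exp_add]; push_cast; ring_nf
    rw [h5, show b i * ((-1) ^ N * exp (-(Real.pi * I * (N * τ))) * (b i)⁻¹) =
      (-1) ^ N * exp (-(Real.pi * I * (N * τ))) * (b i * (b i)⁻¹) by ring,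
      mul_inv_cancel₀ (hne i).2]
    ring

/-- In a combination `F + cG` each point excludes at most one value of `c`. -/
lemma exists_forall_ne_zero {ι : Type*} {V : Set (ι → ℂ)} (hV0 : V.Nonempty)
    (hV : ∀ F ∈ V, ∀ G ∈ V, ∀ c : ℂ, (fun t => F t + c * G t) ∈ V) (S : Finset ι)
    (h : ∀ o ∈ S, ∃ F ∈ V, F o ≠ 0) : ∃ F ∈ V, ∀ o ∈ S, F o ≠ 0 := by
  classical
  induction S using Finset.induction_on with
  | empty => exact ⟨_, hV0.some_mem, by simp⟩
  | insert x S hx ih =>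
    obtain ⟨F, hF, hFS⟩ := ih fun o ho => h o (Finset.mem_insert_of_mem ho)
    obtain ⟨G, hG, hGx⟩ := h x (Finset.mem_insert_self _ _)
    obtain ⟨c, hc⟩ := Infinite.exists_notMem_finset ((insert x S).image fun o => -F o / G o)
    refine ⟨_, hV F hF G hG c, fun o ho h0 => ?_⟩
    by_cases hGo : G o = 0
    · rw [hGo, mul_zero, add_zero] at h0
      rcases Finset.mem_insert.1 ho with rfl | ho
      · exact hGx hGo
      · exact hFS o ho h0
    · refine hc (Finset.mem_image.2 ⟨o, ho, ?_⟩)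
      rw [div_eq_iff hGo]
      linear_combination -h0

section

variable (hτ : 0 < τ.im) (hη : ∀ k : ℤ, k ≠ 0 → (k : ℂ) * η ∉ lattice τ) (hm : 0 < m)
include hτ hη hm

lemma infinite_curve : (curve τ η m).Infinite := by
  rw [← Set.infinite_coe_iff]
  have : Infinite (OnePoint ℂ) := Infinite.of_injective _ OnePoint.coe_injective
  exact Infinite.of_surjective _ (surjective_curveProj hτ hη hm)

/-- If neither `y` nor its reflection lay in `C`, some section would vanish on `C` but at no point
of the finite orbit of `t₀` under permutations and reflection. The product of its transforms is
symmetric and vanishes on the infinite set `C`, hence on the whole curve, yet not at `y`. -/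
lemma mem_or_reflection_mem {C : Set (SymEll τ m)} (hC : C ⊆ curve τ η m)
    (hCc : IsClosed[zariski τ m] C) (hCi : C.Infinite) {y : SymEll τ m} (hy : y ∈ curve τ η m) :
    y ∈ C ∨ reflection τ η m y ∈ C := by
  classical
  obtain ⟨t₀, rfl⟩ := proj_surjective y
  by_contra! hnot
  rw [isClosed_zariski_iff, ← @isOpen_compl_iff _ _ (zariskiCover τ m)] at hCc
  set O : Finset (Fin m → ℂ) := (Finset.univ.image fun (g : Equiv.Perm (Fin m)) i => t₀ (g i)) ∪
    (Finset.univ.image fun (g : Equiv.Perm (Fin m)) i => 2 * η - t₀ (g i)) with hO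
  have hOC : ∀ o ∈ O, o ∈ (proj τ ⁻¹' C)ᶜ := by
    intro o ho
    rcases Finset.mem_union.1 ho with h | h
    · obtain ⟨g, -, rfl⟩ := Finset.mem_image.1 h
      have : proj τ (fun i => t₀ (g i)) = proj τ t₀ :=
        proj_eq_proj_iff.2 ⟨g, fun i => by simp⟩
      simpa [this] using hnot.1
    · obtain ⟨g, -, rfl⟩ := Finset.mem_image.1 h
      have : proj τ (fun i => 2 * η - t₀ (g i)) = reflection τ η m (proj τ t₀) := by
        rw [← proj_reflect]
        exact proj_eq_proj_iff.2 ⟨g, fun i => by simp⟩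
      simpa [this] using hnot.2
  have hex : ∀ o ∈ O, ∃ N₀ : ℕ, ∀ N, N₀ ≤ N → ∃ G, IsSec τ N 0 G ∧ G o ≠ 0 ∧
      ∀ t ∈ proj τ ⁻¹' C, G t = 0 := by
    intro o ho
    obtain ⟨a, b, n, F, hF, hFo, hFC⟩ := exists_section_of_isOpen hCc (hOC o ho)
    refine ⟨∑ i, (n i).natAbs + 2, fun N hN => ?_⟩
    obtain ⟨G, hG, hGo, hFG⟩ := hF.exists_isSec hτ hFo (N := N) fun i => by
      have := Finset.single_le_sum (f := fun i => (n i).natAbs) (fun _ _ => Nat.zero_le _)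
        (Finset.mem_univ i)
      omega
    exact ⟨G, hG, hGo, fun t ht => hFG t (by_contra fun h => hFC t h ht)⟩
  choose! N₀ hN₀ using hex
  set N := O.sup N₀
  obtain ⟨F, ⟨hF, hFC⟩, hFO⟩ := exists_forall_ne_zero
    (V := {G | IsSec τ N 0 G ∧ ∀ t ∈ proj τ ⁻¹' C, G t = 0})
    ⟨_, IsSec.zero N 0, fun _ _ => rfl⟩
    (fun F hF G hG c => ⟨hF.1.add (hG.1.const_mul c), fun t ht => by
      simp [hF.2 t ht, hG.2 t ht]⟩) O fun o ho => by
        obtain ⟨G, hG, hGo, hGC⟩ := hN₀ o ho N (Finset.le_sup ho)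
        exact ⟨G, ⟨hG, hGC⟩, hGo⟩
  set R : (Fin m → ℂ) → ℂ := fun t => ∏ g : Equiv.Perm (Fin m),
    (F (fun i => t (g i)) * F fun i => 2 * η - t (g i)) with hRdef
  have hR : IsSymSec τ η (Fintype.card (Equiv.Perm (Fin m)) * N) R := by
    refine ⟨?_, fun h t => ?_, fun t => ?_⟩
    · refine (IsSec.prod Finset.univ fun g _ => (hF.comp_perm g).mul
        ((hF.comp_reflect (2 * η)).comp_perm g)).congr ?_ ?_ fun t => rfl
      · simp; ring
      · simp; ring
    · exact Equiv.prod_comp (Equiv.mulLeft h) fun g =>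
        F (fun i => t (g i)) * F fun i => 2 * η - t (g i)
    · refine Finset.prod_congr rfl fun g _ => ?_
      simp only [sub_sub_cancel]
      exact mul_comm _ _
  have hRC : C ⊆ {x | x ∈ curve τ η m ∧ ∃ t, proj τ t = x ∧ R t = 0} := by
    intro x hx
    obtain ⟨t, rfl⟩ := proj_surjective x
    refine ⟨hC hx, t, rfl, Finset.prod_eq_zero (Finset.mem_univ 1) ?_⟩
    rw [mul_eq_zero]
    exact Or.inl (hFC t hx)
  have h0 := hR.eq_zero hτ hη hm (hCi.mono hRC) hy
  obtain ⟨g, -, hg⟩ := Finset.prod_eq_zero_iff.1 h0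
  rcases mul_eq_zero.1 hg with h | h
  · exact hFO _ (Finset.mem_union_left _ (Finset.mem_image_of_mem _ (Finset.mem_univ g))) h
  · exact hFO _ (Finset.mem_union_right _ (Finset.mem_image_of_mem _ (Finset.mem_univ g))) h

lemma isAlgebraicCurve_curve : IsAlgebraicCurve τ (curve τ η m) where
  nonempty := (infinite_curve hτ hη hm).nonempty
  closed := zariski_isClosed_curve hτ
  dim Z hZ := @topologicalKrullDim_eq_one _ (zariski τ m) (zariski_t1Space hτ) _
    (reflection τ η m) (zariski_isClosed_curve hτ) (infinite_curve hτ hη hm)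
    zariski_continuous_reflection reflection_reflection
    (fun _ hx => (reflection_mem_curve hτ hη hm hx).1)
    (fun _ hC hCc hCi _ hy => mem_or_reflection_mem hτ hη hm hC hCc hCi hy) Z hZ

end

end

section

variable {τ η : ℂ} {m : ℕ}

/-! ### Bethe ansatz equations -/

lemma psi_eq (t : Fin m → ℂ) (c l : ℂ) :
    psi τ η t c l = exp (c * l) * divTheta τ (tDiv η t) l := by
  rw [psi, divTheta_tDiv]

/-- The eigenvalue equation for `psi τ η t c`, without denominators. -/
def IsPsiRel (τ η : ℂ) (t : Fin m → ℂ) (c e : ℂ) : Prop :=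
  ∀ l, theta τ (l + 2 * η * m) * psi τ η t c (l - 2 * η) +
    theta τ (l - 2 * η * m) * psi τ η t c (l + 2 * η) = e * theta τ l * psi τ η t c l

lemma psi_differentiable (hτ : 0 < τ.im) (t : Fin m → ℂ) (c : ℂ) :
    Differentiable ℂ (psi τ η t c) := by
  have h : psi τ η t c = fun l => exp (c * l) * divTheta τ (tDiv η t) l := funext (psi_eq t c)
  rw [h]
  exact (by fun_prop : Differentiable ℂ fun l => exp (c * l)).mul (divTheta_isTheta hτ _).diff

lemma psi_ne_zero (hτ : 0 < τ.im) (t : Fin m → ℂ) (c : ℂ) : psi τ η t c ≠ 0 := fun h =>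
  divTheta_ne_zero hτ (tDiv η t) (funext fun l => by
    have := congrFun h l
    rw [psi_eq] at this
    exact (mul_eq_zero.1 this).resolve_left (exp_ne_zero _))

lemma IsPsiRel.isLameEigenfunction (hτ : 0 < τ.im) {t : Fin m → ℂ} {c e : ℂ}
    (h : IsPsiRel τ η t c e) : IsLameEigenfunction τ η m (psi τ η t c) e where
  holomorphic := psi_differentiable hτ t c
  ne_zero := psi_ne_zero hτ t c
  eq l hl := by
    have := h l
    rw [lameOp]
    field_simp
    linear_combination this

lemma psi_half_period (t : Fin m → ℂ) (c l : ℂ) :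
    psi τ η t (c + I * Real.pi / (2 * η)) l = exp (Real.pi * I * l / (2 * η)) * psi τ η t c l := by
  rw [psi, psi, ← mul_assoc, ← exp_add]
  congr 2
  ring

lemma IsPsiRel.half_period (hη : η ≠ 0) {t : Fin m → ℂ} {c e : ℂ} (h : IsPsiRel τ η t c e) :
    IsPsiRel τ η t (c + I * Real.pi / (2 * η)) (-e) := by
  intro l
  have h1 : exp (Real.pi * I * (l - 2 * η) / (2 * η)) = -exp (Real.pi * I * l / (2 * η)) := by
    rw [show Real.pi * I * (l - 2 * η) / (2 * η) = Real.pi * I * l / (2 * η) - Real.pi * I by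
      field_simp, exp_sub, exp_pi_mul_I]
    ring
  have h2 : exp (Real.pi * I * (l + 2 * η) / (2 * η)) = -exp (Real.pi * I * l / (2 * η)) := by
    rw [show Real.pi * I * (l + 2 * η) / (2 * η) = Real.pi * I * l / (2 * η) + Real.pi * I by
      field_simp, exp_add, exp_pi_mul_I]
    ring
  rw [psi_half_period, psi_half_period, psi_half_period, h1, h2]
  linear_combination -exp (Real.pi * I * l / (2 * η)) * h l

/-- At `l = 2ηm` the forward shift drops out, and the eigenvalue is the remaining quotient. -/
lemma IsPsiRel.eigenvalue_eq (hτ : 0 < τ.im) (hη : ∀ k : ℤ, k ≠ 0 → (k : ℂ) * η ∉ lattice τ)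
    (hm : 0 < m) {t : Fin m → ℂ} {c e : ℂ} (h : IsPsiRel τ η t c e)
    (ht : divTheta τ (tDiv η t) (2 * η * m) ≠ 0) : eigenvalue τ η t c = e := by
  have hθ : theta τ (2 * η * m) ≠ 0 := theta_int_ne hτ hη (k := m) (by omega) (by push_cast; ring)
  have h1 := h (2 * η * m)
  rw [sub_self, theta_zero, zero_mul, add_zero, psi_eq, psi_eq, divTheta_tDiv] at h1
  rw [divTheta_tDiv] at h1 ht
  rw [eigenvalue, Finset.prod_div_distrib]
  have h2 : ∏ j, theta τ (t j + (2 * m - 3) * η) = ∏ j, theta τ (2 * η * m - 2 * η + t j - η) :=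
    Finset.prod_congr rfl fun j _ => by congr 1; ring
  have h3 : ∏ j, theta τ (t j + (2 * m - 1) * η) = ∏ j, theta τ (2 * η * m + t j - η) :=
    Finset.prod_congr rfl fun j _ => by congr 1; ring
  rw [h2, h3]
  rw [show c * (2 * η * m - 2 * η) = c * (2 * η * m) + -(2 * η * c) by ring, exp_add,
    show 2 * η * m + 2 * η * m = 4 * η * m by ring] at h1
  have h4 := exp_ne_zero (c * (2 * η * m))
  have h5 : theta τ (4 * η * m) * exp (-(2 * η * c)) *
      ∏ j, theta τ (2 * η * m - 2 * η + t j - η) = e * theta τ (2 * η * m) *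
        ∏ j, theta τ (2 * η * m + t j - η) := mul_left_cancel₀ h4 (by linear_combination h1)
  rw [mul_div_assoc', div_eq_iff ht, mul_div_assoc', div_mul_eq_mul_div, div_eq_iff hθ]
  linear_combination h5

lemma IsEigen.exists_isPsiRel {e : ℂ} {t : Fin m → ℂ} {ψ : ℂ → ℂ}
    (h : IsEigen τ η m e (tDiv η t) ψ) : ∃ c, IsPsiRel τ η t c e := by
  obtain ⟨C, c, hC, hψ⟩ := h.form
  refine ⟨c, fun l => mul_left_cancel₀ hC ?_⟩
  have := h.rel l
  simp only [hψ, mul_assoc, ← psi_eq] at this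
  simp only [mul_assoc] at this ⊢
  linear_combination this

lemma IsEigen.top_ne {e : ℂ} {t : Fin m → ℂ} {ψ : ℂ → ℂ}
    (h : IsEigen τ η m e (tDiv η t) ψ) : divTheta τ (tDiv η t) (2 * η * m) ≠ 0 := by
  obtain ⟨C, c, hC, hψ⟩ := h.form
  intro h0
  have := h.top
  rw [hψ, h0, mul_zero] at this
  exact zero_ne_one this

/-- At a zero of `psi`, the eigenvalue equation is a Bethe ansatz equation. -/
lemma betheFun_mul {t : Fin m → ℂ} (ht : IsAdmissible τ η t)
    (h2 : theta τ (2 * η) ≠ 0) {α β γ : ℂ} (h : IsRel τ η m (tDiv η t) α β γ) (i : Fin m) :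
    α * betheFun τ η t i = β := by
  have h1 := h (η - t i)
  have h0 : divTheta τ (tDiv η t) (η - t i) = 0 := by
    rw [divTheta_tDiv]
    exact Finset.prod_eq_zero (Finset.mem_univ i) (by
      rw [show η - t i + t i - η = 0 by ring, theta_zero])
  rw [h0, mul_zero, mul_zero, divTheta_tDiv, divTheta_tDiv,
    ← Finset.mul_prod_erase _ _ (Finset.mem_univ i),
    ← Finset.mul_prod_erase _ (fun j => theta τ (η - t i + 2 * η + t j - η)) (Finset.mem_univ i),
    Finset.prod_congr rfl fun j _ => show theta τ (η - t i - 2 * η + t j - η) =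
      theta τ (t j - t i - 2 * η) by congr 1; ring,
    Finset.prod_congr rfl fun j _ => show theta τ (η - t i + 2 * η + t j - η) =
      theta τ (t j - t i + 2 * η) by congr 1; ring,
    show η - t i - 2 * η + t i - η = -(2 * η) by ring,
    show η - t i + 2 * η + t i - η = 2 * η by ring,
    show η - t i + 2 * η * m = -(t i - η * (1 + 2 * m)) by ring,
    show η - t i - 2 * η * m = -(t i - η * (1 - 2 * m)) by ring, theta_neg, theta_neg,
    theta_neg] at h1
  have h3 := ht.denom_one i
  have h4 : ∏ j ∈ Finset.univ.erase i, theta τ (t j - t i + 2 * η) ≠ 0 :=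
    Finset.prod_ne_zero_iff.2 fun j hj => ht.denom_two i j (Finset.ne_of_mem_erase hj).symm
  rw [betheFun, Finset.prod_div_distrib, div_mul_div_comm, mul_div_assoc',
    div_eq_iff (mul_ne_zero h3 h4)]
  refine mul_left_cancel₀ h2 ?_
  linear_combination h1

lemma IsPsiRel.isRel {t : Fin m → ℂ} {c e : ℂ} (h : IsPsiRel τ η t c e) :
    IsRel τ η m (tDiv η t) (exp (-(2 * η * c))) (exp (2 * η * c)) e := by
  intro l
  have := h l
  rw [psi_eq, psi_eq, psi_eq, show c * (l - 2 * η) = c * l + -(2 * η * c) by ring,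
    show c * (l + 2 * η) = c * l + 2 * η * c by ring, exp_add, exp_add] at this
  refine mul_left_cancel₀ (exp_ne_zero (c * l)) ?_
  linear_combination this

lemma IsPsiRel.betheFun_eq {t : Fin m → ℂ} (ht : IsAdmissible τ η t)
    (h2 : theta τ (2 * η) ≠ 0) {c e : ℂ} (h : IsPsiRel τ η t c e) (i : Fin m) :
    betheFun τ η t i = exp (4 * η * c) := by
  have := betheFun_mul ht h2 h.isRel i
  refine mul_left_cancel₀ (exp_ne_zero (-(2 * η * c))) ?_
  rw [this, ← exp_add]
  congr 1; ring

lemma eigenvalue_sq_congr {t : Fin m → ℂ} {c d : ℂ} (h : exp (4 * η * c) = exp (4 * η * d)) :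
    eigenvalue τ η t c ^ 2 = eigenvalue τ η t d ^ 2 := by
  have h1 : exp (-(2 * η * c)) ^ 2 = exp (-(2 * η * d)) ^ 2 := by
    rw [← exp_nat_mul, ← exp_nat_mul, show ((2 : ℕ) : ℂ) * -(2 * η * c) = -(4 * η * c) by
      push_cast; ring, show ((2 : ℕ) : ℂ) * -(2 * η * d) = -(4 * η * d) by push_cast; ring,
      exp_neg, exp_neg, h]
  rw [eigenvalue, eigenvalue, mul_pow, mul_pow, h1, ← mul_pow, ← mul_pow]

lemma paramMk_eq_iff {c d : ℂ} :
    paramMk η d = paramMk η c ↔ ∃ k : ℤ, d - c = k * (Real.pi * I / η) := by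
  rw [paramMk, paramMk, eq_comm, QuotientAddGroup.eq, AddSubgroup.mem_zmultiples_iff]
  refine exists_congr fun k => ?_
  rw [zsmul_eq_mul, neg_add_eq_sub, eq_comm]

/-- The exponential fixes `c` modulo `πi/(2η)`. This group contains `πi/η · ℤ` with index two,
whence the two classes. -/
lemma exp_four_eta_eq_iff (hη : η ≠ 0) {c d : ℂ} : exp (4 * η * d) = exp (4 * η * c) ↔
    (paramMk η d = paramMk η c ∨ paramMk η d = paramMk η (c + I * Real.pi / (2 * η))) := by
  rw [exp_eq_exp_iff_exists_int, paramMk_eq_iff, paramMk_eq_iff]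
  constructor
  · rintro ⟨n, hn⟩
    have h1 : d - c = n * (Real.pi * I / (2 * η)) := by
      field_simp
      linear_combination hn / 2
    rcases Int.even_or_odd' n with ⟨k, rfl | rfl⟩
    · refine Or.inl ⟨k, ?_⟩
      rw [h1]; push_cast; field_simp
    · refine Or.inr ⟨k, ?_⟩
      rw [show d - (c + I * Real.pi / (2 * η)) = d - c - I * Real.pi / (2 * η) by ring, h1]
      push_cast; field_simp; ring
  · rintro (⟨k, hk⟩ | ⟨k, hk⟩)
    · refine ⟨2 * k, ?_⟩
      have : d = c + k * (Real.pi * I / η) := by linear_combination hk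
      rw [this]; push_cast; field_simp; ring
    · refine ⟨2 * k + 1, ?_⟩
      have : d = c + I * Real.pi / (2 * η) + k * (Real.pi * I / η) := by linear_combination hk
      rw [this]; push_cast; field_simp; ring

lemma paramMk_half_period_ne (hη : η ≠ 0) (c : ℂ) :
    paramMk η c ≠ paramMk η (c + I * Real.pi / (2 * η)) := by
  intro h
  obtain ⟨k, hk⟩ := paramMk_eq_iff.1 h
  have hpi : (Real.pi : ℂ) * I ≠ 0 := mul_ne_zero (by exact_mod_cast Real.pi_ne_zero) I_ne_zero
  have h1 : ((2 * k + 1 : ℤ) : ℂ) = 0 := by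
    refine mul_left_cancel₀ (div_ne_zero hpi (mul_ne_zero two_ne_zero hη)) ?_
    push_cast
    have h2 : (k : ℂ) * (Real.pi * I / η) = 2 * k * (Real.pi * I / (2 * η)) := by field_simp
    linear_combination -hk - h2
  have h3 : 2 * k + 1 = 0 := by exact_mod_cast h1
  omega

/-! ### Bethe solutions attached to points of the curve -/

section

variable (hτ : 0 < τ.im) (hη : ∀ k : ℤ, k ≠ 0 → (k : ℂ) * η ∉ lattice τ) (hm : 0 < m)
include hτ hη hm

omit hm in
lemma theta_two_eta_ne : theta τ (2 * η) ≠ 0 :=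
  theta_int_ne hτ hη (k := 1) (by omega) (by push_cast; ring)

/-- The three conditions come from the discriminant, from `ψ(2ηm) ≠ 0`, and from the absence of
zeros of `ψ` differing by `2η`. -/
lemma IsEigen.isAdmissible {e : ℂ} (he : IsGeneric τ η m e) {t : Fin m → ℂ} {ψ : ℂ → ℂ}
    (h : IsEigen τ η m e (tDiv η t) ψ) : IsAdmissible τ η t where
  distinct i j hij hmem := by
    refine h.distinct hτ hη hm he.2 hij ?_
    rw [evenTheta, show η - t j - (η - t i) = t i - t j by ring,
      (theta_eq_zero_iff hτ _).2 hmem, zero_mul]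
  denom_one i := by
    have h1 := h.top_ne
    rw [divTheta_tDiv] at h1
    have := Finset.prod_ne_zero_iff.1 h1 i (Finset.mem_univ i)
    rwa [show t i - η * (1 - 2 * m) = 2 * η * m + t i - η by ring]
  denom_two i j _ h0 := by
    have h1 : ψ (η - t i) = 0 := (h.eq_zero_iff hτ _).2
      ⟨η - t i, Multiset.mem_map.2 ⟨i, by simp, rfl⟩, by simp⟩
    refine h.zero_not_shift hτ hη hm he.1 h1 ((h.eq_zero_iff hτ _).2
      ⟨η - t j, Multiset.mem_map.2 ⟨j, by simp, rfl⟩, ?_⟩)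
    rw [show η - t i + 2 * η - (η - t j) = t j - t i + 2 * η by ring]
    exact (theta_eq_zero_iff hτ _).1 h0

/-- The values of the covering map at Bethe solutions. -/
lemma curveMap_of_isBetheSolution {t : Fin m → ℂ} {c : ℂ} (h : IsBetheSolution τ η t c)
    (ht : proj τ t ∈ curve τ η m) :
    curveMap τ η m (proj τ t) = ((eigenvalue τ η t c ^ 2 : ℂ) : OnePoint ℂ) := by
  have h2 := theta_two_eta_ne hτ hη
  have hv := isValue_curveMap hτ hη hm ht
  generalize curveMap τ η m (proj τ t) = z at hv
  have htop : divTheta τ (tDiv η t) (2 * η * m) ≠ 0 := by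
    rw [divTheta_tDiv]
    refine Finset.prod_ne_zero_iff.2 fun i _ => ?_
    rw [show 2 * η * m + t i - η = t i - η * (1 - 2 * m) by ring]
    exact h.1.denom_one i
  induction z using OnePoint.rec with
  | infty =>
    obtain ⟨α, β, γ, hne, hrel, hz⟩ := hv
    -- A Bethe solution never lies over infinity: `α ≠ 0` by admissibility, and `β = α e^{4ηc}`.
    have hα := (hrel.alpha_ne_zero_iff hτ hη hm (tDiv_card t) hne).2 htop
    have hβ : β ≠ 0 := by
      rw [← betheFun_mul h.1 h2 hrel ⟨0, hm⟩, h.2]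
      exact mul_ne_zero hα (exp_ne_zero _)
    exact absurd (ratio_eq_infty_iff.1 hz.symm) (mul_ne_zero hα hβ)
  | coe z =>
    obtain ⟨e, rfl⟩ := IsAlgClosed.exists_pow_nat_eq z (n := 2) (by norm_num)
    obtain ⟨ψ, hψ⟩ := hv.exists_isEigen hτ hη hm (tDiv_card t)
    obtain ⟨d, hd⟩ := hψ.exists_isPsiRel
    have h3 : exp (4 * η * c) = exp (4 * η * d) := by
      rw [← h.2 ⟨0, hm⟩, hd.betheFun_eq h.1 h2]
    rw [eigenvalue_sq_congr h3, hd.eigenvalue_eq hτ hη hm htop]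

/-- The values of the covering map at which it is not given by simple eigenfunctions. -/
def exceptionalValues (τ η : ℂ) (m : ℕ) : Set (OnePoint ℂ) :=
  (fun e : ℂ => ((e ^ 2 : ℂ) : OnePoint ℂ)) '' ({e | ¬ IsGeneric τ η m e} ∪ {0}) ∪ {OnePoint.infty}

lemma finite_exceptional :
    {x | x ∈ curve τ η m ∧ curveMap τ η m x ∈ exceptionalValues τ η m}.Finite := by
  have h1 : (exceptionalValues τ η m).Finite :=
    (((finite_not_isGeneric hτ hη hm).union (Set.finite_singleton _)).image _).union
      (Set.finite_singleton _)
  refine ((finite_preimage_curveProj hτ hη hm h1).image Subtype.val).subset ?_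
  rintro x ⟨hx, h⟩
  exact ⟨⟨x, hx⟩, h, rfl⟩

lemma exists_isEigen_of_not_exceptional {t : Fin m → ℂ} (ht : proj τ t ∈ curve τ η m)
    (h : curveMap τ η m (proj τ t) ∉ exceptionalValues τ η m) :
    ∃ e ψ, e ≠ 0 ∧ IsGeneric τ η m e ∧ curveMap τ η m (proj τ t) = ((e ^ 2 : ℂ) : OnePoint ℂ) ∧
      IsEigen τ η m e (tDiv η t) ψ := by
  have hv := isValue_curveMap hτ hη hm ht
  generalize curveMap τ η m (proj τ t) = z at *
  induction z using OnePoint.rec with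
  | infty => exact absurd (Or.inr rfl) h
  | coe z =>
    obtain ⟨e, rfl⟩ := IsAlgClosed.exists_pow_nat_eq z (n := 2) (by norm_num)
    obtain ⟨ψ, hψ⟩ := hv.exists_isEigen hτ hη hm (tDiv_card t)
    refine ⟨e, ψ, fun h0 => h (Or.inl ⟨e, Or.inr h0, rfl⟩), ?_, rfl, hψ⟩
    by_contra hg
    exact h (Or.inl ⟨e, Or.inl hg, rfl⟩)

lemma mem_hermiteBetheVariety {t : Fin m → ℂ} (ht : proj τ t ∈ curve τ η m)
    (h : curveMap τ η m (proj τ t) ∉ exceptionalValues τ η m) :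
    proj τ t ∈ hermiteBetheVariety τ η m := by
  obtain ⟨e, ψ, -, he, -, hψ⟩ := exists_isEigen_of_not_exceptional hτ hη hm ht h
  have hadm := hψ.isAdmissible hτ hη hm he
  obtain ⟨c, hc⟩ := hψ.exists_isPsiRel
  have h2 := theta_two_eta_ne hτ hη
  exact ⟨t, rfl, hadm, fun i j => by rw [hc.betheFun_eq hadm h2, hc.betheFun_eq hadm h2]⟩

/-- The covering map is open and the sphere has no isolated points, so every neighbourhood in the
curve is infinite and contains a point outside the finite exceptional set. -/
lemma curve_subset_closure : curve τ η m ⊆ closure (hermiteBetheVariety τ η m) := by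
  intro y hy
  rw [mem_closure_iff]
  intro U hU hyU
  have hperf : ∀ z : OnePoint ℂ, (𝓝[≠] z).NeBot := by
    intro z
    induction z using OnePoint.rec with
    | infty => infer_instance
    | coe z => infer_instance
  have hU' : IsOpen ((Subtype.val : curve τ η m → _) ⁻¹' U) := hU.preimage continuous_subtype_val
  have h1 := (isOpenMap_curveProj hτ hη hm).image_mem_nhds (x := ⟨y, hy⟩) (hU'.mem_nhds hyU)
  have := hperf (curveProj τ η m ⟨y, hy⟩)
  have h2 := infinite_of_mem_nhds _ h1
  have hinf : (Subtype.val '' ((Subtype.val : curve τ η m → _) ⁻¹' U)).Infinite :=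
    (h2.of_image _).image Subtype.val_injective.injOn
  obtain ⟨_, ⟨⟨x, hx⟩, hxU, rfl⟩, hxS⟩ := (hinf.sdiff (finite_exceptional hτ hη hm)).nonempty
  obtain ⟨t, rfl⟩ := proj_surjective x
  exact ⟨_, hxU, mem_hermiteBetheVariety hτ hη hm hx fun h => hxS ⟨hx, h⟩⟩

end

end

end HermiteBethe

end

/-! ### Assembly of the theorem -/

open HermiteBethe in
theorem mainTheorem8 (τ η : ℂ) (m : ℕ) (hτ : 0 < τ.im) (hm : 0 < m)
    (hη : ∀ k : ℤ, k ≠ 0 → (k : ℂ) * η ∉ lattice τ) :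
    ∃ (Y : Set (SymEll τ m)) (epsSq : SymEll τ m → OnePoint ℂ) (B : Set (OnePoint ℂ)),
      -- an algebraic curve in the closure of the Hermite-Bethe variety
      IsAlgebraicCurve τ Y ∧ Y ⊆ closure (hermiteBetheVariety τ η m) ∧
      -- the square of the eigenvalue is a two-fold ramified covering of the Riemann sphere
      IsMorphism τ Y epsSq ∧
      (∀ (t : Fin m → ℂ) (c : ℂ), IsBetheSolution τ η t c → proj τ t ∈ Y →
        epsSq (proj τ t) = ((eigenvalue τ η t c ^ 2 : ℂ) : OnePoint ℂ)) ∧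
      IsTwoFoldRamifiedCovering (fun y : Y => epsSq y) B ∧
      -- the involution preserves the square of the eigenvalue and permutes the sheets
      (∀ y ∈ Y, reflection τ η m y ∈ Y ∧ reflection τ η m (reflection τ η m y) = y ∧
        epsSq (reflection τ η m y) = epsSq y ∧ (epsSq y ∉ B → reflection τ η m y ≠ y)) ∧
      -- the two solutions attached to a generic point of the curve
      ∃ S : Set (SymEll τ m), S.Finite ∧ ∀ t : Fin m → ℂ, proj τ t ∈ Y → proj τ t ∉ S →
        proj τ t ∈ hermiteBetheVariety τ η m ∧
        ∃ c c' : ℂ, c' = c + I * Real.pi / (2 * η) ∧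
          paramMk η c ≠ paramMk η c' ∧
          (∀ d : ℂ, IsBetheSolution τ η t d ↔
            (paramMk η d = paramMk η c ∨ paramMk η d = paramMk η c')) ∧
          IsLameEigenfunction τ η m (psi τ η t c) (eigenvalue τ η t c) ∧
          IsLameEigenfunction τ η m (psi τ η t c') (eigenvalue τ η t c') ∧
          (∀ l : ℂ, psi τ η t c' l = exp (Real.pi * I * l / (2 * η)) * psi τ η t c l) ∧
          eigenvalue τ η t c ≠ eigenvalue τ η t c' ∧
          ∀ z : ℂ, epsSq (proj τ t) = ((z ^ 2 : ℂ) : OnePoint ℂ) ↔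
            (z = eigenvalue τ η t c ∨ z = eigenvalue τ η t c') := by
  have hη0 := eta_ne_zero hη
  refine ⟨curve τ η m, curveMap τ η m, branchSet τ η m, isAlgebraicCurve_curve hτ hη hm,
    curve_subset_closure hτ hη hm, isMorphism_curveMap hτ hη hm,
    fun t c h ht => curveMap_of_isBetheSolution hτ hη hm h ht,
    isTwoFoldRamifiedCovering_curveProj hτ hη hm, fun y hy => ?_,
    _, finite_exceptional hτ hη hm, fun t ht hS => ?_⟩
  · obtain ⟨h1, h2⟩ := reflection_mem_curve hτ hη hm hy
    exact ⟨h1, reflection_reflection y, h2, fun hB h =>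
      curveRefl_ne hτ hη hm (y := ⟨y, hy⟩) hB (Subtype.ext h)⟩
  · have hne : curveMap τ η m (proj τ t) ∉ exceptionalValues τ η m := fun h => hS ⟨ht, h⟩
    obtain ⟨e, ψ, he0, he, hmap, hψ⟩ := exists_isEigen_of_not_exceptional hτ hη hm ht hne
    have hadm := hψ.isAdmissible hτ hη hm he
    have htop := hψ.top_ne
    obtain ⟨c, hc⟩ := hψ.exists_isPsiRel
    have hc' := hc.half_period hη0
    have e1 := hc.eigenvalue_eq hτ hη hm htop
    have e2 := hc'.eigenvalue_eq hτ hη hm htop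
    have hb := hc.betheFun_eq hadm (theta_two_eta_ne hτ hη)
    refine ⟨mem_hermiteBetheVariety hτ hη hm ht hne, c, _, rfl, paramMk_half_period_ne hη0 c,
      fun d => ?_, ?_, ?_, psi_half_period t c, ?_, fun z => ?_⟩
    -- The equations constrain `d` only through `e^{4ηd}`, which must equal the common value of the
    -- `b_i`.
    · rw [← exp_four_eta_eq_iff hη0]
      exact ⟨fun h => by rw [← h.2 ⟨0, hm⟩, hb], fun h => ⟨hadm, fun i => by rw [hb, h]⟩⟩
    · rw [e1]; exact hc.isLameEigenfunction hτ
    · rw [e2]; exact hc'.isLameEigenfunction hτ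
    -- The two eigenvalues are `e` and `-e`, and `e ≠ 0` because zero was put among the exceptional
    -- values.
    · rw [e1, e2]
      exact fun h => he0 (self_eq_neg.1 h)
    · rw [hmap, e1, e2, OnePoint.coe_eq_coe, eq_comm, sq_eq_sq_iff_eq_or_eq_neg]
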